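/- For a finite simple graph $G$ let $n$ and $m$ be its numbers of vertices and edges, and let $\alpha=\alpha(G)$ be its arboricity, i.e. the least number of pairwise edge-disjoint forests whose union is $G$. Let $\omega$ be the exponent of matrix multiplication, i.e. the infimum of the numbers $\tau$ such that two real $n\times n$ matrices can be multiplied with $O(n^{\tau})$ arithmetic operations (straight-line programs over $\{+,-,\times,/\}$ with real constants). Running times are those of deterministic programs on a word RAM whose words have $O(\log n)$ bits and whose memory is initially zero; the graph, on the vertex set $\{0,\dots,n-1\}$, is given by $n$, $m$ and an arbitrary list of its edges. As is customary, "time $O(A^{\omega})$" abbreviates "time $O(A^{\tau})$ for every fixed $\tau>\omega$"; below this is written out. Let $\ell=3j+r$, where either $r=0$ and $j\ge 3$, or $r\in\{1,2\}$ and $j\ge 2$. (a) For every real $\tau>\omega$ there are a program that counts the copies of $K_\ell$ in $G$, and a program that decides whether $G$ contains a copy of $K_\ell$ and finds one if it does. Both are correct on every finite graph $G$, and on graphs with $m\ge 1$ they run in time $$O\!\left(\alpha^{(j-2)\tau+r}\cdot m^{\tau}\right),$$ where the implied constant and the one in the word length depend only on $j,r,\tau$. (b) If $r=0$, then $\alpha^{(j-2)\tau}\cdot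 m^{\tau}=O(m^{\ell\tau/6})$ for every $\tau\ge\omega$. (c) Let $$I_j=\left(\frac{\omega-1}{j(3-\omega)+2(\omega-1)},\ \frac12\right).$$ For every $x\in I_j$ there is $\tau_0>\omega$ such that for every $\tau\in[\omega,\tau_0)$ and for every sequence of finite graphs with $m\to\infty$ and $\alpha=\Theta(m^{x})$, the new bound is of smaller order than each of the previous bounds $m^{(j\omega+r)/2}$ and $\alpha^{\ell-2}\cdot m$: $$\alpha^{(j-2)\tau+r}m^{\tau}=o\!\left(m^{(j\omega+r)/2}\right),\qquad \alpha^{(j-2)\tau+r}m^{\tau}=o\!\left(\alpha^{\ell-2}\,m\right).$$ In particular this holds for $\tau=\omega$. -/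

import Mathlib

/-! Arboricity, the exponent of matrix multiplication, and a word RAM with a step count. -/

/-! ### Arboricity -/

/-- The arboricity of `G`: the least number of pairwise edge-disjoint forests whose union is `G`. -/
noncomputable def arboricity {V : Type*} (G : SimpleGraph V) : ℕ :=
  sInf {k : ℕ | ∃ F : Fin k → SimpleGraph V,
    (∀ i, (F i).IsAcyclic) ∧ Pairwise (fun i i' => Disjoint (F i) (F i')) ∧ ⨆ i, F i = G}

/-- The number of edges of `G`. -/
noncomputable def numEdges {V : Type*} (G : SimpleGraph V) : ℕ := G.edgeSet.ncard

/-! ### The exponent of matrix multiplication -/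

/-- `f 0, f 1, …, f (s - 1)` are the values (as functions of the input in `X`) computed by a
straight-line arithmetic program with `s` instructions: every instruction loads a real constant or
applies one of `+, -, *, /` to two values, each of which is an input value (a member of `I`) or the
result of an earlier instruction.  A division is allowed only if it is defined on every input. -/
def IsStraightLine {X : Type*} (I : Set (X → ℝ)) {s : ℕ} (f : Fin s → X → ℝ) : Prop :=
  ∀ k : Fin s,
    (∃ c : ℝ, f k = fun _ => c) ∨
    ∃ g ∈ I ∪ f '' {i | i < k}, ∃ h ∈ I ∪ f '' {i | i < k},
      f k = g + h ∨ f k = g - h ∨ f k = g * h ∨ ((∀ p, h p ≠ 0) ∧ f k = g / h)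

/-- Two real `n × n` matrices can be multiplied with `s` arithmetic operations. -/
def CanMultiply (n s : ℕ) : Prop :=
  ∃ f : Fin s → (Matrix (Fin n) (Fin n) ℝ × Matrix (Fin n) (Fin n) ℝ) → ℝ,
    IsStraightLine
      {g | ∃ a b : Fin n, g = (fun p => p.1 a b) ∨ g = (fun p => p.2 a b)} f ∧
    ∀ a b : Fin n, ∃ k : Fin s, ∀ p, f k p = (p.1 * p.2) a b

/-- The exponent of matrix multiplication: the infimum of the numbers `τ` such that two real
`n × n` matrices can be multiplied with `O(n ^ τ)` arithmetic operations. -/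
noncomputable def matMulExponent : ℝ :=
  sInf {τ : ℝ | ∃ C : ℝ, ∀ n : ℕ, 1 ≤ n → ∃ s : ℕ, CanMultiply n s ∧ (s : ℝ) ≤ C * (n : ℝ) ^ τ}

/-! ### A word RAM with `w`-bit words

Programs of a small imperative language over word registers and word arrays; every elementary
operation on words (including an array access) takes unit time. -/

namespace WordRAM

/-- The store: `reg r` is the content of register `r`, and `arr a i` is cell `i` of array `a`.
A program mentions only finitely many registers and arrays. -/
structure State where
  reg : ℕ → ℕ
  arr : ℕ → ℕ → ℕ

/-- Binary operations on words. -/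
inductive Op where
  | add | sub | mul | div | lt | eq

/-- Arithmetic is modulo `2 ^ w`; `div` is the floor of the quotient (`0` if the divisor is `0`);
comparisons return `0` or `1`. -/
def Op.eval (w : ℕ) : Op → ℕ → ℕ → ℕ
  | .add, x, y => (x + y) % 2 ^ w
  | .sub, x, y => (x + (2 ^ w - y % 2 ^ w)) % 2 ^ w
  | .mul, x, y => (x * y) % 2 ^ w
  | .div, x, y => x / y
  | .lt, x, y => if x < y then 1 else 0
  | .eq, x, y => if x = y then 1 else 0

/-- Expressions: constants, registers, array cells `a[e]`, binary operations. -/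
inductive Expr where
  | const (c : ℕ)
  | reg (r : ℕ)
  | load (a : ℕ) (e : Expr)
  | op (o : Op) (e₁ e₂ : Expr)

/-- The value of an expression in a store. -/
def Expr.eval (w : ℕ) (s : State) : Expr → ℕ
  | .const c => c % 2 ^ w
  | .reg r => s.reg r
  | .load a e => s.arr a (e.eval w s)
  | .op o e₁ e₂ => o.eval w (e₁.eval w s) (e₂.eval w s)

/-- The number of steps for evaluating an expression: one for each of its nodes. -/
def Expr.cost : Expr → ℕ
  | .const _ => 1
  | .reg _ => 1
  | .load _ e => e.cost + 1
  | .op _ e₁ e₂ => e₁.cost + e₂.cost + 1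

/-- Programs: `skip`, `r := e`, `a[e₁] := e₂`, sequencing, branching on `e ≠ 0`, and repeating the
body as long as `e ≠ 0`. -/
inductive Cmd where
  | skip
  | assign (r : ℕ) (e : Expr)
  | store (a : ℕ) (e₁ e₂ : Expr)
  | seq (c₁ c₂ : Cmd)
  | ite (e : Expr) (c₁ c₂ : Cmd)
  | loop (e : Expr) (c : Cmd)

/-- `s` with register `r` set to `x`. -/
def State.setReg (s : State) (r x : ℕ) : State :=
  { s with reg := Function.update s.reg r x }

/-- `s` with cell `i` of array `a` set to `x`. -/
def State.setArr (s : State) (a i x : ℕ) : State :=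
  { s with arr := Function.update s.arr a (Function.update (s.arr a) i x) }

/-- `Run w c s s₁ t`: on words of `w` bits, the program `c` started in the store `s` halts in the
store `s₁` after exactly `t` steps. -/
inductive Run (w : ℕ) : Cmd → State → State → ℕ → Prop
  | skip (s : State) : Run w .skip s s 1
  | assign (r : ℕ) (e : Expr) (s : State) :
      Run w (.assign r e) s (s.setReg r (e.eval w s)) (e.cost + 1)
  | store (a : ℕ) (e₁ e₂ : Expr) (s : State) :
      Run w (.store a e₁ e₂) s (s.setArr a (e₁.eval w s) (e₂.eval w s)) (e₁.cost + e₂.cost + 1)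
  | seq {c₁ c₂ : Cmd} {s s₁ s₂ : State} {t₁ t₂ : ℕ} :
      Run w c₁ s s₁ t₁ → Run w c₂ s₁ s₂ t₂ → Run w (.seq c₁ c₂) s s₂ (t₁ + t₂)
  | ite_true {e : Expr} {c₁ c₂ : Cmd} {s s₁ : State} {t : ℕ} :
      e.eval w s ≠ 0 → Run w c₁ s s₁ t → Run w (.ite e c₁ c₂) s s₁ (e.cost + 1 + t)
  | ite_false {e : Expr} {c₁ c₂ : Cmd} {s s₁ : State} {t : ℕ} :
      e.eval w s = 0 → Run w c₂ s s₁ t → Run w (.ite e c₁ c₂) s s₁ (e.cost + 1 + t)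
  | loop_true {e : Expr} {c : Cmd} {s s₁ s₂ : State} {t₁ t₂ : ℕ} :
      e.eval w s ≠ 0 → Run w c s s₁ t₁ → Run w (.loop e c) s₁ s₂ t₂ →
      Run w (.loop e c) s s₂ (e.cost + 1 + t₁ + t₂)
  | loop_false {e : Expr} {c : Cmd} {s : State} :
      e.eval w s = 0 → Run w (.loop e c) s s (e.cost + 1)

/-- `L` lists every edge of `G` exactly once, in any order, with its endpoints in any order. -/
def IsEdgeList {n : ℕ} (G : SimpleGraph (Fin n)) (L : List (Fin n × Fin n)) : Prop :=
  (L.map (fun e => s(e.1, e.2))).Nodup ∧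
    ∀ e : Sym2 (Fin n), e ∈ L.map (fun e => s(e.1, e.2)) ↔ e ∈ G.edgeSet

/-- The initial store for a graph on `{0, …, n - 1}` with edge list `L`: register `0` holds `n`,
register `1` holds the number of edges, cells `i` of the arrays `0` and `1` hold the two endpoints
of the `i`-th edge, and everything else is `0`. -/
def inputState (n : ℕ) (L : List (Fin n × Fin n)) : State where
  reg := fun r => if r = 0 then n else if r = 1 then L.length else 0
  arr := fun a i =>
    if a = 0 then (L[i]?).elim 0 (fun e => (e.1 : ℕ))
    else if a = 1 then (L[i]?).elim 0 (fun e => (e.2 : ℕ))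
    else 0

/-- A single word RAM program, with words of `O(log n)` bits, halts on every graph `G`, given by any
list of its edges, in a store that satisfies `Q`, and it takes `O(T G)` steps
if `G` has at least one edge. -/
def SolvableInTime (Q : ∀ n : ℕ, SimpleGraph (Fin n) → State → Prop)
    (T : ∀ n : ℕ, SimpleGraph (Fin n) → ℝ) : Prop :=
  ∃ (P : Cmd) (c : ℕ) (C : ℝ), ∀ (n : ℕ) (G : SimpleGraph (Fin n)) (L : List (Fin n × Fin n)),
    IsEdgeList G L → ∀ w : ℕ, (n + 2) ^ c ≤ 2 ^ w →
      ∃ (s : State) (t : ℕ), Run w P (inputState n L) s t ∧ Q n G s ∧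
        (1 ≤ numEdges G → (t : ℝ) ≤ C * T n G)

/-- Register `0` holds the number of copies of `K_ℓ` in `G`. -/
def OutputsCliqueCount (ℓ n : ℕ) (G : SimpleGraph (Fin n)) (s : State) : Prop :=
  s.reg 0 = {K : Finset (Fin n) | G.IsNClique ℓ K}.ncard

/-- Register `0` holds `0` if `G` has no copy of `K_ℓ`; otherwise it holds `1`, and the first `ℓ`
cells of array `2` hold the vertices of a copy of `K_ℓ`. -/
def OutputsCliqueDetection (ℓ n : ℕ) (G : SimpleGraph (Fin n)) (s : State) : Prop :=
  (G.CliqueFree ℓ ∧ s.reg 0 = 0) ∨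
    (s.reg 0 = 1 ∧ ∃ v : Fin ℓ → Fin n,
      (∀ i : Fin ℓ, s.arr 2 i = v i) ∧ ∀ i i' : Fin ℓ, i ≠ i' → G.Adj (v i) (v i'))

end WordRAM

/-! ### The bounds -/

/-- `α ^ ((j - 2) τ + r) * m ^ τ`, where `α` is the arboricity of `G` and `m` its number of edges. -/
noncomputable def cliqueBound (j r : ℕ) (τ : ℝ) {V : Type*} (G : SimpleGraph V) : ℝ :=
  (arboricity G : ℝ) ^ (((j : ℝ) - 2) * τ + r) * (numEdges G : ℝ) ^ τ

/-- The interval `I_j = ((ω - 1) / (j (3 - ω) + 2 (ω - 1)), 1 / 2)`. -/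
noncomputable def arboricityInterval (j : ℕ) : Set ℝ :=
  Set.Ioo ((matMulExponent - 1) / (j * (3 - matMulExponent) + 2 * (matMulExponent - 1))) (1 / 2)

/-!
**The algorithm.** Every subgraph of a graph of arboricity `α` has a vertex of degree at most `2 α`
(`SimpleGraph.exists_degree_induce_le`). Repeatedly removing a vertex of least degree therefore gives
an order of the vertices, and an acyclic orientation of the edges along it, with all out-degrees at
most `d = 2 α` (`WP_peel`, `DegenerateOrder`). Sorted by this order, the cliques with `ℓ` vertices
are the chains of length `ℓ`: lists in which every entry is joined to all later ones by oriented
edges (`ncard_cliques`).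

A chain of length `3 j + r` consists of a prefix of `r` vertices and three chains of length `j`
among the common out-neighbours of the prefix, each pair of which is compatible. For a fixed prefix,
let `A` be the `0`-`1`-matrix of the compatibility of the chains of length `j`. The number of triples
is the sum of the entries of `A * A` over the nonzero entries of `A` (`sum_linkMat`). A program that
runs through all prefixes and multiplies matrices counts the cliques, and from a nonzero term of the
sum it reads off a clique (`BilinearAlg.WP_process`, `BilinearAlg.WP_search`,
`BilinearAlg.WP_findCliques`).

**Its running time.** The order of `A` is `O(m d ^ (j - 2))` without a prefix,
`O(deg⁺ v * d ^ (j - 1))` for a prefix `v`, and `O(d ^ j)` for a prefix that is an edge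
(`DegenerateOrder.length_chains_le`); there are `1`, at most `2 m`, and `m` prefixes, and the numbers
`deg⁺ v` add up to at most `m`. The sum of the powers of these orders with exponent `τ` is
`O(α ^ ((j - 2) τ + r) m ^ τ)` because `α ^ 2 ≤ 2 m` (`DegenerateOrder.exists_sum_chainBound_le`,
`arboricity_sq_le`). Everything else takes `O(m ^ 2)` steps, which is within the bound because
`τ ≥ ω ≥ 2`.

**Matrix multiplication.** The exponent `ω` is defined by straight-line programs with divisions over
`ℝ`, while the program works with words modulo `2 ^ w`. What it needs is a bilinear algorithm with
integer coefficients that computes a positive multiple `D` of the product of two matrices of some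
order `n > 1` with `R < n ^ τ` multiplications (`exists_bilinearAlg`). To find one, consider the
values of a straight-line program as functions on the vector space of the pairs of matrices, and
their Taylor polynomials of order `2` at the origin, where no divisor vanishes: an instruction adds
at most one product of two linear forms to the span of the quadratic parts
(`IsStraightLine.exists_products`), and the entries of the product are quadratic. So `s` instructions
yield a bilinear algorithm over `ℝ` with `2 s` multiplications. Its coefficients generate a finitely
generated `ℚ`-algebra, whose quotient by a maximal ideal is a number field
(`Decomposes.exists_field`). The passage from a field of degree `d` to `ℚ` costs a factor `d ^ 3`
(`Decomposes.exists_rat`), which a high Kronecker power of the algorithm absorbs; at last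
denominators are cleared. The Kronecker powers of the integer algorithm are evaluated one tensor
factor at a time, with `O((k + 1) R ^ k)` operations for matrices of order `n ^ k` (`transform`,
`BilinearMul.kron_mul`, `BilinearAlg.WP_product`).

**The comparison of the bounds.** The estimate by a power of `m` alone is `α ^ 2 ≤ 2 m` once more. For
`α = Θ(m ^ x)` all bounds are powers of `m`; for `x` in the given interval the exponent of the new
bound is strictly smaller at `τ = ω`, hence also for `τ` near `ω` (`exists_isLittleO`).
-/

/-! ### Symbolic execution of programs -/

namespace WordRAM

open WordRAM.Expr (const reg load)

instance : Add Expr := ⟨Expr.op .add⟩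
instance : Sub Expr := ⟨Expr.op .sub⟩
instance : Mul Expr := ⟨Expr.op .mul⟩
instance : Div Expr := ⟨Expr.op .div⟩

infixr:60 " ;; " => Cmd.seq
infix:62 " ≔ " => Cmd.assign

section Eval

variable (w : ℕ) (s : State)

@[simp] theorem Expr.eval_const (c : ℕ) : (Expr.const c).eval w s = c % 2 ^ w := rfl
@[simp] theorem Expr.eval_reg (r : ℕ) : (Expr.reg r).eval w s = s.reg r := rfl
@[simp] theorem Expr.eval_load (a : ℕ) (e : Expr) :
    (Expr.load a e).eval w s = s.arr a (e.eval w s) := rfl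
@[simp] theorem Expr.eval_add (a b : Expr) :
    (a + b).eval w s = (a.eval w s + b.eval w s) % 2 ^ w := rfl
@[simp] theorem Expr.eval_sub (a b : Expr) :
    (a - b).eval w s = (a.eval w s + (2 ^ w - b.eval w s % 2 ^ w)) % 2 ^ w := rfl
@[simp] theorem Expr.eval_mul (a b : Expr) :
    (a * b).eval w s = (a.eval w s * b.eval w s) % 2 ^ w := rfl
@[simp] theorem Expr.eval_div (a b : Expr) :
    (a / b).eval w s = a.eval w s / b.eval w s := rfl
@[simp] theorem Expr.eval_lt (a b : Expr) :
    (Expr.op .lt a b).eval w s = if a.eval w s < b.eval w s then 1 else 0 := rfl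
@[simp] theorem Expr.eval_eq (a b : Expr) :
    (Expr.op .eq a b).eval w s = if a.eval w s = b.eval w s then 1 else 0 := rfl

@[simp] theorem Expr.cost_const (c : ℕ) : (Expr.const c).cost = 1 := rfl
@[simp] theorem Expr.cost_reg (r : ℕ) : (Expr.reg r).cost = 1 := rfl
@[simp] theorem Expr.cost_load (a : ℕ) (e : Expr) : (Expr.load a e).cost = e.cost + 1 := rfl
@[simp] theorem Expr.cost_add (a b : Expr) : (a + b).cost = a.cost + b.cost + 1 := rfl
@[simp] theorem Expr.cost_sub (a b : Expr) : (a - b).cost = a.cost + b.cost + 1 := rfl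
@[simp] theorem Expr.cost_mul (a b : Expr) : (a * b).cost = a.cost + b.cost + 1 := rfl
@[simp] theorem Expr.cost_div (a b : Expr) : (a / b).cost = a.cost + b.cost + 1 := rfl
@[simp] theorem Expr.cost_op (o : Op) (a b : Expr) :
    (Expr.op o a b).cost = a.cost + b.cost + 1 := rfl

end Eval

section Store

variable (s : State)

@[simp] theorem State.reg_setReg (r x r' : ℕ) :
    (s.setReg r x).reg r' = if r' = r then x else s.reg r' := by
  simp [State.setReg, Function.update_apply]

@[simp] theorem State.arr_setReg (r x : ℕ) : (s.setReg r x).arr = s.arr := rfl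

@[simp] theorem State.reg_setArr (a i x : ℕ) : (s.setArr a i x).reg = s.reg := rfl

@[simp] theorem State.arr_setArr (a i x a' : ℕ) :
    (s.setArr a i x).arr a' = if a' = a then Function.update (s.arr a) i x else s.arr a' := by
  by_cases h : a' = a <;> simp [State.setArr, h]

end Store

/-- May the command write to register `r`? -/
def Cmd.wr : Cmd → ℕ → Bool
  | .skip, _ => false
  | .assign r _, r' => r' == r
  | .store _ _ _, _ => false
  | .seq c₁ c₂, r' => c₁.wr r' || c₂.wr r'
  | .ite _ c₁ c₂, r' => c₁.wr r' || c₂.wr r'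
  | .loop _ c, r' => c.wr r'

/-- May the command write to array `a`? -/
def Cmd.wa : Cmd → ℕ → Bool
  | .skip, _ => false
  | .assign _ _, _ => false
  | .store a _ _, a' => a' == a
  | .seq c₁ c₂, a' => c₁.wa a' || c₂.wa a'
  | .ite _ c₁ c₂, a' => c₁.wa a' || c₂.wa a'
  | .loop _ c, a' => c.wa a'

/-- The two stores agree on everything that the command `c` cannot write to. -/
structure Frame (c : Cmd) (s s' : State) : Prop where
  reg : ∀ r, c.wr r = false → s'.reg r = s.reg r
  arr : ∀ a, c.wa a = false → s'.arr a = s.arr a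

theorem Frame.refl (c : Cmd) (s : State) : Frame c s s := ⟨fun _ _ => rfl, fun _ _ => rfl⟩

theorem Frame.trans {c : Cmd} {s s' s'' : State} (h : Frame c s s') (h' : Frame c s' s'') :
    Frame c s s'' :=
  ⟨fun r hr => (h'.reg r hr).trans (h.reg r hr), fun a ha => (h'.arr a ha).trans (h.arr a ha)⟩

theorem Frame.mono {c d : Cmd} {s s' : State} (h : Frame c s s')
    (hr : ∀ r, d.wr r = false → c.wr r = false) (ha : ∀ a, d.wa a = false → c.wa a = false) :
    Frame d s s' :=
  ⟨fun r h' => h.reg r (hr r h'), fun a h' => h.arr a (ha a h')⟩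

theorem Run.frame {w : ℕ} {c : Cmd} {s s' : State} {t : ℕ} (h : Run w c s s' t) :
    Frame c s s' := by
  induction h with
  | skip s => exact Frame.refl _ _
  | assign r e s =>
    refine ⟨fun r' hr => ?_, fun _ _ => rfl⟩
    have : r' ≠ r := by simpa [Cmd.wr] using hr
    simp [this]
  | store a e₁ e₂ s =>
    refine ⟨fun _ _ => rfl, fun a' ha => ?_⟩
    have : a' ≠ a := by simpa [Cmd.wa] using ha
    simp [this]
  | seq _ _ ih₁ ih₂ =>
    exact (ih₁.mono (fun r h => (by simpa [Cmd.wr] using h : _ ∧ _).1)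
      (fun r h => (by simpa [Cmd.wa] using h : _ ∧ _).1)).trans
      (ih₂.mono (fun r h => (by simpa [Cmd.wr] using h : _ ∧ _).2)
      (fun r h => (by simpa [Cmd.wa] using h : _ ∧ _).2))
  | ite_true _ _ ih =>
    exact ih.mono (fun r h => (by simpa [Cmd.wr] using h : _ ∧ _).1)
      (fun r h => (by simpa [Cmd.wa] using h : _ ∧ _).1)
  | ite_false _ _ ih =>
    exact ih.mono (fun r h => (by simpa [Cmd.wr] using h : _ ∧ _).2)
      (fun r h => (by simpa [Cmd.wa] using h : _ ∧ _).2)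
  | loop_true _ _ _ ih₁ ih₂ =>
    exact Frame.trans (ih₁.mono (d := .loop _ _) (fun _ h => h) (fun _ h => h)) ih₂
  | loop_false _ => exact Frame.refl _ _

/-- The command `c`, started in the store `s` at time `t`, halts in a store `s'` at a time `t'`
such that `Q s' t'`. -/
def WP (w : ℕ) (c : Cmd) (s : State) (t : ℕ) (Q : State → ℕ → Prop) : Prop :=
  ∃ s' t', Run w c s s' t' ∧ Q s' (t + t')

variable {w : ℕ} {s : State} {t : ℕ} {Q : State → ℕ → Prop}

theorem WP.mono {c : Cmd} {Q' : State → ℕ → Prop} (h : WP w c s t Q)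
    (hQ : ∀ s' t', Frame c s s' → Q s' t' → Q' s' t') : WP w c s t Q' := by
  obtain ⟨s', t', h1, h2⟩ := h
  exact ⟨s', t', h1, hQ _ _ h1.frame h2⟩

@[simp] theorem WP_skip : WP w .skip s t Q ↔ Q s (t + 1) := by
  constructor
  · rintro ⟨s', t', h, hQ⟩
    cases h
    exact hQ
  · exact fun h => ⟨_, _, .skip s, h⟩

@[simp] theorem WP_assign {r : ℕ} {e : Expr} :
    WP w (r ≔ e) s t Q ↔ Q (s.setReg r (e.eval w s)) (t + (e.cost + 1)) := by
  constructor
  · rintro ⟨s', t', h, hQ⟩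
    cases h
    exact hQ
  · exact fun h => ⟨_, _, .assign r e s, h⟩

@[simp] theorem WP_store {a : ℕ} {e₁ e₂ : Expr} :
    WP w (.store a e₁ e₂) s t Q ↔
      Q (s.setArr a (e₁.eval w s) (e₂.eval w s)) (t + (e₁.cost + e₂.cost + 1)) := by
  constructor
  · rintro ⟨s', t', h, hQ⟩
    cases h
    exact hQ
  · exact fun h => ⟨_, _, .store a e₁ e₂ s, h⟩

@[simp] theorem WP_seq {c₁ c₂ : Cmd} :
    WP w (c₁ ;; c₂) s t Q ↔ WP w c₁ s t (fun s' t' => WP w c₂ s' t' Q) := by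
  constructor
  · rintro ⟨s', t', h, hQ⟩
    cases h with
    | seq h1 h2 => exact ⟨_, _, h1, _, _, h2, by rwa [add_assoc]⟩
  · rintro ⟨s₁, t₁, h1, s₂, t₂, h2, hQ⟩
    exact ⟨_, _, .seq h1 h2, by rwa [← add_assoc]⟩

@[simp] theorem WP_ite {e : Expr} {c₁ c₂ : Cmd} :
    WP w (.ite e c₁ c₂) s t Q ↔
      if e.eval w s ≠ 0 then WP w c₁ s (t + (e.cost + 1)) Q
      else WP w c₂ s (t + (e.cost + 1)) Q := by
  constructor
  · rintro ⟨s', t', h, hQ⟩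
    cases h with
    | ite_true h1 h2 => rw [if_pos h1]; exact ⟨_, _, h2, by rwa [add_assoc]⟩
    | ite_false h1 h2 => rw [if_neg (by simpa using h1)]; exact ⟨_, _, h2, by rwa [add_assoc]⟩
  · split_ifs with h0
    · rintro ⟨s', t', h, hQ⟩
      exact ⟨_, _, .ite_true h0 h, by rwa [← add_assoc]⟩
    · rintro ⟨s', t', h, hQ⟩
      exact ⟨_, _, .ite_false (by simpa using h0) h, by rwa [← add_assoc]⟩

/-- The counted loop `for r := 0, …, e - 1 do c`. -/
def forLoop (r : ℕ) (e : Expr) (c : Cmd) : Cmd :=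
  r ≔ const 0 ;; .loop (.op .lt (reg r) e) (c ;; r ≔ reg r + const 1)

@[simp] theorem forLoop_wr (r : ℕ) (e : Expr) (c : Cmd) (r' : ℕ) :
    (forLoop r e c).wr r' = (r' == r || c.wr r') := by
  simp only [forLoop, Cmd.wr]
  cases r' == r <;> cases c.wr r' <;> rfl

@[simp] theorem forLoop_wa (r : ℕ) (e : Expr) (c : Cmd) (a : ℕ) :
    (forLoop r e c).wa a = c.wa a := by
  simp [forLoop, Cmd.wa]

/-- The rule for counted loops with an invariant `I` and a bound `T k` on the time of the `k`-th
round.  The invariant may not speak of the loop register. -/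
theorem WP_for {r N : ℕ} {e : Expr} {c : Cmd} (I : ℕ → State → Prop) (T : ℕ → ℕ)
    (hN : N < 2 ^ w) (hr : c.wr r = false)
    (he : ∀ s', Frame (forLoop r e c) s s' → e.eval w s' = N)
    (hI : ∀ k s' x, I k s' → I k (s'.setReg r x))
    (h0 : I 0 s)
    (hstep : ∀ k < N, ∀ s', Frame (forLoop r e c) s s' → s'.reg r = k → I k s' →
      ∀ t', WP w c s' t' (fun s'' t'' => I (k + 1) s'' ∧ t'' ≤ t' + T k))
    (hQ : ∀ s' t', Frame (forLoop r e c) s s' → s'.reg r = N → I N s' →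
      t' ≤ t + (∑ k ∈ Finset.range N, (T k + (e.cost + 7)) + (e.cost + 5)) → Q s' t') :
    WP w (forLoop r e c) s t Q := by
  have hone : 1 < 2 ^ w ∨ N = 0 := by omega
  have key : ∀ d k, k + d = N → ∀ s' t', Frame (forLoop r e c) s s' → s'.reg r = k → I k s' →
      WP w (.loop (.op .lt (reg r) e) (c ;; r ≔ reg r + const 1)) s' t'
        (fun s'' t'' => Frame (forLoop r e c) s s'' ∧ s''.reg r = N ∧ I N s'' ∧
          t'' ≤ t' + (∑ i ∈ Finset.Ico k N, (T i + (e.cost + 7)) + (e.cost + 3))) := by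
    intro d
    induction d with
    | zero =>
      intro k hk s' t' hF hs hIk
      obtain rfl : k = N := by simpa using hk
      refine ⟨s', _, .loop_false (by simp [he s' hF, hs]), hF, hs, hIk, ?_⟩
      simp
      omega
    | succ d ih =>
      intro k hk s' t' hF hs hIk
      have hkN : k < N := by omega
      obtain ⟨s₁, t₁, hrun, hI1, ht1⟩ := hstep k hkN s' hF hs hIk 0
      have hF1 : Frame c s' s₁ := hrun.frame
      have hs1 : s₁.reg r = k := by rw [hF1.reg r hr, hs]
      have hF2 : Frame (forLoop r e c) s (s₁.setReg r (k + 1)) := by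
        refine ⟨fun r' h' => ?_, fun a h' => ?_⟩
        · have h'' : r' ≠ r ∧ c.wr r' = false := by simpa using h'
          simp [h''.1, hF1.reg r' h''.2, hF.reg r' h']
        · have h'' : c.wa a = false := by simpa using h'
          simp [hF1.arr a h'', hF.arr a h']
      obtain ⟨s₂, t₂, hrun2, hF', hs2, hI2, ht2⟩ := ih (k + 1) (by omega) (s₁.setReg r (k + 1)) 0
        hF2 (by simp) (hI _ _ _ hI1)
      have hval : (reg r + const 1).eval w s₁ = k + 1 := by
        have : 1 < 2 ^ w := by omega
        simp [hs1, Nat.mod_eq_of_lt this, Nat.mod_eq_of_lt (show k + 1 < 2 ^ w by omega)]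
      have hrun3 : Run w (r ≔ reg r + const 1) s₁ (s₁.setReg r (k + 1)) 4 := by
        have := Run.assign (w := w) r (reg r + const 1) s₁
        rw [hval] at this
        simpa using this
      refine ⟨s₂, _, .loop_true ?_ (.seq hrun hrun3) hrun2, hF', hs2, hI2, ?_⟩
      · simp [he s' hF, hs, hkN]
      · rw [Finset.sum_eq_sum_Ico_succ_bot hkN]
        simp at ht1 ht2 ⊢
        omega
  have hrun0 : Run w (r ≔ const 0) s (s.setReg r 0) 2 := by
    have := Run.assign (w := w) r (const 0) s
    simpa using this
  obtain ⟨s₁, t₁, h1, hF, h2, h3, h4⟩ := key N 0 (by omega) (s.setReg r 0) 0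
    ⟨fun r' h' => by
      have h'' : r' ≠ r ∧ c.wr r' = false := by simpa using h'
      simp [h''.1], fun _ _ => rfl⟩ (by simp) (hI _ _ _ h0)
  refine ⟨s₁, _, .seq hrun0 h1, hQ _ _ hF h2 h3 ?_⟩
  rw [Nat.Ico_zero_eq_range] at h4
  omega

/-- `WP_for` with a uniform bound on the time of a round. -/
theorem WP_for_const {r N : ℕ} {e : Expr} {c : Cmd} (I : ℕ → State → Prop) (T : ℕ)
    (hN : N < 2 ^ w) (hr : c.wr r = false)
    (he : ∀ s', Frame (forLoop r e c) s s' → e.eval w s' = N)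
    (hI : ∀ k s' x, I k s' → I k (s'.setReg r x))
    (h0 : I 0 s)
    (hstep : ∀ k < N, ∀ s', Frame (forLoop r e c) s s' → s'.reg r = k → I k s' →
      ∀ t', WP w c s' t' (fun s'' t'' => I (k + 1) s'' ∧ t'' ≤ t' + T))
    (hQ : ∀ s' t', Frame (forLoop r e c) s s' → s'.reg r = N → I N s' →
      t' ≤ t + (N * (T + (e.cost + 7)) + (e.cost + 5)) → Q s' t') :
    WP w (forLoop r e c) s t Q := by
  refine WP_for I (fun _ => T) hN hr he hI h0 hstep fun s' t' hF h1 h2 h3 => hQ s' t' hF h1 h2 ?_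
  simpa using h3

end WordRAM

/-! ### Kronecker powers of a linear map, one tensor factor at a time -/

namespace WordRAM
open WordRAM.Expr (const reg load)

/-- The entry `(t, a)` of the `i`-th Kronecker power of the matrix `u` with `q` rows and `p`
columns; the base `q` digits of `t` and the base `p` digits of `a` index the tensor factors. -/
def kron (u : ℕ → ℕ → ℤ) (q p : ℕ) : ℕ → ℕ → ℕ → ℤ
  | 0, _, _ => 1
  | i + 1, t, a => kron u q p i (t % q ^ i) (a % p ^ i) * u (t / q ^ i) (a / p ^ i)

/-- An integer constant, as a residue modulo `2 ^ w`. -/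
def coefE (z : ℤ) : Expr :=
  if 0 ≤ z then const z.toNat else const 0 - const (-z).toNat

theorem cast_mod_two_pow (w x : ℕ) : ((x % 2 ^ w : ℕ) : ZMod (2 ^ w)) = x := by
  rw [ZMod.natCast_eq_natCast_iff]
  exact Nat.mod_modEq _ _

theorem sum_range_mul {M : Type*} [AddCommMonoid M] (F : ℕ → M) (p m : ℕ) :
    ∑ x ∈ Finset.range (p * m), F x =
      ∑ a ∈ Finset.range p, ∑ b ∈ Finset.range m, F (a * m + b) := by
  induction p with
  | zero => simp
  | succ p ih => rw [add_mul, one_mul, Finset.sum_range_add, ih, Finset.sum_range_succ]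

theorem coefE_cost (z : ℤ) : (coefE z).cost ≤ 3 := by
  unfold coefE
  split_ifs <;> simp

theorem coefE_eval (w : ℕ) (s : State) (z : ℤ) :
    ((coefE z).eval w s : ZMod (2 ^ w)) = z := by
  unfold coefE
  split_ifs with h
  · have : ((z.toNat : ℤ) : ZMod (2 ^ w)) = z := by rw [Int.toNat_of_nonneg h]
    rw [Expr.eval_const, cast_mod_two_pow, ← this, Int.cast_natCast]
  · have h1 : (((-z).toNat : ℤ) : ZMod (2 ^ w)) = ((-z : ℤ) : ZMod (2 ^ w)) := by
      rw [Int.toNat_of_nonneg (by omega)]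
    have h2 : (-z).toNat % 2 ^ w ≤ 2 ^ w := (Nat.mod_lt _ (by positivity)).le
    simp only [Expr.eval_sub, Expr.eval_const, cast_mod_two_pow, Nat.mod_mod, Nat.cast_add,
      Nat.cast_sub h2]
    simp only [Int.cast_natCast] at h1
    rw [h1]
    have : ((2 ^ w : ℕ) : ZMod (2 ^ w)) = 0 := ZMod.natCast_self _
    rw [this]
    simp

/-- The linear form `∑ a < b, u a * X[σ p + a]`, where `σ` is the content of register `34`. -/
def linE (u : ℕ → ℤ) (X p : ℕ) : ℕ → Expr
  | 0 => const 0
  | b + 1 => linE u X p b + coefE (u b) * load X (reg 34 * const p + const b)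

theorem linE_cost (u : ℕ → ℤ) (X p b : ℕ) : (linE u X p b).cost ≤ 11 * b + 1 := by
  induction b with
  | zero => simp [linE]
  | succ b ih =>
    have := coefE_cost (u b)
    simp [linE]
    omega

theorem linE_eval_lt (w : ℕ) (s : State) (u : ℕ → ℤ) (X p b : ℕ) :
    (linE u X p b).eval w s < 2 ^ w := by
  cases b <;> exact Nat.mod_lt _ (by positivity)

theorem linE_eval {w : ℕ} {s : State} (u : ℕ → ℤ) (X p b : ℕ) (hb : b ≤ p)
    (h : s.reg 34 * p + p < 2 ^ w) :
    ((linE u X p b).eval w s : ZMod (2 ^ w)) =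
      ∑ a ∈ Finset.range b, (u a : ZMod (2 ^ w)) * s.arr X (s.reg 34 * p + a) := by
  induction b with
  | zero => simp [linE]
  | succ b ih =>
    have h1 : p % 2 ^ w = p := Nat.mod_eq_of_lt (by omega)
    have h2 : b % 2 ^ w = b := Nat.mod_eq_of_lt (by omega)
    have h3 : (s.reg 34 * p) % 2 ^ w = s.reg 34 * p := Nat.mod_eq_of_lt (by omega)
    have h4 : (s.reg 34 * p + b) % 2 ^ w = s.reg 34 * p + b := Nat.mod_eq_of_lt (by omega)
    rw [Finset.sum_range_succ, ← ih (by omega)]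
    simp [linE, coefE_eval, h1, h2, h3, h4]

/-- Apply the first `q` rows of `u` to `X[σ p], …, X[σ p + p - 1]` and store the results at
distance `S` in the array `16`; register `32` holds `S`. -/
def applyRows (u : ℕ → ℕ → ℤ) (X p : ℕ) : ℕ → Cmd
  | 0 => .skip
  | t + 1 => applyRows u X p t ;; .store 16 (const t * reg 32 + reg 34) (linE (u t) X p p)

@[simp] theorem applyRows_wr (u : ℕ → ℕ → ℤ) (X p q r : ℕ) : (applyRows u X p q).wr r = false := by
  induction q with
  | zero => rfl
  | succ q ih => simp [applyRows, Cmd.wr, ih]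

theorem applyRows_wa (u : ℕ → ℕ → ℤ) (X p q a : ℕ) (h : a ≠ 16) :
    (applyRows u X p q).wa a = false := by
  induction q with
  | zero => rfl
  | succ q ih => simp [applyRows, Cmd.wa, ih, h]

theorem WP_applyRows {w : ℕ} {s : State} {u : ℕ → ℕ → ℤ} {X p q t : ℕ} {Q : State → ℕ → Prop}
    (hX : X ≠ 16) (h2 : s.reg 34 < s.reg 32)
    (h3 : q * s.reg 32 < 2 ^ w)
    (hQ : ∀ s' t', s'.reg = s.reg → (∀ a ≠ 16, s'.arr a = s.arr a) →
      (∀ r < q, s'.arr 16 (r * s.reg 32 + s.reg 34) = (linE (u r) X p p).eval w s) →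
      (∀ x, (∀ r < q, x ≠ r * s.reg 32 + s.reg 34) → s'.arr 16 x = s.arr 16 x) →
      t' ≤ t + (q * (11 * p + 10) + 1) → Q s' t') :
    WP w (applyRows u X p q) s t Q := by
  induction q generalizing Q with
  | zero =>
    simp only [applyRows, WP_skip]
    exact hQ _ _ rfl (fun _ _ => rfl) (by simp) (fun _ _ => rfl) (by simp)
  | succ q ih =>
    have h4 : (q + 1) * s.reg 32 = q * s.reg 32 + s.reg 32 := by ring
    have h5 : q ≤ q * s.reg 32 := Nat.le_mul_of_pos_right _ (by omega)
    simp only [applyRows, WP_seq, WP_store]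
    refine ih (by omega) fun s' t' hr ha hv hx ht => ?_
    have hev : ∀ b, (linE (u q) X p b).eval w s' = (linE (u q) X p b).eval w s := by
      intro b
      have hc : ∀ z, (coefE z).eval w s' = (coefE z).eval w s := by
        intro z
        unfold coefE
        split_ifs <;> rfl
      induction b with
      | zero => rfl
      | succ b ihb => simp [linE, ihb, hr, ha X hX, hc]
    have hidx : (const q * reg 32 + reg 34 : Expr).eval w s' = q * s.reg 32 + s.reg 34 := by
      simp only [Expr.eval_add, Expr.eval_mul, Expr.eval_const, Expr.eval_reg, hr]
      rw [Nat.mod_eq_of_lt (show q < 2 ^ w by omega),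
        Nat.mod_eq_of_lt (show q * s.reg 32 < 2 ^ w by omega),
        Nat.mod_eq_of_lt (show q * s.reg 32 + s.reg 34 < 2 ^ w by omega)]
    rw [hidx, hev]
    refine hQ _ _ (by simpa using hr) (fun a h => by simp [h, ha a h]) (fun r hr' => ?_)
      (fun x hx' => ?_) ?_
    · rcases Nat.lt_succ_iff_lt_or_eq.mp hr' with h | rfl
      · have : r * s.reg 32 + s.reg 34 ≠ q * s.reg 32 + s.reg 34 := by
          intro h'
          have := Nat.eq_of_mul_eq_mul_right (show 0 < s.reg 32 by omega)
            (show r * s.reg 32 = q * s.reg 32 by omega)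
          omega
        simp [Function.update_of_ne this, hv r h]
      · simp
    · have := hx' q (by omega)
      simp only [State.arr_setArr, if_true, Function.update_of_ne this]
      exact hx x fun r h => hx' r (by omega)
    · have := linE_cost (u q) X p p
      simp only [Expr.cost_add, Expr.cost_mul, Expr.cost_const, Expr.cost_reg]
      have h6 : (q + 1) * (11 * p + 10) = q * (11 * p + 10) + (11 * p + 10) := by ring
      omega

/-- Copy the first `reg 31` cells of the array `Y` to the array `X`. -/
def copyCmd (X Y : ℕ) : Cmd := forLoop 26 (reg 31) (.store X (reg 26) (load Y (reg 26)))

theorem WP_copy {w : ℕ} {s : State} {X Y t : ℕ} {Q : State → ℕ → Prop} (hXY : Y ≠ X)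
    (hZ : s.reg 31 < 2 ^ w)
    (hQ : ∀ s' t', Frame (copyCmd X Y) s s' → (∀ x < s.reg 31, s'.arr X x = s.arr Y x) →
      t' ≤ t + (s.reg 31 * 12 + 6) → Q s' t') :
    WP w (copyCmd X Y) s t Q := by
  refine WP_for_const (fun k s' => ∀ x < k, s'.arr X x = s.arr Y x) 4 hZ rfl
    (fun s' hF => hF.reg 31 (by simp [Cmd.wr])) (fun k s' x h => h) (by simp)
    (fun k hk s' hF hk' hI t' => ?_) (fun s' t' hF _ hI ht => hQ s' t' hF hI (by simpa using ht))
  have hY : s'.arr Y = s.arr Y := hF.arr Y (by simp [Cmd.wa, hXY])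
  simp only [WP_store, Expr.eval_reg, Expr.eval_load, hk', Expr.cost_reg, Expr.cost_load, hY]
  refine ⟨fun x hx => ?_, by omega⟩
  rcases Nat.lt_succ_iff_lt_or_eq.mp hx with h | rfl
  · simp [Function.update_of_ne h.ne, hI x h]
  · simp

/-- Replace the array `X`, of length `p ^ k`, by its image under the `k`-th Kronecker power of the
`q × p` matrix `u`.  Register `23` holds `k`, register `31` the current length.  Each round
consumes the lowest digit of the index and puts the new digit on top. -/
def transform (u : ℕ → ℕ → ℤ) (X p q : ℕ) : Cmd :=
  forLoop 33 (reg 23)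
    (32 ≔ reg 31 / const p ;;
      forLoop 34 (reg 32) (applyRows u X p q) ;;
      31 ≔ reg 32 * const q ;;
      copyCmd X 16)

theorem transform_wr (u : ℕ → ℕ → ℤ) (X p q r : ℕ) :
    (transform u X p q).wr r = (r == 33 || r == 32 || r == 34 || r == 31 || r == 26) := by
  simp [transform, copyCmd, Cmd.wr, Bool.or_assoc]

theorem transform_wa (u : ℕ → ℕ → ℤ) (X p q a : ℕ) (h : a ≠ 16) (h' : a ≠ X) :
    (transform u X p q).wa a = false := by
  simp [transform, copyCmd, Cmd.wa, applyRows_wa _ _ _ _ _ h, h']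

/-- One round of `transform`. -/
theorem WP_transform_round {w : ℕ} {s : State} {u : ℕ → ℕ → ℤ} {X p q S t : ℕ}
    {Q : State → ℕ → Prop} (hX : X ≠ 16) (hp : 0 < p) (hq : 0 < q) (hS : 0 < S)
    (hZ : s.reg 31 = S * p) (h1 : S * p < 2 ^ w) (h2 : S * q < 2 ^ w)
    (hQ : ∀ s' t', s'.reg 31 = S * q →
      (∀ r < q, ∀ x < S, s'.arr X (r * S + x) < 2 ^ w ∧
        (s'.arr X (r * S + x) : ZMod (2 ^ w)) =
          ∑ a ∈ Finset.range p, (u r a : ZMod (2 ^ w)) * s.arr X (x * p + a)) →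
      t' ≤ t + (S * q * (11 * p + 40) + 40) → Q s' t') :
    WP w (32 ≔ reg 31 / const p ;; forLoop 34 (reg 32) (applyRows u X p q) ;;
      31 ≔ reg 32 * const q ;; copyCmd X 16) s t Q := by
  have hpS : p ≤ S * p := Nat.le_mul_of_pos_left _ hS
  have hqS : q ≤ S * q := Nat.le_mul_of_pos_left _ hS
  have hSp : S ≤ S * p := Nat.le_mul_of_pos_right _ hp
  have hSq : S ≤ S * q := Nat.le_mul_of_pos_right _ hq
  have hdiv : (reg 31 / const p : Expr).eval w s = S := by
    simp [hZ, Nat.mod_eq_of_lt (show p < 2 ^ w by omega), Nat.mul_div_cancel _ hp]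
  rw [WP_seq, WP_assign, hdiv, WP_seq]
  refine WP_for_const (N := S) (fun k s' => ∀ r < q, ∀ x < k, s'.arr 16 (r * S + x) < 2 ^ w ∧
      (s'.arr 16 (r * S + x) : ZMod (2 ^ w)) =
          ∑ a ∈ Finset.range p, (u r a : ZMod (2 ^ w)) * s.arr X (x * p + a))
    (q * (11 * p + 10) + 1) (by omega) (by simp)
    (fun s' hF => by simpa using hF.reg 32 (by simp)) (fun k s' x h => h) (by simp)
    (fun k hk s' hF hk' hI t' => ?_) (fun s' t' hF _ hI ht => ?_)
  · have h32 : s'.reg 32 = S := by simpa using hF.reg 32 (by simp)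
    have hXe : s'.arr X = s.arr X := by simpa using hF.arr X (by simp [applyRows_wa _ _ _ _ _ hX])
    have hkp : k * p + p ≤ S * p := by
      have : (k + 1) * p ≤ S * p := Nat.mul_le_mul_right _ hk
      linarith
    refine WP_applyRows hX (by omega) (by rw [h32, mul_comm]; exact h2)
      fun s'' t'' hr ha hv hx ht => ⟨fun r hr' x hxk => ?_, ht⟩
    rcases Nat.lt_succ_iff_lt_or_eq.mp hxk with h | rfl
    · rw [hx]
      · exact hI r hr' x h
      · intro r' _ h'
        rw [h32, hk'] at h'
        have h'' := congrArg (· % S) h'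
        simp only [Nat.mul_add_mod_of_lt hk, Nat.mul_add_mod_of_lt (show x < S by omega)] at h''
        omega
    · have := hv r hr'
      rw [h32, hk'] at this
      rw [this]
      refine ⟨linE_eval_lt _ _ _ _ _ _, ?_⟩
      rw [linE_eval _ _ _ _ le_rfl (by rw [hk']; omega), hk', hXe]
  · have h32 : s'.reg 32 = S := by simpa using hF.reg 32 (by simp)
    have hmul : (reg 32 * const q : Expr).eval w s' = S * q := by
      simp [h32, Nat.mod_eq_of_lt (show q < 2 ^ w by omega), Nat.mod_eq_of_lt h2]
    rw [WP_seq, WP_assign, hmul]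
    refine WP_copy (by omega) (by simpa using h2) fun s'' t'' hF' hc ht' => ?_
    have h31 : s''.reg 31 = S * q := by simpa using hF'.reg 31 (by simp [copyCmd, Cmd.wr])
    refine hQ s'' t'' h31 (fun r hr x hx => ?_) ?_
    · have : r * S + x < S * q := by
        have : (r + 1) * S ≤ q * S := Nat.mul_le_mul_right _ hr
        linarith
      rw [hc _ (by simpa using this)]
      exact hI r hr x hx
    · simp at ht ht'
      have e1 : S * (q * (11 * p + 10) + 1 + 8) = S * q * (11 * p + 10) + S * 9 := by ring
      have e2 : S * q * (11 * p + 40) = S * q * (11 * p + 10) + S * q * 30 := by ring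
      omega

theorem WP_transform {w : ℕ} {s : State} {u : ℕ → ℕ → ℤ} {X p q k B t : ℕ}
    {Q : State → ℕ → Prop} (hX : X ≠ 16) (hp : 0 < p) (hq : 0 < q)
    (hk : s.reg 23 = k) (hkw : k < 2 ^ w) (hZ : s.reg 31 = p ^ k) (hB : B < 2 ^ w)
    (hpq : ∀ i ≤ k, q ^ i * p ^ (k - i) ≤ B)
    (hlt : ∀ x < p ^ k, s.arr X x < 2 ^ w)
    (hQ : ∀ s' t', Frame (transform u X p q) s s' →
      (∀ y < q ^ k, s'.arr X y < 2 ^ w ∧ (s'.arr X y : ZMod (2 ^ w)) =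
          ∑ a ∈ Finset.range (p ^ k), (kron u q p k y a : ZMod (2 ^ w)) * s.arr X a) →
      t' ≤ t + (k * (B * (11 * p + 40) + 50) + 10) → Q s' t') :
    WP w (transform u X p q) s t Q := by
  refine WP_for_const (N := k) (fun i s' => s'.reg 31 = q ^ i * p ^ (k - i) ∧
    ∀ hi < q ^ i, ∀ lo < p ^ (k - i), s'.arr X (hi * p ^ (k - i) + lo) < 2 ^ w ∧
      (s'.arr X (hi * p ^ (k - i) + lo) : ZMod (2 ^ w)) =
        ∑ a ∈ Finset.range (p ^ i), (kron u q p i hi a : ZMod (2 ^ w)) * s.arr X (lo * p ^ i + a))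
    (B * (11 * p + 40) + 40) hkw (by simp [copyCmd, Cmd.wr])
    (fun s' hF => by simpa [hk] using hF.reg 23 (by simp [copyCmd, Cmd.wr]))
    (fun k s' x h => by simpa using h) ?_
    (fun i hi s' hF hi' hI t' => ?_) (fun s' t' hF _ hI ht => ?_)
  · refine ⟨by simpa using hZ, fun h0 hh lo hlo => ?_⟩
    obtain rfl : h0 = 0 := by simpa using hh
    simpa [kron] using hlt lo (by simpa using hlo)
  · obtain ⟨h31, hI⟩ := hI
    have hki : k - i = (k - (i + 1)) + 1 := by omega
    set d := k - (i + 1) with hd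
    have hSpos : 0 < q ^ i * p ^ d := by positivity
    have hZ' : s'.reg 31 = q ^ i * p ^ d * p := by rw [h31, hki, pow_succ]; ring
    have hb1 : q ^ i * p ^ d * p ≤ B := by rw [← hZ', h31]; exact hpq i hi.le
    have hb2 : q ^ i * p ^ d * q ≤ B := by
      have := hpq (i + 1) hi
      rw [← hd, pow_succ] at this
      linarith
    refine WP_transform_round hX hp hq hSpos hZ' (by omega) (by omega)
      fun s'' t'' h31' hv ht => ⟨⟨by rw [h31', pow_succ]; ring, fun y hy lo hlo => ?_⟩, ?_⟩
    · have hqi : 0 < q ^ i := by positivity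
      have hy1 : y / q ^ i < q := by
        rw [Nat.div_lt_iff_lt_mul hqi]
        rwa [pow_succ, mul_comm] at hy
      have hy2 : y % q ^ i < q ^ i := Nat.mod_lt _ hqi
      have hx : y % q ^ i * p ^ d + lo < q ^ i * p ^ d := by
        have : (y % q ^ i + 1) * p ^ d ≤ q ^ i * p ^ d := Nat.mul_le_mul_right _ hy2
        linarith
      have hidx : y * p ^ d + lo = y / q ^ i * (q ^ i * p ^ d) + (y % q ^ i * p ^ d + lo) := by
        conv_lhs => rw [← Nat.div_add_mod y (q ^ i)]
        ring
      obtain ⟨hv1, hv2⟩ := hv _ hy1 _ hx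
      rw [hidx]
      refine ⟨hv1, hv2.trans ?_⟩
      have hpi : 0 < p ^ i := by positivity
      -- split the column index of the next power into its top digit and the rest
      have hsplit : ∀ F : ℕ → ZMod (2 ^ w), ∑ a ∈ Finset.range (p ^ (i + 1)), F a =
          ∑ a ∈ Finset.range p, ∑ a' ∈ Finset.range (p ^ i), F (a * p ^ i + a') := by
        intro F
        rw [pow_succ, mul_comm, sum_range_mul]
      rw [hsplit]
      refine Finset.sum_congr rfl fun a ha => ?_
      have ha' := Finset.mem_range.mp ha
      have hlo' : lo * p + a < p ^ (k - i) := by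
        rw [hki, pow_succ]
        have : (lo + 1) * p ≤ p ^ d * p := Nat.mul_le_mul_right _ hlo
        linarith
      have := (hI _ hy2 _ hlo').2
      rw [show (y % q ^ i * p ^ d + lo) * p + a = y % q ^ i * p ^ (k - i) + (lo * p + a) by
        rw [hki, pow_succ]; ring, this, Finset.mul_sum]
      refine Finset.sum_congr rfl fun a' ha' => ?_
      have ha'' := Finset.mem_range.mp ha'
      have e1 : (a * p ^ i + a') % p ^ i = a' := Nat.mul_add_mod_of_lt ha''
      have e2 : (a * p ^ i + a') / p ^ i = a := by
        rw [mul_comm, Nat.mul_add_div hpi, Nat.div_eq_of_lt ha'', add_zero]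
      simp only [kron, e1, e2]
      rw [show lo * p ^ (i + 1) + (a * p ^ i + a') = (lo * p + a) * p ^ i + a' by
        rw [pow_succ]; ring]
      push_cast
      ring
    · refine ht.trans ?_
      have := Nat.mul_le_mul_right (11 * p + 40) hb2
      omega
  · obtain ⟨_, hI⟩ := hI
    refine hQ s' t' hF (fun y hy => ?_) ?_
    · have := hI y hy 0 (by simp)
      simpa using this
    · simp at ht
      refine ht.trans ?_
      have : k * (B * (11 * p + 40) + 40 + 8) ≤ k * (B * (11 * p + 40) + 50) :=
        Nat.mul_le_mul_left _ (by omega)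
      omega

end WordRAM

/-! ### Matrix products from Kronecker powers of a bilinear algorithm -/

namespace WordRAM

/-- The number whose base `n ^ 2` digits are the base `n` digits of `x`. -/
def spread (n x : ℕ) : ℕ := Nat.ofDigits (n ^ 2) (Nat.digits n x)

/-- The position of the entry `(x, y)` of a matrix of order `n ^ k` in the order in which the base
`n` digits of `x` and `y` are interleaved. -/
def interleave (n x y : ℕ) : ℕ := n * spread n x + spread n y

theorem spread_zero (n : ℕ) : spread n 0 = 0 := by simp [spread]

theorem spread_eq {n : ℕ} (hn : 1 < n) (x : ℕ) :
    spread n x = spread n (x / n) * n ^ 2 + x % n := by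
  rcases Nat.eq_zero_or_pos x with rfl | hx
  · simp [spread]
  · rw [spread, Nat.digits_def' hn hx, Nat.ofDigits_cons, spread]
    ring

theorem spread_top {n : ℕ} (hn : 1 < n) (k a x : ℕ) (ha : a < n) (hx : x < n ^ k) :
    spread n (a * n ^ k + x) = a * (n ^ 2) ^ k + spread n x := by
  induction k generalizing x with
  | zero =>
    obtain rfl : x = 0 := by simpa using hx
    rw [spread_eq hn]
    simp [Nat.div_eq_of_lt ha, Nat.mod_eq_of_lt ha, spread_zero]
  | succ k ih =>
    have e1 : (a * n ^ (k + 1) + x) / n = a * n ^ k + x / n := by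
      rw [pow_succ, show a * (n ^ k * n) + x = n * (a * n ^ k) + x by ring,
        Nat.mul_add_div (by omega)]
    have e2 : (a * n ^ (k + 1) + x) % n = x % n := by
      rw [pow_succ, show a * (n ^ k * n) + x = n * (a * n ^ k) + x by ring, Nat.mul_add_mod]
    have hx' : x / n < n ^ k := by
      rw [Nat.div_lt_iff_lt_mul (by omega)]
      rwa [pow_succ] at hx
    rw [spread_eq hn, e1, e2, ih _ hx', spread_eq hn x]
    ring

theorem interleave_eq {n : ℕ} (hn : 1 < n) (x y : ℕ) : interleave n x y =
    interleave n (x / n) (y / n) * n ^ 2 + (n * (x % n) + y % n) := by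
  rw [interleave, spread_eq hn x, spread_eq hn y, interleave]
  ring

theorem digit_pair_lt {n : ℕ} (hn : 1 < n) (x y : ℕ) : n * (x % n) + y % n < n ^ 2 := by
  have h2 : x % n < n := Nat.mod_lt _ (by omega)
  have h3 : y % n < n := Nat.mod_lt _ (by omega)
  nlinarith

theorem interleave_lt {n : ℕ} (hn : 1 < n) (k x y : ℕ) (hx : x < n ^ k) (hy : y < n ^ k) :
    interleave n x y < (n ^ 2) ^ k := by
  induction k generalizing x y with
  | zero =>
    obtain rfl : x = 0 := by simpa using hx
    obtain rfl : y = 0 := by simpa using hy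
    simp [interleave, spread_zero]
  | succ k ih =>
    have hx' : x / n < n ^ k := by
      rw [Nat.div_lt_iff_lt_mul (by omega)]
      rwa [pow_succ] at hx
    have hy' : y / n < n ^ k := by
      rw [Nat.div_lt_iff_lt_mul (by omega)]
      rwa [pow_succ] at hy
    have h1 := ih _ _ hx' hy'
    have h4 := digit_pair_lt hn x y
    have h5 := interleave_eq hn x y
    rw [h5, pow_succ (n ^ 2) k]
    have : (interleave n (x / n) (y / n) + 1) * n ^ 2 ≤ (n ^ 2) ^ k * n ^ 2 :=
      Nat.mul_le_mul_right _ h1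
    linarith

theorem interleave_inj {n : ℕ} (hn : 1 < n) {x y x' y' : ℕ}
    (h : interleave n x y = interleave n x' y') : x = x' ∧ y = y' := by
  induction hm : x + y + x' + y' using Nat.strong_induction_on generalizing x y x' y' with
  | _ m ih =>
    by_cases h0 : x + y + x' + y' = 0
    · omega
    have e1 := interleave_eq hn x y
    have e2 := interleave_eq hn x' y'
    have l1 := digit_pair_lt hn x y
    have l2 := digit_pair_lt hn x' y'
    have hmod : n * (x % n) + y % n = n * (x' % n) + y' % n := by
      have := congrArg (· % n ^ 2) h
      simpa only [e1, e2, Nat.mul_add_mod_of_lt l1, Nat.mul_add_mod_of_lt l2] using this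
    have hdiv : interleave n (x / n) (y / n) = interleave n (x' / n) (y' / n) :=
      Nat.eq_of_mul_eq_mul_right (show 0 < n ^ 2 by positivity) (by omega)
    have hy : y % n = y' % n := by
      have := congrArg (· % n) hmod
      simpa [Nat.mul_add_mod] using this
    have hx : x % n = x' % n := Nat.eq_of_mul_eq_mul_left (show 0 < n by omega) (by omega)
    have d1 := Nat.div_le_self x n
    have d2 := Nat.div_le_self y n
    have d3 := Nat.div_le_self x' n
    have d4 := Nat.div_le_self y' n
    have hlt : x / n + y / n + x' / n + y' / n < m := by
      by_contra hge
      have : ∀ z, z / n = z → z = 0 := fun z hz => by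
        by_contra hz0
        exact absurd hz (Nat.div_lt_self (Nat.pos_of_ne_zero hz0) hn).ne
      have a1 := this x (by omega)
      have a2 := this y (by omega)
      have a3 := this x' (by omega)
      have a4 := this y' (by omega)
      omega
    obtain ⟨i1, i2⟩ := ih _ hlt hdiv rfl
    have f1 := Nat.div_add_mod x n
    have f2 := Nat.div_add_mod y n
    have f3 := Nat.div_add_mod x' n
    have f4 := Nat.div_add_mod y' n
    rw [i1, hx] at f1
    rw [i2, hy] at f2
    omega

theorem exists_interleave {n : ℕ} (hn : 1 < n) (k a : ℕ) (ha : a < (n ^ 2) ^ k) :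
    ∃ x < n ^ k, ∃ y < n ^ k, interleave n x y = a := by
  induction k generalizing a with
  | zero =>
    obtain rfl : a = 0 := by simpa using ha
    exact ⟨0, by simp, 0, by simp, by simp [interleave, spread_zero]⟩
  | succ k ih =>
    have hn2 : 0 < n ^ 2 := by positivity
    obtain ⟨x, hx, y, hy, h⟩ := ih (a / n ^ 2) (by
      rw [Nat.div_lt_iff_lt_mul hn2]
      rwa [pow_succ] at ha)
    have hr := Nat.mod_lt a hn2
    have hlt : a % n ^ 2 / n < n := by
      rw [Nat.div_lt_iff_lt_mul (by omega)]
      rwa [← sq]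
    have hlt' : a % n ^ 2 % n < n := Nat.mod_lt _ (by omega)
    have bd : ∀ z < n ^ k, ∀ r < n, z * n + r < n ^ (k + 1) := fun z hz r hr => by
      have : (z + 1) * n ≤ n ^ k * n := Nat.mul_le_mul_right _ hz
      rw [pow_succ]
      linarith
    refine ⟨x * n + a % n ^ 2 / n, bd _ hx _ hlt, y * n + a % n ^ 2 % n, bd _ hy _ hlt', ?_⟩
    have dm : ∀ c m : ℕ, m < n → (c * n + m) / n = c := by
      intro c m hm
      rw [mul_comm, Nat.mul_add_div (by omega), Nat.div_eq_of_lt hm, add_zero]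
    rw [interleave_eq hn, dm _ _ hlt, dm _ _ hlt', Nat.mul_add_mod_of_lt hlt,
      Nat.mul_add_mod_of_lt hlt', h, Nat.div_add_mod, Nat.div_add_mod']

theorem interleave_top {n : ℕ} (hn : 1 < n) (k a b x y : ℕ) (ha : a < n) (hb : b < n)
    (hx : x < n ^ k) (hy : y < n ^ k) :
    interleave n (a * n ^ k + x) (b * n ^ k + y) =
      (n * a + b) * (n ^ 2) ^ k + interleave n x y := by
  rw [interleave, spread_top hn k a x ha hx, spread_top hn k b y hb hy, interleave]
  ring

/-- Summation over all positions of a matrix of order `n ^ k`. -/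
theorem sum_interleave {M : Type*} [AddCommMonoid M] {n : ℕ} (hn : 1 < n) (k : ℕ) (F : ℕ → M) :
    ∑ a ∈ Finset.range ((n ^ 2) ^ k), F a =
      ∑ x ∈ Finset.range (n ^ k), ∑ y ∈ Finset.range (n ^ k), F (interleave n x y) := by
  induction k generalizing F with
  | zero => simp [interleave, spread_zero]
  | succ k ih =>
    rw [pow_succ, mul_comm, sum_range_mul, pow_succ n k, mul_comm (n ^ k), sum_range_mul, sq,
      sum_range_mul]
    refine Finset.sum_congr rfl fun a ha => ?_
    simp_rw [← sq, ih, sum_range_mul _ n (n ^ k)]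
    rw [Finset.sum_comm]
    refine Finset.sum_congr rfl fun x hx => Finset.sum_congr rfl fun b hb =>
      Finset.sum_congr rfl fun y hy => ?_
    rw [Finset.mem_range] at ha hb hx hy
    rw [interleave_top hn k a b x y ha hb hx hy, mul_comm n a]

/-- The integers `U`, `V`, `W` form a bilinear algorithm with `R` multiplications for `D` times the
product of two matrices of order `n`; the entry `(x, y)` of a matrix has position `n x + y`. -/
def BilinearMul (n R : ℕ) (D : ℤ) (U V W : ℕ → ℕ → ℤ) : Prop :=
  ∀ x < n, ∀ y < n, ∀ y' < n, ∀ z < n, ∀ x' < n, ∀ z' < n,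
    ∑ t ∈ Finset.range R, W (n * x' + z') t * U t (n * x + y) * V t (n * y' + z) =
      if x = x' ∧ y = y' ∧ z = z' then D else 0

/-- The Kronecker powers of a bilinear algorithm multiply matrices whose entries are stored at the
positions given by `interleave`. -/
theorem BilinearMul.kron {n R : ℕ} {D : ℤ} {U V W : ℕ → ℕ → ℤ} (h : BilinearMul n R D U V W)
    (hn : 1 < n) (k : ℕ) :
    ∀ x < n ^ k, ∀ y < n ^ k, ∀ y' < n ^ k, ∀ z < n ^ k, ∀ x' < n ^ k, ∀ z' < n ^ k,
      ∑ t ∈ Finset.range (R ^ k), kron W (n ^ 2) R k (interleave n x' z') t *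
        kron U R (n ^ 2) k t (interleave n x y) * kron V R (n ^ 2) k t (interleave n y' z) =
      if x = x' ∧ y = y' ∧ z = z' then D ^ k else 0 := by
  induction k with
  | zero =>
    intro x hx y hy y' hy' z hz x' hx' z' hz'
    simp only [pow_zero, Nat.lt_one_iff] at hx hy hy' hz hx' hz'
    subst_vars
    simp [WordRAM.kron]
  | succ k ih =>
    have hnk : 0 < n ^ k := by positivity
    -- every index has a top digit and a remainder
    have split : ∀ x < n ^ (k + 1), ∃ a < n, ∃ x0 < n ^ k, x = a * n ^ k + x0 := by
      intro x hx
      refine ⟨x / n ^ k, ?_, x % n ^ k, Nat.mod_lt _ hnk, ?_⟩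
      · rw [Nat.div_lt_iff_lt_mul hnk]
        rwa [pow_succ, mul_comm] at hx
      · rw [mul_comm]; exact (Nat.div_add_mod x _).symm
    have inj : ∀ a x b y, x < n ^ k → y < n ^ k → (a * n ^ k + x = b * n ^ k + y ↔
        a = b ∧ x = y) := by
      intro a x b y hx hy
      refine ⟨fun h' => ?_, fun h' => by rw [h'.1, h'.2]⟩
      have h1 := congrArg (· % n ^ k) h'
      simp only [Nat.mul_add_mod_of_lt hx, Nat.mul_add_mod_of_lt hy] at h1
      exact ⟨Nat.eq_of_mul_eq_mul_right hnk (by omega), h1⟩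
    intro x hx y hy y' hy' z hz x' hx' z' hz'
    obtain ⟨xa, hxa, x, kx, rfl⟩ := split x hx
    obtain ⟨ya, hya, y, ky, rfl⟩ := split y hy
    obtain ⟨ya', hya', y', ky', rfl⟩ := split y' hy'
    obtain ⟨za, hza, z, kz, rfl⟩ := split z hz
    obtain ⟨xa', hxa', x', kx', rfl⟩ := split x' hx'
    obtain ⟨za', hza', z', kz', rfl⟩ := split z' hz'
    simp only [inj _ _ _ _ kx kx', inj _ _ _ _ ky ky', inj _ _ _ _ kz kz']
    rw [interleave_top hn k _ _ _ _ hxa' hza' kx' kz', interleave_top hn k _ _ _ _ hxa hya kx ky,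
      interleave_top hn k _ _ _ _ hya' hza ky' kz]
    have l1 := interleave_lt hn k _ _ kx' kz'
    have l2 := interleave_lt hn k _ _ kx ky
    have l3 := interleave_lt hn k _ _ ky' kz
    have dm : ∀ c m N : ℕ, m < N → (c * N + m) / N = c := by
      intro c m N hm
      rw [mul_comm, Nat.mul_add_div (by omega), Nat.div_eq_of_lt hm, add_zero]
    rw [pow_succ, mul_comm, sum_range_mul]
    have key : ∀ a ∈ Finset.range R, ∀ b ∈ Finset.range (R ^ k),
        WordRAM.kron W (n ^ 2) R (k + 1) ((n * xa' + za') * (n ^ 2) ^ k + interleave n x' z')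
          (a * R ^ k + b) *
        WordRAM.kron U R (n ^ 2) (k + 1) (a * R ^ k + b)
          ((n * xa + ya) * (n ^ 2) ^ k + interleave n x y) *
        WordRAM.kron V R (n ^ 2) (k + 1) (a * R ^ k + b)
          ((n * ya' + za) * (n ^ 2) ^ k + interleave n y' z) =
        (W (n * xa' + za') a * U a (n * xa + ya) * V a (n * ya' + za)) *
        (WordRAM.kron W (n ^ 2) R k (interleave n x' z') b *
          WordRAM.kron U R (n ^ 2) k b (interleave n x y) *
          WordRAM.kron V R (n ^ 2) k b (interleave n y' z)) := by
      intro a _ b hb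
      have hb := Finset.mem_range.mp hb
      simp only [WordRAM.kron, Nat.mul_add_mod_of_lt l1, Nat.mul_add_mod_of_lt l2,
        Nat.mul_add_mod_of_lt l3, Nat.mul_add_mod_of_lt hb, dm _ _ _ l1, dm _ _ _ l2, dm _ _ _ l3,
        dm _ _ _ hb]
      ring
    rw [Finset.sum_congr rfl fun a ha => Finset.sum_congr rfl (key a ha)]
    simp_rw [← Finset.mul_sum]
    rw [ih x kx y ky y' ky' z kz x' kx' z' kz', ← Finset.sum_mul,
      h xa hxa ya hya ya' hya' za hza xa' hxa' za' hza']
    by_cases h1 : x = x' ∧ y = y' ∧ z = z' <;> by_cases h2 : xa = xa' ∧ ya = ya' ∧ za = za'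
    · rw [if_pos h1, if_pos h2, if_pos (by tauto), pow_succ']
    · rw [if_neg h2, zero_mul, if_neg (fun h => h2 ⟨h.1.1, h.2.1.1, h.2.2.1⟩)]
    · rw [if_neg h1, mul_zero, if_neg (fun h => h1 ⟨h.1.2, h.2.1.2, h.2.2.2⟩)]
    · rw [if_neg h1, mul_zero, if_neg (fun h => h1 ⟨h.1.2, h.2.1.2, h.2.2.2⟩)]

/-- The three transforms compute `D ^ k` times the product of two matrices of order `n ^ k`. -/
theorem BilinearMul.kron_mul {n R : ℕ} {D : ℤ} {U V W : ℕ → ℕ → ℤ}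
    (h : BilinearMul n R D U V W) (hn : 1 < n) (k : ℕ) {A : Type*} [CommRing A]
    (f g : ℕ → A) (x z : ℕ) (hx : x < n ^ k) (hz : z < n ^ k) :
    ∑ t ∈ Finset.range (R ^ k), (WordRAM.kron W (n ^ 2) R k (interleave n x z) t : A) *
      ((∑ a ∈ Finset.range ((n ^ 2) ^ k), (WordRAM.kron U R (n ^ 2) k t a : A) * f a) *
       (∑ a ∈ Finset.range ((n ^ 2) ^ k), (WordRAM.kron V R (n ^ 2) k t a : A) * g a)) =
    (D : A) ^ k * ∑ y ∈ Finset.range (n ^ k), f (interleave n x y) * g (interleave n y z) := by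
  simp_rw [sum_interleave hn, Finset.sum_mul, Finset.mul_sum]
  rw [Finset.sum_comm]
  have step : ∀ x' ∈ Finset.range (n ^ k), ∀ y ∈ Finset.range (n ^ k),
      ∀ y' ∈ Finset.range (n ^ k), ∀ z' ∈ Finset.range (n ^ k),
      ∑ t ∈ Finset.range (R ^ k), (WordRAM.kron W (n ^ 2) R k (interleave n x z) t : A) *
        ((WordRAM.kron U R (n ^ 2) k t (interleave n x' y) : A) * f (interleave n x' y) *
         ((WordRAM.kron V R (n ^ 2) k t (interleave n y' z') : A) * g (interleave n y' z'))) =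
      if x' = x then if y = y' then if z' = z then
        (D : A) ^ k * (f (interleave n x' y) * g (interleave n y' z')) else 0 else 0 else 0 := by
    intro x' hx' y hy y' hy' z' hz'
    simp only [Finset.mem_range] at hx' hy hy' hz'
    have := congrArg (Int.cast : ℤ → A) (h.kron hn k x' hx' y hy y' hy' z' hz' x hx z hz)
    push_cast at this
    calc _ = (∑ t ∈ Finset.range (R ^ k), (WordRAM.kron W (n ^ 2) R k (interleave n x z) t : A) *
        WordRAM.kron U R (n ^ 2) k t (interleave n x' y) *
        WordRAM.kron V R (n ^ 2) k t (interleave n y' z')) *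
          (f (interleave n x' y) * g (interleave n y' z')) := by
          rw [Finset.sum_mul]
          exact Finset.sum_congr rfl fun t _ => by ring
      _ = _ := by
        rw [this]
        split_ifs <;> first | rfl | simp_all
  calc _ = ∑ x' ∈ Finset.range (n ^ k), ∑ y ∈ Finset.range (n ^ k),
      ∑ y' ∈ Finset.range (n ^ k), ∑ z' ∈ Finset.range (n ^ k),
      ∑ t ∈ Finset.range (R ^ k), (WordRAM.kron W (n ^ 2) R k (interleave n x z) t : A) *
        ((WordRAM.kron U R (n ^ 2) k t (interleave n x' y) : A) * f (interleave n x' y) *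
         ((WordRAM.kron V R (n ^ 2) k t (interleave n y' z') : A) * g (interleave n y' z'))) := by
        refine Finset.sum_congr rfl fun x' _ => ?_
        rw [Finset.sum_comm]
        refine Finset.sum_congr rfl fun y _ => ?_
        rw [Finset.sum_comm]
        refine Finset.sum_congr rfl fun y' _ => ?_
        rw [Finset.sum_comm]
    _ = _ := by
        rw [Finset.sum_congr rfl fun x' hx' => Finset.sum_congr rfl fun y hy =>
          Finset.sum_congr rfl fun y' hy' => Finset.sum_congr rfl fun z' hz' =>
          step x' hx' y hy y' hy' z' hz']
        simp [Finset.sum_ite_irrel, hx, hz]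
        refine Finset.sum_congr rfl fun y hy => ?_
        simp [Finset.mem_range.mp hy]

end WordRAM

/-! ### Counting triangles by matrix multiplication -/

namespace WordRAM
open WordRAM.Expr (const reg load)

theorem sub_mod_two_pow {w x y : ℕ} (h : y ≤ x) (hx : x < 2 ^ w) :
    (x + (2 ^ w - y % 2 ^ w)) % 2 ^ w = x - y := by
  rw [Nat.mod_eq_of_lt (show y < 2 ^ w by omega), show x + (2 ^ w - y) = (x - y) + 2 ^ w by omega,
    Nat.add_mod_right, Nat.mod_eq_of_lt (by omega)]

/-- A bilinear algorithm over the integers: `R` multiplications give `D` times the product of two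
matrices of order `n`. -/
structure BilinearAlg where
  n : ℕ
  R : ℕ
  D : ℕ
  U : ℕ → ℕ → ℤ
  V : ℕ → ℕ → ℤ
  W : ℕ → ℕ → ℤ
  one_lt_n : 1 < n
  sq_le_R : n ^ 2 ≤ R
  D_pos : 0 < D
  mul : BilinearMul n R D U V W

namespace BilinearAlg

variable (a : BilinearAlg) {w : ℕ} {s : State} {t : ℕ} {Q : State → ℕ → Prop}

/-- With `N` in register `14`, find the least `k` such that `N ≤ n ^ k`, and compute `n ^ k`, `k`,
`R ^ k` and `D ^ k` in the registers `22`, `23`, `24`, `25`. -/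
def sizes : Cmd :=
  22 ≔ const 1 ;; 23 ≔ const 0 ;; 24 ≔ const 1 ;; 25 ≔ const 1 ;;
  forLoop 26 (reg 14) (.ite (.op .lt (reg 22) (reg 14))
    (22 ≔ reg 22 * const a.n ;; 23 ≔ reg 23 + const 1 ;; 24 ≔ reg 24 * const a.R ;;
      25 ≔ reg 25 * const a.D) .skip)

theorem WP_sizes {N : ℕ} (hN : s.reg 14 = N) (hNw : N < 2 ^ w)
    (h1 : a.R ^ (Nat.clog a.n N) < 2 ^ w) (h2 : a.D ^ (Nat.clog a.n N) < 2 ^ w)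
    (h3 : a.R < 2 ^ w) (h4 : a.D < 2 ^ w)
    (hQ : ∀ s' t', Frame a.sizes s s' → s'.reg 22 = a.n ^ Nat.clog a.n N →
      s'.reg 23 = Nat.clog a.n N → s'.reg 24 = a.R ^ Nat.clog a.n N →
      s'.reg 25 = a.D ^ Nat.clog a.n N → t' ≤ t + (N * 40 + 20) → Q s' t') :
    WP w a.sizes s t Q := by
  have hn := a.one_lt_n
  have hR := a.sq_le_R
  have hD := a.D_pos
  set c := Nat.clog a.n N with hc
  have hnR : a.n ≤ a.R := by nlinarith
  have h1w : 1 < 2 ^ w := by omega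
  have pow_lt : ∀ b, 0 < b → b ^ c < 2 ^ w → ∀ i ≤ c, b ^ i < 2 ^ w := fun b hb hb' i hi =>
    (Nat.pow_le_pow_right hb hi).trans_lt hb'
  have hnc : a.n ^ c < 2 ^ w := (Nat.pow_le_pow_left hnR c).trans_lt h1
  refine WP.mono (Q := fun s' t' => s'.reg 22 = a.n ^ c ∧ s'.reg 23 = c ∧ s'.reg 24 = a.R ^ c ∧
    s'.reg 25 = a.D ^ c ∧ t' ≤ t + (N * 40 + 20)) ?_
    fun s' t' hF h => hQ s' t' hF h.1 h.2.1 h.2.2.1 h.2.2.2.1 h.2.2.2.2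
  simp only [sizes, WP_seq, WP_assign, Expr.eval_const, Nat.mod_eq_of_lt h1w, Nat.zero_mod]
  refine WP_for_const (N := N) (fun i s' => s'.reg 22 = a.n ^ min i c ∧ s'.reg 23 = min i c ∧
    s'.reg 24 = a.R ^ min i c ∧ s'.reg 25 = a.D ^ min i c) 30 hNw rfl
    (fun s' hF => by simpa [hN] using hF.reg 14 rfl) (fun i s' x h => by simpa using h) (by simp)
    (fun i hi s' hF hi' hI t' => ?_) (fun s' t' hF _ hI ht => ?_)
  · obtain ⟨e1, e2, e3, e4⟩ := hI
    have h14 : s'.reg 14 = N := by simpa [hN] using hF.reg 14 rfl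
    simp only [WP_ite, Expr.eval_lt, Expr.eval_reg, h14, e1]
    by_cases hic : i < c
    · have hlt : a.n ^ min i c < N := by
        rw [min_eq_left hic.le]
        by_contra hge
        exact absurd (Nat.clog_le_of_le_pow (not_lt.mp hge)) (not_le.mpr hic)
      have hm : min i c = i := min_eq_left hic.le
      have hm' : min (i + 1) c = i + 1 := min_eq_left hic
      have p1 := pow_lt a.n (by omega) hnc (i + 1) hic
      have p2 := pow_lt a.R (by omega) h1 (i + 1) hic
      have p3 := pow_lt a.D hD h2 (i + 1) hic
      simp only [hm] at e1 e2 e3 e4 hlt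
      rw [pow_succ] at p1 p2 p3
      have q1 := Nat.mod_eq_of_lt h1w
      have q2 := Nat.mod_eq_of_lt h3
      have q3 := Nat.mod_eq_of_lt h4
      have q4 := Nat.mod_eq_of_lt (show a.n < 2 ^ w by omega)
      have q5 := Nat.mod_eq_of_lt (show i + 1 < 2 ^ w by omega)
      have q6 := Nat.mod_eq_of_lt p1
      have q7 := Nat.mod_eq_of_lt p2
      have q8 := Nat.mod_eq_of_lt p3
      simp [hm, hm', hlt, e1, e2, e3, e4, q1, q2, q3, q4, q5, q6, q7, q8, pow_succ]
    · have hlt : ¬ a.n ^ min i c < N := by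
        rw [min_eq_right (by omega), not_lt]
        exact Nat.le_pow_clog hn N
      have hm : min i c = c := min_eq_right (by omega)
      have hm' : min (i + 1) c = c := min_eq_right (by omega)
      simp only [hlt, if_false, ne_eq, not_true_eq_false, WP_skip, hm']
      rw [hm] at e1 e2 e3 e4
      exact ⟨⟨e1, e2, e3, e4⟩, by simp⟩
  · have hcN : c ≤ N := Nat.clog_le_of_le_pow (Nat.lt_pow_self hn).le
    rw [min_eq_right hcN] at hI
    obtain ⟨e1, e2, e3, e4⟩ := hI
    refine ⟨e1, e2, e3, e4, ?_⟩
    simp at ht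
    omega

/-- Tabulate `spread` in the array `11`, for the arguments below the content of register `22`. -/
def spreadTable : Cmd :=
  .store 11 (const 0) (const 0) ;;
  forLoop 26 (reg 22) (.store 11 (reg 26)
    (load 11 (reg 26 / const a.n) * const (a.n ^ 2) + (reg 26 - reg 26 / const a.n * const a.n)))

theorem WP_spreadTable {k : ℕ} (hM : s.reg 22 = a.n ^ k) (h1 : (a.n ^ 2) ^ k < 2 ^ w)
    (h2 : a.n ^ 2 < 2 ^ w)
    (hQ : ∀ s' t', Frame a.spreadTable s s' → (∀ x < a.n ^ k, s'.arr 11 x = spread a.n x) →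
      t' ≤ t + (a.n ^ k * 40 + 20) → Q s' t') :
    WP w a.spreadTable s t Q := by
  have hn := a.one_lt_n
  have hnn : a.n < 2 ^ w := lt_of_le_of_lt (Nat.le_self_pow two_ne_zero _) h2
  have hMw : a.n ^ k < 2 ^ w := by
    refine lt_of_le_of_lt ?_ h1
    exact Nat.pow_le_pow_left (Nat.le_self_pow two_ne_zero _) k
  refine WP.mono (Q := fun s' t' => (∀ x < a.n ^ k, s'.arr 11 x = spread a.n x) ∧
    t' ≤ t + (a.n ^ k * 40 + 20)) ?_ fun s' t' hF h => hQ s' t' hF h.1 h.2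
  simp only [spreadTable, WP_seq, WP_store, Expr.eval_const, Nat.zero_mod]
  refine WP_for_const (N := a.n ^ k) (fun i s' => s'.arr 11 0 = 0 ∧
      ∀ x < i, s'.arr 11 x = spread a.n x) 30 hMw rfl
    (fun s' hF => by simpa [hM] using hF.reg 22 rfl) (fun i s' x h => by simpa using h) (by simp)
    (fun i hi s' hF hi' hI t' => ?_) (fun s' t' hF _ hI ht => ⟨hI.2, ?_⟩)
  · obtain ⟨hI0, hI⟩ := hI
    have hval : s'.arr 11 (i / a.n) = spread a.n (i / a.n) := by
      rcases Nat.eq_zero_or_pos i with rfl | hpos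
      · simpa [spread_zero] using hI0
      · exact hI _ (Nat.div_lt_self hpos hn)
    have hsp := spread_eq hn i
    have hlt : spread a.n i < 2 ^ w := by
      have := interleave_lt hn k 0 i (by positivity) hi
      simp only [interleave, spread_zero, mul_zero, zero_add] at this
      omega
    have hle : i / a.n * a.n ≤ i := Nat.div_mul_le_self i a.n
    have hmod : i - i / a.n * a.n = i % a.n := by
      have := Nat.div_add_mod i a.n
      rw [mul_comm] at this
      omega
    simp only [WP_store, Expr.eval_add, Expr.eval_mul, Expr.eval_sub, Expr.eval_div, Expr.eval_load,
      Expr.eval_reg, Expr.eval_const, hi', Nat.mod_eq_of_lt hnn, hval, Nat.mod_eq_of_lt h2]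
    rw [Nat.mod_eq_of_lt (show i / a.n * a.n < 2 ^ w by omega), sub_mod_two_pow hle (by omega), hmod,
      Nat.mod_eq_of_lt (show spread a.n (i / a.n) * a.n ^ 2 < 2 ^ w by omega), ← hsp,
      Nat.mod_eq_of_lt hlt]
    refine ⟨⟨?_, fun x hx => ?_⟩, by simp⟩
    · rcases Nat.eq_zero_or_pos i with rfl | hpos
      · simp [spread_zero]
      · simp [Function.update_of_ne hpos.ne, hI0]
    · rcases Nat.lt_succ_iff_lt_or_eq.mp hx with h | rfl
      · simp [Function.update_of_ne h.ne, hI x h]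
      · simp
  · simp at ht
    omega

end BilinearAlg

end WordRAM

namespace WordRAM
open WordRAM.Expr (const reg load)
namespace BilinearAlg

variable (a : BilinearAlg) {w : ℕ} {s : State} {t : ℕ} {Q : State → ℕ → Prop}

/-- Multiply the matrices of order `n ^ k` in the arrays `13` and `14`; the array `15` receives
`D ^ k` times the product. -/
def product : Cmd :=
  31 ≔ reg 22 * reg 22 ;; transform a.U 13 (a.n ^ 2) a.R ;;
  31 ≔ reg 22 * reg 22 ;; transform a.V 14 (a.n ^ 2) a.R ;;
  forLoop 26 (reg 24) (.store 15 (reg 26) (load 13 (reg 26) * load 14 (reg 26))) ;;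
  31 ≔ reg 24 ;; transform a.W 15 a.R (a.n ^ 2)

theorem product_wr (r : ℕ) :
    a.product.wr r = (r == 31 || r == 33 || r == 32 || r == 34 || r == 26) := by
  simp only [product, Cmd.wr, transform_wr, forLoop_wr]
  cases r == 31 <;> cases r == 33 <;> cases r == 32 <;> cases r == 34 <;> cases r == 26 <;> rfl

theorem product_wa (b : ℕ) (h13 : b ≠ 13) (h14 : b ≠ 14) (h15 : b ≠ 15) (h16 : b ≠ 16) :
    a.product.wa b = false := by
  simp [product, Cmd.wa, transform_wa, h13, h14, h15, h16]

theorem WP_product {k : ℕ} (hM : s.reg 22 = a.n ^ k) (hk : s.reg 23 = k)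
    (hR : s.reg 24 = a.R ^ k) (hkw : k < 2 ^ w) (hRw : a.R ^ k < 2 ^ w)
    (hf : ∀ x < (a.n ^ 2) ^ k, s.arr 13 x < 2 ^ w) (hg : ∀ x < (a.n ^ 2) ^ k, s.arr 14 x < 2 ^ w)
    (hQ : ∀ s' t', Frame a.product s s' →
      (∀ x < a.n ^ k, ∀ z < a.n ^ k, s'.arr 15 (interleave a.n x z) < 2 ^ w ∧
        (s'.arr 15 (interleave a.n x z) : ZMod (2 ^ w)) = (a.D : ZMod (2 ^ w)) ^ k *
          ∑ y ∈ Finset.range (a.n ^ k), (s.arr 13 (interleave a.n x y) : ZMod (2 ^ w)) *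
            s.arr 14 (interleave a.n y z)) →
      t' ≤ t + ((k + 1) * (a.R ^ k * (33 * a.R + 500))) → Q s' t') :
    WP w a.product s t Q := by
  have hn := a.one_lt_n
  have hnR := a.sq_le_R
  have hn2 : 0 < a.n ^ 2 := by positivity
  have hRpos : 0 < a.R := by omega
  have hRk : 0 < a.R ^ k := by positivity
  have hsq : a.n ^ k * a.n ^ k = (a.n ^ 2) ^ k := by rw [← mul_pow, sq]
  have hle : (a.n ^ 2) ^ k ≤ a.R ^ k := Nat.pow_le_pow_left hnR k
  have hUV : ∀ i ≤ k, a.R ^ i * (a.n ^ 2) ^ (k - i) ≤ a.R ^ k := fun i hi => by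
    calc _ ≤ a.R ^ i * a.R ^ (k - i) := Nat.mul_le_mul_left _ (Nat.pow_le_pow_left hnR _)
      _ = a.R ^ k := by rw [← pow_add]; congr 1; omega
  have hW : ∀ i ≤ k, (a.n ^ 2) ^ i * a.R ^ (k - i) ≤ a.R ^ k := fun i hi => by
    calc _ ≤ a.R ^ i * a.R ^ (k - i) := Nat.mul_le_mul_right _ (Nat.pow_le_pow_left hnR _)
      _ = a.R ^ k := by rw [← pow_add]; congr 1; omega
  have hmm : (a.n ^ k * a.n ^ k) % 2 ^ w = (a.n ^ 2) ^ k := by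
    rw [hsq, Nat.mod_eq_of_lt (by omega)]
  refine WP.mono (Q := fun s' t' =>
      (∀ x < a.n ^ k, ∀ z < a.n ^ k, s'.arr 15 (interleave a.n x z) < 2 ^ w ∧
        (s'.arr 15 (interleave a.n x z) : ZMod (2 ^ w)) = (a.D : ZMod (2 ^ w)) ^ k *
          ∑ y ∈ Finset.range (a.n ^ k), (s.arr 13 (interleave a.n x y) : ZMod (2 ^ w)) *
            s.arr 14 (interleave a.n y z)) ∧
      t' ≤ t + ((k + 1) * (a.R ^ k * (33 * a.R + 500)))) ?_
    fun s' t' hF h => hQ s' t' hF h.1 h.2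
  simp only [product, WP_seq, WP_assign, Expr.eval_mul, Expr.eval_reg, hM, hmm]
  refine WP_transform (k := k) (by norm_num) hn2 hRpos (by simpa using hk) hkw (by simp) hRw hUV
    (by simpa using hf) fun s₁ t₁ hF₁ hv₁ ht₁ => ?_
  have h22 : s₁.reg 22 = a.n ^ k := by
    simpa [hM] using hF₁.reg 22 (by simp [transform_wr])
  have h23 : s₁.reg 23 = k := by simpa [hk] using hF₁.reg 23 (by simp [transform_wr])
  have h24 : s₁.reg 24 = a.R ^ k := by simpa [hR] using hF₁.reg 24 (by simp [transform_wr])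
  have h14 : s₁.arr 14 = s.arr 14 := by
    simpa using hF₁.arr 14 (transform_wa _ _ _ _ _ (by norm_num) (by norm_num))
  rw [h22, hmm]
  refine WP_transform (k := k) (by norm_num) hn2 hRpos (by simpa using h23) hkw (by simp) hRw hUV
    (by simpa [h14] using hg) fun s₂ t₂ hF₂ hv₂ ht₂ => ?_
  have h23' : s₂.reg 23 = k := by simpa [h23] using hF₂.reg 23 (by simp [transform_wr])
  have h24' : s₂.reg 24 = a.R ^ k := by simpa [h24] using hF₂.reg 24 (by simp [transform_wr])
  have h13 : s₂.arr 13 = s₁.arr 13 := by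
    simpa using hF₂.arr 13 (transform_wa _ _ _ _ _ (by norm_num) (by norm_num))
  refine WP_for_const (N := a.R ^ k) (fun i s' => ∀ x < i, s'.arr 15 x =
      (s₂.arr 13 x * s₂.arr 14 x) % 2 ^ w) 10 hRw rfl
    (fun s' hF => by simpa [h24'] using hF.reg 24 rfl) (fun i s' x h => by simpa using h) (by simp)
    (fun i hi s' hF hi' hI t' => ?_) (fun s₃ t₃ hF₃ _ hI ht₃ => ?_)
  · have e13 : s'.arr 13 = s₂.arr 13 := hF.arr 13 rfl
    have e14 : s'.arr 14 = s₂.arr 14 := hF.arr 14 rfl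
    simp only [WP_store, Expr.eval_mul, Expr.eval_load, Expr.eval_reg, hi', e13, e14]
    refine ⟨fun x hx => ?_, by simp⟩
    rcases Nat.lt_succ_iff_lt_or_eq.mp hx with h | rfl
    · simp [Function.update_of_ne h.ne, hI x h]
    · simp
  have h23'' : s₃.reg 23 = k := (hF₃.reg 23 rfl).trans h23'
  have h24'' : s₃.reg 24 = a.R ^ k := (hF₃.reg 24 rfl).trans h24'
  rw [h24'']
  refine WP_transform (k := k) (by norm_num) hRpos hn2 (by simpa using h23'') hkw (by simp) hRw hW
    (fun x hx => by simpa [hI x hx] using Nat.mod_lt _ (by positivity)) fun s₄ t₄ _ hv₄ ht₄ => ?_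
  refine ⟨fun x hx z hz => ?_, ?_⟩
  · obtain ⟨l, e⟩ := hv₄ _ (interleave_lt hn k x z hx hz)
    refine ⟨l, e.trans ?_⟩
    rw [← Int.cast_natCast a.D, ← a.mul.kron_mul hn k (fun i => (s.arr 13 i : ZMod (2 ^ w)))
      (fun i => (s.arr 14 i : ZMod (2 ^ w))) x z hx hz]
    refine Finset.sum_congr rfl fun r hr => ?_
    have hr := Finset.mem_range.mp hr
    have e1 := (hv₁ r hr).2
    have e2 := (hv₂ r hr).2
    simp only [State.arr_setReg] at e1 e2 ⊢
    rw [hI r hr, cast_mod_two_pow, Nat.cast_mul, h13, e1, e2, h14]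
  · simp at ht₁ ht₂ ht₃ ht₄
    have hkk : k ≤ k * a.R ^ k := Nat.le_mul_of_pos_right _ hRk
    have e3 : 150 * k ≤ 380 * (k * a.R ^ k) := by omega
    have e1 : (k + 1) * (a.R ^ k * (33 * a.R + 500)) =
      3 * (k * (a.R ^ k * (11 * a.R + 40) + 50)) + a.R ^ k * (33 * a.R + 500)
        + 380 * (k * a.R ^ k) - 150 * k := by
      apply (Nat.sub_eq_of_eq_add _).symm
      ring
    have e2 : k * (a.R ^ k * (11 * a.n ^ 2 + 40) + 50) ≤ k * (a.R ^ k * (11 * a.R + 40) + 50) := by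
      gcongr
    have e4 : a.R ^ k * (33 * a.R + 500) = a.R ^ k * (33 * a.R) + 500 * a.R ^ k := by ring
    omega

/-- `WP_product` for matrices of natural numbers, when the word length suffices. -/
theorem WP_product_nat {k : ℕ} (A B : ℕ → ℕ → ℕ) (hM : s.reg 22 = a.n ^ k) (hk : s.reg 23 = k)
    (hR : s.reg 24 = a.R ^ k) (hkw : k < 2 ^ w) (hRw : a.R ^ k < 2 ^ w)
    (hA : ∀ x < a.n ^ k, ∀ y < a.n ^ k, s.arr 13 (interleave a.n x y) = A x y)
    (hB : ∀ x < a.n ^ k, ∀ y < a.n ^ k, s.arr 14 (interleave a.n x y) = B x y)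
    (hf : ∀ x < (a.n ^ 2) ^ k, s.arr 13 x < 2 ^ w) (hg : ∀ x < (a.n ^ 2) ^ k, s.arr 14 x < 2 ^ w)
    (hlt : ∀ x z, a.D ^ k * ∑ y ∈ Finset.range (a.n ^ k), A x y * B y z < 2 ^ w)
    (hQ : ∀ s' t', Frame a.product s s' →
      (∀ x < a.n ^ k, ∀ z < a.n ^ k, s'.arr 15 (interleave a.n x z) =
        a.D ^ k * ∑ y ∈ Finset.range (a.n ^ k), A x y * B y z) →
      t' ≤ t + ((k + 1) * (a.R ^ k * (33 * a.R + 500))) → Q s' t') :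
    WP w a.product s t Q := by
  refine a.WP_product hM hk hR hkw hRw hf hg fun s' t' hF h ht => hQ s' t' hF (fun x hx z hz => ?_) ht
  obtain ⟨l, e⟩ := h x hx z hz
  have : ((a.D ^ k * ∑ y ∈ Finset.range (a.n ^ k), A x y * B y z : ℕ) : ZMod (2 ^ w)) =
      s'.arr 15 (interleave a.n x z) := by
    rw [e]
    push_cast
    congr 1
    refine Finset.sum_congr rfl fun y hy => ?_
    have hy := Finset.mem_range.mp hy
    rw [hA x hx y hy, hB y hy z hz]
  rw [ZMod.natCast_eq_natCast_iff'] at this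
  rwa [Nat.mod_eq_of_lt (hlt x z), Nat.mod_eq_of_lt l, eq_comm] at this

end BilinearAlg
end WordRAM

/-! ### Chains of a relation -/

namespace WordRAM
open WordRAM.Expr (const reg load)

/-- The lists of length `i` with entries from `V` in which any two entries are related by `E`, the
earlier one to the later one. -/
def chains (E : ℕ → ℕ → Bool) (V : List ℕ) : ℕ → List (List ℕ)
  | 0 => [[]]
  | i + 1 => (chains E V i).flatMap fun c => (V.filter fun v => c.all (E · v)).map fun v => c ++ [v]

theorem mem_chains {E : ℕ → ℕ → Bool} {V : List ℕ} {i : ℕ} {l : List ℕ} :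
    l ∈ chains E V i ↔ l.length = i ∧ (∀ x ∈ l, x ∈ V) ∧ l.Pairwise (fun u v => E u v) := by
  induction i generalizing l with
  | zero =>
    simp only [chains, List.mem_singleton]
    constructor
    · rintro rfl; simp
    · rintro ⟨h, -⟩; exact List.length_eq_zero_iff.mp h
  | succ i ih =>
    simp only [chains, List.mem_flatMap, List.mem_map, List.mem_filter, List.all_eq_true, ih]
    constructor
    · rintro ⟨c, ⟨h1, h2, h3⟩, v, ⟨hv, hc⟩, rfl⟩
      refine ⟨by simp [h1], ?_, ?_⟩
      · intro x hx
        rcases List.mem_append.mp hx with h | h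
        · exact h2 x h
        · rw [List.mem_singleton.mp h]; exact hv
      · rw [List.pairwise_append]
        exact ⟨h3, by simp, fun x hx y hy => by rw [List.mem_singleton.mp hy]; exact hc x hx⟩
    · rintro ⟨h1, h2, h3⟩
      have hne : l ≠ [] := by rintro rfl; simp at h1
      have hl := List.dropLast_append_getLast hne
      rw [← hl, List.pairwise_append] at h3
      refine ⟨l.dropLast, ⟨by simp [h1], fun x hx => h2 x (List.dropLast_subset _ hx), h3.1⟩,
        l.getLast hne, ⟨h2 _ (List.getLast_mem hne), fun x hx => h3.2.2 x hx _ (by simp)⟩, hl⟩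

theorem length_of_mem_chains {E : ℕ → ℕ → Bool} {V : List ℕ} {i : ℕ} {l : List ℕ}
    (h : l ∈ chains E V i) : l.length = i := (mem_chains.mp h).1

theorem nodup_chains {E : ℕ → ℕ → Bool} {V : List ℕ} (hV : V.Nodup) (i : ℕ) :
    (chains E V i).Nodup := by
  induction i with
  | zero => simp [chains]
  | succ i ih =>
    simp only [chains]
    rw [List.nodup_flatMap]
    refine ⟨fun c _ => (hV.filter _).map fun x y h => by simpa using h, ih.imp fun {c d} hcd => ?_⟩
    rw [Function.onFun, List.disjoint_left]
    intro l h1 h2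
    obtain ⟨x, -, rfl⟩ := List.mem_map.mp h1
    obtain ⟨y, -, h⟩ := List.mem_map.mp h2
    exact hcd (by simpa using (List.append_inj' h rfl).1.symm)

/-- The array `f` holds the lists in `C`, each at the beginning of a block of `j` cells. -/
def FlatList (f : ℕ → ℕ) (j : ℕ) (C : List (List ℕ)) : Prop :=
  ∀ x (hx : x < C.length) p (hp : p < C[x].length), f (x * j + p) = C[x][p]

theorem FlatList.congr {f g : ℕ → ℕ} {j : ℕ} {C : List (List ℕ)} (h : FlatList f j C)
    (hC : ∀ c ∈ C, c.length ≤ j) (hfg : ∀ i < C.length * j, g i = f i) : FlatList g j C := by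
  intro x hx p hp
  rw [hfg]
  · exact h x hx p hp
  · have h1 := hC _ (List.getElem_mem hx)
    have : (x + 1) * j ≤ C.length * j := Nat.mul_le_mul_right _ hx
    rw [add_mul, one_mul] at this
    omega

theorem FlatList.push {f g : ℕ → ℕ} {j : ℕ} {C : List (List ℕ)} {l : List ℕ} (h : FlatList f j C)
    (hC : ∀ c ∈ C, c.length ≤ j) (hfg : ∀ i < C.length * j, g i = f i)
    (hl : ∀ p (hp : p < l.length), g (C.length * j + p) = l[p]) : FlatList g j (C ++ [l]) := by
  intro x hx p hp
  rcases Nat.lt_or_ge x C.length with hx' | hx'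
  · simp only [List.getElem_append_left hx'] at hp ⊢
    exact h.congr hC hfg x hx' p hp
  · obtain rfl : x = C.length := by simp at hx; omega
    simp only [List.getElem_concat_length] at hp ⊢
    exact hl p hp

/-- Extend the chain number `reg 17` in the array `9` by the vertex `reg 21`, with the result at
position `reg 15` of the array `10`; register `19` tells whether this is a chain. -/
def extendChain (j : ℕ) : Cmd :=
  19 ≔ const 1 ;;
  forLoop 18 (reg 16) (
    20 ≔ load 9 (reg 17 * const j + reg 18) ;;
    .store 10 (reg 15 * const j + reg 18) (reg 20) ;;
    19 ≔ reg 19 * load 7 (reg 20 * reg 0 + reg 21)) ;;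
  .store 10 (reg 15 * const j + reg 16) (reg 21)

variable {w : ℕ} {s : State} {t : ℕ} {Q : State → ℕ → Prop}

/-- The array `7` holds the matrix of the relation `E` on the numbers below `n`, the content of
register `0`. -/
structure HasRel (w n : ℕ) (E : ℕ → ℕ → Bool) (s : State) : Prop where
  reg_zero : s.reg 0 = n
  entry : ∀ u < n, ∀ v < n, s.arr 7 (u * n + v) = (E u v).toNat
  sq_lt : n * n < 2 ^ w

theorem HasRel.idx {n u v : ℕ} (hu : u < n) (hv : v < n) : u * n + v < n * n := by
  have : (u + 1) * n ≤ n * n := Nat.mul_le_mul_right _ hu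
  rw [add_mul, one_mul] at this
  omega

theorem HasRel.frame {n : ℕ} {E : ℕ → ℕ → Bool} (h : HasRel w n E s) {s' : State}
    (h0 : s'.reg 0 = s.reg 0) (h7 : s'.arr 7 = s.arr 7) : HasRel w n E s' :=
  ⟨h0.trans h.reg_zero, by rw [h7]; exact h.entry, h.sq_lt⟩

theorem HasRel.eval {n : ℕ} {E : ℕ → ℕ → Bool} (h : HasRel w n E s) {e₁ e₂ : Expr} {u v : ℕ}
    (h1 : e₁.eval w s = u) (h2 : e₂.eval w s = v) (hu : u < n) (hv : v < n) :
    (load 7 (e₁ * reg 0 + e₂)).eval w s = (E u v).toNat := by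
  have hlt := HasRel.idx hu hv
  have := h.sq_lt
  simp only [Expr.eval_load, Expr.eval_add, Expr.eval_mul, Expr.eval_reg, h1, h2, h.reg_zero]
  rw [Nat.mod_eq_of_lt (show u * n < 2 ^ w by omega),
    Nat.mod_eq_of_lt (show u * n + v < 2 ^ w by omega), h.entry u hu v hv]

theorem toNat_mul_mod {w : ℕ} (b c : Bool) (hw : 1 < 2 ^ w) :
    (b.toNat * c.toNat) % 2 ^ w = (b && c).toNat := by
  cases b <;> cases c <;> simp [Nat.mod_eq_of_lt hw]

theorem WP_extendChain {j n m v : ℕ} {E : ℕ → ℕ → Bool} {C : List (List ℕ)} {l : List ℕ} {k : ℕ}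
    (hE : HasRel w n E s) (hk : k < C.length) (hl : C[k] = l) (h9 : FlatList (s.arr 9) j C)
    (h17 : s.reg 17 = k) (h16 : s.reg 16 = l.length) (h15 : s.reg 15 = m) (h21 : s.reg 21 = v)
    (hv : v < n) (hln : ∀ x ∈ l, x < n) (hlj : l.length < j) (hkj : k * j + j < 2 ^ w)
    (hmj : m * j + j < 2 ^ w) (hw : 1 < 2 ^ w)
    (hQ : ∀ s' t', Frame (extendChain j) s s' → s'.reg 19 = (l.all (E · v)).toNat →
      (∀ i < m * j, s'.arr 10 i = s.arr 10 i) →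
      (∀ p (hp : p < (l ++ [v]).length), s'.arr 10 (m * j + p) = (l ++ [v])[p]) →
      t' ≤ t + (j * 40 + 20) → Q s' t') :
    WP w (extendChain j) s t Q := by
  have hjw : j < 2 ^ w := by omega
  refine WP.mono (Q := fun s' t' => s'.reg 19 = (l.all (E · v)).toNat ∧
      (∀ i < m * j, s'.arr 10 i = s.arr 10 i) ∧
      (∀ p (hp : p < (l ++ [v]).length), s'.arr 10 (m * j + p) = (l ++ [v])[p]) ∧
      t' ≤ t + (j * 40 + 20)) ?_ fun s' t' hF h => hQ s' t' hF h.1 h.2.1 h.2.2.1 h.2.2.2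
  simp only [extendChain, WP_seq, WP_assign, Expr.eval_const, Nat.mod_eq_of_lt hw]
  refine WP_for_const (N := l.length) (fun i s' => s'.reg 19 = ((l.take i).all (E · v)).toNat ∧
      (∀ i < m * j, s'.arr 10 i = s.arr 10 i) ∧
      (∀ p (hp : p < l.length), p < i → s'.arr 10 (m * j + p) = l[p]))
    28 (by omega) rfl (fun s' hF => by simpa [h16] using hF.reg 16 rfl)
    (fun i s' x h => by simpa using h) (by simp)
    (fun i hi s' hF hi' hI t' => ?_) (fun s' t' hF _ hI ht => ?_)
  · obtain ⟨e1, e2, e3⟩ := hI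
    have e9 : s'.arr 9 = s.arr 9 := hF.arr 9 rfl
    have e17 : s'.reg 17 = k := by simpa [h17] using hF.reg 17 rfl
    have e15 : s'.reg 15 = m := by simpa [h15] using hF.reg 15 rfl
    have e21 : s'.reg 21 = v := by simpa [h21] using hF.reg 21 rfl
    have hE' : HasRel w n E s' := hE.frame (hF.reg 0 rfl) (hF.arr 7 rfl)
    have hu : (load 9 (reg 17 * const j + reg 18)).eval w s' = l[i] := by
      simp only [Expr.eval_load, Expr.eval_add, Expr.eval_mul, Expr.eval_reg, Expr.eval_const,
        Nat.mod_eq_of_lt hjw, e17, hi', e9]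
      rw [Nat.mod_eq_of_lt (show k * j < 2 ^ w by omega),
        Nat.mod_eq_of_lt (show k * j + i < 2 ^ w by omega), h9 k hk i (by rw [hl]; exact hi)]
      simp only [hl]
    have hm1 : (m * j) % 2 ^ w = m * j := Nat.mod_eq_of_lt (by omega)
    have hm2 : (m * j + i) % 2 ^ w = m * j + i := Nat.mod_eq_of_lt (by omega)
    simp only [WP_seq, WP_assign, WP_store, hu]
    have hval := (hE'.frame (s' := (s'.setReg 20 l[i]).setArr 10 (m * j + i) l[i])
      (by simp) (by simp)).eval (e₁ := reg 20) (e₂ := reg 21) (u := l[i]) (v := v) (by simp)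
      (by simp [e21]) (hln _ (List.getElem_mem _)) hv
    simp only [Expr.eval_add, Expr.eval_mul, Expr.eval_reg, Expr.eval_const, State.reg_setReg,
      Nat.mod_eq_of_lt hjw, e15, hi', hm1, hm2, if_pos, Nat.reduceEqDiff, if_false] at hval ⊢
    rw [hval, State.reg_setArr, State.reg_setReg, if_neg (by norm_num), e1, toNat_mul_mod _ _ hw]
    refine ⟨⟨?_, fun i' hi' => ?_, fun p hp hpi => ?_⟩, by simp⟩
    · rw [List.take_succ_eq_append_getElem hi, List.all_append]
      simp
    · simp [Function.update_of_ne (show i' ≠ m * j + i by omega), e2 i' hi']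
    · rcases Nat.lt_succ_iff_lt_or_eq.mp hpi with h | rfl
      · simp [Function.update_of_ne (show m * j + p ≠ m * j + i by omega), e3 p hp h]
      · simp
  · obtain ⟨e1, e2, e3⟩ := hI
    have e16 : s'.reg 16 = l.length := by simpa [h16] using hF.reg 16 rfl
    have e15 : s'.reg 15 = m := by simpa [h15] using hF.reg 15 rfl
    have e21 : s'.reg 21 = v := by simpa [h21] using hF.reg 21 rfl
    have hm1 : (m * j) % 2 ^ w = m * j := Nat.mod_eq_of_lt (by omega)
    have hm2 : (m * j + l.length) % 2 ^ w = m * j + l.length := Nat.mod_eq_of_lt (by omega)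
    simp only [WP_store, Expr.eval_add, Expr.eval_mul, Expr.eval_reg, Expr.eval_const,
      Nat.mod_eq_of_lt hjw, e15, e16, e21, hm1, hm2]
    refine ⟨by simpa using e1, fun i hi => ?_, fun p hp => ?_, ?_⟩
    · simp [Function.update_of_ne (show i ≠ m * j + l.length by omega), e2 i hi]
    · rcases Nat.lt_or_ge p l.length with h | h
      · simp [Function.update_of_ne (show m * j + p ≠ m * j + l.length by omega),
          List.getElem_append_left h, e3 p h h]
      · obtain rfl : p = l.length := by simp at hp; omega
        simp
    · simp at ht ⊢
      omega

end WordRAM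

namespace WordRAM
open WordRAM.Expr (const reg load)
variable {w : ℕ} {s : State} {t : ℕ} {Q : State → ℕ → Prop}

/-- The array `8` holds the list `V`, and register `12` its length. -/
structure HasCand (V : List ℕ) (s : State) : Prop where
  length : s.reg 12 = V.length
  entry : ∀ i (hi : i < V.length), s.arr 8 i = V[i]

theorem HasCand.frame {V : List ℕ} (h : HasCand V s) {s' : State}
    (h12 : s'.reg 12 = s.reg 12) (h8 : s'.arr 8 = s.arr 8) : HasCand V s' :=
  ⟨h12.trans h.length, by rw [h8]; exact h.entry⟩

/-- Extend all chains by one element: from the `reg 14` chains of length `reg 16` in the array `9`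
to those of length `reg 16 + 1`. -/
def nextLevel (j : ℕ) : Cmd :=
  15 ≔ const 0 ;;
  forLoop 17 (reg 14) (forLoop 13 (reg 12)
    (21 ≔ load 8 (reg 13) ;; extendChain j ;; 15 ≔ reg 15 + reg 19)) ;;
  31 ≔ reg 15 * const j ;; copyCmd 9 10 ;; 14 ≔ reg 15

/-- The chains that extend a given one by a member of `V`. -/
def extensions (E : ℕ → ℕ → Bool) (V : List ℕ) (c : List ℕ) : List (List ℕ) :=
  (V.filter fun v => c.all (E · v)).map fun v => c ++ [v]

theorem WP_nextLevel {j n i B : ℕ} {E : ℕ → ℕ → Bool} {V : List ℕ}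
    (hE : HasRel w n E s) (hV : HasCand V s) (hVn : ∀ v ∈ V, v < n) (hij : i < j)
    (h16 : s.reg 16 = i) (h14 : s.reg 14 = (chains E V i).length)
    (h9 : FlatList (s.arr 9) j (chains E V i))
    (hB : ∀ i ≤ j, (chains E V i).length ≤ B) (hVB : V.length ≤ B) (hBw : (B + 1) * j < 2 ^ w)
    (hw : 1 < 2 ^ w)
    (hQ : ∀ s' t', Frame (nextLevel j) s s' → s'.reg 14 = (chains E V (i + 1)).length →
      FlatList (s'.arr 9) j (chains E V (i + 1)) →
      t' ≤ t + (B * (B * (j * 40 + 40) + 20 + j * 12) + 40) → Q s' t') :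
    WP w (nextLevel j) s t Q := by
  set C := chains E V i with hC
  have hj : 0 < j := by omega
  have hBw' : B * j + j < 2 ^ w := by rwa [add_mul, one_mul] at hBw
  have hBlt : B < 2 ^ w := by
    have : B ≤ B * j := Nat.le_mul_of_pos_right _ hj
    omega
  have hjw : j < 2 ^ w := by omega
  have hlen : ∀ c ∈ C, c.length = i := fun c hc => length_of_mem_chains hc
  have hchn : chains E V (i + 1) = C.flatMap (extensions E V) := rfl
  have hnew : ∀ c ∈ C.flatMap (extensions E V), c.length ≤ j := fun c hc =>
    (length_of_mem_chains (i := i + 1) (E := E) (V := V) hc).le.trans hij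
  refine WP.mono (Q := fun s' t' => s'.reg 14 = (chains E V (i + 1)).length ∧
      FlatList (s'.arr 9) j (chains E V (i + 1)) ∧
      t' ≤ t + (B * (B * (j * 40 + 40) + 20 + j * 12) + 40)) ?_
    fun s' t' hF h => hQ s' t' hF h.1 h.2.1 h.2.2
  simp only [nextLevel, WP_seq, WP_assign, Expr.eval_const, Nat.zero_mod]
  refine WP_for_const (N := C.length) (fun k s' =>
      s'.reg 15 = ((C.take k).flatMap (extensions E V)).length ∧
      FlatList (s'.arr 10) j ((C.take k).flatMap (extensions E V)))
    (B * (j * 40 + 40) + 6) ((hB i hij.le).trans_lt hBlt) rfl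
    (fun s' hF => by simpa [h14] using hF.reg 14 rfl) (fun i s' x h => by simpa using h)
    ⟨by simp, by intro x hx; simp at hx⟩
    (fun k hk s' hF hk' hI t' => ?_) (fun s' t' hF _ hI ht => ?_)
  · have e9 : s'.arr 9 = s.arr 9 := hF.arr 9 rfl
    have e16 : s'.reg 16 = i := (hF.reg 16 rfl).trans h16
    have hE' : HasRel w n E s' := hE.frame (hF.reg 0 rfl) (hF.arr 7 rfl)
    have hV' : HasCand V s' := hV.frame (hF.reg 12 rfl) (hF.arr 8 rfl)
    have hck : C[k] ∈ C := List.getElem_mem hk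
    have hsub : ∀ l m : List (List ℕ), l ++ m = C.flatMap (extensions E V) → l.length ≤ B ∧
        ∀ c ∈ l, c.length ≤ j := by
      intro l m hlm
      refine ⟨?_, fun c hc => hnew c (by rw [← hlm]; exact List.mem_append_left _ hc)⟩
      have := hB (i + 1) hij
      rw [hchn, ← hlm, List.length_append] at this
      omega
    set F := (C.take k).flatMap (extensions E V) with hF0
    have hFk : (C.take (k + 1)).flatMap (extensions E V) = F ++ extensions E V C[k] := by
      rw [List.take_succ_eq_append_getElem hk, List.flatMap_append]
      simp [hF0]
    obtain ⟨m, hm⟩ : ∃ m, F ++ extensions E V C[k] ++ m = C.flatMap (extensions E V) := by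
      rw [← hFk]
      refine ⟨(C.drop (k + 1)).flatMap (extensions E V), ?_⟩
      rw [← List.flatMap_append, List.take_append_drop]
    rw [hFk]
    refine WP_for_const (N := V.length) (fun k' s' =>
        s'.reg 15 = (F ++ extensions E (V.take k') C[k]).length ∧
        FlatList (s'.arr 10) j (F ++ extensions E (V.take k') C[k]))
      (j * 40 + 32) (hVB.trans_lt hBlt) rfl
      (fun s'' hF => (hF.reg 12 rfl).trans hV'.length) (fun i s' x h => by simpa using h)
      (by simpa [extensions] using hI)
      (fun r hr s'' hF' hr' hI' t'' => ?_) (fun s'' t'' hF' _ hI' ht => ?_)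
    · obtain ⟨g1, g2⟩ := hI'
      obtain ⟨m', hm'⟩ : ∃ m', F ++ extensions E (V.take (r + 1)) C[k] ++ m' =
          C.flatMap (extensions E V) := by
        refine ⟨extensions E (V.drop (r + 1)) C[k] ++ m, ?_⟩
        rw [← hm]
        simp only [extensions, List.append_assoc]
        rw [← List.append_assoc (List.map _ _), ← List.map_append, ← List.filter_append,
          List.take_append_drop]
      have hext : extensions E (V.take (r + 1)) C[k] = extensions E (V.take r) C[k] ++
          (if C[k].all (E · V[r]) then [C[k] ++ [V[r]]] else []) := by
        simp only [extensions]
        rw [List.take_succ_eq_append_getElem hr, List.filter_append, List.map_append]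
        congr 1
        split_ifs with h <;> simp [h]
      set F' := F ++ extensions E (V.take r) C[k] with hF'0
      rw [hext, ← List.append_assoc, ← hF'0] at hm' ⊢
      obtain ⟨hs1, hs2⟩ := hsub F' _ (by rw [List.append_assoc] at hm'; exact hm')
      have hbl : ∀ x ≤ B, x * j + j < 2 ^ w := fun x hx => by
        have := Nat.mul_le_mul_right j hx
        omega
      have hE'' : HasRel w n E s'' := hE'.frame (hF'.reg 0 rfl) (hF'.arr 7 rfl)
      have hV'' : HasCand V s'' := hV'.frame (hF'.reg 12 rfl) (hF'.arr 8 rfl)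
      have e9' : s''.arr 9 = s.arr 9 := (hF'.arr 9 rfl).trans e9
      have e16' : s''.reg 16 = i := (hF'.reg 16 rfl).trans e16
      have e17' : s''.reg 17 = k := (hF'.reg 17 rfl).trans hk'
      simp only [WP_seq, WP_assign, Expr.eval_load, Expr.eval_reg, hr', hV''.entry r hr]
      refine WP_extendChain (C := C) (l := C[k]) (k := k) (m := F'.length) (v := V[r]) (n := n)
        (E := E) (hE''.frame (by simp) (by simp)) hk rfl (by simpa [e9'] using h9) (by simpa using e17')
        (by simpa [hlen _ hck] using e16') (by simpa using g1) (by simp)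
        (hVn _ (List.getElem_mem hr))
        (fun x hx => hVn x ((mem_chains.mp hck).2.1 x hx)) (by rw [hlen _ hck]; exact hij)
        (hbl k (hk.le.trans (hB i hij.le))) (hbl _ hs1) hw fun s₃ t₃ hF₃ h19 hold hnw ht₃ => ?_
      have e15 : s₃.reg 15 = F'.length := by simpa [g1] using hF₃.reg 15 rfl
      rw [Expr.eval_add, Expr.eval_reg, Expr.eval_reg, h19, e15]
      refine ⟨?_, by simp at ht₃ ⊢; omega⟩
      by_cases hc : C[k].all (E · V[r])
      · rw [if_pos hc] at hm' ⊢
        obtain ⟨hs3, -⟩ := hsub _ _ hm'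
        rw [List.length_append, List.length_singleton] at hs3
        rw [hc]
        refine ⟨?_, ?_⟩
        · simp [Nat.mod_eq_of_lt (show F'.length + 1 < 2 ^ w by omega)]
        · exact g2.push (g := s₃.arr 10) hs2 (by simpa using hold) hnw
      · rw [if_neg hc, List.append_nil]
        rw [Bool.not_eq_true] at hc
        rw [hc]
        refine ⟨?_, ?_⟩
        · simp [Nat.mod_eq_of_lt (show F'.length < 2 ^ w by omega)]
        · exact g2.congr (g := s₃.arr 10) hs2 (by simpa using hold)
    · rw [List.take_length] at hI'
      refine ⟨hI', ht.trans ?_⟩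
      simp only [Expr.cost_reg]
      have e : V.length * (j * 40 + 32 + (1 + 7)) ≤ B * (j * 40 + 40) :=
        Nat.mul_le_mul hVB (by omega)
      omega
  · rw [List.take_length, ← hchn] at hI
    obtain ⟨e15, h10⟩ := hI
    have hBn := hB (i + 1) hij
    have hbj := Nat.mul_le_mul_right j hBn
    have hm1 : ((chains E V (i + 1)).length * j) % 2 ^ w = (chains E V (i + 1)).length * j :=
      Nat.mod_eq_of_lt (by omega)
    simp only [Expr.eval_mul, Expr.eval_reg, Expr.eval_const, e15, Nat.mod_eq_of_lt hjw, hm1]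
    refine WP_copy (by norm_num) (by simp; omega) fun s₂ t₂ hF₂ hc ht₂ => ?_
    have e15' : s₂.reg 15 = (chains E V (i + 1)).length := by simpa [e15] using hF₂.reg 15 rfl
    refine ⟨by simp [e15'], ?_, ?_⟩
    · simp only [State.reg_setReg, if_true, State.arr_setReg] at hc
      exact h10.congr (g := s₂.arr 9) (fun c hc => hnew c hc) hc
    · simp at ht ht₂ ⊢
      have e1 : C.length * (B * (j * 40 + 40) + 6 + 8) ≤ B * (B * (j * 40 + 40) + 14) :=
        Nat.mul_le_mul (hB i hij.le) (by omega)
      have e2 : B * (B * (j * 40 + 40) + 20 + j * 12) =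
        B * (B * (j * 40 + 40) + 14) + 12 * (B * j) + 6 * B := by ring
      omega

/-- List all chains of length `j` of the candidates in the array `9`. -/
def allChains (j : ℕ) : Cmd := 14 ≔ const 1 ;; forLoop 16 (const j) (nextLevel j)

theorem WP_allChains {j n B : ℕ} {E : ℕ → ℕ → Bool} {V : List ℕ}
    (hE : HasRel w n E s) (hV : HasCand V s) (hVn : ∀ v ∈ V, v < n)
    (hB : ∀ i ≤ j, (chains E V i).length ≤ B) (hVB : V.length ≤ B) (hBw : (B + 1) * j < 2 ^ w)
    (hw : 1 < 2 ^ w)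
    (hQ : ∀ s' t', Frame (allChains j) s s' → s'.reg 14 = (chains E V j).length →
      FlatList (s'.arr 9) j (chains E V j) →
      t' ≤ t + (j * (B * B * (j * 52 + 60) + 60) + 20) → Q s' t') :
    WP w (allChains j) s t Q := by
  have hjw : j < 2 ^ w := lt_of_le_of_lt (Nat.le_mul_of_pos_left _ (by omega)) hBw
  refine WP.mono (Q := fun s' t' => s'.reg 14 = (chains E V j).length ∧
      FlatList (s'.arr 9) j (chains E V j) ∧
      t' ≤ t + (j * (B * B * (j * 52 + 60) + 60) + 20)) ?_
    fun s' t' hF h => hQ s' t' hF h.1 h.2.1 h.2.2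
  simp only [allChains, WP_seq, WP_assign, Expr.eval_const, Nat.mod_eq_of_lt hw]
  refine WP_for_const (N := j) (fun i s' => s'.reg 14 = (chains E V i).length ∧
      FlatList (s'.arr 9) j (chains E V i)) (B * (B * (j * 40 + 40) + 20 + j * 12) + 40)
    hjw rfl (fun s' _ => Nat.mod_eq_of_lt hjw) (fun i s' x h => by simpa using h)
    ⟨by simp [chains], fun x hx p hp => by
      have : (chains E V 0)[x].length = 0 := length_of_mem_chains (List.getElem_mem hx)
      omega⟩
    (fun i hi s' hF hi' hI t' => ?_) (fun s' t' hF _ hI ht => ⟨hI.1, hI.2, ht.trans ?_⟩)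
  · refine WP_nextLevel (hE.frame (hF.reg 0 rfl) (hF.arr 7 rfl))
      (hV.frame (hF.reg 12 rfl) (hF.arr 8 rfl)) hVn hi hi' hI.1 hI.2 hB hVB hBw hw
      fun s'' t'' _ h1 h2 ht => ⟨⟨h1, h2⟩, ht⟩
  · have hB1 : 1 ≤ B := by simpa [chains] using hB 0 (Nat.zero_le _)
    have e1 : B * (B * (j * 40 + 40) + 20 + j * 12) ≤ B * B * (j * 52 + 60) := by
      have : B * (20 + j * 12) ≤ B * (B * (20 + j * 12)) :=
        Nat.mul_le_mul_left _ (Nat.le_mul_of_pos_left _ hB1)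
      linarith
    have e2 : j * (B * (B * (j * 40 + 40) + 20 + j * 12) + 40 + (1 + 7)) ≤
        j * (B * B * (j * 52 + 60) + 60) := Nat.mul_le_mul_left _ (by omega)
    simp only [Expr.cost_const]
    omega

end WordRAM

/-! ### The matrix of compatible chains -/

namespace WordRAM
open WordRAM.Expr (const reg load)
variable {w : ℕ} {s : State} {t : ℕ} {Q : State → ℕ → Prop}

/-- Is every entry of `c` related to every entry of `d`? -/
def joined (E : ℕ → ℕ → Bool) (c d : List ℕ) : Bool := c.all fun u => d.all fun v => E u v

/-- The `0`-`1`-matrix of the relation `joined` on a list of chains, bordered by zeros. -/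
def linkMat (E : ℕ → ℕ → Bool) (C : List (List ℕ)) (x y : ℕ) : ℕ :=
  if x < C.length ∧ y < C.length then (joined E (C.getD x []) (C.getD y [])).toNat else 0

theorem linkMat_le_one (E : ℕ → ℕ → Bool) (C : List (List ℕ)) (x y : ℕ) : linkMat E C x y ≤ 1 := by
  unfold linkMat
  split_ifs
  · exact Bool.toNat_le _
  · omega

theorem linkMat_eq_zero_right {E : ℕ → ℕ → Bool} {C : List (List ℕ)} {x y : ℕ} (h : C.length ≤ y) :
    linkMat E C x y = 0 := if_neg (by omega)

/-- Compute the entry of `linkMat` in row `reg 26` and column `reg 27`. -/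
def linkEntry (j : ℕ) : Cmd :=
  29 ≔ .op .lt (reg 26) (reg 14) * .op .lt (reg 27) (reg 14) ;;
  forLoop 18 (const j) (forLoop 28 (const j) (29 ≔ reg 29 *
    load 7 (load 9 (reg 26 * const j + reg 18) * reg 0 + load 9 (reg 27 * const j + reg 28))))

theorem FlatList.eval {j n x p : ℕ} {C : List (List ℕ)} {ca : List ℕ} {e₁ e₂ : Expr}
    (h : FlatList (s.arr 9) j C) (hx : x < C.length) (hc : C.getD x [] = ca) (hp : p < ca.length)
    (h1 : e₁.eval w s = x) (h2 : e₂.eval w s = p) (hjw : j < 2 ^ w) (hpj : p < j)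
    (hN : C.length * j < 2 ^ w) (hn : ∀ v ∈ ca, v < n) :
    (load 9 (e₁ * const j + e₂)).eval w s = ca[p] ∧ ca[p] < n := by
  refine ⟨?_, hn _ (List.getElem_mem hp)⟩
  have hcx : C[x] = ca := by rw [← hc, List.getD_eq_getElem _ _ hx]
  have : (x + 1) * j ≤ C.length * j := Nat.mul_le_mul_right _ hx
  rw [add_mul, one_mul] at this
  simp only [Expr.eval_load, Expr.eval_add, Expr.eval_mul, Expr.eval_const, h1, h2,
    Nat.mod_eq_of_lt hjw]
  rw [Nat.mod_eq_of_lt (show x * j < 2 ^ w by omega),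
    Nat.mod_eq_of_lt (show x * j + p < 2 ^ w by omega), h x hx p (by rw [hcx]; exact hp)]
  simp only [hcx]

theorem WP_linkEntry {j n x y : ℕ} {E : ℕ → ℕ → Bool} {C : List (List ℕ)}
    (hE : HasRel w n E s) (h14 : s.reg 14 = C.length) (h9 : FlatList (s.arr 9) j C)
    (hC : ∀ ca ∈ C, ca.length = j ∧ ∀ v ∈ ca, v < n) (hjw : j < 2 ^ w)
    (hN : C.length * j < 2 ^ w) (hw : 1 < 2 ^ w) (h26 : s.reg 26 = x) (h27 : s.reg 27 = y)
    (hQ : ∀ s' t', Frame (linkEntry j) s s' → s'.reg 29 = linkMat E C x y →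
      t' ≤ t + (j * (j * 40 + 20) + 20) → Q s' t') :
    WP w (linkEntry j) s t Q := by
  refine WP.mono (Q := fun s' t' => s'.reg 29 = linkMat E C x y ∧
    t' ≤ t + (j * (j * 40 + 20) + 20)) ?_ fun s' t' hF h => hQ s' t' hF h.1 h.2
  have hinit : (Expr.op .lt (reg 26) (reg 14) * .op .lt (reg 27) (reg 14)).eval w s =
      (decide (x < C.length) && decide (y < C.length)).toNat := by
    rw [← toNat_mul_mod _ _ hw]
    simp only [Expr.eval_mul, Expr.eval_lt, Expr.eval_reg, h26, h27, h14]
    congr 2 <;> · split_ifs with h <;> simp [h]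
  simp only [linkEntry, WP_seq, WP_assign, hinit]
  set b := decide (x < C.length) && decide (y < C.length) with hb
  set ca := C.getD x [] with hc
  set da := C.getD y [] with hd
  refine WP_for_const (N := j) (fun i s' => s'.reg 29 =
      (b && (ca.take i).all fun u => da.all fun v => E u v).toNat) (j * 40 + 8) hjw rfl
    (fun s' _ => Nat.mod_eq_of_lt hjw) (fun i s' x h => by simpa using h) (by simp)
    (fun i hi s₁ hF₁ hi₁ hI₁ t₁ => ?_) (fun s' t' hF _ hI ht => ⟨?_, ?_⟩)
  · refine WP_for_const (N := j) (fun k s' => s'.reg 29 =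
      (b && ((ca.take i).all fun u => da.all fun v => E u v) &&
        (ca.drop i).head?.all fun u => (da.take k).all fun v => E u v).toNat) 30 hjw rfl
      (fun s' _ => Nat.mod_eq_of_lt hjw) (fun i s' x h => by simpa using h)
      (by rw [hI₁]; cases (ca.drop i).head? <;> simp)
      (fun k hk s₂ hF₂ hk₂ hI₂ t₂ => ?_) (fun s' t' hF _ hI ht => ⟨?_, ?_⟩)
    · have e9 : s₂.arr 9 = s.arr 9 := (hF₂.arr 9 rfl).trans (hF₁.arr 9 rfl)
      have e0 : s₂.reg 0 = s.reg 0 := (hF₂.reg 0 rfl).trans (hF₁.reg 0 rfl)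
      have e7 : s₂.arr 7 = s.arr 7 := (hF₂.arr 7 rfl).trans (hF₁.arr 7 rfl)
      have e26 : s₂.reg 26 = x := (hF₂.reg 26 rfl).trans ((hF₁.reg 26 rfl).trans (by simpa using h26))
      have e27 : s₂.reg 27 = y := (hF₂.reg 27 rfl).trans ((hF₁.reg 27 rfl).trans (by simpa using h27))
      have e18 : s₂.reg 18 = i := (hF₂.reg 18 rfl).trans hi₁
      simp only [WP_assign]
      refine ⟨?_, by simp⟩
      rw [State.reg_setReg, if_pos rfl, Expr.eval_mul, Expr.eval_reg, hI₂]
      by_cases hxy : b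
      · obtain ⟨hx, hy⟩ : x < C.length ∧ y < C.length := by simpa [hb] using hxy
        have hcm : ca ∈ C := by
          rw [hc, List.getD_eq_getElem _ _ hx]; exact List.getElem_mem hx
        have hdm : da ∈ C := by
          rw [hd, List.getD_eq_getElem _ _ hy]; exact List.getElem_mem hy
        obtain ⟨hcl, hcn⟩ := hC ca hcm
        obtain ⟨hdl, hdn⟩ := hC da hdm
        have hic : i < ca.length := by omega
        have hkd : k < da.length := by omega
        have h9' : FlatList (s₂.arr 9) j C := by rw [e9]; exact h9
        obtain ⟨v1, l1⟩ := h9'.eval (w := w) (e₁ := reg 26) (e₂ := reg 18) hx hc.symm hic e26 e18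
          hjw hi hN hcn
        obtain ⟨v2, l2⟩ := h9'.eval (w := w) (e₁ := reg 27) (e₂ := reg 28) hy hd.symm hkd e27 hk₂
          hjw hk hN hdn
        rw [(hE.frame e0 e7).eval v1 v2 l1 l2, toNat_mul_mod _ _ hw]
        have : (ca.drop i).head? = some ca[i] := by
          rw [List.head?_drop, List.getElem?_eq_getElem hic]
        rw [this]
        simp only [Option.all_some]
        rw [List.take_succ_eq_append_getElem hkd, List.all_append]
        simp [Bool.and_assoc]
      · have : b = false := by simpa using hxy
        simp [this]
    · rw [hI]
      by_cases hxy : b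
      · obtain ⟨hx, hy⟩ : x < C.length ∧ y < C.length := by simpa [hb] using hxy
        have hcm : ca ∈ C := by
          rw [hc, List.getD_eq_getElem _ _ hx]; exact List.getElem_mem hx
        have hdm : da ∈ C := by
          rw [hd, List.getD_eq_getElem _ _ hy]; exact List.getElem_mem hy
        have hic : i < ca.length := by rw [(hC ca hcm).1]; exact hi
        have : (ca.drop i).head? = some ca[i] := by
          rw [List.head?_drop, List.getElem?_eq_getElem hic]
        rw [this]
        simp only [Option.all_some]
        rw [List.take_succ_eq_append_getElem hic, List.all_append,
          List.take_of_length_le (hC da hdm).1.le]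
        simp [Bool.and_assoc]
      · have : b = false := by simpa using hxy
        simp [this]
    · simp at ht
      omega
  · rw [hI]
    unfold linkMat joined
    by_cases hxy : x < C.length ∧ y < C.length
    · have hcm : ca ∈ C := by
        rw [hc, List.getD_eq_getElem _ _ hxy.1]; exact List.getElem_mem hxy.1
      rw [if_pos hxy, List.take_of_length_le (hC ca hcm).1.le]
      rw [hb, decide_eq_true hxy.1, decide_eq_true hxy.2]
      rfl
    · rw [if_neg hxy]
      have : b = false := by simpa [hb] using hxy
      simp [this]
  · simp at ht
    have : j * (j * 40 + 8 + 8) ≤ j * (j * 40 + 20) := Nat.mul_le_mul_left _ (by omega)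
    omega

namespace BilinearAlg
variable (a : BilinearAlg)

/-- The expression for the position of the matrix entry in row `x` and column `y`. -/
def posE (x y : ℕ) : Expr := const a.n * load 11 (reg x) + load 11 (reg y)

theorem posE_eval {k x y rx ry : ℕ} (h11 : ∀ x < a.n ^ k, s.arr 11 x = spread a.n x)
    (hx : x < a.n ^ k) (hy : y < a.n ^ k) (h1 : s.reg rx = x) (h2 : s.reg ry = y)
    (hw : (a.n ^ 2) ^ k < 2 ^ w) (hnw : a.n < 2 ^ w) :
    (a.posE rx ry).eval w s = interleave a.n x y := by
  have hlt := interleave_lt a.one_lt_n k x y hx hy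
  have hlt' : interleave a.n x y < 2 ^ w := by omega
  unfold interleave at *
  simp only [posE, Expr.eval_add, Expr.eval_mul, Expr.eval_load, Expr.eval_const, Expr.eval_reg, h1,
    h2, h11 x hx, h11 y hy, Nat.mod_eq_of_lt hnw]
  rw [Nat.mod_eq_of_lt (show a.n * spread a.n x < 2 ^ w by omega), Nat.mod_eq_of_lt hlt']

/-- Store the matrix of compatible chains in the arrays `12`, `13` and `14`. -/
def buildMatrix (j : ℕ) : Cmd :=
  forLoop 26 (reg 22) (forLoop 27 (reg 22) (linkEntry j ;; 30 ≔ a.posE 26 27 ;;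
    .store 12 (reg 30) (reg 29) ;; .store 13 (reg 30) (reg 29) ;; .store 14 (reg 30) (reg 29)))

theorem WP_buildMatrix {j n k : ℕ} {E : ℕ → ℕ → Bool} {C : List (List ℕ)}
    (hE : HasRel w n E s) (h14 : s.reg 14 = C.length) (h9 : FlatList (s.arr 9) j C)
    (hC : ∀ c ∈ C, c.length = j ∧ ∀ v ∈ c, v < n) (hjw : j < 2 ^ w)
    (hN : C.length * j < 2 ^ w) (hw : 1 < 2 ^ w) (hM : s.reg 22 = a.n ^ k)
    (h11 : ∀ x < a.n ^ k, s.arr 11 x = spread a.n x)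
    (hkw : (a.n ^ 2) ^ k < 2 ^ w) (hnw : a.n < 2 ^ w)
    (hQ : ∀ s' t', Frame (a.buildMatrix j) s s' →
      (∀ b, b = 12 ∨ b = 13 ∨ b = 14 → ∀ x < a.n ^ k, ∀ y < a.n ^ k,
        s'.arr b (interleave a.n x y) = linkMat E C x y) →
      t' ≤ t + (a.n ^ k * (a.n ^ k * (j * (j * 40 + 20) + 50) + 20) + 10) → Q s' t') :
    WP w (a.buildMatrix j) s t Q := by
  have hMw : a.n ^ k < 2 ^ w :=
    (Nat.pow_le_pow_left (Nat.le_self_pow two_ne_zero _) k).trans_lt hkw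
  refine WP_for_const (N := a.n ^ k) (fun i s' => ∀ b, b = 12 ∨ b = 13 ∨ b = 14 →
      ∀ x < i, ∀ y < a.n ^ k, s'.arr b (interleave a.n x y) = linkMat E C x y)
    (a.n ^ k * (j * (j * 40 + 20) + 50) + 8) hMw rfl
    (fun s' hF => (hF.reg 22 rfl).trans hM) (fun i s' x h => by simpa using h)
    (by simp)
    (fun x hx s₁ hF₁ hx₁ hI₁ t₁ => ?_) (fun s' t' hF _ hI ht => hQ s' t' hF hI ?_)
  · refine WP_for_const (N := a.n ^ k) (fun i s' => ∀ b, b = 12 ∨ b = 13 ∨ b = 14 →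
        (∀ x' < x, ∀ y < a.n ^ k, s'.arr b (interleave a.n x' y) = linkMat E C x' y) ∧
        ∀ y < i, s'.arr b (interleave a.n x y) = linkMat E C x y)
      (j * (j * 40 + 20) + 20 + 18) hMw rfl
      (fun s' hF => (hF.reg 22 rfl).trans ((hF₁.reg 22 rfl).trans hM))
      (fun i s' x h => by simpa using h) (fun b hb => ⟨hI₁ b hb, by simp⟩)
      (fun y hy s₂ hF₂ hy₂ hI₂ t₂ => ?_) (fun s' t' hF _ hI ht => ⟨fun b hb x' hx' y hy => ?_, ?_⟩)
    · have e9 : s₂.arr 9 = s.arr 9 := (hF₂.arr 9 rfl).trans (hF₁.arr 9 rfl)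
      have e11 : s₂.arr 11 = s.arr 11 := (hF₂.arr 11 rfl).trans (hF₁.arr 11 rfl)
      have e0 : s₂.reg 0 = s.reg 0 := (hF₂.reg 0 rfl).trans (hF₁.reg 0 rfl)
      have e7 : s₂.arr 7 = s.arr 7 := (hF₂.arr 7 rfl).trans (hF₁.arr 7 rfl)
      have e14 : s₂.reg 14 = C.length := (hF₂.reg 14 rfl).trans ((hF₁.reg 14 rfl).trans h14)
      have e26 : s₂.reg 26 = x := (hF₂.reg 26 rfl).trans hx₁
      rw [WP_seq]
      refine WP_linkEntry (hE.frame e0 e7) e14 (by rw [e9]; exact h9) hC hjw hN hw e26 hy₂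
        fun s₃ t₃ hF₃ h29 ht₃ => ?_
      have f11 : ∀ x < a.n ^ k, s₃.arr 11 x = spread a.n x := by
        rw [hF₃.arr 11 rfl, e11]; exact h11
      have hpos := a.posE_eval (w := w) f11 hx hy ((hF₃.reg 26 rfl).trans e26)
        ((hF₃.reg 27 rfl).trans hy₂) hkw hnw
      simp only [WP_seq, WP_assign, WP_store, hpos]
      refine ⟨fun b hb => ?_, by simp [posE]; omega⟩
      have hbarr : s₃.arr b = s₂.arr b := by
        rcases hb with rfl | rfl | rfl <;> exact hF₃.arr _ rfl
      obtain ⟨i1, i2⟩ := hI₂ b hb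
      rw [← hbarr] at i1 i2
      have hfin : ∀ b' x', b' = 12 ∨ b' = 13 ∨ b' = 14 →
          ((((s₃.setReg 30 (interleave a.n x y)).setArr 12 (interleave a.n x y)
            (linkMat E C x y)).setArr 13 (interleave a.n x y) (linkMat E C x y)).setArr 14
            (interleave a.n x y) (linkMat E C x y)).arr b' x' =
            Function.update (s₃.arr b') (interleave a.n x y) (linkMat E C x y) x' := by
        intro b' x' hb'
        rcases hb' with rfl | rfl | rfl <;> simp
      simp only [Expr.eval_reg, State.reg_setReg, State.reg_setArr, if_true, h29,
        Nat.reduceEqDiff, if_false]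
      simp only [hfin b _ hb]
      refine ⟨fun x' hx' y' hy' => ?_, fun y' hy' => ?_⟩
      · rw [Function.update_of_ne, i1 x' hx' y' hy']
        intro h
        have := (interleave_inj a.one_lt_n h).1
        omega
      · rcases Nat.lt_succ_iff_lt_or_eq.mp hy' with h | rfl
        · rw [Function.update_of_ne, i2 y' h]
          intro h'
          have := (interleave_inj a.one_lt_n h').2
          omega
        · simp
    · obtain ⟨i1, i2⟩ := hI b hb
      rcases Nat.lt_succ_iff_lt_or_eq.mp hx' with h | rfl
      · exact i1 x' h y hy
      · exact i2 y hy
    · simp at ht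
      have : a.n ^ k * (j * (j * 40 + 20) + 20 + 18 + 8) ≤ a.n ^ k * (j * (j * 40 + 20) + 50) :=
        Nat.mul_le_mul_left _ (by omega)
      linarith
  · simp at ht
    have : a.n ^ k * (a.n ^ k * (j * (j * 40 + 20) + 50) + 8 + 8) ≤
      a.n ^ k * (a.n ^ k * (j * (j * 40 + 20) + 50) + 20) := Nat.mul_le_mul_left _ (by omega)
    linarith

end BilinearAlg
end WordRAM

/-! ### Triangles of compatible chains -/

namespace WordRAM
open WordRAM.Expr (const reg load)
variable {w : ℕ} {s : State} {t : ℕ} {Q : State → ℕ → Prop}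

theorem sum_getD {M : Type*} [AddCommMonoid M] {C : List (List ℕ)} (hC : C.Nodup)
    (f : List ℕ → M) :
    ∑ x ∈ Finset.range C.length, f (C.getD x []) = ∑ c ∈ C.toFinset, f c := by
  refine Finset.sum_nbij (fun x => C.getD x []) ?_ ?_ ?_ fun _ _ => rfl
  · intro x hx
    have hx := Finset.mem_range.mp hx
    simp only [List.getD_eq_getElem _ _ hx, List.mem_toFinset]
    exact List.getElem_mem hx
  · intro x hx y hy h
    have hx : x < C.length := by simpa using hx
    have hy : y < C.length := by simpa using hy
    simp only [List.getD_eq_getElem _ _ hx, List.getD_eq_getElem _ _ hy] at h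
    exact (List.Nodup.getElem_inj_iff hC).mp h
  · intro c hc
    obtain ⟨x, hx, rfl⟩ := List.getElem_of_mem (by simpa using hc : c ∈ C)
    exact ⟨x, by simpa using hx, List.getD_eq_getElem _ _ hx⟩

theorem joined_iff {E : ℕ → ℕ → Bool} {c d : List ℕ} :
    joined E c d ↔ ∀ u ∈ c, ∀ v ∈ d, E u v := by
  simp [joined, List.all_eq_true]

theorem append_mem_chains {E : ℕ → ℕ → Bool} {V : List ℕ} {i j : ℕ} {c d : List ℕ}
    (hc : c ∈ chains E V i) (hd : d ∈ chains E V j) (h : joined E c d) :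
    c ++ d ∈ chains E V (i + j) := by
  obtain ⟨c1, c2, c3⟩ := mem_chains.mp hc
  obtain ⟨d1, d2, d3⟩ := mem_chains.mp hd
  refine mem_chains.mpr ⟨by simp [c1, d1], fun x hx => ?_,
    List.pairwise_append.mpr ⟨c3, d3, joined_iff.mp h⟩⟩
  rcases List.mem_append.mp hx with h | h
  exacts [c2 x h, d2 x h]

theorem take_drop_mem_chains {E : ℕ → ℕ → Bool} {V : List ℕ} {i j : ℕ} {l : List ℕ}
    (hl : l ∈ chains E V (i + j)) :
    l.take i ∈ chains E V i ∧ l.drop i ∈ chains E V j ∧ joined E (l.take i) (l.drop i) := by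
  obtain ⟨h1, h2, h3⟩ := mem_chains.mp hl
  rw [← List.take_append_drop i l, List.pairwise_append] at h3
  exact ⟨mem_chains.mpr ⟨by simp; omega, fun x hx => h2 x (List.mem_of_mem_take hx), h3.1⟩,
    mem_chains.mpr ⟨by simp [h1], fun x hx => h2 x (List.mem_of_mem_drop hx), h3.2.1⟩,
    joined_iff.mpr h3.2.2⟩

theorem joined_append_right {E : ℕ → ℕ → Bool} {c d e : List ℕ} :
    joined E c (d ++ e) = (joined E c d && joined E c e) := by
  rw [Bool.eq_iff_iff, Bool.and_eq_true, joined_iff, joined_iff, joined_iff]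
  simp only [List.mem_append]
  constructor
  · exact fun h => ⟨fun u hu v hv => h u hu v (.inl hv), fun u hu v hv => h u hu v (.inr hv)⟩
  · rintro ⟨h1, h2⟩ u hu v (hv | hv)
    exacts [h1 u hu v hv, h2 u hu v hv]

/-- A chain of length `3 j` is a triple of pairwise compatible chains of length `j`, in a unique
way. -/
theorem sum_linkMat {E : ℕ → ℕ → Bool} {V : List ℕ} (hV : V.Nodup) (j M : ℕ)
    (hM : (chains E V j).length ≤ M) :
    ∑ x ∈ Finset.range (chains E V j).length, ∑ z ∈ Finset.range (chains E V j).length,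
      linkMat E (chains E V j) x z * ∑ y ∈ Finset.range M,
        linkMat E (chains E V j) x y * linkMat E (chains E V j) y z =
      (chains E V (3 * j)).length := by
  set C := chains E V j with hC
  have hCn : C.Nodup := nodup_chains hV j
  have hin : ∀ x z, ∑ y ∈ Finset.range M, linkMat E C x y * linkMat E C y z =
      ∑ y ∈ Finset.range C.length, linkMat E C x y * linkMat E C y z := by
    intro x z
    refine (Finset.sum_subset (Finset.range_subset_range.mpr hM) fun y _ hy => ?_).symm
    rw [linkMat_eq_zero_right (by simpa using hy), zero_mul]
  have hlink : ∀ x ∈ Finset.range C.length, ∀ y ∈ Finset.range C.length,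
      linkMat E C x y = (joined E (C.getD x []) (C.getD y [])).toNat := fun x hx y hy =>
    if_pos ⟨Finset.mem_range.mp hx, Finset.mem_range.mp hy⟩
  calc _ = ∑ x ∈ Finset.range C.length, ∑ z ∈ Finset.range C.length,
        (joined E (C.getD x []) (C.getD z [])).toNat * ∑ y ∈ Finset.range C.length,
        (joined E (C.getD x []) (C.getD y [])).toNat *
        (joined E (C.getD y []) (C.getD z [])).toNat := by
        refine Finset.sum_congr rfl fun x hx => Finset.sum_congr rfl fun z hz => ?_
        rw [hin, hlink x hx z hz]
        congr 1
        exact Finset.sum_congr rfl fun y hy => by rw [hlink x hx y hy, hlink y hy z hz]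
    _ = ∑ c ∈ C.toFinset, ∑ e ∈ C.toFinset, (joined E c e).toNat * ∑ d ∈ C.toFinset,
        (joined E c d).toNat * (joined E d e).toNat := by
        rw [← sum_getD hCn]
        refine Finset.sum_congr rfl fun x _ => ?_
        rw [← sum_getD hCn]
        refine Finset.sum_congr rfl fun z _ => ?_
        rw [← sum_getD hCn]
    _ = ((C.toFinset ×ˢ C.toFinset ×ˢ C.toFinset).filter fun p =>
          joined E p.1 p.2.1 ∧ joined E p.1 p.2.2 ∧ joined E p.2.2 p.2.1).card := by
        rw [Finset.card_filter, Finset.sum_product]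
        refine Finset.sum_congr rfl fun c _ => ?_
        rw [Finset.sum_product]
        refine Finset.sum_congr rfl fun e _ => ?_
        rw [Finset.mul_sum]
        refine Finset.sum_congr rfl fun d _ => ?_
        cases joined E c e <;> cases joined E c d <;> cases joined E d e <;> rfl
    _ = (chains E V (3 * j)).toFinset.card := by
        refine Finset.card_nbij' (fun p => p.1 ++ (p.2.2 ++ p.2.1))
          (fun l => (l.take j, (l.drop j).drop j, (l.drop j).take j)) ?_ ?_ ?_ ?_
        · rintro ⟨c, e, d⟩ hp
          simp only [Finset.coe_filter, Finset.mem_product, List.mem_toFinset, Set.mem_ofPred_eq] at hp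
          obtain ⟨⟨h1, h2, h3⟩, h4, h5, h6⟩ := hp
          simp only [Finset.mem_coe, List.mem_toFinset]
          have := append_mem_chains h1 (append_mem_chains h3 h2 h6)
            (by rw [joined_append_right, h4, h5]; rfl)
          rwa [show 3 * j = j + (j + j) by ring]
        · intro l hl
          simp only [Finset.mem_coe, List.mem_toFinset] at hl
          rw [show 3 * j = j + (j + j) by ring] at hl
          obtain ⟨h1, h2, h3⟩ := take_drop_mem_chains hl
          obtain ⟨h4, h5, h6⟩ := take_drop_mem_chains h2
          rw [← List.take_append_drop j (l.drop j), joined_append_right, Bool.and_eq_true] at h3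
          simp only [Finset.coe_filter, Finset.mem_product, List.mem_toFinset, Set.mem_ofPred_eq]
          exact ⟨⟨h1, h5, h4⟩, h3.2, h3.1, h6⟩
        · rintro ⟨c, e, d⟩ hp
          simp only [Finset.coe_filter, Finset.mem_product, List.mem_toFinset, Set.mem_ofPred_eq] at hp
          obtain ⟨⟨h1, h2, h3⟩, -⟩ := hp
          have l1 := length_of_mem_chains h1
          have l3 := length_of_mem_chains h3
          simp [← l1, l1.trans l3.symm]
        · intro l hl
          simp
    _ = _ := List.toFinset_card_of_nodup (nodup_chains hV _)

namespace BilinearAlg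
variable (a : BilinearAlg)

/-- Add up the entries of the product of the matrix with itself over the nonzero entries of the
matrix; registers `36` and `37` remember the position of a nonzero term. -/
def countTriangles : Cmd :=
  35 ≔ const 0 ;;
  forLoop 26 (reg 14) (forLoop 27 (reg 14) (
    30 ≔ a.posE 26 27 ;;
    29 ≔ load 12 (reg 30) * (load 15 (reg 30) / reg 25) ;;
    35 ≔ reg 35 + reg 29 ;;
    .ite (reg 29) (36 ≔ reg 26 ;; 37 ≔ reg 27) .skip))

theorem WP_countTriangles {N k d : ℕ} {A P : ℕ → ℕ → ℕ} (h14 : s.reg 14 = N)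
    (hNM : N ≤ a.n ^ k) (h25 : s.reg 25 = d) (hd : 0 < d)
    (h11 : ∀ x < a.n ^ k, s.arr 11 x = spread a.n x)
    (hkw : (a.n ^ 2) ^ k < 2 ^ w) (hnw : a.n < 2 ^ w)
    (hA : ∀ x < N, ∀ z < N, s.arr 12 (interleave a.n x z) = A x z)
    (hP : ∀ x < N, ∀ z < N, s.arr 15 (interleave a.n x z) = d * P x z)
    (hT : ∑ x ∈ Finset.range N, ∑ z ∈ Finset.range N, A x z * P x z < 2 ^ w)
    (hQ : ∀ s' t', Frame a.countTriangles s s' →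
      s'.reg 35 = ∑ x ∈ Finset.range N, ∑ z ∈ Finset.range N, A x z * P x z →
      (s'.reg 35 ≠ 0 → s'.reg 36 < N ∧ s'.reg 37 < N ∧
        A (s'.reg 36) (s'.reg 37) * P (s'.reg 36) (s'.reg 37) ≠ 0) →
      t' ≤ t + (N * (N * 50 + 20) + 10) → Q s' t') :
    WP w a.countTriangles s t Q := by
  have hNw : N < 2 ^ w := by
    have : a.n ^ k ≤ (a.n ^ 2) ^ k := Nat.pow_le_pow_left (Nat.le_self_pow two_ne_zero _) k
    omega
  refine WP.mono (Q := fun s' t' =>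
      (s'.reg 35 = ∑ x ∈ Finset.range N, ∑ z ∈ Finset.range N, A x z * P x z ∧
      (s'.reg 35 ≠ 0 → s'.reg 36 < N ∧ s'.reg 37 < N ∧
        A (s'.reg 36) (s'.reg 37) * P (s'.reg 36) (s'.reg 37) ≠ 0)) ∧
      t' ≤ t + (N * (N * 50 + 20) + 10)) ?_ fun s' t' hF h => hQ s' t' hF h.1.1 h.1.2 h.2
  simp only [countTriangles, WP_seq, WP_assign, Expr.eval_const, Nat.zero_mod]
  refine WP_for_const (N := N) (fun i s' =>
      s'.reg 35 = ∑ x ∈ Finset.range i, ∑ z ∈ Finset.range N, A x z * P x z ∧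
      (s'.reg 35 ≠ 0 → s'.reg 36 < N ∧ s'.reg 37 < N ∧
        A (s'.reg 36) (s'.reg 37) * P (s'.reg 36) (s'.reg 37) ≠ 0)) (N * 50 + 8) hNw rfl
    (fun s' hF => (hF.reg 14 rfl).trans (by simpa using h14)) (fun i s' x h => by simpa using h)
    (by simp) (fun x hx s₁ hF₁ hx₁ hI₁ t₁ => ?_) (fun s' t' hF _ hI ht => ⟨hI, ?_⟩)
  · refine WP_for_const (N := N) (fun i s' =>
        s'.reg 35 = ∑ x ∈ Finset.range x, ∑ z ∈ Finset.range N, A x z * P x z +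
          ∑ z ∈ Finset.range i, A x z * P x z ∧
        (s'.reg 35 ≠ 0 → s'.reg 36 < N ∧ s'.reg 37 < N ∧
          A (s'.reg 36) (s'.reg 37) * P (s'.reg 36) (s'.reg 37) ≠ 0)) 40 hNw rfl
      (fun s' hF => (hF.reg 14 rfl).trans ((hF₁.reg 14 rfl).trans (by simpa using h14)))
      (fun i s' x h => by simpa using h) (by simpa using hI₁)
      (fun z hz s₂ hF₂ hz₂ hI₂ t₂ => ?_)
      (fun s' t' hF _ hI ht => ⟨by rw [Finset.sum_range_succ]; exact hI, ?_⟩)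
    · obtain ⟨i1, i2⟩ := hI₂
      have e11 : s₂.arr 11 = s.arr 11 := (hF₂.arr 11 rfl).trans (hF₁.arr 11 rfl)
      have e12 : s₂.arr 12 = s.arr 12 := (hF₂.arr 12 rfl).trans (hF₁.arr 12 rfl)
      have e15 : s₂.arr 15 = s.arr 15 := (hF₂.arr 15 rfl).trans (hF₁.arr 15 rfl)
      have e25 : s₂.reg 25 = d := (hF₂.reg 25 rfl).trans ((hF₁.reg 25 rfl).trans (by simpa using h25))
      have e26 : s₂.reg 26 = x := (hF₂.reg 26 rfl).trans hx₁
      have hpos := a.posE_eval (w := w) (s := s₂) (rx := 26) (ry := 27) (by rw [e11]; exact h11)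
        (hx.trans_le hNM) (hz.trans_le hNM) e26 hz₂ hkw hnw
      -- every partial sum is at most the whole sum
      have hle : ∑ x ∈ Finset.range x, ∑ z ∈ Finset.range N, A x z * P x z +
          ∑ z ∈ Finset.range (z + 1), A x z * P x z < 2 ^ w := by
        refine lt_of_le_of_lt ?_ hT
        calc _ ≤ ∑ x ∈ Finset.range x, ∑ z ∈ Finset.range N, A x z * P x z +
              ∑ z ∈ Finset.range N, A x z * P x z := by
              gcongr
              exact hz
          _ = ∑ x ∈ Finset.range (x + 1), ∑ z ∈ Finset.range N, A x z * P x z :=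
              (Finset.sum_range_succ _ _).symm
          _ ≤ _ := by gcongr; exact hx
      rw [Finset.sum_range_succ] at hle
      have hval : A x z * P x z < 2 ^ w := by omega
      have hm := Nat.mod_eq_of_lt hval
      have hm' := Nat.mod_eq_of_lt (show ∑ x ∈ Finset.range x, ∑ z ∈ Finset.range N, A x z * P x z +
          ∑ z ∈ Finset.range z, A x z * P x z + A x z * P x z < 2 ^ w by omega)
      have hdiv : d * P x z / d = P x z := Nat.mul_div_cancel_left _ hd
      have hc : (a.posE 26 27).cost = 7 := rfl
      simp only [WP_seq, WP_assign, WP_ite, WP_skip, hpos]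
      simp only [Expr.eval_mul, Expr.eval_div, Expr.eval_add, Expr.eval_load, Expr.eval_reg,
        State.reg_setReg, State.arr_setReg, e12, e15, hA x hx z hz, hP x hx z hz, e25, i1,
        Nat.reduceEqDiff, if_false, if_true, hdiv, hm, hm', e26, hz₂, hc]
      by_cases h0 : A x z * P x z = 0
      · rw [if_neg (not_not.mpr h0), h0, Finset.sum_range_succ, h0]
        refine ⟨⟨by simp, ?_⟩, by simp⟩
        simpa [i1] using i2
      · rw [if_pos h0, Finset.sum_range_succ]
        refine ⟨⟨by ring, fun _ => ?_⟩, by simp⟩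
        simpa [hx, hz] using h0
    · simp at ht
      linarith
  · simp at ht
    linarith

end BilinearAlg
end WordRAM

namespace WordRAM
open WordRAM.Expr (const reg load)
variable {w : ℕ} {s : State} {t : ℕ} {Q : State → ℕ → Prop}
namespace BilinearAlg
variable (a : BilinearAlg)

/-- Given two compatible chains with numbers `reg 36` and `reg 37`, find a chain between them, and
write the prefix `reg 10`, `reg 11` of length `r` and the three chains to the array `2`. -/
def writeWitness (r j : ℕ) : Cmd :=
  forLoop 27 (reg 14) (.ite (load 12 (a.posE 36 27) * load 12 (a.posE 27 37)) (38 ≔ reg 27) .skip) ;;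
  .store 2 (const 0) (reg 10) ;; .store 2 (const 1) (reg 11) ;;
  forLoop 18 (const j) (
    .store 2 (const r + reg 18) (load 9 (reg 36 * const j + reg 18)) ;;
    .store 2 (const (r + j) + reg 18) (load 9 (reg 38 * const j + reg 18)) ;;
    .store 2 (const (r + 2 * j) + reg 18) (load 9 (reg 37 * const j + reg 18)))

theorem WP_writeWitness {n k r j : ℕ} {E : ℕ → ℕ → Bool} {V : List ℕ}
    (hVn : ∀ v ∈ V, v < n) (h14 : s.reg 14 = (chains E V j).length)
    (hNM : (chains E V j).length ≤ a.n ^ k) (h9 : FlatList (s.arr 9) j (chains E V j))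
    (h11 : ∀ x < a.n ^ k, s.arr 11 x = spread a.n x)
    (hkw : (a.n ^ 2) ^ k < 2 ^ w) (hnw : a.n < 2 ^ w) (hjw : r + 3 * j < 2 ^ w)
    (hN : (chains E V j).length * j < 2 ^ w) (hw : 1 < 2 ^ w)
    (hA : ∀ x < a.n ^ k, ∀ z < a.n ^ k, s.arr 12 (interleave a.n x z) = linkMat E (chains E V j) x z)
    (h36 : s.reg 36 < (chains E V j).length) (h37 : s.reg 37 < (chains E V j).length)
    (hne : linkMat E (chains E V j) (s.reg 36) (s.reg 37) * ∑ y ∈ Finset.range (a.n ^ k),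
      linkMat E (chains E V j) (s.reg 36) y * linkMat E (chains E V j) y (s.reg 37) ≠ 0)
    (hQ : ∀ s' t', Frame (a.writeWitness r j) s s' →
      (∃ l ∈ chains E V (3 * j), (∀ p (hp : p < l.length), s'.arr 2 (r + p) = l[p]) ∧
        (1 ≤ r → s'.arr 2 0 = s.reg 10) ∧ (2 ≤ r → s'.arr 2 1 = s.reg 11)) →
      t' ≤ t + ((chains E V j).length * 40 + j * 50 + 30) → Q s' t') :
    WP w (a.writeWitness r j) s t Q := by
  set C := chains E V j with hC
  set x := s.reg 36 with hx
  set z := s.reg 37 with hz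
  have hNw : C.length < 2 ^ w := by
    have : a.n ^ k ≤ (a.n ^ 2) ^ k := Nat.pow_le_pow_left (Nat.le_self_pow two_ne_zero _) k
    omega
  refine WP.mono (Q := fun s' t' =>
      (∃ l ∈ chains E V (3 * j), (∀ p (hp : p < l.length), s'.arr 2 (r + p) = l[p]) ∧
        (1 ≤ r → s'.arr 2 0 = s.reg 10) ∧ (2 ≤ r → s'.arr 2 1 = s.reg 11)) ∧
      t' ≤ t + (C.length * 40 + j * 50 + 30)) ?_ fun s' t' hF h => hQ s' t' hF h.1 h.2
  obtain ⟨hxz, hsum⟩ := mul_ne_zero_iff.mp hne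
  obtain ⟨y, -, hy⟩ := Finset.exists_ne_zero_of_sum_ne_zero hsum
  have hyN : y < C.length := by
    by_contra h
    exact hy (by rw [linkMat_eq_zero_right (not_lt.mp h), zero_mul])
  simp only [writeWitness, WP_seq]
  refine WP_for_const (N := C.length) (fun i s' => (∃ y < i, linkMat E C x y * linkMat E C y z ≠ 0) →
      s'.reg 38 < C.length ∧ linkMat E C x (s'.reg 38) * linkMat E C (s'.reg 38) z ≠ 0) 25 hNw rfl
    (fun s' hF => (hF.reg 14 rfl).trans h14) (fun i s' x h => by simpa using h) (by simp)
    (fun i hi s₁ hF₁ hi₁ hI₁ t₁ => ?_) (fun s₁ t₁ hF₁ _ hI₁ ht₁ => ?_)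
  · have e11 : s₁.arr 11 = s.arr 11 := hF₁.arr 11 rfl
    have e12 : s₁.arr 12 = s.arr 12 := hF₁.arr 12 rfl
    have e36 : s₁.reg 36 = x := hF₁.reg 36 rfl
    have e37 : s₁.reg 37 = z := hF₁.reg 37 rfl
    have f11 : ∀ x < a.n ^ k, s₁.arr 11 x = spread a.n x := by rw [e11]; exact h11
    have p1 := a.posE_eval (w := w) f11 (h36.trans_le hNM) (hi.trans_le hNM) e36 hi₁ hkw hnw
    have p2 := a.posE_eval (w := w) f11 (hi.trans_le hNM) (h37.trans_le hNM) hi₁ e37 hkw hnw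
    have hlt : linkMat E C x i * linkMat E C i z < 2 ^ w := by
      have := Nat.mul_le_mul (linkMat_le_one E C x i) (linkMat_le_one E C i z)
      omega
    have hcond : (load 12 (a.posE 36 27) * load 12 (a.posE 27 37)).eval w s₁ =
        linkMat E C x i * linkMat E C i z := by
      rw [Expr.eval_mul, Expr.eval_load, Expr.eval_load, p1, p2, e12,
        hA _ (h36.trans_le hNM) _ (hi.trans_le hNM), hA _ (hi.trans_le hNM) _ (h37.trans_le hNM),
        Nat.mod_eq_of_lt hlt]
    rw [WP_ite, hcond]
    by_cases h0 : linkMat E C x i * linkMat E C i z = 0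
    · rw [if_neg (not_not.mpr h0), WP_skip]
      refine ⟨?_, by simp [posE]⟩
      rintro ⟨y, hy, hy'⟩
      rcases Nat.lt_succ_iff_lt_or_eq.mp hy with h | rfl
      · exact hI₁ ⟨y, h, hy'⟩
      · exact absurd h0 hy'
    · rw [if_pos h0, WP_assign]
      refine ⟨fun _ => ?_, by simp [posE]⟩
      simpa [hi₁, hi] using h0
  obtain ⟨hyN', hy'⟩ := hI₁ ⟨y, hyN, hy⟩
  set y' := s₁.reg 38 with hy'0
  clear hy hyN y
  -- the three chains are pairwise compatible
  have link : ∀ u v, u < C.length → v < C.length → linkMat E C u v ≠ 0 →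
      joined E (C.getD u []) (C.getD v []) := by
    intro u v hu hv h
    rw [linkMat, if_pos ⟨hu, hv⟩] at h
    simpa using h
  obtain ⟨hxy, hyz⟩ := mul_ne_zero_iff.mp hy'
  have mem : ∀ u, u < C.length → C.getD u [] ∈ C := fun u hu => by
    rw [List.getD_eq_getElem _ _ hu]; exact List.getElem_mem hu
  set c := C.getD x [] with hc
  set d := C.getD y' [] with hd
  set e := C.getD z [] with he
  have hl : c ++ (d ++ e) ∈ chains E V (3 * j) := by
    rw [show 3 * j = j + (j + j) by ring]
    exact append_mem_chains (mem _ h36) (append_mem_chains (mem _ hyN') (mem _ h37)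
      (link _ _ hyN' h37 hyz)) (by
        rw [joined_append_right, link _ _ h36 hyN' hxy, link _ _ h36 h37 hxz]; rfl)
  have lc : c.length = j := length_of_mem_chains (mem _ h36)
  have ld : d.length = j := length_of_mem_chains (mem _ hyN')
  have le' : e.length = j := length_of_mem_chains (mem _ h37)
  have hCn : ∀ c ∈ C, ∀ v ∈ c, v < n := fun c hc v hv => hVn v ((mem_chains.mp hc).2.1 v hv)
  have e9 : s₁.arr 9 = s.arr 9 := hF₁.arr 9 rfl
  have e36 : s₁.reg 36 = x := hF₁.reg 36 rfl
  have e37 : s₁.reg 37 = z := hF₁.reg 37 rfl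
  have e10 : s₁.reg 10 = s.reg 10 := hF₁.reg 10 rfl
  have e11 : s₁.reg 11 = s.reg 11 := hF₁.reg 11 rfl
  simp only [WP_store, Expr.eval_const, Nat.zero_mod, Nat.mod_eq_of_lt hw, Expr.eval_reg]
  refine WP_for_const (N := j) (fun i s' =>
      ((∀ p < i, s'.arr 2 (r + p) = c.getD p 0) ∧ (∀ p < i, s'.arr 2 (r + j + p) = d.getD p 0) ∧
        ∀ p < i, s'.arr 2 (r + 2 * j + p) = e.getD p 0) ∧
      (1 ≤ r → s'.arr 2 0 = s.reg 10) ∧ (2 ≤ r → s'.arr 2 1 = s.reg 11)) 40 (by omega) rfl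
    (fun s' _ => Nat.mod_eq_of_lt (by omega)) (fun i s' x h => by simpa using h)
    (by simp [e10, e11])
    (fun p hp s₂ hF₂ hp₂ hI₂ t₂ => ?_) (fun s₂ t₂ hF₂ _ hI₂ ht₂ => ?_)
  · obtain ⟨⟨i1, i2, i3⟩, i4, i5⟩ := hI₂
    have f9 : s₂.arr 9 = s.arr 9 := (hF₂.arr 9 rfl).trans (by simpa using e9)
    have f36 : s₂.reg 36 = x := (hF₂.reg 36 rfl).trans (by simpa using e36)
    have f37 : s₂.reg 37 = z := (hF₂.reg 37 rfl).trans (by simpa using e37)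
    have f38 : s₂.reg 38 = y' := (hF₂.reg 38 rfl).trans (by simp [hy'0])
    have g9 : ∀ s' : State, s'.arr 9 = s₂.arr 9 → FlatList (s'.arr 9) j C := fun s' h => by
      rw [h, f9]; exact h9
    have hpc : p < c.length := by omega
    have hpd : p < d.length := by omega
    have hpe : p < e.length := by omega
    have ev : ∀ (s' : State), s'.arr 9 = s₂.arr 9 → s'.reg = s₂.reg →
        (load 9 (reg 36 * const j + reg 18)).eval w s' = c.getD p 0 ∧
        (load 9 (reg 38 * const j + reg 18)).eval w s' = d.getD p 0 ∧
        (load 9 (reg 37 * const j + reg 18)).eval w s' = e.getD p 0 := by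
      intro s' ha hr
      rw [List.getD_eq_getElem _ _ hpc, List.getD_eq_getElem _ _ hpd, List.getD_eq_getElem _ _ hpe]
      refine ⟨((g9 s' ha).eval (e₁ := reg 36) (e₂ := reg 18) (n := n) h36 hc.symm hpc
        (by simp [hr, f36]) (by simp [hr, hp₂]) (by omega) hp hN (hCn _ (mem _ h36))).1,
        ((g9 s' ha).eval (e₁ := reg 38) (e₂ := reg 18) (n := n) hyN' hd.symm hpd
        (by simp [hr, f38]) (by simp [hr, hp₂]) (by omega) hp hN (hCn _ (mem _ hyN'))).1,
        ((g9 s' ha).eval (e₁ := reg 37) (e₂ := reg 18) (n := n) h37 he.symm hpe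
        (by simp [hr, f37]) (by simp [hr, hp₂]) (by omega) hp hN (hCn _ (mem _ h37))).1⟩
    have b1 := Nat.mod_eq_of_lt (show r < 2 ^ w by omega)
    have b2 := Nat.mod_eq_of_lt (show r + j < 2 ^ w by omega)
    have b3 := Nat.mod_eq_of_lt (show r + 2 * j < 2 ^ w by omega)
    have b4 := Nat.mod_eq_of_lt (show r + p < 2 ^ w by omega)
    have b5 := Nat.mod_eq_of_lt (show r + j + p < 2 ^ w by omega)
    have b6 := Nat.mod_eq_of_lt (show r + 2 * j + p < 2 ^ w by omega)
    simp only [WP_seq, WP_store]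
    rw [(ev s₂ rfl rfl).1, (ev _ (by simp) (by simp)).2.1, (ev _ (by simp) (by simp)).2.2]
    simp only [Expr.eval_add, Expr.eval_const, Expr.eval_reg, State.reg_setArr, hp₂, b1, b2, b3, b4,
      b5, b6, State.arr_setArr, if_true]
    refine ⟨⟨⟨fun p' hp' => ?_, fun p' hp' => ?_, fun p' hp' => ?_⟩, fun h => ?_, fun h => ?_⟩,
      by simp⟩
    · rw [Function.update_of_ne (by omega), Function.update_of_ne (by omega)]
      rcases Nat.lt_succ_iff_lt_or_eq.mp hp' with h | rfl
      · rw [Function.update_of_ne (by omega), i1 _ h]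
      · rw [Function.update_self]
    · rw [Function.update_of_ne (by omega)]
      rcases Nat.lt_succ_iff_lt_or_eq.mp hp' with h | rfl
      · rw [Function.update_of_ne (by omega), Function.update_of_ne (by omega), i2 _ h]
      · rw [Function.update_self]
    · rcases Nat.lt_succ_iff_lt_or_eq.mp hp' with h | rfl
      · rw [Function.update_of_ne (by omega), Function.update_of_ne (by omega),
          Function.update_of_ne (by omega), i3 _ h]
      · rw [Function.update_self]
    · rw [Function.update_of_ne (by omega), Function.update_of_ne (by omega),
        Function.update_of_ne (by omega), i4 h]
    · rw [Function.update_of_ne (by omega), Function.update_of_ne (by omega),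
        Function.update_of_ne (by omega), i5 h]
  · obtain ⟨⟨i1, i2, i3⟩, i4, i5⟩ := hI₂
    refine ⟨⟨_, hl, fun p hp => ?_, i4, i5⟩, ?_⟩
    · rw [← List.getD_eq_getElem _ 0 hp]
      simp only [List.length_append, lc, ld, le'] at hp
      rcases Nat.lt_or_ge p j with h1 | h1
      · rw [i1 p h1, List.getD_append _ _ _ _ (by omega)]
      rw [List.getD_append_right _ _ _ _ (by omega), lc]
      rcases Nat.lt_or_ge (p - j) j with h2 | h2
      · rw [show r + p = r + j + (p - j) by omega, i2 _ h2, List.getD_append _ _ _ _ (by omega)]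
      · rw [List.getD_append_right _ _ _ _ (by omega), ld,
          show r + p = r + 2 * j + (p - j - j) by omega, i3 _ (by omega)]
    · simp at ht₁ ht₂
      linarith

end BilinearAlg
end WordRAM

namespace WordRAM
open WordRAM.Expr (const reg load)
variable {w : ℕ} {s : State} {t : ℕ} {Q : State → ℕ → Prop}
namespace BilinearAlg
variable (a : BilinearAlg)

/-- Add the number of chains of length `3 j` of the candidates to register `2`; if there is one,
write one of them, after the prefix `reg 10`, `reg 11` of length `r`, to the array `2`. -/
def process (r j : ℕ) : Cmd :=
  allChains j ;; a.sizes ;; a.spreadTable ;; a.buildMatrix j ;; a.product ;; a.countTriangles ;;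
  2 ≔ reg 2 + reg 35 ;; .ite (reg 35) (a.writeWitness r j) .skip

theorem process_wr (r j x : ℕ) (hx : x ∉ [2, 13, 14, 15, 16, 17, 18, 19, 20, 21, 22, 23, 24, 25, 26,
    27, 28, 29, 30, 31, 32, 33, 34, 35, 36, 37, 38]) : (a.process r j).wr x = false := by
  simp only [List.mem_cons, not_or, List.not_mem_nil, not_false_eq_true, and_true] at hx
  simp [process, allChains, nextLevel, extendChain, copyCmd, sizes, spreadTable, buildMatrix,
    linkEntry, product_wr, countTriangles, writeWitness, Cmd.wr, hx]

theorem process_wa (r j x : ℕ) (hx : x ∉ [2, 9, 10, 11, 12, 13, 14, 15, 16]) :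
    (a.process r j).wa x = false := by
  simp only [List.mem_cons, not_or, List.not_mem_nil, not_false_eq_true, and_true] at hx
  obtain ⟨h1, h2, h3, h4, h5, h6, h7, h8, h9⟩ := hx
  simp [process, allChains, nextLevel, extendChain, copyCmd, sizes, spreadTable, buildMatrix,
    linkEntry, a.product_wa x h6 h7 h8 h9, countTriangles, writeWitness, Cmd.wa, h1, h2, h3, h4, h5,
    h6, h7]

/-- The time of `process` is at most `procConst j` times `B ^ 2 + (k + 1) R ^ k`, where `B` bounds
the numbers of candidates and of short chains and `n ^ k` is the order of the matrices. -/
def procConst (j : ℕ) : ℕ := j * (52 * j + 120) + j * (40 * j + 20) + 33 * a.R + 1000 + 50 * j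

/-- `process` adds the number of chains of length `3 j` to the count and exhibits one of them; its
time is governed by the number of candidates and the numbers of chains of length at most `j`. -/
theorem WP_process {n r j B : ℕ} {E : ℕ → ℕ → Bool} {V : List ℕ}
    (hE : HasRel w n E s) (hV : HasCand V s) (hVn : ∀ v ∈ V, v < n) (hVd : V.Nodup)
    (hB : ∀ i ≤ j, (chains E V i).length ≤ B) (hVB : V.length ≤ B) (hBw : (B + 1) * j < 2 ^ w)
    (hw : 1 < 2 ^ w) (hRw : a.R < 2 ^ w) (hDw : a.D < 2 ^ w) (hjw : r + 3 * j < 2 ^ w)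
    (hRk : a.R ^ Nat.clog a.n (chains E V j).length < 2 ^ w)
    (hDk : a.D ^ Nat.clog a.n (chains E V j).length *
      a.n ^ Nat.clog a.n (chains E V j).length < 2 ^ w)
    (hT : s.reg 2 + (chains E V (3 * j)).length < 2 ^ w)
    (hQ : ∀ s' t', Frame (a.process r j) s s' →
      s'.reg 2 = s.reg 2 + (chains E V (3 * j)).length →
      ((chains E V (3 * j)).length = 0 → s'.arr 2 = s.arr 2) →
      ((chains E V (3 * j)).length ≠ 0 → ∃ l ∈ chains E V (3 * j),
        (∀ p (hp : p < l.length), s'.arr 2 (r + p) = l[p]) ∧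
        (1 ≤ r → s'.arr 2 0 = s.reg 10) ∧ (2 ≤ r → s'.arr 2 1 = s.reg 11)) →
      t' ≤ t + a.procConst j * (B * B + (Nat.clog a.n (chains E V j).length + 1) *
        a.R ^ Nat.clog a.n (chains E V j).length) → Q s' t') :
    WP w (a.process r j) s t Q := by
  have hn := a.one_lt_n
  have hnR := a.sq_le_R
  have hD := a.D_pos
  set C := chains E V j with hC
  set k := Nat.clog a.n C.length with hk
  set M := a.n ^ k with hM
  have hNM : C.length ≤ M := Nat.le_pow_clog hn _
  have hMpos : 0 < M := by positivity
  have hMM : (a.n ^ 2) ^ k = M * M := by rw [hM, ← mul_pow, sq]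
  have hMR : M * M ≤ a.R ^ k := by rw [← hMM]; exact Nat.pow_le_pow_left hnR k
  have hMle : M ≤ M * M := Nat.le_mul_of_pos_left _ hMpos
  have hnn : a.n ≤ a.n ^ 2 := Nat.le_self_pow two_ne_zero _
  have hnw : a.n < 2 ^ w := by omega
  have hDpos : 0 < a.D ^ k := by positivity
  have hDk1 : a.D ^ k < 2 ^ w := lt_of_le_of_lt (Nat.le_mul_of_pos_right _ hMpos) hDk
  have hkM : k < M := Nat.lt_pow_self hn
  have hkw : (a.n ^ 2) ^ k < 2 ^ w := by omega
  have hNB : C.length ≤ B := hB j le_rfl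
  have hNj : C.length * j < 2 ^ w :=
    lt_of_le_of_lt (Nat.mul_le_mul_right _ (by omega)) hBw
  have hCl : ∀ c ∈ C, c.length = j ∧ ∀ v ∈ c, v < n := fun c hc =>
    ⟨length_of_mem_chains hc, fun v hv => hVn v ((mem_chains.mp hc).2.1 v hv)⟩
  have hlinkw : ∀ x y, linkMat E C x y < 2 ^ w := fun x y =>
    (linkMat_le_one E C x y).trans_lt hw
  have hcnt := sum_linkMat (E := E) hVd j M hNM
  rw [← hC] at hcnt
  refine WP.mono (Q := fun s' t' => s'.reg 2 = s.reg 2 + (chains E V (3 * j)).length ∧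
      ((chains E V (3 * j)).length = 0 → s'.arr 2 = s.arr 2) ∧
      ((chains E V (3 * j)).length ≠ 0 → ∃ l ∈ chains E V (3 * j),
        (∀ p (hp : p < l.length), s'.arr 2 (r + p) = l[p]) ∧
        (1 ≤ r → s'.arr 2 0 = s.reg 10) ∧ (2 ≤ r → s'.arr 2 1 = s.reg 11)) ∧
      t' ≤ t + a.procConst j * (B * B + (k + 1) * a.R ^ k)) ?_
    fun s' t' hF h => hQ s' t' hF h.1 h.2.1 h.2.2.1 h.2.2.2
  simp only [process, WP_seq]
  refine WP_allChains hE hV hVn hB hVB hBw hw fun s₁ t₁ hF₁ h14 h9 ht₁ => ?_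
  rw [← hC] at h14 h9
  refine a.WP_sizes h14 (by omega) hRk hDk1 hRw hDw fun s₂ t₂ hF₂ h22 h23 h24 h25 ht₂ => ?_
  rw [← hk] at h22 h23 h24 h25
  refine a.WP_spreadTable h22 hkw (by omega) fun s₃ t₃ hF₃ h11 ht₃ => ?_
  have f9₃ : s₃.arr 9 = s₁.arr 9 := (hF₃.arr 9 rfl).trans (hF₂.arr 9 rfl)
  have f14₃ : s₃.reg 14 = C.length := (hF₃.reg 14 rfl).trans ((hF₂.reg 14 rfl).trans h14)
  have f22₃ : s₃.reg 22 = M := (hF₃.reg 22 rfl).trans h22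
  have fE₃ : HasRel w n E s₃ := ((hE.frame (hF₁.reg 0 rfl) (hF₁.arr 7 rfl)).frame
    (hF₂.reg 0 rfl) (hF₂.arr 7 rfl)).frame (hF₃.reg 0 rfl) (hF₃.arr 7 rfl)
  refine a.WP_buildMatrix fE₃ f14₃ (by rw [f9₃]; exact h9) hCl (by omega) hNj hw f22₃ h11 hkw hnw
    fun s₄ t₄ hF₄ hmat ht₄ => ?_
  have f22₄ : s₄.reg 22 = M := (hF₄.reg 22 rfl).trans f22₃
  have f23₄ : s₄.reg 23 = k := (hF₄.reg 23 rfl).trans ((hF₃.reg 23 rfl).trans h23)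
  have f24₄ : s₄.reg 24 = a.R ^ k := (hF₄.reg 24 rfl).trans ((hF₃.reg 24 rfl).trans h24)
  have hlt : ∀ b, b = 12 ∨ b = 13 ∨ b = 14 → ∀ x < (a.n ^ 2) ^ k, s₄.arr b x < 2 ^ w := by
    intro b hb x hx
    obtain ⟨y, hy, z, hz, rfl⟩ := exists_interleave hn k x hx
    rw [hmat b hb y hy z hz]
    exact hlinkw y z
  refine a.WP_product_nat (linkMat E C) (linkMat E C) f22₄ f23₄ f24₄ (by omega) hRk
    (hmat 13 (by simp)) (hmat 14 (by simp)) (hlt 13 (by simp)) (hlt 14 (by simp)) (fun x z => ?_)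
    fun s₅ t₅ hF₅ hprod ht₅ => ?_
  · refine lt_of_le_of_lt (Nat.mul_le_mul_left _ ?_) hDk
    calc ∑ y ∈ Finset.range M, linkMat E C x y * linkMat E C y z
        ≤ ∑ y ∈ Finset.range M, 1 := Finset.sum_le_sum fun y _ =>
          Nat.mul_le_mul (linkMat_le_one E C x y) (linkMat_le_one E C y z)
      _ = M := by simp
  have f14₅ : s₅.reg 14 = C.length :=
    (hF₅.reg 14 (by simp [product_wr])).trans ((hF₄.reg 14 rfl).trans f14₃)
  have f25₅ : s₅.reg 25 = a.D ^ k := (hF₅.reg 25 (by simp [product_wr])).trans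
    ((hF₄.reg 25 rfl).trans ((hF₃.reg 25 rfl).trans h25))
  have f11₅ : ∀ x < M, s₅.arr 11 x = spread a.n x := by
    rw [hF₅.arr 11 (a.product_wa 11 (by norm_num) (by norm_num) (by norm_num) (by norm_num)),
      hF₄.arr 11 rfl]
    exact h11
  have f12₅ : ∀ x < M, ∀ y < M, s₅.arr 12 (interleave a.n x y) = linkMat E C x y := by
    rw [hF₅.arr 12 (a.product_wa 12 (by norm_num) (by norm_num) (by norm_num) (by norm_num))]
    exact hmat 12 (by simp)
  refine a.WP_countTriangles (N := C.length) (k := k) (d := a.D ^ k) (A := linkMat E C)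
    (P := fun x z => ∑ y ∈ Finset.range M, linkMat E C x y * linkMat E C y z) f14₅ hNM f25₅ hDpos
    f11₅ hkw hnw (fun x hx z hz => f12₅ x (hx.trans_le hNM) z (hz.trans_le hNM))
    (fun x hx z hz => hprod x (hx.trans_le hNM) z (hz.trans_le hNM)) (by rw [hcnt]; omega)
    fun s₆ t₆ hF₆ h35 hwit ht₆ => ?_
  rw [hcnt] at h35
  have f2 : s₆.reg 2 = s.reg 2 := (hF₆.reg 2 rfl).trans ((hF₅.reg 2 (by simp [product_wr])).trans
    ((hF₄.reg 2 rfl).trans ((hF₃.reg 2 rfl).trans ((hF₂.reg 2 rfl).trans (hF₁.reg 2 rfl)))))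
  have f2a : s₆.arr 2 = s.arr 2 := (hF₆.arr 2 rfl).trans ((hF₅.arr 2
    (a.product_wa 2 (by norm_num) (by norm_num) (by norm_num) (by norm_num))).trans
    ((hF₄.arr 2 rfl).trans ((hF₃.arr 2 rfl).trans ((hF₂.arr 2 rfl).trans (hF₁.arr 2 rfl)))))
  have f10 : ∀ x, x = 10 ∨ x = 11 → s₆.reg x = s.reg x := by
    rintro x (rfl | rfl) <;> exact (hF₆.reg _ rfl).trans ((hF₅.reg _ (by simp [product_wr])).trans
      ((hF₄.reg _ rfl).trans ((hF₃.reg _ rfl).trans ((hF₂.reg _ rfl).trans (hF₁.reg _ rfl)))))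
  have f14₆ : s₆.reg 14 = C.length := (hF₆.reg 14 rfl).trans f14₅
  have f9₆ : s₆.arr 9 = s₁.arr 9 := (hF₆.arr 9 rfl).trans ((hF₅.arr 9
    (a.product_wa 9 (by norm_num) (by norm_num) (by norm_num) (by norm_num))).trans
    ((hF₄.arr 9 rfl).trans f9₃))
  have f11₆ : ∀ x < M, s₆.arr 11 x = spread a.n x := by rw [hF₆.arr 11 rfl]; exact f11₅
  have f12₆ : ∀ x < M, ∀ y < M, s₆.arr 12 (interleave a.n x y) = linkMat E C x y := by
    rw [hF₆.arr 12 rfl]; exact f12₅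
  -- the time spent so far, and in the last step
  have htime : t₆ + C.length * 40 + j * 50 + 30 + 10 ≤
      t + a.procConst j * (B * B + (k + 1) * a.R ^ k) := by
    have hB1 : 1 ≤ B := by simpa [chains] using hB 0 (Nat.zero_le _)
    have hX1 : 1 ≤ B * B := Nat.mul_le_mul hB1 hB1
    have hBB : B ≤ B * B := Nat.le_mul_of_pos_left _ hB1
    set X := B * B with hX
    set Z := a.R ^ k with hZ
    have hY : Z ≤ (k + 1) * Z := Nat.le_mul_of_pos_left _ (by omega)
    set Y := (k + 1) * Z with hYd
    have hMY : M * M ≤ Y := hMR.trans hY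
    have hNN : C.length * C.length ≤ X := Nat.mul_le_mul hNB hNB
    have e1 : (k + 1) * (Z * (33 * a.R + 500)) = Y * (33 * a.R + 500) := by rw [hYd]; ring
    rw [e1] at ht₅
    have e2 : M * M * (j * (j * 40 + 20) + 70) ≤ Y * (j * (j * 40 + 20) + 70) :=
      Nat.mul_le_mul_right _ hMY
    have e3 : j * 1 ≤ j * X := Nat.mul_le_mul_left _ hX1
    have e4 : 0 ≤ Y * (j * (52 * j + 120)) := Nat.zero_le _
    have e5 : 0 ≤ X * (j * (40 * j + 20) + 33 * a.R) := Nat.zero_le _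
    have e6 : 0 ≤ Y * j := Nat.zero_le _
    have e7 : j * (X * (j * 52 + 60) + 60) ≤ j * (X * (j * 52 + 120)) :=
      Nat.mul_le_mul_left _ (by linarith)
    rw [← hM] at ht₃ ht₄
    simp only [procConst]
    linarith
  rw [WP_assign, WP_ite]
  have hsum : (reg 2 + reg 35 : Expr).eval w s₆ = s.reg 2 + (chains E V (3 * j)).length := by
    simp only [Expr.eval_add, Expr.eval_reg, f2, h35, Nat.mod_eq_of_lt hT]
  rw [hsum]
  simp only [Expr.eval_reg, State.reg_setReg, h35, Nat.reduceEqDiff, if_false, Expr.cost_add,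
    Expr.cost_reg]
  by_cases h0 : (chains E V (3 * j)).length = 0
  · rw [if_neg (not_not.mpr h0), WP_skip]
    exact ⟨by simp, fun _ => by simp [f2a], fun h => absurd h0 h, by linarith⟩
  · rw [if_pos h0]
    obtain ⟨w1, w2, w3⟩ := hwit (by rw [h35]; exact h0)
    refine a.WP_writeWitness (n := n) (k := k) (E := E) (V := V) hVn (by simpa using f14₆) hNM
      (by simpa [f9₆] using h9) (by simpa using f11₆) hkw hnw hjw hNj hw (by simpa using f12₆)
      (by simpa using w1) (by simpa using w2) (by simpa using w3) fun s₇ t₇ hF₇ hw₇ ht₇ => ?_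
    refine ⟨(hF₇.reg 2 rfl).trans (by simp), fun h => absurd h h0, fun _ => ?_, by linarith⟩
    obtain ⟨l, hl, g1, g2, g3⟩ := hw₇
    refine ⟨l, hl, g1, fun h => ?_, fun h => ?_⟩
    · rw [g2 h]; simpa using f10 10 (by simp)
    · rw [g3 h]; simpa using f10 11 (by simp)

end BilinearAlg
end WordRAM

/-! ### The list of the vertices -/

namespace WordRAM
open WordRAM.Expr (const reg load)
variable {w : ℕ} {s : State} {t : ℕ} {Q : State → ℕ → Prop}

/-- Register `1` and the arrays `0` and `1` hold the list `es` of edges. -/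
structure HasEdges (es : List (ℕ × ℕ)) (s : State) : Prop where
  length : s.reg 1 = es.length
  fst : ∀ i (hi : i < es.length), s.arr 0 i = es[i].1
  snd : ∀ i (hi : i < es.length), s.arr 1 i = es[i].2

theorem HasEdges.frame {es : List (ℕ × ℕ)} (h : HasEdges es s) {s' : State}
    (h1 : s'.reg 1 = s.reg 1) (h0 : s'.arr 0 = s.arr 0) (h1' : s'.arr 1 = s.arr 1) :
    HasEdges es s' :=
  ⟨h1.trans h.length, by rw [h0]; exact h.fst, by rw [h1']; exact h.snd⟩

/-- Register `5` and the array `4` hold the list `V` of vertices. -/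
structure HasVerts (V : List ℕ) (s : State) : Prop where
  length : s.reg 5 = V.length
  entry : ∀ i (hi : i < V.length), s.arr 4 i = V[i]

theorem HasVerts.frame {V : List ℕ} (h : HasVerts V s) {s' : State}
    (h5 : s'.reg 5 = s.reg 5) (h4 : s'.arr 4 = s.arr 4) : HasVerts V s' :=
  ⟨h5.trans h.length, by rw [h4]; exact h.entry⟩

/-- Append the value of `e` to the list of vertices unless it is marked in the array `3`. -/
def visit (e : Expr) : Cmd :=
  4 ≔ e ;; .ite (load 3 (reg 4)) .skip
    (.store 3 (reg 4) (const 1) ;; .store 4 (reg 5) (reg 4) ;; 5 ≔ reg 5 + const 1)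

theorem length_le_of_nodup {V : List ℕ} {n : ℕ} (hV : V.Nodup) (hn : ∀ v ∈ V, v < n) :
    V.length ≤ n := by
  have := (hV.subperm (l₂ := List.range n) fun v hv => List.mem_range.mpr (hn v hv)).length_le
  simpa using this

theorem WP_visit {e : Expr} {V : List ℕ} {x n : ℕ} (hV : HasVerts V s) (hVd : V.Nodup)
    (hVn : ∀ v ∈ V, v < n) (h3 : ∀ v, s.arr 3 v = if v ∈ V then 1 else 0)
    (he : e.eval w s = x) (hx : x < n) (hn : n + 1 < 2 ^ w)
    (hQ : ∀ s' t', Frame (visit e) s s' → (∃ V', HasVerts V' s' ∧ V'.Nodup ∧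
      (∀ v, v ∈ V' ↔ v ∈ V ∨ v = x) ∧ ∀ v, s'.arr 3 v = if v ∈ V' then 1 else 0) →
      t' ≤ t + (e.cost + 15) → Q s' t') :
    WP w (visit e) s t Q := by
  refine WP.mono (Q := fun s' t' => (∃ V', HasVerts V' s' ∧ V'.Nodup ∧
      (∀ v, v ∈ V' ↔ v ∈ V ∨ v = x) ∧ ∀ v, s'.arr 3 v = if v ∈ V' then 1 else 0) ∧
      t' ≤ t + (e.cost + 15)) ?_ fun s' t' hF h => hQ s' t' hF h.1 h.2
  have hone : 1 % 2 ^ w = 1 := Nat.mod_eq_of_lt (by omega)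
  have hlen := length_le_of_nodup hVd hVn
  have hadd : (V.length + 1) % 2 ^ w = V.length + 1 := Nat.mod_eq_of_lt (by omega)
  simp only [visit, WP_seq, WP_assign, he, WP_ite, Expr.eval_load, Expr.eval_reg, State.reg_setReg,
    if_true, State.arr_setReg, h3]
  by_cases hxV : x ∈ V
  · simp only [hxV, if_true, ne_eq, one_ne_zero, not_false_eq_true, WP_skip]
    refine ⟨⟨V, hV.frame (by simp) (by simp), hVd, fun v => ⟨.inl, ?_⟩, by simpa using h3⟩,
      by simp; omega⟩
    rintro (h | rfl)
    exacts [h, hxV]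
  · simp only [hxV, if_false, ne_eq, not_true_eq_false, WP_store]
    refine ⟨⟨V ++ [x], ⟨?_, fun i hi => ?_⟩, ?_, fun v => by simp, fun v => ?_⟩, by simp; omega⟩
    · simp [hV.length, hone, hadd]
    · rcases Nat.lt_or_ge i V.length with h | h
      · simp [hV.length, Function.update_of_ne h.ne, hV.entry i h, List.getElem_append_left h]
      · obtain rfl : i = V.length := by simp at hi; omega
        simp [hV.length]
    · rw [List.nodup_append]
      refine ⟨hVd, by simp, ?_⟩
      intro u hu v hv
      rw [List.mem_singleton] at hv
      rintro rfl
      exact hxV (hv ▸ hu)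
    · by_cases hvx : v = x
      · subst hvx; simp [hone]
      · simp [h3, hvx]

/-- List the vertices that lie on edges. -/
def listVertices : Cmd :=
  5 ≔ const 0 ;; forLoop 3 (reg 1) (visit (load 0 (reg 3)) ;; visit (load 1 (reg 3)))

/-- `v` is an endpoint of `e`. -/
def Touches (e : ℕ × ℕ) (v : ℕ) : Prop := e.1 = v ∨ e.2 = v

instance (e : ℕ × ℕ) (v : ℕ) : Decidable (Touches e v) := inferInstanceAs (Decidable (_ ∨ _))

theorem WP_listVertices {es : List (ℕ × ℕ)} {n : ℕ} (hes : HasEdges es s)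
    (hn : ∀ e ∈ es, e.1 < n ∧ e.2 < n) (hnw : n + 1 < 2 ^ w) (hmw : es.length < 2 ^ w)
    (h3 : ∀ v, s.arr 3 v = 0)
    (hQ : ∀ s' t', Frame listVertices s s' → (∃ V, HasVerts V s' ∧ V.Nodup ∧
      ∀ v, v ∈ V ↔ ∃ e ∈ es, Touches e v) → t' ≤ t + (es.length * 50 + 10) → Q s' t') :
    WP w listVertices s t Q := by
  refine WP.mono (Q := fun s' t' => (∃ V, HasVerts V s' ∧ V.Nodup ∧
      ∀ v, v ∈ V ↔ ∃ e ∈ es, Touches e v) ∧ t' ≤ t + (es.length * 50 + 10)) ?_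
    fun s' t' hF h => hQ s' t' hF h.1 h.2
  simp only [listVertices, WP_seq, WP_assign, Expr.eval_const, Nat.zero_mod]
  refine WP_for_const (N := es.length) (fun k s' => ∃ V, HasVerts V s' ∧ V.Nodup ∧
      (∀ v, v ∈ V ↔ ∃ e ∈ es.take k, Touches e v) ∧ ∀ v, s'.arr 3 v = if v ∈ V then 1 else 0)
    36 hmw rfl (fun s' hF => (hF.reg 1 rfl).trans (by simpa using hes.length)) ?_
    ⟨[], ⟨by simp, by simp⟩, by simp, by simp, by simpa using h3⟩
    (fun k hk s₁ hF₁ hk₁ hI₁ t₁ => ?_) (fun s' t' hF _ hI ht => ?_)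
  · rintro k s' x ⟨V, h1, h2, h3, h4⟩
    exact ⟨V, h1.frame (by simp) (by simp), h2, h3, by simpa using h4⟩
  · obtain ⟨V, hV, hVd, hmem, h3⟩ := hI₁
    have hes₁ : HasEdges es s₁ := hes.frame ((hF₁.reg 1 rfl).trans (by simp))
      ((hF₁.arr 0 rfl).trans (by simp)) ((hF₁.arr 1 rfl).trans (by simp))
    have hek : es[k] ∈ es := List.getElem_mem hk
    have hVn : ∀ v ∈ V, v < n := by
      intro v hv
      obtain ⟨e, he, h⟩ := (hmem v).mp hv
      have := hn e (List.mem_of_mem_take he)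
      rcases h with rfl | rfl
      exacts [this.1, this.2]
    rw [WP_seq]
    refine WP_visit (x := es[k].1) hV hVd hVn h3 (by simp [hk₁, hes₁.fst k hk]) (hn _ hek).1 hnw
      fun s₂ t₂ hF₂ h₂ ht₂ => ?_
    obtain ⟨V₂, hV₂, hVd₂, hmem₂, h3₂⟩ := h₂
    have e3 : s₂.reg 3 = k := (hF₂.reg 3 rfl).trans hk₁
    have hVn₂ : ∀ v ∈ V₂, v < n := by
      intro v hv
      rcases (hmem₂ v).mp hv with h | rfl
      exacts [hVn v h, (hn _ hek).1]
    have e1 : s₂.arr 1 k = es[k].2 := by rw [hF₂.arr 1 rfl]; exact hes₁.snd k hk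
    refine WP_visit (x := es[k].2) hV₂ hVd₂ hVn₂ h3₂ (by simp [e3, e1]) (hn _ hek).2 hnw
      fun s₃ t₃ hF₃ h₃ ht₃ => ?_
    obtain ⟨V₃, hV₃, hVd₃, hmem₃, h3₃⟩ := h₃
    refine ⟨⟨V₃, hV₃, hVd₃, fun v => ?_, h3₃⟩, by simp at ht₂ ht₃; omega⟩
    rw [hmem₃, hmem₂, hmem, List.take_succ_eq_append_getElem hk]
    constructor
    · rintro ((⟨e, he, h⟩ | rfl) | rfl)
      · exact ⟨e, List.mem_append_left _ he, h⟩
      · exact ⟨es[k], List.mem_append_right _ (List.mem_singleton.mpr rfl), .inl rfl⟩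
      · exact ⟨es[k], List.mem_append_right _ (List.mem_singleton.mpr rfl), .inr rfl⟩
    · rintro ⟨e, he, h⟩
      rcases List.mem_append.mp he with he | he
      · exact .inl (.inl ⟨e, he, h⟩)
      · rw [List.mem_singleton] at he
        subst he
        rcases h with h | h
        · exact .inl (.inr h.symm)
        · exact .inr h.symm
  · obtain ⟨V, hV, hVd, hmem, -⟩ := hI
    rw [List.take_length] at hmem
    refine ⟨⟨V, hV, hVd, hmem⟩, ?_⟩
    simp at ht
    omega

/-! ### A degeneracy order -/

/-- The number of edges at `v` both of whose endpoints have not been assigned a position. -/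
def remDeg (es : List (ℕ × ℕ)) (pos : ℕ → ℕ) (v : ℕ) : ℕ :=
  es.countP fun e => pos e.1 = 0 ∧ pos e.2 = 0 ∧ Touches e v

/-- Compute the numbers `remDeg` for the positions in the array `5` in the array `6`. -/
def degrees : Cmd :=
  forLoop 3 (reg 1) (.store 6 (load 0 (reg 3)) (const 0) ;; .store 6 (load 1 (reg 3)) (const 0)) ;;
  forLoop 3 (reg 1) (.ite (load 5 (load 0 (reg 3)) + load 5 (load 1 (reg 3))) .skip
    (.store 6 (load 0 (reg 3)) (load 6 (load 0 (reg 3)) + const 1) ;;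
     .store 6 (load 1 (reg 3)) (load 6 (load 1 (reg 3)) + const 1)))

theorem WP_degrees {es : List (ℕ × ℕ)} {pos : ℕ → ℕ} (hes : HasEdges es s)
    (hne : ∀ e ∈ es, e.1 ≠ e.2) (hpos : s.arr 5 = pos)
    (hposw : ∀ e ∈ es, pos e.1 + pos e.2 < 2 ^ w) (hmw : es.length + 1 < 2 ^ w)
    (hQ : ∀ s' t', Frame degrees s s' → (∀ v, (∃ e ∈ es, Touches e v) →
      s'.arr 6 v = remDeg es pos v) → t' ≤ t + (es.length * 80 + 20) → Q s' t') :
    WP w degrees s t Q := by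
  refine WP.mono (Q := fun s' t' => (∀ v, (∃ e ∈ es, Touches e v) →
      s'.arr 6 v = remDeg es pos v) ∧ t' ≤ t + (es.length * 80 + 20)) ?_
    fun s' t' hF h => hQ s' t' hF h.1 h.2
  have hone : 1 % 2 ^ w = 1 := Nat.mod_eq_of_lt (by omega)
  rw [degrees, WP_seq]
  refine WP_for_const (N := es.length) (fun k s' => ∀ v, (∃ e ∈ es.take k, Touches e v) →
      s'.arr 6 v = 0) 10 (by omega) rfl (fun s' hF => (hF.reg 1 rfl).trans hes.length)
    (fun k s' x h => by simpa using h) (by simp)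
    (fun k hk s₁ hF₁ hk₁ hI₁ t₁ => ?_) (fun s₁ t₁ hF₁ _ hI₁ ht₁ => ?_)
  · have hes₁ : HasEdges es s₁ := hes.frame (hF₁.reg 1 rfl) (hF₁.arr 0 rfl) (hF₁.arr 1 rfl)
    simp only [WP_seq, WP_store, Expr.eval_load, Expr.eval_reg, Expr.eval_const, Nat.zero_mod, hk₁,
      hes₁.fst k hk, State.reg_setArr, State.arr_setArr]
    simp only [Nat.reduceEqDiff, if_false, hes₁.snd k hk, if_true]
    refine ⟨fun v hv => ?_, by simp⟩
    rw [Function.update_apply, Function.update_apply]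
    split_ifs with h1 h2
    · rfl
    · rfl
    · apply hI₁
      obtain ⟨e, he, h⟩ := hv
      rw [List.take_succ_eq_append_getElem hk] at he
      rcases List.mem_append.mp he with he | he
      · exact ⟨e, he, h⟩
      · rw [List.mem_singleton] at he
        subst he
        rcases h with h | h
        · exact absurd h.symm h2
        · exact absurd h.symm h1
  · rw [List.take_length] at hI₁
    refine WP_for_const (N := es.length) (fun k s' => ∀ v, (∃ e ∈ es, Touches e v) →
        s'.arr 6 v = remDeg (es.take k) pos v) 45 (by omega) rfl
      (fun s' hF => (hF.reg 1 rfl).trans ((hF₁.reg 1 rfl).trans hes.length))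
      (fun k s' x h => by simpa using h) (by simpa [remDeg] using hI₁)
      (fun k hk s₂ hF₂ hk₂ hI₂ t₂ => ?_) (fun s₂ t₂ hF₂ _ hI₂ ht₂ => ?_)
    · have hes₂ : HasEdges es s₂ := (hes.frame (hF₁.reg 1 rfl) (hF₁.arr 0 rfl) (hF₁.arr 1 rfl)).frame
        (hF₂.reg 1 rfl) (hF₂.arr 0 rfl) (hF₂.arr 1 rfl)
      have hek : es[k] ∈ es := List.getElem_mem hk
      have e5 : s₂.arr 5 = pos := (hF₂.arr 5 rfl).trans ((hF₁.arr 5 rfl).trans hpos)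
      have hle : ∀ v, remDeg (es.take k) pos v ≤ es.length := fun v =>
        List.countP_le_length.trans (by simp)
      have hsucc : ∀ v, remDeg (es.take (k + 1)) pos v = remDeg (es.take k) pos v +
          if pos es[k].1 = 0 ∧ pos es[k].2 = 0 ∧ Touches es[k] v then 1 else 0 := by
        intro v
        rw [List.take_succ_eq_append_getElem hk, remDeg, List.countP_append, remDeg]
        congr 1
        simp [List.countP_cons]
      have d1 := hI₂ es[k].1 ⟨_, hek, .inl rfl⟩
      have d2 := hI₂ es[k].2 ⟨_, hek, .inr rfl⟩
      have hcond : (load 5 (load 0 (reg 3)) + load 5 (load 1 (reg 3))).eval w s₂ =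
          pos es[k].1 + pos es[k].2 := by
        simp [hk₂, hes₂.fst k hk, hes₂.snd k hk, e5, Nat.mod_eq_of_lt (hposw _ hek)]
      rw [WP_ite, hcond]
      by_cases h0 : pos es[k].1 + pos es[k].2 = 0
      · obtain ⟨p1, p2⟩ : pos es[k].1 = 0 ∧ pos es[k].2 = 0 := by omega
        have m1 := Nat.mod_eq_of_lt (show remDeg (es.take k) pos es[k].1 + 1 < 2 ^ w by
          have := hle es[k].1; omega)
        have m2 := Nat.mod_eq_of_lt (show remDeg (es.take k) pos es[k].2 + 1 < 2 ^ w by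
          have := hle es[k].2; omega)
        rw [if_neg (not_not.mpr h0), WP_seq, WP_store, WP_store]
        simp only [Expr.eval_add, Expr.eval_load, Expr.eval_reg, Expr.eval_const, State.reg_setArr,
          State.arr_setArr, hk₂, hes₂.fst k hk]
        simp only [Nat.reduceEqDiff, if_false, if_true, hes₂.snd k hk,
          Function.update_of_ne (hne _ hek).symm, d1, d2, hone, m1, m2]
        refine ⟨fun v hv => ?_, by simp⟩
        rw [hsucc, Function.update_apply, Function.update_apply]
        by_cases h2 : v = es[k].2
        · subst h2; simp [p1, p2, Touches]
        · by_cases h1 : v = es[k].1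
          · subst h1; simp [p1, p2, Touches, h2]
          · have : ¬ Touches es[k] v := by
              rintro (h | h)
              exacts [h1 h.symm, h2 h.symm]
            simp [h1, h2, this, hI₂ v hv]
      · rw [if_pos h0, WP_skip]
        refine ⟨fun v hv => ?_, by simp⟩
        rw [hsucc, if_neg (by omega), add_zero, hI₂ v hv]
    · rw [List.take_length] at hI₂
      refine ⟨hI₂, ?_⟩
      simp at ht₁ ht₂
      omega

end WordRAM

namespace WordRAM
open WordRAM.Expr (const reg load)
variable {w : ℕ} {s : State} {t : ℕ} {Q : State → ℕ → Prop}

/-- The positions `1, …, i` have been assigned to `i` of the vertices in `V` in such a way that every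
one of them has at most `d` edges to vertices that follow it or are unassigned, that is, whose
position is `0`. -/
structure Peeled (es : List (ℕ × ℕ)) (V : List ℕ) (d i : ℕ) (pos : ℕ → ℕ) : Prop where
  card : V.countP (fun v => pos v ≠ 0) = i
  le : ∀ v, pos v ≤ i
  inj : ∀ u v, pos u = pos v → pos u ≠ 0 → u = v
  later : ∀ v, pos v ≠ 0 → es.countP (fun e => Touches e v ∧ (pos e.1 = 0 ∨ pos v ≤ pos e.1) ∧
    (pos e.2 = 0 ∨ pos v ≤ pos e.2)) ≤ d

theorem Peeled.step {es : List (ℕ × ℕ)} {V : List ℕ} {d i : ℕ} {pos : ℕ → ℕ}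
    (h : Peeled es V d i pos) (hV : V.Nodup) {v : ℕ} (hv : v ∈ V) (h0 : pos v = 0)
    (hd : remDeg es pos v ≤ d) : Peeled es V d (i + 1) (Function.update pos v (i + 1)) where
  card := by
    obtain ⟨l₁, l₂, rfl⟩ := List.append_of_mem hv
    have hl : ∀ u ∈ l₁ ++ l₂, u ≠ v := by
      rintro u hu rfl
      rw [List.nodup_middle] at hV
      exact (List.nodup_cons.mp hV).1 hu
    have hc : ∀ l : List ℕ, (∀ u ∈ l, u ≠ v) →
        l.countP (fun u => Function.update pos v (i + 1) u ≠ 0) = l.countP (fun u => pos u ≠ 0) := by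
      intro l hl
      refine List.countP_congr fun u hu => ?_
      rw [Function.update_of_ne (hl u hu)]
    have := h.card
    rw [List.countP_append, List.countP_cons] at this ⊢
    rw [hc l₁ fun u hu => hl u (by simp [hu]), hc l₂ fun u hu => hl u (by simp [hu])]
    simp only [h0, ne_eq, not_true_eq_false, decide_false, Bool.false_eq_true, if_false] at this
    simp
    simp at this
    omega
  le u := by
    rw [Function.update_apply]
    split_ifs
    · exact le_rfl
    · exact (h.le u).trans (Nat.le_succ i)
  inj u x hux hu := by
    have h1 := h.le u
    have h2 := h.le x
    have h3 := h.inj u x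
    rw [Function.update_apply, Function.update_apply] at hux
    rw [Function.update_apply] at hu
    split_ifs at hux hu with g1 g2
    · rw [g1, g2]
    · omega
    · omega
    · exact h3 hux hu
  later u hu := by
    have hle : ∀ x, pos x ≠ i + 1 := fun x => by have := h.le x; omega
    by_cases huv : u = v
    · subst huv
      refine le_trans (List.countP_mono_left fun e _ he => ?_) hd
      simp only [Function.update_self, decide_eq_true_eq] at he ⊢
      have key : ∀ x, Function.update pos u (i + 1) x = 0 ∨ i + 1 ≤ Function.update pos u (i + 1) x →
          pos x = 0 := by
        intro x hx
        rw [Function.update_apply] at hx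
        have := h.le x
        split_ifs at hx with g
        · rw [g, h0]
        · omega
      exact ⟨key _ he.2.1, key _ he.2.2, he.1⟩
    · rw [Function.update_of_ne huv] at hu
      refine le_trans (List.countP_mono_left fun e _ he => ?_) (h.later u hu)
      simp only [Function.update_of_ne huv, decide_eq_true_eq] at he ⊢
      have key : ∀ x, Function.update pos v (i + 1) x = 0 ∨ pos u ≤ Function.update pos v (i + 1) x →
          pos x = 0 ∨ pos u ≤ pos x := by
        intro x hx
        rw [Function.update_apply] at hx
        split_ifs at hx with g
        · exact .inl (by rw [g, h0])
        · exact hx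
      exact ⟨he.1, key _ he.2.1, key _ he.2.2⟩

/-- Put into register `7` an unassigned vertex with the fewest edges to unassigned vertices. -/
def selectMin : Cmd :=
  8 ≔ reg 1 + const 1 ;; 7 ≔ const 0 ;;
  forLoop 9 (reg 5) (4 ≔ load 4 (reg 9) ;; .ite (load 5 (reg 4)) .skip
    (.ite (.op .lt (load 6 (reg 4)) (reg 8)) (8 ≔ load 6 (reg 4) ;; 7 ≔ reg 4) .skip))

theorem WP_selectMin {V : List ℕ} {pos deg : ℕ → ℕ} {m d : ℕ} (hV : HasVerts V s)
    (hpos : s.arr 5 = pos) (hdeg : ∀ v ∈ V, s.arr 6 v = deg v) (hm : s.reg 1 = m)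
    (hmw : m + 1 < 2 ^ w) (hVw : V.length < 2 ^ w) (hle : ∀ v ∈ V, deg v ≤ m)
    (hd : ∃ v ∈ V, pos v = 0 ∧ deg v ≤ d)
    (hQ : ∀ s' t', Frame selectMin s s' → s'.reg 7 ∈ V ∧ pos (s'.reg 7) = 0 ∧ deg (s'.reg 7) ≤ d →
      t' ≤ t + (V.length * 40 + 20) → Q s' t') :
    WP w selectMin s t Q := by
  refine WP.mono (Q := fun s' t' => (s'.reg 7 ∈ V ∧ pos (s'.reg 7) = 0 ∧ deg (s'.reg 7) ≤ d) ∧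
      t' ≤ t + (V.length * 40 + 20)) ?_ fun s' t' hF h => hQ s' t' hF h.1 h.2
  have hone : 1 % 2 ^ w = 1 := Nat.mod_eq_of_lt (by omega)
  simp only [selectMin, WP_seq, WP_assign]
  refine WP_for_const (N := V.length) (fun k s' => (∀ v ∈ V.take k, pos v = 0 → s'.reg 8 ≤ deg v) ∧
      (s'.reg 8 = m + 1 ∨ s'.reg 7 ∈ V ∧ pos (s'.reg 7) = 0 ∧ deg (s'.reg 7) = s'.reg 8)) 25
    hVw rfl (fun s' hF => (hF.reg 5 rfl).trans (by simpa using hV.length))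
    (fun k s' x h => by simpa using h)
    ⟨by simp, .inl (by simp [hm, hone, Nat.mod_eq_of_lt hmw])⟩
    (fun k hk s₁ hF₁ hk₁ hI₁ t₁ => ?_) (fun s' t' hF _ hI ht => ?_)
  · have hV₁ : HasVerts V s₁ := hV.frame ((hF₁.reg 5 rfl).trans (by simp))
      ((hF₁.arr 4 rfl).trans (by simp))
    have e5 : s₁.arr 5 = pos := (hF₁.arr 5 rfl).trans (by simpa using hpos)
    have e6 : ∀ v ∈ V, s₁.arr 6 v = deg v := by
      rw [hF₁.arr 6 rfl]; simpa using hdeg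
    have hVk : V[k] ∈ V := List.getElem_mem hk
    have key : ∀ x ≤ deg V[k], (∀ v ∈ V.take k, pos v = 0 → x ≤ deg v) →
        ∀ v ∈ V.take (k + 1), pos v = 0 → x ≤ deg v := by
      intro x hx h v hv
      rw [List.take_succ_eq_append_getElem hk] at hv
      rcases List.mem_append.mp hv with hv | hv
      · exact h v hv
      · rw [List.mem_singleton.mp hv]; exact fun _ => hx
    simp only [WP_seq, WP_assign, WP_ite, WP_skip, Expr.eval_load, Expr.eval_reg, Expr.eval_lt,
      State.reg_setReg, State.arr_setReg, hk₁, hV₁.entry k hk, e5]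
    simp only [Nat.reduceEqDiff, if_true, if_false, e6 _ hVk]
    obtain ⟨h1, h2⟩ := hI₁
    by_cases hp : pos V[k] = 0
    · rw [if_neg (not_not.mpr hp)]
      by_cases hlt : deg V[k] < s₁.reg 8
      · rw [if_pos hlt, if_pos one_ne_zero]
        refine ⟨⟨key _ le_rfl fun v hv hv0 => hlt.le.trans (h1 v hv hv0), .inr ⟨hVk, hp, trivial⟩⟩, ?_⟩
        simp
      · rw [if_neg hlt, if_neg (not_not.mpr rfl)]
        exact ⟨⟨key _ (not_lt.mp hlt) h1, h2⟩, by simp⟩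
    · rw [if_pos hp]
      refine ⟨⟨fun v hv hv0 => ?_, h2⟩, by simp⟩
      rw [List.take_succ_eq_append_getElem hk] at hv
      rcases List.mem_append.mp hv with hv | hv
      · exact h1 v hv hv0
      · rw [List.mem_singleton.mp hv] at hv0; exact absurd hv0 hp
  · rw [List.take_length] at hI
    obtain ⟨v, hv, hv0, hvd⟩ := hd
    have h8 := hI.1 v hv hv0
    have := hle v hv
    rcases hI.2 with h | ⟨g1, g2, g3⟩
    · omega
    · refine ⟨⟨g1, g2, by omega⟩, ?_⟩
      simp at ht
      omega

/-- Compute positions in the array `5` by repeatedly removing a vertex of least degree. -/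
def peel : Cmd :=
  forLoop 6 (reg 5) (degrees ;; selectMin ;; .store 5 (reg 7) (reg 6 + const 1))

/-- The number `d` only has to bound the least degree of every remaining graph. -/
theorem WP_peel {es : List (ℕ × ℕ)} {V : List ℕ} {d : ℕ} (hes : HasEdges es s) (hV : HasVerts V s)
    (hVd : V.Nodup) (hmem : ∀ v, v ∈ V ↔ ∃ e ∈ es, Touches e v)
    (hne : ∀ e ∈ es, e.1 ≠ e.2) (h5 : ∀ v, s.arr 5 v = 0)
    (hd : ∀ pos : ℕ → ℕ, (∃ v ∈ V, pos v = 0) → ∃ v ∈ V, pos v = 0 ∧ remDeg es pos v ≤ d)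
    (hmw : es.length + 1 < 2 ^ w) (hVw : 2 * V.length < 2 ^ w)
    (hQ : ∀ s' t', Frame peel s s' → (∃ pos, s'.arr 5 = pos ∧ Peeled es V d V.length pos) →
      t' ≤ t + (V.length * (es.length * 80 + V.length * 40 + 60) + 10) → Q s' t') :
    WP w peel s t Q := by
  refine WP.mono (Q := fun s' t' => (∃ pos, s'.arr 5 = pos ∧ Peeled es V d V.length pos) ∧
      t' ≤ t + (V.length * (es.length * 80 + V.length * 40 + 60) + 10)) ?_
    fun s' t' hF h => hQ s' t' hF h.1 h.2
  have hone : 1 % 2 ^ w = 1 := Nat.mod_eq_of_lt (by omega)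
  refine WP_for_const (N := V.length) (fun k s' => Peeled es V d k (s'.arr 5))
    (es.length * 80 + V.length * 40 + 50) (by omega) rfl
    (fun s' hF => (hF.reg 5 rfl).trans hV.length)
    (fun k s' x h => by simpa using h) ?_
    (fun k hk s₁ hF₁ hk₁ hI₁ t₁ => ?_) (fun s' t' hF _ hI ht => ?_)
  · rw [show s.arr 5 = fun _ => 0 from funext h5]
    exact ⟨by simp, by simp, by simp, by simp⟩
  · have hes₁ : HasEdges es s₁ := hes.frame (hF₁.reg 1 rfl) (hF₁.arr 0 rfl) (hF₁.arr 1 rfl)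
    have hV₁ : HasVerts V s₁ := hV.frame (hF₁.reg 5 rfl) (hF₁.arr 4 rfl)
    rw [WP_seq]
    refine WP_degrees hes₁ hne rfl (fun e _ => ?_) hmw fun s₂ t₂ hF₂ hdeg ht₂ => ?_
    · have := hI₁.le e.1
      have := hI₁.le e.2
      omega
    rw [WP_seq]
    have h5₂ : s₂.arr 5 = s₁.arr 5 := hF₂.arr 5 rfl
    obtain ⟨u, hu, hu0⟩ : ∃ v ∈ V, s₁.arr 5 v = 0 := by
      by_contra! hall
      have : V.countP (fun v => s₁.arr 5 v ≠ 0) = V.length :=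
        List.countP_eq_length.mpr fun v hv => by simpa using hall v hv
      rw [hI₁.card] at this
      omega
    refine WP_selectMin (V := V) (pos := s₁.arr 5) (deg := remDeg es (s₁.arr 5)) (d := d)
      (m := es.length) (hV₁.frame (hF₂.reg 5 rfl) (hF₂.arr 4 rfl)) h5₂
      (fun v hv => hdeg v ((hmem v).mp hv)) ((hF₂.reg 1 rfl).trans hes₁.length) hmw (by omega)
      (fun v _ => List.countP_le_length) (hd _ ⟨u, hu, hu0⟩) fun s₃ t₃ hF₃ hsel ht₃ => ?_
    have e6 : s₃.reg 6 = k := (hF₃.reg 6 rfl).trans ((hF₂.reg 6 rfl).trans hk₁)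
    have e5 : s₃.arr 5 = s₁.arr 5 := (hF₃.arr 5 rfl).trans h5₂
    rw [WP_store]
    refine ⟨?_, by simp; omega⟩
    simp only [State.arr_setArr, if_true, Expr.eval_reg, Expr.eval_add, Expr.eval_const, e5, e6,
      hone, Nat.mod_eq_of_lt (show k + 1 < 2 ^ w by omega)]
    exact hI₁.step hVd hsel.1 hsel.2.1 hsel.2.2
  · refine ⟨⟨_, rfl, hI⟩, ?_⟩
    simp only [Expr.cost_reg] at ht
    have e : V.length * (es.length * 80 + V.length * 40 + 50 + (1 + 7)) ≤
      V.length * (es.length * 80 + V.length * 40 + 60) := Nat.mul_le_mul_left _ (by omega)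
    omega

end WordRAM

/-! ### The acyclic orientation -/

namespace WordRAM
open WordRAM.Expr (const reg load)
variable {w : ℕ} {s : State} {t : ℕ} {Q : State → ℕ → Prop}

/-- The relation that directs every edge in `es` towards the endpoint with the larger position. -/
def orientation (es : List (ℕ × ℕ)) (pos : ℕ → ℕ) (u v : ℕ) : Bool :=
  decide (pos u < pos v) && (decide ((u, v) ∈ es) || decide ((v, u) ∈ es))

/-- Write the matrix of the relation `orientation` to the array `7`. -/
def orient : Cmd :=
  forLoop 3 (reg 1) (4 ≔ load 0 (reg 3) ;; 7 ≔ load 1 (reg 3) ;;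
    .ite (.op .lt (load 5 (reg 4)) (load 5 (reg 7)))
      (.store 7 (reg 4 * reg 0 + reg 7) (const 1)) (.store 7 (reg 7 * reg 0 + reg 4) (const 1)))

theorem mul_add_eq_iff {n u v x y : ℕ} (hv : v < n) (hy : y < n) :
    u * n + v = x * n + y ↔ u = x ∧ v = y := by
  refine ⟨fun h => ?_, by rintro ⟨rfl, rfl⟩; rfl⟩
  have hn : 0 < n := by omega
  have h1 := congrArg (· / n) h
  have h2 := congrArg (· % n) h
  simp only [mul_comm _ n, Nat.mul_add_div hn, Nat.mul_add_mod, Nat.div_eq_of_lt hv,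
    Nat.div_eq_of_lt hy, Nat.mod_eq_of_lt hv, Nat.mod_eq_of_lt hy] at h1 h2
  exact ⟨by simpa using h1, h2⟩

theorem WP_orient {es : List (ℕ × ℕ)} {n : ℕ} {pos : ℕ → ℕ} (hes : HasEdges es s)
    (hn : ∀ e ∈ es, e.1 < n ∧ e.2 < n) (hpos : s.arr 5 = pos)
    (hne : ∀ e ∈ es, pos e.1 ≠ pos e.2) (h0 : s.reg 0 = n) (h7 : ∀ x, s.arr 7 x = 0)
    (hnw : n * n < 2 ^ w) (hmw : es.length < 2 ^ w) (hw : 1 < 2 ^ w)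
    (hQ : ∀ s' t', Frame orient s s' → HasRel w n (orientation es pos) s' →
      t' ≤ t + (es.length * 40 + 10) → Q s' t') :
    WP w orient s t Q := by
  refine WP.mono (Q := fun s' t' => HasRel w n (orientation es pos) s' ∧
      t' ≤ t + (es.length * 40 + 10)) ?_ fun s' t' hF h => hQ s' t' hF h.1 h.2
  have hone : 1 % 2 ^ w = 1 := Nat.mod_eq_of_lt hw
  refine WP_for_const (N := es.length) (fun k s' => ∀ u < n, ∀ v < n,
      s'.arr 7 (u * n + v) = (orientation (es.take k) pos u v).toNat)
    30 hmw rfl (fun s' hF => (hF.reg 1 rfl).trans hes.length)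
    (fun k s' x h => by simpa using h) (by simp [orientation, h7])
    (fun k hk s₁ hF₁ hk₁ hI₁ t₁ => ?_) (fun s' t' hF _ hI ht => ?_)
  · have hes₁ : HasEdges es s₁ := hes.frame (hF₁.reg 1 rfl) (hF₁.arr 0 rfl) (hF₁.arr 1 rfl)
    have e5 : s₁.arr 5 = pos := (hF₁.arr 5 rfl).trans hpos
    have e0 : s₁.reg 0 = n := (hF₁.reg 0 rfl).trans h0
    have hek : es[k] ∈ es := List.getElem_mem hk
    obtain ⟨hx, hy⟩ := hn _ hek
    have hxy := hne _ hek
    have key : ∀ x y, x < n → y < n → pos x < pos y → (x = es[k].1 ∧ y = es[k].2 ∨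
        x = es[k].2 ∧ y = es[k].1) → ∀ u < n, ∀ v < n,
        Function.update (s₁.arr 7) (x * n + y) 1 (u * n + v) =
          (orientation (es.take (k + 1)) pos u v).toNat := by
      intro x y hx hy hlt hor u hu v hv
      have hmem : ∀ p : ℕ × ℕ, p ∈ es.take (k + 1) ↔ p ∈ es.take k ∨ p = es[k] := fun p => by
        rw [List.take_succ_eq_append_getElem hk, List.mem_append, List.mem_singleton]
      rw [Function.update_apply]
      simp only [mul_add_eq_iff hv hy]
      by_cases huv : u = x ∧ v = y
      · obtain ⟨rfl, rfl⟩ := huv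
        have : (u, v) = es[k] ∨ (v, u) = es[k] := by
          rcases hor with ⟨h1, h2⟩ | ⟨h1, h2⟩
          · exact .inl (by rw [h1, h2])
          · exact .inr (by rw [h1, h2])
        rcases this with h | h <;> simp [orientation, hlt, hmem, h]
      · rw [if_neg huv, hI₁ u hu v hv]
        congr 1
        simp only [orientation]
        by_cases hp : pos u < pos v
        · have h1 : ¬ (u, v) = es[k] := by
            intro h
            rcases hor with ⟨h1, h2⟩ | ⟨h1, h2⟩
            · exact huv ⟨by rw [h1, ← h], by rw [h2, ← h]⟩
            · rw [h1, h2, ← h] at hlt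
              simp at hlt
              omega
          have h2 : ¬ (v, u) = es[k] := by
            intro h
            rcases hor with ⟨h1, h2⟩ | ⟨h1, h2⟩
            · rw [h1, h2, ← h] at hlt
              simp at hlt
              omega
            · exact huv ⟨by rw [h1, ← h], by rw [h2, ← h]⟩
          simp [hp, hmem, h1, h2]
        · simp [hp]
    have hidx : ∀ x y, x < n → y < n → (x * n + y) % 2 ^ w = x * n + y ∧
        (x * n) % 2 ^ w = x * n := by
      intro x y hx hy
      have := HasRel.idx hx hy
      exact ⟨Nat.mod_eq_of_lt (by omega), Nat.mod_eq_of_lt (by omega)⟩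
    simp only [WP_seq, WP_assign, WP_ite, WP_store, Expr.eval_load, Expr.eval_reg, Expr.eval_lt,
      Expr.eval_add, Expr.eval_mul, Expr.eval_const, State.reg_setReg, State.arr_setReg,
      State.arr_setArr, hk₁, e5]
    simp [hes₁.fst k hk, hes₁.snd k hk, e0, hone, hidx _ _ hx hy, hidx _ _ hy hx]
    by_cases hlt : pos es[k].1 < pos es[k].2
    · rw [if_pos hlt]
      exact key _ _ hx hy hlt (.inl ⟨rfl, rfl⟩)
    · rw [if_neg hlt]
      exact key _ _ hy hx (by omega) (.inr ⟨rfl, rfl⟩)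
  · rw [List.take_length] at hI
    refine ⟨⟨(hF.reg 0 rfl).trans h0, hI, hnw⟩, ?_⟩
    simp at ht
    omega

/-! ### The search over all prefixes -/

/-- Make the list of those vertices `v` in the array `4` for which the value of `e` with `v` in
register `21` is not `0` the list of candidates. -/
def gather (e : Expr) : Cmd :=
  12 ≔ const 0 ;; forLoop 13 (reg 5) (21 ≔ load 4 (reg 13) ;;
    .ite e (.store 8 (reg 12) (reg 21) ;; 12 ≔ reg 12 + const 1) .skip)

theorem WP_gather {e : Expr} {V : List ℕ} {p : ℕ → Bool} (hV : HasVerts V s)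
    (hp : ∀ v ∈ V, ∀ s' : State, s'.reg 21 = v → s'.reg 0 = s.reg 0 → s'.reg 10 = s.reg 10 →
      s'.reg 11 = s.reg 11 → s'.arr 7 = s.arr 7 → e.eval w s' = (p v).toNat)
    (hVw : V.length + 1 < 2 ^ w)
    (hQ : ∀ s' t', Frame (gather e) s s' → HasCand (V.filter p) s' →
      t' ≤ t + (V.length * (e.cost + 30) + 10) → Q s' t') :
    WP w (gather e) s t Q := by
  refine WP.mono (Q := fun s' t' => HasCand (V.filter p) s' ∧
      t' ≤ t + (V.length * (e.cost + 30) + 10)) ?_ fun s' t' hF h => hQ s' t' hF h.1 h.2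
  have hone : 1 % 2 ^ w = 1 := Nat.mod_eq_of_lt (by omega)
  simp only [gather, WP_seq, WP_assign]
  refine WP_for_const (N := V.length) (fun k s' => HasCand ((V.take k).filter p) s')
    (e.cost + 20) (by omega) rfl (fun s' hF => (hF.reg 5 rfl).trans (by simpa using hV.length))
    (fun k s' x h => h.frame (by simp) (by simp)) ⟨by simp, by simp⟩
    (fun k hk s₁ hF₁ hk₁ hI₁ t₁ => ?_) (fun s' t' hF _ hI ht => ?_)
  · have hV₁ : HasVerts V s₁ := hV.frame ((hF₁.reg 5 rfl).trans (by simp))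
      ((hF₁.arr 4 rfl).trans (by simp))
    have hmem : V[k] ∈ V := List.getElem_mem hk
    have he : e.eval w (s₁.setReg 21 V[k]) = (p V[k]).toNat :=
      hp _ hmem _ (by simp) (by simpa using hF₁.reg 0 rfl) (by simpa using hF₁.reg 10 rfl)
        (by simpa using hF₁.reg 11 rfl) (by simpa using hF₁.arr 7 rfl)
    have hfl : ((V.take k).filter p).length ≤ V.length :=
      (List.length_filter_le _ _).trans (by simp)
    simp only [WP_seq, WP_assign, WP_ite, WP_store, WP_skip, Expr.eval_load, Expr.eval_reg, hk₁,
      hV₁.entry k hk, he]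
    rw [List.take_succ_eq_append_getElem hk, List.filter_append]
    cases hpk : p V[k] with
    | false =>
      simp only [Bool.toNat_false, ne_eq, not_true_eq_false, if_false]
      refine ⟨?_, by simp; omega⟩
      simpa [hpk] using hI₁.frame (s' := s₁.setReg 21 V[k]) (by simp) (by simp)
    | true =>
      simp only [Bool.toNat_true, ne_eq, one_ne_zero, not_false_eq_true, if_true]
      refine ⟨⟨?_, fun i hi => ?_⟩, by simp; omega⟩
      · simp [hpk, hI₁.length, hone]
        refine Nat.mod_eq_of_lt (by omega)
      · simp only [List.filter_cons, hpk, if_true, List.filter_nil] at hi ⊢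
        rcases Nat.lt_or_ge i ((V.take k).filter p).length with h | h
        · simp [hI₁.length, Function.update_of_ne h.ne, List.getElem_append_left h, hI₁.entry i h]
        · obtain rfl : i = ((V.take k).filter p).length := by simp at hi; omega
          simp [hI₁.length]
  · rw [List.take_length] at hI
    refine ⟨hI, ?_⟩
    simp only [Expr.cost_reg, Expr.cost_const] at ht
    have : V.length * (e.cost + 20 + (1 + 7)) ≤ V.length * (e.cost + 30) :=
      Nat.mul_le_mul_left _ (by omega)
    simp
    omega

/-- The beginnings of the chains: one dummy if `r = 0`, the vertices if `r = 1`, the edges if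
`r = 2`. -/
def prefixes (r : ℕ) (es : List (ℕ × ℕ)) (V : List ℕ) : List (ℕ × ℕ) :=
  if r = 0 then [(0, 0)] else if r = 1 then V.map fun v => (v, 0) else es

/-- Whether `v` may follow the prefix `p`. -/
def follows (r : ℕ) (E : ℕ → ℕ → Bool) (p : ℕ × ℕ) (v : ℕ) : Bool :=
  if r = 0 then true else if r = 1 then E p.1 v else E p.1 v && E p.2 v

/-- The number of prefixes. -/
def prefixCount (r : ℕ) : Expr := if r = 0 then const 1 else if r = 1 then reg 5 else reg 1

/-- Load the prefix with number `reg 39` into the registers `10` and `11`. -/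
def loadPrefix (r : ℕ) : Cmd :=
  if r = 0 then .skip else if r = 1 then 10 ≔ load 4 (reg 39) else
    10 ≔ load 0 (reg 39) ;; 11 ≔ load 1 (reg 39)

/-- The test whether the vertex in register `21` may follow the prefix. -/
def followsTest (r : ℕ) : Expr :=
  if r = 0 then const 1 else if r = 1 then load 7 (reg 10 * reg 0 + reg 21) else
    load 7 (reg 10 * reg 0 + reg 21) * load 7 (reg 11 * reg 0 + reg 21)

namespace BilinearAlg
variable (a : BilinearAlg)

/-- Process the candidates after every prefix. -/
def search (r j : ℕ) : Cmd :=
  2 ≔ const 0 ;;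
  forLoop 39 (prefixCount r) (loadPrefix r ;; gather (followsTest r) ;; a.process r j)

/-- The number of chains with `r + 3 j` elements, computed from their prefixes. -/
def searchCount (r j : ℕ) (es : List (ℕ × ℕ)) (V : List ℕ) (E : ℕ → ℕ → Bool) : ℕ :=
  ((prefixes r es V).map fun p => (chains E (V.filter (follows r E p)) (3 * j)).length).sum

/-- A bound for the time that `process` takes when the number of chains of length `j` is `N` and
the numbers of candidates and of shorter chains are at most `B`. -/
def processTime (j B N : ℕ) : ℕ :=
  a.procConst j * (B * B + (Nat.clog a.n N + 1) * a.R ^ Nat.clog a.n N)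

/-- `search` counts the chains of length `r + 3 j` and exhibits one of them. Its time is the sum over
all prefixes of the time of `process` and of the time for listing the candidates. -/
theorem WP_search {n r j : ℕ} {es : List (ℕ × ℕ)} {V : List ℕ} {E : ℕ → ℕ → Bool}
    {B : ℕ × ℕ → ℕ} (hr : r ≤ 2)
    (hes : HasEdges es s) (hn : ∀ e ∈ es, e.1 < n ∧ e.2 < n) (hV : HasVerts V s) (hVd : V.Nodup)
    (hVn : ∀ v ∈ V, v < n) (hE : HasRel w n E s)
    (hB : ∀ p ∈ prefixes r es V, ∀ i ≤ j, (chains E (V.filter (follows r E p)) i).length ≤ B p)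
    (hVB : ∀ p ∈ prefixes r es V, (V.filter (follows r E p)).length ≤ B p)
    (hBw : ∀ p ∈ prefixes r es V, (B p + 1) * j < 2 ^ w)
    (hw : 1 < 2 ^ w) (hRw : a.R < 2 ^ w) (hDw : a.D < 2 ^ w) (hjw : r + 3 * j < 2 ^ w)
    (hRk : ∀ p ∈ prefixes r es V,
      a.R ^ Nat.clog a.n (chains E (V.filter (follows r E p)) j).length < 2 ^ w)
    (hDk : ∀ p ∈ prefixes r es V,
      a.D ^ Nat.clog a.n (chains E (V.filter (follows r E p)) j).length *
        a.n ^ Nat.clog a.n (chains E (V.filter (follows r E p)) j).length < 2 ^ w)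
    (hT : searchCount r j es V E < 2 ^ w) (hVw : V.length + 1 < 2 ^ w) (hmw : es.length < 2 ^ w)
    (hQ : ∀ s' t', Frame (a.search r j) s s' → s'.reg 2 = searchCount r j es V E →
      (searchCount r j es V E ≠ 0 → ∃ p ∈ prefixes r es V,
        ∃ l ∈ chains E (V.filter (follows r E p)) (3 * j),
        (∀ i (hi : i < l.length), s'.arr 2 (r + i) = l[i]) ∧
        (1 ≤ r → s'.arr 2 0 = p.1) ∧ (2 ≤ r → s'.arr 2 1 = p.2)) →
      t' ≤ t + (((prefixes r es V).map fun p =>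
        a.processTime j (B p) (chains E (V.filter (follows r E p)) j).length +
          (V.length * 50 + 50)).sum + 10) → Q s' t') :
    WP w (a.search r j) s t Q := by
  set P := prefixes r es V with hP
  set cand : ℕ × ℕ → List ℕ := fun p => V.filter (follows r E p) with hcand
  set cnt : List (ℕ × ℕ) → ℕ := fun P => (P.map fun p => (chains E (cand p) (3 * j)).length).sum
    with hcnt
  have hcntT : searchCount r j es V E = cnt P := rfl
  set f : ℕ × ℕ → ℕ := fun p => a.processTime j (B p) (chains E (cand p) j).length +
    (V.length * 50 + 50) with hf
  have hone : 1 % 2 ^ w = 1 := Nat.mod_eq_of_lt hw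
  have hcost : (prefixCount r).cost = 1 := by
    simp only [prefixCount]; split_ifs <;> rfl
  have hcost' : (followsTest r).cost ≤ 15 := by
    simp only [followsTest]; split_ifs <;> simp
  have hPlen : P.length < 2 ^ w := by
    simp only [hP, prefixes]
    split_ifs
    · simpa using hw
    · rw [List.length_map]; omega
    · exact hmw
  refine WP.mono (Q := fun s' t' => s'.reg 2 = cnt P ∧ (cnt P ≠ 0 → ∃ p ∈ P,
        ∃ l ∈ chains E (cand p) (3 * j),
        (∀ i (hi : i < l.length), s'.arr 2 (r + i) = l[i]) ∧
        (1 ≤ r → s'.arr 2 0 = p.1) ∧ (2 ≤ r → s'.arr 2 1 = p.2)) ∧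
        t' ≤ t + ((P.map f).sum + 10 + P.length * 0)) ?_
    fun s' t' hF h => hQ s' t' hF h.1 h.2.1 (by simpa using h.2.2)
  simp only [search, WP_seq, WP_assign, Expr.eval_const, Nat.zero_mod]
  have hframe : ∀ s' : State, Frame (forLoop 39 (prefixCount r) (loadPrefix r ;;
      gather (followsTest r) ;; a.process r j)) (s.setReg 2 0) s' →
      HasEdges es s' ∧ HasVerts V s' ∧ HasRel w n E s' := by
    intro s' hF
    have h1 : ∀ x, x = 0 ∨ x = 1 ∨ x = 5 → s'.reg x = s.reg x := by
      intro x hx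
      rw [hF.reg x]
      · rcases hx with rfl | rfl | rfl <;> simp
      · rw [forLoop_wr]
        simp only [Cmd.wr, gather, forLoop_wr, loadPrefix]
        rcases hx with rfl | rfl | rfl <;> split_ifs <;>
          simp [Cmd.wr, a.process_wr]
    have h2 : ∀ x, x = 0 ∨ x = 1 ∨ x = 4 ∨ x = 7 → s'.arr x = s.arr x := by
      intro x hx
      rw [hF.arr x]
      · simp
      · rw [forLoop_wa]
        simp only [Cmd.wa, gather, forLoop_wa, loadPrefix]
        rcases hx with rfl | rfl | rfl | rfl <;> split_ifs <;>
          simp [Cmd.wa, a.process_wa]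
    exact ⟨hes.frame (h1 1 (by simp)) (h2 0 (by simp)) (h2 1 (by simp)),
      hV.frame (h1 5 (by simp)) (h2 4 (by simp)), hE.frame (h1 0 (by simp)) (h2 7 (by simp))⟩
  refine WP_for (N := P.length) (fun k s' => s'.reg 2 = cnt (P.take k) ∧
      (cnt (P.take k) ≠ 0 → ∃ p ∈ P, ∃ l ∈ chains E (cand p) (3 * j),
        (∀ i (hi : i < l.length), s'.arr 2 (r + i) = l[i]) ∧
        (1 ≤ r → s'.arr 2 0 = p.1) ∧ (2 ≤ r → s'.arr 2 1 = p.2)))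
    (fun k => f (P.getD k (0, 0)) - 8) hPlen ?_ (fun s' hF => ?_)
    (fun k s' x h => by simpa using h) (by simp [hcnt])
    (fun k hk s₁ hF₁ hk₁ hI₁ t₁ => ?_) (fun s' t' hF _ hI ht => ?_)
  · simp only [Cmd.wr, gather, forLoop_wr, loadPrefix]
    split_ifs <;> simp [Cmd.wr, a.process_wr]
  · obtain ⟨hes', hV', -⟩ := hframe s' hF
    simp only [hP, prefixes, prefixCount]
    split_ifs
    · simp [hone]
    · simp [hV'.length]
    · simp [hes'.length]
  · obtain ⟨hes₁, hV₁, hE₁⟩ := hframe s₁ hF₁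
    have hPk : P[k] ∈ P := List.getElem_mem hk
    have hfk : f (P.getD k (0, 0)) = f P[k] := by rw [List.getD_eq_getElem _ _ hk]
    rw [hfk, WP_seq]
    -- the effect of loading the prefix
    have hload : WP w (loadPrefix r) s₁ t₁ fun s' t' => ((1 ≤ r → s'.reg 10 = P[k].1) ∧
        (2 ≤ r → s'.reg 11 = P[k].2) ∧ (1 ≤ r → P[k].1 < n) ∧ (2 ≤ r → P[k].2 < n)) ∧
        t' ≤ t₁ + 10 := by
      have hr' : r = 0 ∨ r = 1 ∨ r = 2 := by omega
      rcases hr' with rfl | rfl | rfl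
      · simp [loadPrefix]
      · have hk' : k < V.length := by simpa [hP, prefixes] using hk
        have hPk' : P[k] = (V[k], 0) := by simp [hP, prefixes]
        simp [loadPrefix, hk₁, hV₁.entry k hk', hPk', hVn V[k] (List.getElem_mem hk')]
      · have hk' : k < es.length := by simpa [hP, prefixes] using hk
        have hPk' : P[k] = es[k] := by simp [hP, prefixes]
        have := hn es[k] (List.getElem_mem hk')
        have e1 : P[k].1 = es[k].1 := congrArg Prod.fst hPk'
        have e2 : P[k].2 = es[k].2 := congrArg Prod.snd hPk'
        simp only [loadPrefix, OfNat.ofNat_ne_zero, OfNat.ofNat_ne_one, if_false, WP_seq, WP_assign]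
        simp [hk₁, hes₁.fst k hk', hes₁.snd k hk']
        exact ⟨e1.symm, e2.symm, e1 ▸ this.1, e2 ▸ this.2⟩
    refine hload.mono fun s₂ t₂ hF₂ h₂ => ?_
    obtain ⟨⟨g10, g11, gn1, gn2⟩, ht₂⟩ := h₂
    have lw : ∀ x, x ≠ 10 → x ≠ 11 → (loadPrefix r).wr x = false := by
      intro x hx hx'; simp only [loadPrefix]; split_ifs <;> simp [Cmd.wr, hx, hx']
    have la : ∀ x, (loadPrefix r).wa x = false := by
      intro x; simp only [loadPrefix]; split_ifs <;> simp [Cmd.wa]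
    have hV₂ : HasVerts V s₂ := hV₁.frame (hF₂.reg 5 (lw 5 (by simp) (by simp))) (hF₂.arr 4 (la 4))
    have hE₂ : HasRel w n E s₂ := hE₁.frame (hF₂.reg 0 (lw 0 (by simp) (by simp))) (hF₂.arr 7 (la 7))
    rw [WP_seq]
    refine WP_gather (p := follows r E P[k]) hV₂ (fun v hv s' q1 q2 q3 q4 q5 => ?_) hVw
      fun s₃ t₃ hF₃ hC₃ ht₃ => ?_
    · have hE' : HasRel w n E s' := hE₂.frame q2 q5
      have hr' : r = 0 ∨ r = 1 ∨ r = 2 := by omega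
      rcases hr' with rfl | rfl | rfl
      · simp [followsTest, follows, hone]
      · simp only [followsTest, follows, one_ne_zero, if_false, if_true]
        exact hE'.eval (by simpa [q3] using g10 le_rfl) (by simpa using q1) (gn1 le_rfl) (hVn v hv)
      · simp only [followsTest, follows, OfNat.ofNat_ne_zero, OfNat.ofNat_ne_one, if_false]
        rw [Expr.eval_mul,
          hE'.eval (u := P[k].1) (v := v) (by simpa [q3] using g10 (by simp)) (by simpa using q1)
            (gn1 (by simp)) (hVn v hv),
          hE'.eval (u := P[k].2) (v := v) (by simpa [q4] using g11 le_rfl) (by simpa using q1)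
            (gn2 le_rfl) (hVn v hv), toNat_mul_mod _ _ hw]
    have hsucc : cnt (P.take (k + 1)) = cnt (P.take k) + (chains E (cand P[k]) (3 * j)).length := by
      simp only [hcnt]
      rw [List.take_succ_eq_append_getElem hk, List.map_append, List.sum_append]
      simp
    have hcle : cnt (P.take (k + 1)) ≤ cnt P := by
      simp only [hcnt]
      conv_rhs => rw [← List.take_append_drop (k + 1) P]
      rw [List.map_append, List.sum_append]
      exact Nat.le_add_right _ _
    have e2₃ : s₃.reg 2 = cnt (P.take k) :=
      (hF₃.reg 2 rfl).trans ((hF₂.reg 2 (lw 2 (by simp) (by simp))).trans hI₁.1)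
    have e2a : s₃.arr 2 = s₁.arr 2 := (hF₃.arr 2 rfl).trans (hF₂.arr 2 (la 2))
    have e10 : s₃.reg 10 = s₂.reg 10 := hF₃.reg 10 rfl
    have e11 : s₃.reg 11 = s₂.reg 11 := hF₃.reg 11 rfl
    refine a.WP_process (B := B P[k]) (hE₂.frame (hF₃.reg 0 rfl) (hF₃.arr 7 rfl)) hC₃
      (fun v hv => hVn v (List.mem_filter.mp hv).1) (hVd.filter _) (hB _ hPk) (hVB _ hPk)
      (hBw _ hPk) hw hRw hDw hjw (hRk _ hPk) (hDk _ hPk) ?_ fun s₄ t₄ hF₄ h2 h20 h21 ht₄ => ?_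
    · rw [e2₃]
      change cnt (P.take k) + (chains E (cand P[k]) (3 * j)).length < _
      omega
    · change _ = _ + (chains E (cand P[k]) (3 * j)).length at h2
      refine ⟨⟨by rw [h2, e2₃, hsucc], fun hne => ?_⟩, ?_⟩
      · by_cases hz : (chains E (cand P[k]) (3 * j)).length = 0
        · rw [h20 hz, e2a]
          exact hI₁.2 (by omega)
        · obtain ⟨l, hl, k1, k2, k3⟩ := h21 hz
          refine ⟨P[k], hPk, l, hl, k1, fun h => ?_, fun h => ?_⟩
          · rw [k2 h, e10, g10 h]
          · rw [k3 h, e11, g11 h]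
      · have e : V.length * ((followsTest r).cost + 30) ≤ V.length * 45 :=
          Nat.mul_le_mul_left _ (by omega)
        have e' : f P[k] = a.procConst j * (B P[k] * B P[k] +
          (Nat.clog a.n (chains E (V.filter (follows r E P[k])) j).length + 1) *
          a.R ^ Nat.clog a.n (chains E (V.filter (follows r E P[k])) j).length) +
          (V.length * 50 + 50) := rfl
        rw [e']
        omega
  · rw [List.take_length] at hI
    refine ⟨hI.1, hI.2, ht.trans ?_⟩
    have e1 : ∑ k ∈ Finset.range P.length, (f (P.getD k (0, 0)) - 8 + ((prefixCount r).cost + 7)) =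
        ∑ k ∈ Finset.range P.length, f (P.getD k (0, 0)) := by
      refine Finset.sum_congr rfl fun k _ => ?_
      have : 8 ≤ f (P.getD k (0, 0)) := by simp only [hf]; omega
      omega
    have e2 : ∑ k ∈ Finset.range P.length, f (P.getD k (0, 0)) = (P.map f).sum := by
      rw [← Fin.sum_univ_eq_sum_range (fun k => f (P.getD k (0, 0))), ← List.sum_ofFn]
      congr 1
      refine List.ext_getElem (by simp) fun i h1 h2 => ?_
      simp at h2
      simp
    rw [hcost] at ht ⊢
    rw [hcost] at e1
    rw [e1, e2]
    simp
    omega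

end BilinearAlg
end WordRAM

/-! ### Bounds for the numbers of chains -/

namespace WordRAM

theorem follows_zero (E : ℕ → ℕ → Bool) (p : ℕ × ℕ) : follows 0 E p = fun _ => true := by
  funext v; simp [follows]

theorem follows_one (E : ℕ → ℕ → Bool) (p : ℕ × ℕ) : follows 1 E p = E p.1 := by
  funext v; simp [follows]

theorem length_chains_succ_le {E : ℕ → ℕ → Bool} {V : List ℕ} {d : ℕ}
    (hd : ∀ u ∈ V, (V.filter (E u)).length ≤ d) (i : ℕ) :
    (chains E V (i + 2)).length ≤ (chains E V (i + 1)).length * d := by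
  rw [chains, List.length_flatMap]
  refine (List.sum_le_card_nsmul _ d fun x hx => ?_).trans (by simp)
  obtain ⟨c, hc, rfl⟩ := List.mem_map.mp hx
  obtain ⟨hl, hV, -⟩ := mem_chains.mp hc
  obtain ⟨u, c, rfl⟩ := List.exists_cons_of_length_eq_add_one hl
  rw [List.length_map]
  refine le_trans ?_ (hd u (hV u (by simp)))
  rw [← List.countP_eq_length_filter, ← List.countP_eq_length_filter]
  exact List.countP_mono_left fun v _ hv => by
    simp only [List.all_cons, Bool.and_eq_true] at hv
    exact hv.1

theorem length_chains_one (E : ℕ → ℕ → Bool) (V : List ℕ) : (chains E V 1).length = V.length := by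
  simp [chains]

theorem length_chains_le_mul_pow {E : ℕ → ℕ → Bool} {V : List ℕ} {d : ℕ}
    (hd : ∀ u ∈ V, (V.filter (E u)).length ≤ d) (k i : ℕ) :
    (chains E V (k + 1 + i)).length ≤ (chains E V (k + 1)).length * d ^ i := by
  induction i with
  | zero => simp
  | succ i ih =>
    rw [show k + 1 + (i + 1) = (k + i) + 2 by ring, pow_succ, ← mul_assoc]
    refine (length_chains_succ_le hd (k + i)).trans (Nat.mul_le_mul_right _ ?_)
    rwa [show k + i + 1 = k + 1 + i by ring]

theorem length_chains_le_pow (E : ℕ → ℕ → Bool) (V : List ℕ) (i : ℕ) :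
    (chains E V i).length ≤ V.length ^ i := by
  cases i with
  | zero => simp [chains]
  | succ i =>
    have := length_chains_le_mul_pow (E := E) (V := V) (d := V.length)
      (fun u _ => List.length_filter_le _ _) 0 i
    rwa [zero_add, length_chains_one, Nat.add_comm 1 i, ← pow_succ'] at this

/-- Chains are counted by their first elements. -/
theorem length_chains_succ {E : ℕ → ℕ → Bool} {V : List ℕ} (hV : V.Nodup) (i : ℕ) :
    (chains E V (i + 1)).length = (V.map fun v => (chains E (V.filter (E v)) i).length).sum := by
  have hperm : (chains E V (i + 1)).Perm
      (V.flatMap fun v => (chains E (V.filter (E v)) i).map (v :: ·)) := by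
    refine (List.perm_ext_iff_of_nodup (nodup_chains hV _) ?_).mpr fun l => ?_
    · rw [List.nodup_flatMap]
      refine ⟨fun v _ => (nodup_chains (hV.filter _) i).map fun x y h => by simpa using h,
        hV.imp fun {u v} huv => ?_⟩
      intro l h1 h2
      obtain ⟨x, -, rfl⟩ := List.mem_map.mp h1
      obtain ⟨y, -, h⟩ := List.mem_map.mp h2
      exact huv (by simp at h; exact h.1.symm)
    · simp only [List.mem_flatMap, List.mem_map, mem_chains]
      constructor
      · rintro ⟨hl, hm, hp⟩
        obtain ⟨v, l, rfl⟩ := List.exists_cons_of_length_eq_add_one hl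
        rw [List.pairwise_cons] at hp
        refine ⟨v, hm v (by simp), l, ⟨by simpa using hl, fun x hx => ?_, hp.2⟩, rfl⟩
        exact List.mem_filter.mpr ⟨hm x (by simp [hx]), hp.1 x hx⟩
      · rintro ⟨v, hv, l, ⟨hl, hm, hp⟩, rfl⟩
        refine ⟨by simpa using hl, ?_, List.pairwise_cons.mpr ⟨fun x hx =>
          (List.mem_filter.mp (hm x hx)).2, hp⟩⟩
        intro x hx
        rcases List.mem_cons.mp hx with rfl | hx
        exacts [hv, (List.mem_filter.mp (hm x hx)).1]
  rw [hperm.length_eq, List.length_flatMap]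
  simp

/-- `es` lists every edge once, and the endpoints of the edges differ. -/
structure SimpleEdges (es : List (ℕ × ℕ)) : Prop where
  nodup : es.Nodup
  swap : ∀ u v, (u, v) ∈ es → (v, u) ∉ es

theorem SimpleEdges.ne {es : List (ℕ × ℕ)} (h : SimpleEdges es) {e : ℕ × ℕ} (he : e ∈ es) :
    e.1 ≠ e.2 := by
  obtain ⟨u, v⟩ := e
  rintro (rfl : u = v)
  exact h.swap _ _ he he

/-- What the first three phases compute: the list `V` of the endpoints of edges, and positions that
orient the edges acyclically with out-degree at most `d`. -/
structure DegenerateOrder (es : List (ℕ × ℕ)) (V : List ℕ) (d : ℕ) (pos : ℕ → ℕ) : Prop where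
  simple : SimpleEdges es
  nodup : V.Nodup
  mem : ∀ v, v ∈ V ↔ ∃ e ∈ es, Touches e v
  inj : ∀ u ∈ V, ∀ v ∈ V, pos u = pos v → u = v
  later : ∀ v ∈ V, es.countP (fun e => Touches e v ∧ pos v ≤ pos e.1 ∧ pos v ≤ pos e.2) ≤ d

theorem Peeled.degenerateOrder {es : List (ℕ × ℕ)} {V : List ℕ} {d : ℕ} {pos : ℕ → ℕ}
    (h : Peeled es V d V.length pos) (hs : SimpleEdges es) (hV : V.Nodup)
    (hmem : ∀ v, v ∈ V ↔ ∃ e ∈ es, Touches e v) : DegenerateOrder es V d pos where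
  simple := hs
  nodup := hV
  mem := hmem
  inj u hu v _ huv := by
    have := List.countP_eq_length.mp h.card u hu
    exact h.inj u v huv (by simpa using this)
  later v hv := by
    have := List.countP_eq_length.mp h.card v hv
    refine le_trans (List.countP_mono_left fun e _ he => ?_) (h.later v (by simpa using this))
    simp only [decide_eq_true_eq] at he ⊢
    exact ⟨he.1, .inr he.2.1, .inr he.2.2⟩

namespace DegenerateOrder
variable {es : List (ℕ × ℕ)} {V : List ℕ} {d : ℕ} {pos : ℕ → ℕ}

theorem pos_ne (h : DegenerateOrder es V d pos) {e : ℕ × ℕ} (he : e ∈ es) : pos e.1 ≠ pos e.2 :=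
  fun hp => h.simple.ne he (h.inj _ ((h.mem _).mpr ⟨e, he, .inl rfl⟩) _
    ((h.mem _).mpr ⟨e, he, .inr rfl⟩) hp)

/-- The edge in `es` with the endpoints `u` and `v`. -/
def edgeOf (es : List (ℕ × ℕ)) (u v : ℕ) : ℕ × ℕ := if (u, v) ∈ es then (u, v) else (v, u)

theorem edgeOf_mem {u v : ℕ} (h : orientation es pos u v = true) : edgeOf es u v ∈ es := by
  simp only [orientation, Bool.and_eq_true, Bool.or_eq_true, decide_eq_true_eq] at h
  simp only [edgeOf]
  split_ifs with h1
  · exact h1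
  · exact h.2.resolve_left h1

theorem pos_lt {u v : ℕ} (h : orientation es pos u v = true) : pos u < pos v := by
  simp only [orientation, Bool.and_eq_true, decide_eq_true_eq] at h
  exact h.1

theorem edgeOf_inj {u v u' v' : ℕ} (h : orientation es pos u v = true)
    (h' : orientation es pos u' v' = true) (he : edgeOf es u v = edgeOf es u' v') :
    u = u' ∧ v = v' := by
  have h1 := pos_lt h
  have h2 := pos_lt h'
  simp only [edgeOf] at he
  split_ifs at he <;> simp only [Prod.mk.injEq] at he <;> obtain ⟨rfl, rfl⟩ := he <;>
    first | exact ⟨rfl, rfl⟩ | omega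

theorem mem_left {u v : ℕ} (h : DegenerateOrder es V d pos) (hE : orientation es pos u v = true) :
    u ∈ V := by
  refine (h.mem u).mpr ⟨_, edgeOf_mem hE, ?_⟩
  simp only [edgeOf]
  split_ifs
  exacts [.inl rfl, .inr rfl]

theorem mem_right {u v : ℕ} (h : DegenerateOrder es V d pos)
    (hE : orientation es pos u v = true) : v ∈ V := by
  refine (h.mem v).mpr ⟨_, edgeOf_mem hE, ?_⟩
  simp only [edgeOf]
  split_ifs
  exacts [.inr rfl, .inl rfl]

theorem length_filter_le (h : DegenerateOrder es V d pos) {v : ℕ} (hv : v ∈ V) :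
    (V.filter (orientation es pos v)).length ≤ d := by
  refine le_trans ?_ (h.later v hv)
  have hnd : ((V.filter (orientation es pos v)).map (edgeOf es v)).Nodup :=
    List.Nodup.map_on (fun x hx y hy hxy =>
      (edgeOf_inj (List.mem_filter.mp hx).2 (List.mem_filter.mp hy).2 hxy).2) (h.nodup.filter _)
  rw [List.countP_eq_length_filter, ← List.length_map (edgeOf es v)]
  refine (hnd.subperm fun e he => ?_).length_le
  obtain ⟨u, hu, rfl⟩ := List.mem_map.mp he
  have hE := (List.mem_filter.mp hu).2
  have hlt := pos_lt hE
  refine List.mem_filter.mpr ⟨edgeOf_mem hE, ?_⟩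
  simp only [edgeOf]
  split_ifs <;> simp [Touches, hlt.le]

theorem length_chains_two_le (h : DegenerateOrder es V d pos) :
    (chains (orientation es pos) V 2).length ≤ es.length := by
  have hpair : ∀ l ∈ chains (orientation es pos) V 2, ∃ u v, l = [u, v] ∧
      orientation es pos u v = true := by
    intro l hl
    obtain ⟨h1, -, h3⟩ := mem_chains.mp hl
    obtain ⟨u, v, rfl⟩ := List.length_eq_two.mp h1
    exact ⟨u, v, rfl, by simpa using h3⟩
  have hnd : ((chains (orientation es pos) V 2).map
      fun l => edgeOf es (l.getD 0 0) (l.getD 1 0)).Nodup := by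
    refine List.Nodup.map_on (fun x hx y hy hxy => ?_) (nodup_chains h.nodup 2)
    obtain ⟨u, v, rfl, h1⟩ := hpair x hx
    obtain ⟨u', v', rfl, h2⟩ := hpair y hy
    obtain ⟨rfl, rfl⟩ := edgeOf_inj h1 h2 (by simpa using hxy)
    rfl
  have hsub : ∀ e ∈ (chains (orientation es pos) V 2).map
      fun l => edgeOf es (l.getD 0 0) (l.getD 1 0), e ∈ es := by
    intro e he
    obtain ⟨l, hl, rfl⟩ := List.mem_map.mp he
    obtain ⟨u, v, rfl, h1⟩ := hpair l hl
    simpa using edgeOf_mem h1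
  simpa using (hnd.subperm hsub).length_le

/-- The sum of the out-degrees is at most the number of edges. -/
theorem sum_length_filter_le (h : DegenerateOrder es V d pos) :
    (V.map fun v => (V.filter (orientation es pos v)).length).sum ≤ es.length := by
  have := h.length_chains_two_le
  rw [length_chains_succ h.nodup] at this
  simpa only [length_chains_one] using this

theorem length_le (h : DegenerateOrder es V d pos) : V.length ≤ 2 * es.length := by
  have hsub : ∀ v ∈ V, v ∈ es.map Prod.fst ++ es.map Prod.snd := by
    intro v hv
    obtain ⟨e, he, h⟩ := (h.mem v).mp hv
    rcases h with rfl | rfl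
    · exact List.mem_append_left _ (List.mem_map_of_mem he)
    · exact List.mem_append_right _ (List.mem_map_of_mem he)
  have := (h.nodup.subperm hsub).length_le
  simp only [List.length_append, List.length_map] at this
  omega

/-- Chains are counted by the edges on which their first two elements lie. -/
theorem length_chains_add_two (h : DegenerateOrder es V d pos) (i : ℕ) :
    (chains (orientation es pos) V (i + 2)).length =
      (es.map fun e => (chains (orientation es pos)
        (V.filter (follows 2 (orientation es pos) e)) i).length).sum := by
  set E := orientation es pos with hE
  let first : ℕ × ℕ → ℕ := fun e => if pos e.1 < pos e.2 then e.1 else e.2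
  let second : ℕ × ℕ → ℕ := fun e => if pos e.1 < pos e.2 then e.2 else e.1
  have hfs : ∀ e ∈ es, E (first e) (second e) = true ∧ edgeOf es (first e) (second e) = e := by
    rintro ⟨u, v⟩ he
    have hne := h.pos_ne he
    simp only at hne
    by_cases hp : pos u < pos v
    · simp [first, second, hp, hE, orientation, edgeOf, he]
    · have hp' : pos v < pos u := by omega
      simp [first, second, hp, hE, orientation, edgeOf, he, hp', h.simple.swap u v he]
  have hfol : ∀ e x, follows 2 E e x = (E (first e) x && E (second e) x) := by
    intro e x
    simp only [follows, OfNat.ofNat_ne_zero, OfNat.ofNat_ne_one, if_false, first, second]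
    split_ifs
    · rfl
    · rw [Bool.and_comm]
  have hperm : (chains E V (i + 2)).Perm
      (es.flatMap fun e => (chains E (V.filter (follows 2 E e)) i).map
        (fun l => first e :: second e :: l)) := by
    refine (List.perm_ext_iff_of_nodup (nodup_chains h.nodup _) ?_).mpr fun l => ?_
    · rw [List.nodup_flatMap]
      refine ⟨fun v _ => (nodup_chains (h.nodup.filter _) i).map fun x y h => by simpa using h,
        List.Nodup.pairwise_of_forall_ne h.simple.nodup fun e he e' he' hee => ?_⟩
      intro l h1 h2
      obtain ⟨x, -, rfl⟩ := List.mem_map.mp h1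
      obtain ⟨y, -, h⟩ := List.mem_map.mp h2
      simp only [List.cons.injEq] at h
      apply hee
      rw [← (hfs e he).2, ← (hfs e' he').2, h.1, h.2.1]
    · simp only [List.mem_flatMap, List.mem_map, mem_chains]
      constructor
      · rintro ⟨hl, hm, hp⟩
        obtain ⟨u, l, rfl⟩ := List.exists_cons_of_length_eq_add_one hl
        obtain ⟨v, l, rfl⟩ := List.exists_cons_of_length_eq_add_one (n := i) (by simpa using hl)
        rw [List.pairwise_cons, List.pairwise_cons] at hp
        have huv : E u v = true := hp.1 v (by simp)
        have hmem := edgeOf_mem huv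
        obtain ⟨h1, h2⟩ := hfs _ hmem
        obtain ⟨h3, h4⟩ := edgeOf_inj h1 huv h2
        refine ⟨_, hmem, l, ⟨by simpa using hl, fun x hx => ?_, hp.2.2⟩, by rw [h3, h4]⟩
        refine List.mem_filter.mpr ⟨hm x (by simp [hx]), ?_⟩
        rw [hfol, h3, h4, hp.1 x (by simp [hx]), hp.2.1 x hx]
        rfl
      · rintro ⟨e, he, l, ⟨hl, hm, hp⟩, rfl⟩
        obtain ⟨h1, h2⟩ := hfs _ he
        have hx : ∀ x ∈ l, x ∈ V ∧ E (first e) x = true ∧ E (second e) x = true := by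
          intro x hx
          obtain ⟨g1, g2⟩ := List.mem_filter.mp (hm x hx)
          rw [hfol, Bool.and_eq_true] at g2
          exact ⟨g1, g2⟩
        refine ⟨by simpa using hl, fun x hxl => ?_, ?_⟩
        · rcases List.mem_cons.mp hxl with rfl | hxl
          · exact h.mem_left h1
          rcases List.mem_cons.mp hxl with rfl | hxl
          · exact h.mem_right h1
          · exact (hx x hxl).1
        · refine List.pairwise_cons.mpr ⟨fun x hxl => ?_, List.pairwise_cons.mpr
            ⟨fun x hxl => (hx x hxl).2.2, hp⟩⟩
          rcases List.mem_cons.mp hxl with rfl | hxl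
          · exact h1
          · exact (hx x hxl).2.1
  rw [hperm.length_eq, List.length_flatMap]
  simp

theorem searchCount_eq (h : DegenerateOrder es V d pos) {r : ℕ} (hr : r ≤ 2) (j : ℕ) :
    BilinearAlg.searchCount r j es V (orientation es pos) =
      (chains (orientation es pos) V (3 * j + r)).length := by
  have hr' : r = 0 ∨ r = 1 ∨ r = 2 := by omega
  rcases hr' with rfl | rfl | rfl
  · simp [BilinearAlg.searchCount, prefixes, follows_zero]
  · rw [length_chains_succ h.nodup]
    simp [BilinearAlg.searchCount, prefixes, follows_one, Function.comp_def]
  · rw [h.length_chains_add_two]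
    rfl

/-- A bound for the numbers of the chains with at most `j` elements after the prefix `p`. -/
def chainBound (r j d : ℕ) (es : List (ℕ × ℕ)) (V : List ℕ) (E : ℕ → ℕ → Bool) (p : ℕ × ℕ) : ℕ :=
  if r = 0 then 2 * es.length * d ^ (j - 2) + 1
  else if r = 1 then (V.filter (E p.1)).length * d ^ (j - 1) + 1
  else d ^ j + 1

theorem length_chains_le (h : DegenerateOrder es V d pos) {r j : ℕ} (hr : r ≤ 2) (hj : 2 ≤ j)
    (hd : es ≠ [] → 1 ≤ d) {p : ℕ × ℕ} (hp : p ∈ prefixes r es V) {i : ℕ} (hi : i ≤ j) :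
    (chains (orientation es pos) (V.filter (follows r (orientation es pos) p)) i).length ≤
      chainBound r j d es V (orientation es pos) p := by
  set E := orientation es pos with hE
  have hsub : ∀ q : ℕ → Bool, ∀ u ∈ V.filter q, ((V.filter q).filter (E u)).length ≤ d := by
    intro q u hu
    refine le_trans ?_ (h.length_filter_le (List.mem_filter.mp hu).1)
    rw [List.filter_comm]
    exact List.length_filter_le _ _
  have hpow : es ≠ [] → ∀ a b, a ≤ b → d ^ a ≤ d ^ b := fun hne a b hab =>
    Nat.pow_le_pow_right (hd hne) hab
  have hnil : es = [] → V = [] := by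
    rintro rfl
    have := h.length_le
    simpa using this
  rcases i with _ | i
  · simp only [chains, List.length_singleton, chainBound]
    split_ifs <;> exact Nat.le_add_left _ _
  by_cases hne : es = []
  · rw [hnil hne, List.filter_nil, Nat.add_comm, ← zero_add 1]
    refine (length_chains_le_mul_pow (d := 0) (by simp) 0 i).trans ?_
    simp [length_chains_one]
  have hr' : r = 0 ∨ r = 1 ∨ r = 2 := by omega
  rcases hr' with rfl | rfl | rfl
  · simp only [chainBound, follows_zero, if_true, List.filter_true]
    have hV : ∀ u ∈ V, (V.filter (E u)).length ≤ d := fun u hu => h.length_filter_le hu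
    have hbase : 2 * es.length ≤ 2 * es.length * d ^ (j - 2) :=
      Nat.le_mul_of_pos_right _ (Nat.pow_pos (hd hne))
    rcases i with _ | i
    · rw [zero_add, length_chains_one]
      have := h.length_le
      omega
    · have h1 := length_chains_le_mul_pow hV 1 i
      have h2 : (chains E V (1 + 1)).length * d ^ i ≤ es.length * d ^ (j - 2) :=
        Nat.mul_le_mul h.length_chains_two_le (hpow hne _ _ (by omega))
      rw [show 1 + 1 + i = i + 1 + 1 by ring] at h1
      have h3 : es.length * d ^ (j - 2) ≤ 2 * es.length * d ^ (j - 2) :=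
        Nat.mul_le_mul_right _ (by omega)
      omega
  · have h1 := length_chains_le_mul_pow (hsub (follows 1 E p)) 0 i
    rw [zero_add, length_chains_one, Nat.add_comm 1 i] at h1
    refine h1.trans ?_
    simp only [chainBound, one_ne_zero, if_false, if_true, follows_one]
    exact (Nat.mul_le_mul_left _ (hpow hne _ _ (by omega))).trans (Nat.le_add_right _ _)
  · have h1 := length_chains_le_mul_pow (hsub (follows 2 E p)) 0 i
    rw [zero_add, length_chains_one, Nat.add_comm 1 i] at h1
    refine h1.trans ?_
    have hp1 : p.1 ∈ V := (h.mem _).mpr ⟨p, hp, .inl rfl⟩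
    have h2 : (V.filter (follows 2 E p)).length ≤ d := by
      refine le_trans ?_ (h.length_filter_le hp1)
      rw [← List.countP_eq_length_filter, ← List.countP_eq_length_filter]
      exact List.countP_mono_left fun v _ hv => by
        simp only [follows, OfNat.ofNat_ne_zero, OfNat.ofNat_ne_one, if_false,
          Bool.and_eq_true] at hv
        exact hv.1
    simp only [chainBound, OfNat.ofNat_ne_zero, OfNat.ofNat_ne_one, if_false]
    calc _ ≤ d * d ^ i := Nat.mul_le_mul_right _ h2
      _ = d ^ (i + 1) := (pow_succ' _ _).symm
      _ ≤ d ^ j + 1 := (hpow hne _ _ hi).trans (Nat.le_add_right _ _)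

/-- The elements that the search outputs, a prefix followed by a chain, lie on a common clique. -/
theorem adj_of_witness {r j : ℕ} (hr : r ≤ 2) {p : ℕ × ℕ}
    (hp : p ∈ prefixes r es V) {l : List ℕ}
    (hl : l ∈ chains (orientation es pos) (V.filter (follows r (orientation es pos) p)) (3 * j))
    {f : ℕ → ℕ} (hf : ∀ i (hi : i < l.length), f (r + i) = l[i]) (h1 : 1 ≤ r → f 0 = p.1)
    (h2 : 2 ≤ r → f 1 = p.2) {x y : ℕ} (hxy : x < y) (hy : y < 3 * j + r) :
    (f x, f y) ∈ es ∨ (f y, f x) ∈ es := by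
  obtain ⟨hlen, hm, hpw⟩ := mem_chains.mp hl
  have horient : ∀ {u v}, orientation es pos u v = true → (u, v) ∈ es ∨ (v, u) ∈ es := by
    intro u v huv
    simp only [orientation, Bool.and_eq_true, Bool.or_eq_true, decide_eq_true_eq] at huv
    exact huv.2
  have hlate : ∀ z, r ≤ z → z < 3 * j + r → ∃ hz : z - r < l.length, f z = l[z - r] := by
    intro z hz hz'
    refine ⟨by omega, ?_⟩
    rw [← hf (z - r) (by omega)]
    congr 1
    omega
  obtain hxr | hxr := Nat.lt_or_ge x r
  · obtain hyr | hyr := Nat.lt_or_ge y r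
    · obtain rfl : r = 2 := by omega
      obtain rfl : x = 0 := by omega
      obtain rfl : y = 1 := by omega
      rw [h1 (by simp), h2 le_rfl]
      exact .inl hp
    · obtain ⟨hz, hfz⟩ := hlate y hyr hy
      have hfol := (List.mem_filter.mp (hm _ (List.getElem_mem hz))).2
      rw [← hfz] at hfol
      have hr' : r = 1 ∨ r = 2 := by omega
      rcases hr' with rfl | rfl
      · obtain rfl : x = 0 := by omega
        simp only [follows, one_ne_zero, if_false, if_true, ← h1 le_rfl] at hfol
        exact horient hfol
      · simp only [follows, OfNat.ofNat_ne_zero, OfNat.ofNat_ne_one, if_false, Bool.and_eq_true,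
          ← h1 (by simp), ← h2 le_rfl] at hfol
        have hx' : x = 0 ∨ x = 1 := by omega
        rcases hx' with rfl | rfl
        exacts [horient hfol.1, horient hfol.2]
  · obtain ⟨hz, hfz⟩ := hlate y (by omega) hy
    obtain ⟨hz', hfz'⟩ := hlate x hxr (by omega)
    rw [hfz, hfz']
    exact horient (List.pairwise_iff_getElem.mp hpw _ _ hz' hz (by omega))

end DegenerateOrder
end WordRAM

/-! ### Arboricity -/

section Arboricity
open SimpleGraph

theorem SimpleGraph.IsAcyclic.ncard_edgeSet_le {W : Type*} [Finite W] {F : SimpleGraph W}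
    (hF : F.IsAcyclic) : F.edgeSet.ncard ≤ Nat.card W := by
  classical
  rcases isEmpty_or_nonempty W with hW | hW
  · have : F.edgeSet = ∅ := by
      ext e
      induction e with
      | h a b => exact (hW.false a).elim
    simp [this]
  · obtain ⟨T, hFT, -, hT⟩ := (connected_top (V := W)).exists_isTree_le_of_le_of_isAcyclic le_top hF
    have : Fintype W := Fintype.ofFinite W
    have h1 := hT.card_edgeFinset
    have h2 : F.edgeSet.ncard ≤ T.edgeSet.ncard :=
      Set.ncard_le_ncard (edgeSet_mono hFT) (Set.toFinite _)
    rw [← coe_edgeFinset, ← coe_edgeFinset, Set.ncard_coe_finset, Set.ncard_coe_finset] at h2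
    rw [← coe_edgeFinset, Set.ncard_coe_finset, Nat.card_eq_fintype_card]
    omega

theorem SimpleGraph.ncard_edgeSet_iSup_le {W : Type*} [Finite W] {k : ℕ}
    {F : Fin k → SimpleGraph W} (hF : ∀ i, (F i).IsAcyclic) :
    (⨆ i, F i).edgeSet.ncard ≤ k * Nat.card W := by
  classical
  have : (⨆ i, F i).edgeSet = ⋃ i, (F i).edgeSet := by
    ext e
    induction e with
    | h a b => simp
  rw [this]
  calc _ ≤ ∑ i : Fin k, (F i).edgeSet.ncard := by
        refine (Set.ncard_iUnion_le_of_fintype _).trans le_rfl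
    _ ≤ ∑ _i : Fin k, Nat.card W := Finset.sum_le_sum fun i _ => (hF i).ncard_edgeSet_le
    _ = _ := by simp

/-- Every induced subgraph of a union of `k` forests has a vertex of degree at most `2 k`. -/
theorem SimpleGraph.exists_degree_induce_le {W : Type*} [Fintype W] {k : ℕ}
    {F : Fin k → SimpleGraph W} (hF : ∀ i, (F i).IsAcyclic) {S : Finset W} (hS : S.Nonempty) :
    ∃ v ∈ S, {u | u ∈ S ∧ (⨆ i, F i).Adj v u}.ncard ≤ 2 * k := by
  classical
  set H : SimpleGraph S := ⨆ i, (F i).induce (S : Set W) with hH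
  have hadj : ∀ v u : S, H.Adj v u ↔ (⨆ i, F i).Adj v u := by
    intro v u
    simp [hH, iSup_adj]
  have hle := ncard_edgeSet_iSup_le (k := k) (F := fun i => (F i).induce (S : Set W))
    fun i => (hF i).induce _
  rw [← hH] at hle
  have hsum := H.sum_degrees_eq_twice_card_edges
  rw [← coe_edgeFinset, Set.ncard_coe_finset] at hle
  obtain ⟨v, hv⟩ : ∃ v : S, H.degree v ≤ 2 * k := by
    by_contra! hcon
    have h1 : ∑ v : S, (2 * k + 1) ≤ ∑ v, H.degree v := Finset.sum_le_sum fun v _ => hcon v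
    rw [hsum] at h1
    have hpos : 0 < Fintype.card S := by
      rw [Fintype.card_coe]; exact hS.card_pos
    simp only [Finset.sum_const, Finset.card_univ, smul_eq_mul] at h1
    have h3 : Nat.card (S : Set W) = Fintype.card S := by
      rw [← Nat.card_eq_fintype_card]; rfl
    rw [h3] at hle
    nlinarith
  refine ⟨v, v.2, le_trans ?_ hv⟩
  have : {u | u ∈ S ∧ (⨆ i, F i).Adj v u} = ((H.neighborFinset v).image Subtype.val : Finset W) := by
    ext u
    simp only [Set.mem_ofPred_eq, Finset.coe_image, Set.mem_image, Finset.mem_coe,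
      mem_neighborFinset, hadj]
    constructor
    · rintro ⟨h1, h2⟩; exact ⟨⟨u, h1⟩, h2, rfl⟩
    · rintro ⟨x, h1, rfl⟩; exact ⟨x.2, h1⟩
  rw [this, Set.ncard_coe_finset]
  exact Finset.card_image_le

/-- A graph is acyclic if in some order every vertex has at most one neighbour that follows it:
the first vertex of a cycle would have two. -/
theorem SimpleGraph.isAcyclic_of_injective {W : Type*} {F : SimpleGraph W} {key : W → ℕ}
    (hkey : Function.Injective key) (hF : ∀ v a b, F.Adj v a → F.Adj v b → key v < key a →
      key v < key b → a = b) : F.IsAcyclic := by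
  classical
  intro u c hc
  obtain ⟨x, hx', hmin'⟩ := c.support.toFinset.exists_min_image key ⟨u, by simp⟩
  have hx : x ∈ c.support := by simpa using hx'
  have hmin : ∀ y ∈ c.support, key x ≤ key y := fun y hy => hmin' y (by simpa using hy)
  have hc' := hc.rotate hx
  have hmem : ∀ y ∈ (c.rotate x hx).support, key x ≤ key y := by
    intro y hy
    exact hmin y (by simpa using hy)
  have hlt : ∀ y, F.Adj x y → y ∈ (c.rotate x hx).support → key x < key y := fun y hxy hy =>
    lt_of_le_of_ne (hmem y hy) fun h => hxy.ne (hkey h)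
  have h1 := (c.rotate x hx).adj_snd hc'.not_nil
  have h2 := ((c.rotate x hx).adj_penultimate hc'.not_nil).symm
  exact hc'.snd_ne_penultimate (hF x _ _ h1 h2 (hlt _ h1 (Walk.getVert_mem_support _ _))
    (hlt _ h2 (Walk.getVert_mem_support _ _)))

/-- If the vertices can be ordered so that each has at most `D` neighbours that follow it, then the
edges can be partitioned into `D` forests, each with at most one edge from any vertex to the
following ones. -/
theorem exists_forests {W : Type*} [Fintype W] (G : SimpleGraph W) {key : W → ℕ} {D : ℕ}
    (hkey : Function.Injective key) (hD : ∀ v, {u | G.Adj v u ∧ key v < key u}.ncard ≤ D) :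
    ∃ F : Fin D → SimpleGraph W, (∀ i, (F i).IsAcyclic) ∧
      Pairwise (fun i i' => Disjoint (F i) (F i')) ∧ ⨆ i, F i = G := by
  classical
  let out : W → Finset W := fun v => Finset.univ.filter fun u => G.Adj v u ∧ key v < key u
  have hout : ∀ v u, u ∈ out v ↔ G.Adj v u ∧ key v < key u := fun v u => by simp [out]
  let idx : W → W → ℕ := fun v u => ((out v).filter fun x => key x < key u).card
  have hidx : ∀ v u, u ∈ out v → idx v u < D := by
    intro v u hu
    have : (out v).card ≤ D := by
      have := hD v
      rwa [show {u | G.Adj v u ∧ key v < key u} = (out v : Set W) by ext; simp [out],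
        Set.ncard_coe_finset] at this
    refine lt_of_lt_of_le (Finset.card_lt_card ?_) this
    refine ⟨Finset.filter_subset _ _, fun h => ?_⟩
    have := h hu
    simp at this
  have hinj : ∀ v, ∀ a ∈ out v, ∀ b ∈ out v, key a < key b → idx v a < idx v b := by
    intro v a ha b hb hab
    refine Finset.card_lt_card ⟨fun x hx => ?_, fun h => ?_⟩
    · rw [Finset.mem_filter] at hx ⊢
      exact ⟨hx.1, hx.2.trans hab⟩
    · have := h (Finset.mem_filter.mpr ⟨ha, hab⟩)
      simp at this
  let F : Fin D → SimpleGraph W := fun i =>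
    { Adj := fun a b => (b ∈ out a ∧ idx a b = i) ∨ (a ∈ out b ∧ idx b a = i)
      symm := ⟨fun a b h => h.symm⟩
      loopless := ⟨fun a h => by
        have h' : a ∈ out a := h.elim And.left And.left
        exact lt_irrefl _ ((hout a a).mp h').2⟩ }
  have hFa : ∀ i a b, (F i).Adj a b → key a < key b → b ∈ out a ∧ idx a b = i := by
    intro i a b h hlt
    rcases h with h | h
    · exact h
    · exact absurd ((hout _ _).mp h.1).2 (by omega)
  refine ⟨F, fun i => isAcyclic_of_injective hkey fun v a b ha hb hva hvb => ?_, fun i i' hii => ?_,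
    ?_⟩
  · obtain ⟨a1, a2⟩ := hFa i v a ha hva
    obtain ⟨b1, b2⟩ := hFa i v b hb hvb
    rcases lt_trichotomy (key a) (key b) with h | h | h
    · have := hinj v a a1 b b1 h; omega
    · exact hkey h
    · have := hinj v b b1 a a1 h; omega
  · change Disjoint (F i) (F i')
    rw [disjoint_iff]
    ext a b
    simp only [inf_adj, bot_adj, iff_false, not_and]
    intro h1 h2
    have hne : key a ≠ key b := fun h => h1.ne (hkey h)
    rcases lt_or_gt_of_ne hne with h | h
    · exact hii (Fin.ext ((hFa i a b h1 h).2.symm.trans (hFa i' a b h2 h).2))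
    · exact hii (Fin.ext ((hFa i b a h1.symm h).2.symm.trans (hFa i' b a h2.symm h).2))
  · ext a b
    rw [iSup_adj]
    constructor
    · rintro ⟨i, h | h⟩
      exacts [((hout _ _).mp h.1).1, ((hout _ _).mp h.1).1.symm]
    · intro h
      rcases lt_or_gt_of_ne (fun h' => h.ne (hkey h') : key a ≠ key b) with hlt | hlt
      · have := (hout a b).mpr ⟨h, hlt⟩
        exact ⟨⟨_, hidx _ _ this⟩, .inl ⟨this, rfl⟩⟩
      · have := (hout b a).mpr ⟨h.symm, hlt⟩
        exact ⟨⟨_, hidx _ _ this⟩, .inr ⟨this, rfl⟩⟩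

/-- Ordered by degree, a graph with `m` edges has at most `√(2 m)` edges from a vertex to the
following ones, because the endpoints of these edges have at least the degree of that vertex. -/
theorem exists_forests_sq_le {n : ℕ} (G : SimpleGraph (Fin n)) :
    ∃ D : ℕ, D ^ 2 ≤ 2 * numEdges G ∧ ∃ F : Fin D → SimpleGraph (Fin n), (∀ i, (F i).IsAcyclic) ∧
      Pairwise (fun i i' => Disjoint (F i) (F i')) ∧ ⨆ i, F i = G := by
  classical
  let key : Fin n → ℕ := fun v => G.degree v * n + v
  have hkeylt : ∀ v u, key v < key u → G.degree v ≤ G.degree u := by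
    intro v u h
    by_contra! hlt
    have h1 : (G.degree u + 1) * n ≤ G.degree v * n := Nat.mul_le_mul_right _ hlt
    have := u.2
    simp only [key] at h
    rw [add_mul] at h1
    omega
  have hkey : Function.Injective key := fun u v h => by
    have h2 := (WordRAM.mul_add_eq_iff u.2 v.2).mp h
    exact Fin.ext h2.2
  let out : Fin n → Finset (Fin n) := fun v => Finset.univ.filter fun u => G.Adj v u ∧ key v < key u
  have hsq : ∀ v, (out v).card ^ 2 ≤ 2 * numEdges G := by
    intro v
    have h1 : (out v).card ≤ G.degree v := by
      rw [← card_neighborFinset_eq_degree]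
      refine Finset.card_le_card fun u hu => ?_
      simpa using (Finset.mem_filter.mp hu).2.1
    calc (out v).card ^ 2 = ∑ _u ∈ out v, (out v).card := by simp [sq]
      _ ≤ ∑ u ∈ out v, G.degree u := Finset.sum_le_sum fun u hu =>
          h1.trans (hkeylt v u (Finset.mem_filter.mp hu).2.2)
      _ ≤ ∑ u, G.degree u := Finset.sum_le_sum_of_subset (Finset.subset_univ _)
      _ = 2 * numEdges G := by
          rw [G.sum_degrees_eq_twice_card_edges, numEdges, ← coe_edgeFinset, Set.ncard_coe_finset]
  rcases isEmpty_or_nonempty (Fin n) with hn | hn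
  · refine ⟨0, by simp, fun _ => ⊥, fun i => i.elim0, fun i => i.elim0, ?_⟩
    ext a
    exact (hn.false a).elim
  · obtain ⟨v, hv⟩ := Finite.exists_max fun v => (out v).card
    refine ⟨(out v).card, hsq v, exists_forests G hkey fun u => ?_⟩
    rw [show {x | G.Adj u x ∧ key u < key x} = (out u : Set (Fin n)) by ext; simp [out],
      Set.ncard_coe_finset]
    exact hv u

theorem arboricity_spec {n : ℕ} (G : SimpleGraph (Fin n)) :
    ∃ F : Fin (arboricity G) → SimpleGraph (Fin n), (∀ i, (F i).IsAcyclic) ∧ ⨆ i, F i = G := by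
  obtain ⟨D, -, h⟩ := exists_forests_sq_le G
  obtain ⟨F, h1, -, h2⟩ := Nat.sInf_mem (s := {k : ℕ | ∃ F : Fin k → SimpleGraph (Fin n),
    (∀ i, (F i).IsAcyclic) ∧ Pairwise (fun i i' => Disjoint (F i) (F i')) ∧ ⨆ i, F i = G}) ⟨D, h⟩
  exact ⟨F, h1, h2⟩

theorem arboricity_sq_le {n : ℕ} (G : SimpleGraph (Fin n)) :
    arboricity G ^ 2 ≤ 2 * numEdges G := by
  obtain ⟨D, hD, h⟩ := exists_forests_sq_le G
  have : arboricity G ≤ D := Nat.sInf_le h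
  exact (Nat.pow_le_pow_left this 2).trans hD

theorem one_le_arboricity {n : ℕ} {G : SimpleGraph (Fin n)} (hm : 1 ≤ numEdges G) :
    1 ≤ arboricity G := by
  by_contra! h
  obtain ⟨F, -, hF⟩ := arboricity_spec G
  have h0 : arboricity G = 0 := by omega
  have : G = ⊥ := by
    rw [← hF]
    ext a b
    simp only [iSup_adj, bot_adj, iff_false, not_exists]
    intro i
    exact absurd i.2 (by omega)
  rw [this] at hm
  simp [numEdges] at hm

end Arboricity

/-! ### Lists of edges and cliques -/

namespace WordRAM
open SimpleGraph

/-- The list of edges as pairs of numbers. -/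
def natEdges {n : ℕ} (L : List (Fin n × Fin n)) : List (ℕ × ℕ) :=
  L.map fun e => ((e.1 : ℕ), (e.2 : ℕ))

variable {n : ℕ} {G : SimpleGraph (Fin n)} {L : List (Fin n × Fin n)}

theorem natEdges_lt : ∀ e ∈ natEdges L, e.1 < n ∧ e.2 < n := by
  intro e he
  obtain ⟨x, -, rfl⟩ := List.mem_map.mp he
  exact ⟨x.1.2, x.2.2⟩

theorem mk_mem_natEdges {u v : Fin n} : ((u : ℕ), (v : ℕ)) ∈ natEdges L ↔ (u, v) ∈ L := by
  simp only [natEdges, List.mem_map, Prod.mk.injEq, Prod.exists]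
  constructor
  · rintro ⟨a, b, h, h1, h2⟩
    rwa [← Fin.ext h1, ← Fin.ext h2]
  · exact fun h => ⟨u, v, h, rfl, rfl⟩

namespace IsEdgeList

theorem adj_iff (hL : IsEdgeList G L) {u v : Fin n} : G.Adj u v ↔ (u, v) ∈ L ∨ (v, u) ∈ L := by
  rw [← mem_edgeSet, ← hL.2, List.mem_map]
  constructor
  · rintro ⟨⟨a, b⟩, h, hab⟩
    rcases Sym2.eq_iff.mp hab with ⟨rfl, rfl⟩ | ⟨rfl, rfl⟩
    exacts [.inl h, .inr h]
  · rintro (h | h)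
    exacts [⟨_, h, rfl⟩, ⟨_, h, Sym2.eq_swap⟩]

theorem adj_iff_nat (hL : IsEdgeList G L) {u v : Fin n} :
    G.Adj u v ↔ ((u : ℕ), (v : ℕ)) ∈ natEdges L ∨ ((v : ℕ), (u : ℕ)) ∈ natEdges L := by
  rw [hL.adj_iff, mk_mem_natEdges, mk_mem_natEdges]

theorem length_eq (hL : IsEdgeList G L) : L.length = numEdges G := by
  classical
  have h : G.edgeSet = ((L.map fun e => s(e.1, e.2)).toFinset : Set (Sym2 (Fin n))) := by
    ext e
    rw [← hL.2]
    simp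
  rw [numEdges, h, Set.ncard_coe_finset, List.toFinset_card_of_nodup hL.1, List.length_map]

theorem simpleEdges (hL : IsEdgeList G L) : SimpleEdges (natEdges L) where
  nodup := by
    refine List.Nodup.map (fun a b h => ?_) (List.Nodup.of_map _ hL.1)
    simp only [Prod.mk.injEq] at h
    exact Prod.ext (Fin.ext h.1) (Fin.ext h.2)
  swap u v h1 h2 := by
    obtain ⟨hu, hv⟩ := natEdges_lt _ h1
    have h1' : (⟨u, hu⟩, ⟨v, hv⟩) ∈ L := mk_mem_natEdges.mp h1
    have h2' : (⟨v, hv⟩, ⟨u, hu⟩) ∈ L := mk_mem_natEdges.mp h2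
    have heq := List.inj_on_of_nodup_map hL.1 h1' h2' Sym2.eq_swap
    have hadj := hL.adj_iff.mpr (.inl h1')
    simp only [Prod.mk.injEq] at heq
    exact hadj.ne heq.1

/-- As long as vertices are left, one of them has at most `2 α` remaining neighbours. -/
theorem exists_remDeg_le (hL : IsEdgeList G L) {V : List ℕ}
    (hV : ∀ v, v ∈ V ↔ ∃ e ∈ natEdges L, Touches e v) {pos : ℕ → ℕ} (h0 : ∃ v ∈ V, pos v = 0) :
    ∃ v ∈ V, pos v = 0 ∧ remDeg (natEdges L) pos v ≤ 2 * arboricity G := by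
  classical
  have hVn : ∀ v ∈ V, v < n := by
    intro v hv
    obtain ⟨e, he, h⟩ := (hV v).mp hv
    have := natEdges_lt e he
    rcases h with rfl | rfl
    exacts [this.1, this.2]
  let S : Finset (Fin n) := Finset.univ.filter fun v => (v : ℕ) ∈ V ∧ pos v = 0
  obtain ⟨v₀, hv₀, hp₀⟩ := h0
  obtain ⟨F, hF, hFG⟩ := arboricity_spec G
  obtain ⟨v, hv, hle⟩ := exists_degree_induce_le hF (S := S)
    ⟨⟨v₀, hVn _ hv₀⟩, by simp [S, hv₀, hp₀]⟩
  rw [hFG] at hle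
  have hvS : (v : ℕ) ∈ V ∧ pos v = 0 := by simpa [S] using hv
  refine ⟨v, hvS.1, hvS.2, le_trans ?_ hle⟩
  let T : Finset (Fin n) := Finset.univ.filter fun u => u ∈ S ∧ G.Adj v u
  have hT : {u | u ∈ S ∧ G.Adj v u} = (T : Set (Fin n)) := by ext; simp [T]
  rw [hT, Set.ncard_coe_finset]
  -- map an edge at `v` to its other endpoint
  let other : ℕ × ℕ → ℕ := fun e => if e.1 = v then e.2 else e.1
  set l := (natEdges L).filter fun e => pos e.1 = 0 ∧ pos e.2 = 0 ∧ Touches e v with hl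
  have hlmem : ∀ e ∈ l, e ∈ natEdges L ∧ pos e.1 = 0 ∧ pos e.2 = 0 ∧ Touches e v := by
    intro e he
    rw [hl, List.mem_filter] at he
    exact ⟨he.1, by simpa using he.2⟩
  have hs := hL.simpleEdges
  have hnd : (l.map other).Nodup := by
    refine List.Nodup.map_on (fun x hx y hy hxy => ?_) (hs.nodup.filter _)
    obtain ⟨hx1, -, -, hx2⟩ := hlmem x hx
    obtain ⟨hy1, -, -, hy2⟩ := hlmem y hy
    have hxne := hs.ne hx1
    have hyne := hs.ne hy1
    obtain ⟨a, b⟩ := x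
    obtain ⟨a', b'⟩ := y
    have hsw := hs.swap _ _ hx1
    simp only [other, Touches] at *
    split_ifs at hxy with h1 h2 h2
    · rw [h1, h2, hxy]
    · exfalso
      apply hsw
      rw [hxy, h1, ← hy2.resolve_left h2]; exact hy1
    · exfalso
      apply hsw
      rw [hxy, hx2.resolve_left h1, ← h2]; exact hy1
    · rw [hxy, hx2.resolve_left h1, hy2.resolve_left h2]
  have hsub : ∀ u ∈ l.map other, u ∈ (T.image Fin.val).toList := by
    intro u hu
    obtain ⟨e, he, rfl⟩ := List.mem_map.mp hu
    obtain ⟨h1, h2, h3, h4⟩ := hlmem e he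
    obtain ⟨a, b⟩ := e
    obtain ⟨ha, hb⟩ := natEdges_lt _ h1
    have haV : a ∈ V := (hV a).mpr ⟨_, h1, .inl rfl⟩
    have hbV : b ∈ V := (hV b).mpr ⟨_, h1, .inr rfl⟩
    simp only [other, Finset.mem_toList, Finset.mem_image]
    simp only [Touches] at h4
    split_ifs with hav
    · refine ⟨⟨b, hb⟩, ?_, rfl⟩
      simp only [T, S, Finset.mem_filter, Finset.mem_univ, true_and]
      refine ⟨⟨hbV, h3⟩, hL.adj_iff_nat.mpr (.inl ?_)⟩
      rw [← hav]; exact h1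
    · refine ⟨⟨a, ha⟩, ?_, rfl⟩
      simp only [T, S, Finset.mem_filter, Finset.mem_univ, true_and]
      refine ⟨⟨haV, h2⟩, hL.adj_iff_nat.mpr (.inr ?_)⟩
      rw [← h4.resolve_left hav]; exact h1
  have := (hnd.subperm hsub).length_le
  rw [List.length_map, Finset.length_toList] at this
  rw [remDeg, List.countP_eq_length_filter]
  exact this.trans Finset.card_image_le

/-- The cliques with `ℓ ≥ 2` vertices are the chains of length `ℓ`. -/
theorem ncard_cliques (hL : IsEdgeList G L) {V : List ℕ} {d : ℕ} {pos : ℕ → ℕ}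
    (h : DegenerateOrder (natEdges L) V d pos) {ℓ : ℕ} (hℓ : 2 ≤ ℓ) :
    {K : Finset (Fin n) | G.IsNClique ℓ K}.ncard =
      (chains (orientation (natEdges L) pos) V ℓ).length := by
  classical
  set E := orientation (natEdges L) pos with hE
  have hadj : ∀ {u v : Fin n}, E u v = true → G.Adj u v := by
    intro u v huv
    simp only [hE, orientation, Bool.and_eq_true, Bool.or_eq_true, decide_eq_true_eq] at huv
    exact hL.adj_iff_nat.mpr huv.2
  have hEadj : ∀ {u v : Fin n}, G.Adj u v → pos u < pos v → E u v = true := by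
    intro u v huv hp
    simp only [hE, orientation, Bool.and_eq_true, Bool.or_eq_true, decide_eq_true_eq]
    exact ⟨hp, hL.adj_iff_nat.mp huv⟩
  have hVn : ∀ v ∈ V, v < n := by
    intro v hv
    obtain ⟨e, he, h⟩ := (h.mem v).mp hv
    have := natEdges_lt e he
    rcases h with rfl | rfl
    exacts [this.1, this.2]
  let f : List ℕ → Finset (Fin n) := fun l => Finset.univ.filter fun v => (v : ℕ) ∈ l
  have hf : ∀ l v, v ∈ f l ↔ (v : ℕ) ∈ l := fun l v => by simp [f]
  have hnodup : ∀ l ∈ chains E V ℓ, l.Nodup := fun l hl =>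
    (mem_chains.mp hl).2.2.imp fun {u v} huv => by
      have := DegenerateOrder.pos_lt huv
      rintro rfl
      exact lt_irrefl _ this
  have hcard : ∀ l ∈ chains E V ℓ, (f l).card = ℓ := by
    intro l hl
    obtain ⟨h1, h2, -⟩ := mem_chains.mp hl
    rw [← h1, ← List.toFinset_card_of_nodup (hnodup l hl)]
    rw [← Finset.card_image_of_injective (f l) Fin.val_injective]
    congr 1
    ext u
    simp only [Finset.mem_image, hf, List.mem_toFinset]
    constructor
    · rintro ⟨v, hv, rfl⟩; exact hv
    · exact fun hu => ⟨⟨u, hVn u (h2 u hu)⟩, hu, rfl⟩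
  have himage : {K : Finset (Fin n) | G.IsNClique ℓ K} = f '' {l | l ∈ chains E V ℓ} := by
    ext K
    simp only [Set.mem_ofPred_eq, Set.mem_image]
    constructor
    · intro hK
      -- sort the clique by positions
      set l₀ := (K.image Fin.val).toList with hl₀
      have hm₀ : ∀ u, u ∈ l₀ ↔ ∃ v ∈ K, (v : ℕ) = u := fun u => by simp [hl₀]
      set l := l₀.insertionSort (fun u v => pos u ≤ pos v) with hl
      have hperm : l.Perm l₀ := List.perm_insertionSort _ _
      have hm : ∀ u, u ∈ l ↔ ∃ v ∈ K, (v : ℕ) = u := fun u => by rw [hperm.mem_iff, hm₀]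
      have hKV : ∀ v ∈ K, (v : ℕ) ∈ V := by
        intro v hv
        obtain ⟨u, hu, hne⟩ := Finset.exists_mem_ne (by rw [hK.2]; omega : 1 < K.card) v
        rcases hL.adj_iff_nat.mp (hK.1 hv hu hne.symm) with h' | h'
        · exact (h.mem _).mpr ⟨_, h', .inl rfl⟩
        · exact (h.mem _).mpr ⟨_, h', .inr rfl⟩
      have hsorted : l.Pairwise (fun u v => pos u ≤ pos v) := by
        have : Std.Total (fun u v : ℕ => pos u ≤ pos v) := ⟨fun u v => le_total _ _⟩
        have : IsTrans ℕ (fun u v : ℕ => pos u ≤ pos v) := ⟨fun u v x h1 h2 => h1.trans h2⟩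
        exact List.pairwise_insertionSort _ _
      have hnd : l.Nodup := hperm.nodup_iff.mpr (Finset.nodup_toList _)
      refine ⟨l, mem_chains.mpr ⟨?_, ?_, ?_⟩, ?_⟩
      · rw [hperm.length_eq, hl₀, Finset.length_toList,
          Finset.card_image_of_injective _ Fin.val_injective, hK.2]
      · intro u hu
        obtain ⟨v, hv, rfl⟩ := (hm u).mp hu
        exact hKV v hv
      · refine List.Pairwise.imp_of_mem (fun {u v} hu hv huv => ?_) (hsorted.and hnd)
        obtain ⟨a, ha, rfl⟩ := (hm u).mp hu
        obtain ⟨b, hb, rfl⟩ := (hm v).mp hv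
        refine hEadj (hK.1 ha hb fun hab => huv.2 (by rw [hab])) (lt_of_le_of_ne huv.1 fun hp => ?_)
        exact huv.2 (h.inj _ (hKV a ha) _ (hKV b hb) hp)
      · ext v
        rw [hf, hm]
        constructor
        · rintro ⟨u, hu, huv⟩; rwa [← Fin.ext huv]
        · exact fun hv => ⟨v, hv, rfl⟩
    · rintro ⟨l, hl, rfl⟩
      refine ⟨fun u hu v hv huv => ?_, hcard l hl⟩
      rw [Finset.mem_coe, hf] at hu hv
      have hpw : l.Pairwise fun u v => E u v = true := (mem_chains.mp hl).2.2
      have : (E u v = true) ∨ (E v u = true) := by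
        obtain ⟨x, hx, hxu⟩ := List.getElem_of_mem hu
        obtain ⟨y, hy, hyv⟩ := List.getElem_of_mem hv
        rw [List.pairwise_iff_getElem] at hpw
        rcases lt_trichotomy x y with hlt | rfl | hlt
        · exact .inl (by rw [← hxu, ← hyv]; exact hpw _ _ hx hy hlt)
        · exact absurd (Fin.ext (hxu.symm.trans hyv)) huv
        · exact .inr (by rw [← hxu, ← hyv]; exact hpw _ _ hy hx hlt)
      rcases this with h | h
      exacts [hadj h, (hadj h).symm]
  have hinj : Set.InjOn f {l | l ∈ chains E V ℓ} := by
    intro l hl l' hl' hll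
    have hp := (mem_chains.mp hl).2.2
    have hp' := (mem_chains.mp hl').2.2
    have hperm : l.Perm l' := by
      refine (List.perm_ext_iff_of_nodup (hnodup l hl) (hnodup l' hl')).mpr fun u => ?_
      constructor
      · intro hu
        have := (hf l ⟨u, hVn u ((mem_chains.mp hl).2.1 u hu)⟩).mpr hu
        rw [hll] at this
        exact (hf _ _).mp this
      · intro hu
        have := (hf l' ⟨u, hVn u ((mem_chains.mp hl').2.1 u hu)⟩).mpr hu
        rw [← hll] at this
        exact (hf _ _).mp this
    refine hperm.eq_of_pairwise (fun a b _ _ hab hba => ?_) hp hp'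
    have := DegenerateOrder.pos_lt hab
    have := DegenerateOrder.pos_lt hba
    omega
  rw [himage, hinj.ncard_image]
  have : {l | l ∈ chains E V ℓ} = ((chains E V ℓ).toFinset : Set (List ℕ)) := by ext; simp
  rw [this, Set.ncard_coe_finset, List.toFinset_card_of_nodup (nodup_chains h.nodup ℓ)]

end IsEdgeList
end WordRAM

/-! ### The program -/

namespace WordRAM
open WordRAM.Expr (const reg load)
variable {w : ℕ}

theorem two_pow_clog_le (N : ℕ) : 2 ^ Nat.clog 2 N ≤ 2 * N + 1 := by
  rcases Nat.lt_or_ge 1 N with h | h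
  · have h1 := Nat.pow_pred_clog_lt_self one_lt_two h
    have h2 := Nat.clog_pos one_lt_two h
    obtain ⟨k, hk⟩ := Nat.exists_eq_add_one.mpr h2
    rw [hk] at h1 ⊢
    simp only [Nat.pred_succ] at h1
    rw [pow_succ]
    omega
  · rw [Nat.clog_of_right_le_one h]
    simp

theorem pow_clog_le {b n N M : ℕ} (hn : 1 < n) (hNM : N ≤ M) :
    b ^ Nat.clog n N ≤ (2 * M + 1) ^ b := by
  rcases Nat.eq_zero_or_pos b with rfl | hb
  · simpa using pow_le_one₀ (n := Nat.clog n N) le_rfl (zero_le_one (α := ℕ))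
  calc b ^ Nat.clog n N ≤ b ^ Nat.clog 2 M :=
        Nat.pow_le_pow_right hb ((Nat.clog_mono_right n hNM).trans (Nat.clog_anti_left one_lt_two hn))
    _ ≤ (2 ^ b) ^ Nat.clog 2 M := Nat.pow_le_pow_left Nat.lt_two_pow_self.le _
    _ = (2 ^ Nat.clog 2 M) ^ b := by rw [← pow_mul, ← pow_mul, mul_comm]
    _ ≤ (2 * M + 1) ^ b := Nat.pow_le_pow_left (two_pow_clog_le M) b

namespace BilinearAlg
variable (a : BilinearAlg)

theorem processTime_mono {j B N M : ℕ} (h : N ≤ M) : a.processTime j B N ≤ a.processTime j B M := by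
  have h1 := Nat.clog_mono_right a.n h
  have hR : 0 < a.R := lt_of_lt_of_le (by have := a.one_lt_n; positivity) a.sq_le_R
  exact Nat.mul_le_mul_left _ (Nat.add_le_add_left
    (Nat.mul_le_mul (Nat.succ_le_succ h1) (Nat.pow_le_pow_right hR h1)) _)

/-- List the vertices, orient the edges, and search for cliques.

The arrays are used as follows: `0` and `1` hold the edges, `2` the clique, `3` marks for the
vertices listed in `4`, `5` their positions and `6` their degrees, `7` the matrix of the orientation,
`8` the candidates, `9` and `10` lists of chains, `11` the table of `spread`, `12` to `14` the matrix
of compatible chains and the copies of it that `product` overwrites, `15` the product, and `16`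
scratch space. Register `2` holds the count. -/
def findCliques (r j : ℕ) : Cmd := listVertices ;; peel ;; orient ;; a.search r j

/-- Words of `w` bits are long enough if `(n + 2) ^ wordExp ≤ 2 ^ w`. -/
def wordExp (j : ℕ) : ℕ := (3 * j + 6) * (a.R + a.D + a.n) + (4 * j + 20)

/-- `findCliques` counts the cliques with `3 j + r` vertices and exhibits one of them. Its time is
dominated by the calls of `process`, which are controlled by `chainBound`. -/
theorem WP_findCliques {n r j : ℕ} {G : SimpleGraph (Fin n)} {L : List (Fin n × Fin n)}
    (hr : r ≤ 2) (hj : 2 ≤ j) (hL : IsEdgeList G L) (hw : (n + 2) ^ a.wordExp j ≤ 2 ^ w) :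
    WP w (a.findCliques r j) (inputState n L) 0 fun s t =>
      s.reg 2 = {K : Finset (Fin n) | G.IsNClique (3 * j + r) K}.ncard ∧ s.reg 2 < 2 ^ w ∧
      (s.reg 2 ≠ 0 → ∃ v : Fin (3 * j + r) → Fin n, (∀ i : Fin (3 * j + r), s.arr 2 i = v i) ∧
        ∀ i i' : Fin (3 * j + r), i ≠ i' → G.Adj (v i) (v i')) ∧
      ∃ V pos, DegenerateOrder (natEdges L) V (2 * arboricity G) pos ∧
        t ≤ ((prefixes r (natEdges L) V).map fun p => a.processTime j
          (DegenerateOrder.chainBound r j (2 * arboricity G) (natEdges L) V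
            (orientation (natEdges L) pos) p)
          (DegenerateOrder.chainBound r j (2 * arboricity G) (natEdges L) V
            (orientation (natEdges L) pos) p)).sum + 1000 * (numEdges G ^ 2 + 1) := by
  set es := natEdges L with hes_def
  set d := 2 * arboricity G with hd_def
  set m := numEdges G with hm_def
  have hlen : es.length = m := by rw [hes_def, natEdges, List.length_map, hL.length_eq]
  have hs : SimpleEdges es := hL.simpleEdges
  -- the sizes of all numbers that occur
  set X := n + 2 with hX
  have hX2 : 2 ≤ X := by omega
  have hmn : m ≤ n * n := by
    rw [hm_def, ← hL.length_eq]
    have := (List.Nodup.of_map _ hL.1).length_le_card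
    simpa using this
  have hdX : d ≤ X ^ 3 := by
    have h1 := arboricity_sq_le G
    rw [← hm_def] at h1
    have h2 : arboricity G ≤ 2 * n := by
      by_contra! h
      nlinarith
    have h3 : 4 ≤ X ^ 2 := by nlinarith
    calc d ≤ 4 * n := by omega
      _ ≤ X ^ 2 * X := Nat.mul_le_mul h3 (by omega)
      _ = X ^ 3 := by ring
  have hpow : ∀ e, e < a.wordExp j → X ^ e < 2 ^ w := fun e he =>
    (Nat.pow_lt_pow_right (by omega) he).trans_le hw
  have hmul : ∀ b, b ≤ a.R + a.D + a.n → (3 * j + 6) * b < a.wordExp j := by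
    intro b hb
    have := Nat.mul_le_mul_left (3 * j + 6) hb
    simp only [wordExp]
    omega
  have hsmall : ∀ e, e ≤ 4 * j + 19 → X ^ e < 2 ^ w := fun e he => hpow e (by
    simp only [wordExp]; omega)
  have hself : ∀ b, b < X ^ b := fun b => Nat.lt_pow_self (by omega)
  have hself' : ∀ b, b ≤ a.R + a.D + a.n → b < 2 ^ w := by
    intro b hb
    have h1 : X ^ b ≤ X ^ ((3 * j + 6) * b) :=
      Nat.pow_le_pow_right (by omega) (Nat.le_mul_of_pos_left _ (by omega))
    have := hself b
    have := hpow _ (hmul b hb)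
    omega
  have hw1 : X ^ 1 < 2 ^ w := hsmall 1 (by omega)
  have hw2 : X ^ 2 < 2 ^ w := hsmall 2 (by omega)
  have hX2n : n * n + n + 2 ≤ X ^ 2 := by nlinarith
  rw [pow_one] at hw1
  have hB : ∀ V, V.length ≤ n → ∀ E p,
      DegenerateOrder.chainBound r j d es V E p + 1 ≤ X ^ (3 * j + 5) := by
    intro V hV E p
    have hdp : ∀ i ≤ j, d ^ i ≤ X ^ (3 * j) := fun i hi =>
      (Nat.pow_le_pow_left hdX i).trans
        (by rw [← pow_mul]; exact Nat.pow_le_pow_right (by omega) (by omega))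
    have hone : 1 ≤ X ^ (3 * j) := Nat.one_le_pow _ _ (by omega)
    have hgoal : X ^ 3 * X ^ (3 * j) + 2 ≤ X ^ (3 * j + 5) := by
      have e : X ^ (3 * j + 5) = X ^ 5 * X ^ (3 * j) := by rw [← pow_add]; congr 1; omega
      have h5 : X ^ 3 + 2 ≤ X ^ 5 := by
        have h4 : 4 ≤ X ^ 2 := by nlinarith
        have : X ^ 3 * 4 ≤ X ^ 3 * X ^ 2 := Nat.mul_le_mul_left _ h4
        rw [show X ^ 3 * X ^ 2 = X ^ 5 by rw [← pow_add]] at this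
        have h3 : 1 ≤ X ^ 3 := Nat.one_le_pow _ _ (by omega)
        omega
      rw [e]
      have := Nat.mul_le_mul_right (X ^ (3 * j)) h5
      rw [add_mul] at this
      omega
    have h3 : X ≤ X ^ 3 := Nat.le_self_pow (by norm_num) _
    refine le_trans ?_ hgoal
    simp only [DegenerateOrder.chainBound]
    split_ifs
    · have : 2 * es.length ≤ X ^ 3 := by
        rw [hlen]
        calc 2 * m ≤ X * X ^ 2 := Nat.mul_le_mul hX2 (by omega)
          _ = X ^ 3 := by ring
      have := Nat.mul_le_mul this (hdp (j - 2) (by omega))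
      omega
    · have h1 : (V.filter (E p.1)).length ≤ X ^ 3 :=
        (List.length_filter_le _ _).trans (by omega)
      have := Nat.mul_le_mul h1 (hdp (j - 1) (by omega))
      omega
    · have := Nat.mul_le_mul (show 1 ≤ X ^ 3 by omega) (hdp j le_rfl)
      omega
  have hBclog : ∀ V, V.length ≤ n → ∀ E p N b, N ≤ DegenerateOrder.chainBound r j d es V E p →
      b ^ Nat.clog a.n N ≤ X ^ ((3 * j + 6) * b) := by
    intro V hV E p N b hN
    refine (pow_clog_le a.one_lt_n hN).trans ?_
    rw [pow_mul, show 3 * j + 6 = 3 * j + 5 + 1 by omega]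
    refine Nat.pow_le_pow_left ?_ b
    have := hB V hV E p
    have := Nat.mul_le_mul_left (X ^ (3 * j + 5)) hX2
    rw [← pow_succ] at this
    omega
  -- run the program
  have hes : HasEdges es (inputState n L) := by
    refine ⟨by simp [inputState, hes_def, natEdges], fun i hi => ?_, fun i hi => ?_⟩ <;>
    · have : i < L.length := by simpa [hes_def, natEdges] using hi
      simp [inputState, hes_def, natEdges, this]
  have harr : ∀ x, 2 ≤ x → ∀ y, (inputState n L).arr x y = 0 := by
    intro x hx y
    simp [inputState, show x ≠ 0 by omega, show x ≠ 1 by omega]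
  rw [findCliques, WP_seq]
  refine WP_listVertices hes natEdges_lt (by omega) (by omega) (harr 3 (by simp))
    fun s₁ t₁ hF₁ h₁ ht₁ => ?_
  obtain ⟨V, hV, hVd, hmem⟩ := h₁
  have hVn : ∀ v ∈ V, v < n := by
    intro v hv
    obtain ⟨e, he, h⟩ := (hmem v).mp hv
    have := natEdges_lt e he
    rcases h with rfl | rfl
    exacts [this.1, this.2]
  have hVlen : V.length ≤ n := length_le_of_nodup hVd hVn
  have hes₁ : HasEdges es s₁ := hes.frame (hF₁.reg 1 rfl) (hF₁.arr 0 rfl) (hF₁.arr 1 rfl)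
  rw [WP_seq]
  refine WP_peel (d := d) hes₁ hV hVd hmem (fun e he => hs.ne he)
    (by rw [hF₁.arr 5 rfl]; exact harr 5 (by simp)) (fun pos h0 => hL.exists_remDeg_le hmem h0)
    (by omega) (by nlinarith) fun s₂ t₂ hF₂ h₂ ht₂ => ?_
  obtain ⟨pos, hpos, hpeel⟩ := h₂
  have hdeg := hpeel.degenerateOrder hs hVd hmem
  have hes₂ : HasEdges es s₂ := hes₁.frame (hF₂.reg 1 rfl) (hF₂.arr 0 rfl) (hF₂.arr 1 rfl)
  have hV₂ : HasVerts V s₂ := hV.frame (hF₂.reg 5 rfl) (hF₂.arr 4 rfl)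
  rw [WP_seq]
  refine WP_orient hes₂ natEdges_lt hpos (fun e he => hdeg.pos_ne he)
    ((hF₂.reg 0 rfl).trans ((hF₁.reg 0 rfl).trans rfl))
    (by rw [hF₂.arr 7 rfl, hF₁.arr 7 rfl]; exact harr 7 (by simp)) (by omega) (by omega) (by omega)
    fun s₃ t₃ hF₃ hE ht₃ => ?_
  have hes₃ : HasEdges es s₃ := hes₂.frame (hF₃.reg 1 rfl) (hF₃.arr 0 rfl) (hF₃.arr 1 rfl)
  have hV₃ : HasVerts V s₃ := hV₂.frame (hF₃.reg 5 rfl) (hF₃.arr 4 rfl)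
  have hd1 : es ≠ [] → 1 ≤ d := by
    intro hne
    have : 1 ≤ m := by rw [← hlen]; exact List.length_pos_iff.mpr hne
    have := one_le_arboricity this
    omega
  have hcount := hdeg.searchCount_eq hr j
  set E := orientation es pos with hE_def
  set B := DegenerateOrder.chainBound r j d es V E with hB_def
  have hchain : ∀ p ∈ prefixes r es V, ∀ i ≤ j,
      (chains E (V.filter (follows r E p)) i).length ≤ B p :=
    fun p hp i hi => hdeg.length_chains_le hr hj hd1 hp hi
  have hcountw : searchCount r j es V E < 2 ^ w := by
    rw [hcount]
    refine lt_of_le_of_lt ((length_chains_le_pow _ _ _).trans (Nat.pow_le_pow_left ?_ _))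
      (hsmall (3 * j + r) (by omega))
    omega
  refine a.WP_search (B := B) hr hes₃ natEdges_lt hV₃ hVd hVn hE hchain
    (fun p hp => by
      have := hchain p hp 1 (by omega)
      rwa [length_chains_one] at this)
    (fun p hp => ?_) (by omega) (hself' _ (by omega)) (hself' _ (by omega)) ?_
    (fun p hp => ?_) (fun p hp => ?_) hcountw (by omega) (by omega)
    fun s₄ t₄ hF₄ h4 hwit ht₄ => ?_
  · calc (B p + 1) * j ≤ X ^ (3 * j + 5) * X ^ j :=
          Nat.mul_le_mul (hB V hVlen E p) (hself j).le
      _ = X ^ (4 * j + 5) := by rw [← pow_add]; congr 1; omega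
      _ < 2 ^ w := hsmall _ (by omega)
  · exact (hself _).trans (hsmall _ (by omega))
  · exact (hBclog V hVlen E p _ _ (hchain p hp j le_rfl)).trans_lt (hpow _ (hmul _ (by omega)))
  · refine (Nat.mul_le_mul (hBclog V hVlen E p _ _ (hchain p hp j le_rfl))
      (hBclog V hVlen E p _ _ (hchain p hp j le_rfl))).trans_lt ?_
    rw [← pow_add, ← mul_add]
    exact hpow _ (hmul _ (by omega))
  · rw [hcount, ← hL.ncard_cliques hdeg (by omega : 2 ≤ 3 * j + r)] at h4
    refine ⟨h4, ?_, fun hne => ?_, V, pos, hdeg, ?_⟩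
    · rw [h4, hL.ncard_cliques hdeg (by omega : 2 ≤ 3 * j + r), ← hcount]
      exact hcountw
    · rw [h4, hL.ncard_cliques hdeg (by omega : 2 ≤ 3 * j + r), ← hcount] at hne
      obtain ⟨p, hp, l, hl, k1, k2, k3⟩ := hwit hne
      have key : ∀ x y, x < y → y < 3 * j + r →
          (s₄.arr 2 x, s₄.arr 2 y) ∈ es ∨ (s₄.arr 2 y, s₄.arr 2 x) ∈ es :=
        fun x y hxy hy => DegenerateOrder.adj_of_witness hr hp hl k1 k2 k3 hxy hy
      have key' : ∀ x y, x ≠ y → x < 3 * j + r → y < 3 * j + r →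
          (s₄.arr 2 x, s₄.arr 2 y) ∈ es ∨ (s₄.arr 2 y, s₄.arr 2 x) ∈ es := by
        intro x y hne hx hy
        rcases lt_or_gt_of_ne hne with h | h
        exacts [key x y h hy, (key y x h hx).symm]
      have hlt : ∀ i : Fin (3 * j + r), s₄.arr 2 i < n := by
        intro i
        obtain ⟨y, hy, hyi⟩ : ∃ y < 3 * j + r, (i : ℕ) ≠ y := by
          by_cases h : (i : ℕ) = 0
          · exact ⟨1, by omega, by omega⟩
          · exact ⟨0, by omega, h⟩
        rcases key' i y hyi i.2 hy with h | h
        exacts [(natEdges_lt _ h).1, (natEdges_lt _ h).2]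
      exact ⟨fun i => ⟨s₄.arr 2 i, hlt i⟩, fun i => rfl, fun i i' hii =>
        hL.adj_iff_nat.mpr (key' i i' (fun h => hii (Fin.ext h)) i.2 i'.2)⟩
    · have hV2 : V.length ≤ 2 * m := hlen ▸ hdeg.length_le
      have hP : (prefixes r es V).length ≤ 2 * m + 1 := by
        simp only [prefixes]
        split_ifs
        · simp
        · rw [List.length_map]; omega
        · omega
      have hsum : ((prefixes r es V).map fun p =>
          a.processTime j (B p) (chains E (V.filter (follows r E p)) j).length +
            (V.length * 50 + 50)).sum ≤
          ((prefixes r es V).map fun p => a.processTime j (B p) (B p)).sum +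
            (2 * m + 1) * (100 * m + 50) := by
        rw [List.sum_map_add]
        refine Nat.add_le_add (List.sum_le_sum fun p hp =>
          a.processTime_mono (hchain p hp j le_rfl)) ?_
        rw [List.map_const', List.sum_replicate, smul_eq_mul]
        exact Nat.mul_le_mul hP (by omega)
      have hVt : V.length * (es.length * 80 + V.length * 40 + 60) ≤ 2 * m * (160 * m + 60) :=
        Nat.mul_le_mul hV2 (by omega)
      have hmm : m ≤ m ^ 2 := Nat.le_self_pow two_ne_zero _
      have e1 : 2 * m * (160 * m + 60) = 320 * m ^ 2 + 120 * m := by ring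
      have e2 : (2 * m + 1) * (100 * m + 50) = 200 * m ^ 2 + 200 * m + 50 := by ring
      rw [hlen] at ht₁ ht₂ ht₃
      rw [hlen] at hVt
      change t₄ ≤ ((prefixes r es V).map fun p => a.processTime j (B p) (B p)).sum +
        1000 * (m ^ 2 + 1)
      omega

end BilinearAlg
end WordRAM

/-! ### The running time -/

namespace WordRAM
namespace BilinearAlg
variable (a : BilinearAlg)

/-- If `R < n ^ τ`, then `process` takes time `O(B ^ τ)`, where `B` bounds the number of chains. -/
theorem exists_processTime_le {τ : ℝ} (hτ : 2 ≤ τ) (hR : (a.R : ℝ) < (a.n : ℝ) ^ τ) (j : ℕ) :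
    ∃ C : ℝ, 0 ≤ C ∧ ∀ B : ℕ, 1 ≤ B → (a.processTime j B B : ℝ) ≤ C * (B : ℝ) ^ τ := by
  have hn := a.one_lt_n
  have hn0 : (0 : ℝ) < a.n := by positivity
  set T : ℝ := (a.n : ℝ) ^ τ with hT
  have hT0 : 0 < T := by positivity
  -- the factor `k + 1` is absorbed because `R < n ^ τ`
  obtain ⟨K, hK⟩ := (tendsto_self_mul_const_pow_of_lt_one (r := a.R / T) (by positivity)
    ((div_lt_one hT0).mpr hR)).bddAbove_range
  have hK' : ∀ k : ℕ, (k : ℝ) * (a.R / T) ^ k ≤ K := fun k => hK ⟨k, rfl⟩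
  have hK0 : 0 ≤ K := by simpa using hK' 0
  have hk : ∀ k : ℕ, ((k : ℝ) + 1) * (a.R : ℝ) ^ k ≤ (K + 1) * T ^ k := by
    intro k
    have h1 : (a.R / T) ^ k ≤ 1 := pow_le_one₀ (by positivity) ((div_lt_one hT0).mpr hR).le
    have h2 : ((k : ℝ) + 1) * (a.R / T) ^ k ≤ K + 1 := by linarith [hK' k]
    rw [div_pow, ← mul_div_assoc, div_le_iff₀ (by positivity)] at h2
    exact h2
  refine ⟨a.procConst j * (1 + (K + 1) * T), by positivity, fun B hB => ?_⟩
  have hB1 : (1 : ℝ) ≤ B := by exact_mod_cast hB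
  have hB0 : (0 : ℝ) < B := by linarith
  set k := Nat.clog a.n B with hkdef
  have hnk : a.n ^ k ≤ a.n * B := by
    rcases Nat.lt_or_ge 1 B with h | h
    · have h1 := Nat.pow_pred_clog_lt_self hn h
      obtain ⟨i, hi⟩ := Nat.exists_eq_add_one.mpr (Nat.clog_pos hn h)
      rw [hi, Nat.pred_succ] at h1
      rw [hkdef, hi, pow_succ, mul_comm]
      exact Nat.mul_le_mul_left _ h1.le
    · rw [hkdef, Nat.clog_of_right_le_one h, pow_zero]
      exact Nat.one_le_iff_ne_zero.mpr (by positivity)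
  have hTk : T ^ k ≤ T * (B : ℝ) ^ τ := by
    rw [hT, ← Real.mul_rpow hn0.le hB0.le, ← Real.rpow_natCast, ← Real.rpow_mul hn0.le, mul_comm τ,
      Real.rpow_mul hn0.le, Real.rpow_natCast]
    exact Real.rpow_le_rpow (by positivity) (by exact_mod_cast hnk) (by linarith)
  have hBB : (B : ℝ) * B ≤ (B : ℝ) ^ τ := by
    rw [← sq, ← Real.rpow_two]
    exact Real.rpow_le_rpow_of_exponent_le hB1 hτ
  have hmain : ((k : ℝ) + 1) * (a.R : ℝ) ^ k ≤ (K + 1) * (T * (B : ℝ) ^ τ) :=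
    (hk k).trans (mul_le_mul_of_nonneg_left hTk (by linarith))
  rw [processTime, ← hkdef]
  push_cast
  rw [mul_assoc]
  refine mul_le_mul_of_nonneg_left ?_ (by positivity)
  linarith

end BilinearAlg

open Real

/-- `d = 2 α`, and `α ^ 2 ≤ 2 m`: two factors `d` may be exchanged for a factor `m`. -/
theorem mul_rpow_le_of_sq_le {α m d τ x : ℝ} (hα : 1 ≤ α) (hm : 1 ≤ m) (hsq : α ^ 2 ≤ 2 * m)
    (hd : d = 2 * α) (hτ : 2 ≤ τ) :
    m * d ^ (x + 2 * (τ - 1)) ≤ 8 ^ (τ - 1) * 2 ^ x * (α ^ x * m ^ τ) := by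
  have hd0 : 0 < d := by linarith
  have h1 : d ^ (2 * (τ - 1)) ≤ (8 * m) ^ (τ - 1) := by
    rw [rpow_mul hd0.le, rpow_two]
    refine rpow_le_rpow (by positivity) ?_ (by linarith)
    rw [hd]
    nlinarith
  have h2 : m * m ^ (τ - 1) = m ^ τ := by
    rw [← rpow_one_add' (by linarith) (by linarith)]
    congr 1
    ring
  calc m * d ^ (x + 2 * (τ - 1)) = m * (d ^ x * d ^ (2 * (τ - 1))) := by rw [rpow_add hd0]
    _ ≤ m * (d ^ x * (8 * m) ^ (τ - 1)) := by gcongr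
    _ = 8 ^ (τ - 1) * d ^ x * (m * m ^ (τ - 1)) := by
        rw [mul_rpow (by norm_num) (by linarith)]; ring
    _ = _ := by rw [h2, hd, mul_rpow (by norm_num) (by linarith)]; ring

/-- The sum over all prefixes of the `τ`-th powers of the numbers of chains is within the required
bound. For `r = 1` it is governed by the sum of the `τ`-th powers of the out-degrees: a power is at
most the out-degree times `d ^ (τ - 1)`, and the out-degrees add up to the number of edges. -/
theorem DegenerateOrder.exists_sum_chainBound_le (r j : ℕ) {τ : ℝ} (hr : r ≤ 2) (hj : 2 ≤ j)
    (hτ : 2 ≤ τ) :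
    ∃ C : ℝ, 0 ≤ C ∧ ∀ (es : List (ℕ × ℕ)) (V : List ℕ) (α : ℕ) (pos : ℕ → ℕ),
      DegenerateOrder es V (2 * α) pos → 1 ≤ es.length → 1 ≤ α → α ^ 2 ≤ 2 * es.length →
      (((prefixes r es V).map fun p =>
        ((chainBound r j (2 * α) es V (orientation es pos) p : ℕ) : ℝ) ^ τ).sum ≤
        C * ((α : ℝ) ^ (((j : ℝ) - 2) * τ + r) * (es.length : ℝ) ^ τ)) := by
  have hj2 : (2 : ℝ) ≤ j := by exact_mod_cast hj
  have hj0 : 0 ≤ ((j : ℝ) - 2) * τ := mul_nonneg (by linarith) (by linarith)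
  have hcast : (((j - 2 : ℕ) : ℕ) : ℝ) = (j : ℝ) - 2 := by rw [Nat.cast_sub hj]; norm_num
  have hr' : r = 0 ∨ r = 1 ∨ r = 2 := by omega
  rcases hr' with rfl | rfl | rfl
  · refine ⟨(3 * 2 ^ (j - 2)) ^ τ, by positivity, fun es V α pos h hm hα hsq => ?_⟩
    have hm1 : (1 : ℝ) ≤ es.length := by exact_mod_cast hm
    have hα1 : (1 : ℝ) ≤ α := by exact_mod_cast hα
    simp only [prefixes, if_true, List.map_cons, List.map_nil, List.sum_cons, List.sum_nil, add_zero,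
      chainBound, Nat.cast_zero]
    have h1 : (1 : ℝ) ≤ es.length * (2 * α) ^ (j - 2) :=
      one_le_mul_of_one_le_of_one_le hm1 (one_le_pow₀ (by linarith))
    calc _ ≤ ((3 * 2 ^ (j - 2)) * ((α : ℝ) ^ (j - 2) * es.length)) ^ τ := by
          refine rpow_le_rpow (by positivity) ?_ (by linarith)
          push_cast
          rw [mul_pow] at h1 ⊢
          linarith
      _ = _ := by
          have e : ((α : ℝ) ^ (j - 2)) ^ τ = (α : ℝ) ^ (((j : ℝ) - 2) * τ) := by
            rw [← rpow_natCast, ← rpow_mul (by positivity), hcast]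
          rw [mul_rpow (by positivity) (by positivity),
            mul_rpow (x := (α : ℝ) ^ (j - 2)) (by positivity) (by positivity), e]
  · refine ⟨(2 + 2 ^ τ) * (8 ^ (τ - 1) * 2 ^ (((j : ℝ) - 2) * τ + 1)), by positivity,
      fun es V α pos h hm hα hsq => ?_⟩
    have hm1 : (1 : ℝ) ≤ es.length := by exact_mod_cast hm
    have hα1 : (1 : ℝ) ≤ α := by exact_mod_cast hα
    have hsq' : (α : ℝ) ^ 2 ≤ 2 * es.length := by exact_mod_cast hsq
    set d : ℝ := 2 * α with hd
    have hd1 : 1 ≤ d := by linarith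
    set x : ℝ := ((j : ℝ) - 2) * τ + 1 with hx
    have hkey := mul_rpow_le_of_sq_le (x := x) hα1 hm1 hsq' hd hτ
    have hexp : x + 2 * (τ - 1) = (j : ℝ) * τ - 1 := by rw [hx]; ring
    rw [hexp] at hkey
    set Y := d ^ ((j : ℝ) * τ - 1) with hY
    have hY1 : 1 ≤ Y := one_le_rpow hd1 (by rw [← hexp, hx]; linarith)
    have hterm : ∀ v ∈ V, ((chainBound 1 j (2 * α) es V (orientation es pos) (v, 0) : ℕ) : ℝ) ^ τ ≤
        1 + 2 ^ τ * Y * ((V.filter (orientation es pos v)).length : ℝ) := by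
      intro v hv
      set b := (V.filter (orientation es pos v)).length with hb
      have hbd : (b : ℝ) ≤ d := by
        have := h.length_filter_le hv
        rw [← hb] at this
        rw [hd]
        exact_mod_cast this
      simp only [chainBound, one_ne_zero, if_false, if_true, ← hb]
      push_cast
      rw [← hd]
      rcases Nat.eq_zero_or_pos b with h0 | h0
      · simp [h0]
      · have hb1 : (1 : ℝ) ≤ b := by exact_mod_cast h0
        have h1 : (1 : ℝ) ≤ b * d ^ (j - 1) :=
          one_le_mul_of_one_le_of_one_le hb1 (one_le_pow₀ hd1)
        have h2 : (b : ℝ) ^ τ ≤ b * d ^ (τ - 1) := by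
          calc (b : ℝ) ^ τ = b * (b : ℝ) ^ (τ - 1) := by
                rw [← rpow_one_add' (by linarith) (by linarith)]; congr 1; ring
            _ ≤ b * d ^ (τ - 1) := by
                refine mul_le_mul_of_nonneg_left (rpow_le_rpow (by linarith) hbd (by linarith))
                  (by linarith)
        have h3 : d ^ (τ - 1) * (d ^ (j - 1)) ^ τ = Y := by
          rw [← rpow_natCast, ← rpow_mul (by linarith), ← rpow_add (by linarith), hY,
            Nat.cast_sub (by omega)]
          congr 1
          push_cast
          ring
        calc ((b : ℝ) * d ^ (j - 1) + 1) ^ τ ≤ (2 * (b * d ^ (j - 1))) ^ τ :=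
              rpow_le_rpow (by positivity) (by linarith) (by linarith)
          _ = 2 ^ τ * ((b : ℝ) ^ τ * (d ^ (j - 1)) ^ τ) := by
              rw [mul_rpow (by norm_num) (by positivity), mul_rpow (by positivity) (by positivity)]
          _ ≤ 2 ^ τ * (b * d ^ (τ - 1) * (d ^ (j - 1)) ^ τ) := by gcongr
          _ = 2 ^ τ * Y * b := by rw [← h3]; ring
          _ ≤ _ := by linarith
    have hsum : (V.map fun v =>
        ((chainBound 1 j (2 * α) es V (orientation es pos) (v, 0) : ℕ) : ℝ) ^ τ).sum ≤
        2 * es.length + 2 ^ τ * Y * es.length := by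
      refine (List.sum_le_sum hterm).trans ?_
      rw [List.sum_map_add, List.map_const', List.sum_replicate, nsmul_eq_mul, mul_one,
        List.sum_map_mul_left]
      have e1 : ((V.length : ℕ) : ℝ) ≤ 2 * es.length := by exact_mod_cast h.length_le
      have e2 : ((V.map fun v => ((V.filter (orientation es pos v)).length : ℝ)).sum) ≤ es.length := by
        have := h.sum_length_filter_le
        have h' : (((V.map fun v => (V.filter (orientation es pos v)).length).sum : ℕ) : ℝ) ≤
          es.length := by exact_mod_cast this
        rw [Nat.cast_list_sum, List.map_map] at h'
        exact h'
      have e3 : 2 ^ τ * Y * (V.map fun v => ((V.filter (orientation es pos v)).length : ℝ)).sum ≤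
        2 ^ τ * Y * es.length := mul_le_mul_of_nonneg_left e2 (by positivity)
      linarith
    simp only [prefixes, one_ne_zero, if_false, if_true, List.map_map, Function.comp_def,
      Nat.cast_one, ← hx]
    refine hsum.trans ?_
    have e4 : (es.length : ℝ) ≤ es.length * Y := le_mul_of_one_le_right (by linarith) hY1
    have h2τ : (0 : ℝ) < 2 ^ τ := by positivity
    calc _ ≤ (2 + 2 ^ τ) * (es.length * Y) := by nlinarith
      _ ≤ (2 + 2 ^ τ) * (8 ^ (τ - 1) * 2 ^ x * ((α : ℝ) ^ x * (es.length : ℝ) ^ τ)) := by gcongr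
      _ = _ := by ring
  · refine ⟨2 ^ τ * (8 ^ (τ - 1) * 2 ^ (((j : ℝ) - 2) * τ + 2)), by positivity,
      fun es V α pos h hm hα hsq => ?_⟩
    have hm1 : (1 : ℝ) ≤ es.length := by exact_mod_cast hm
    have hα1 : (1 : ℝ) ≤ α := by exact_mod_cast hα
    have hsq' : (α : ℝ) ^ 2 ≤ 2 * es.length := by exact_mod_cast hsq
    set d : ℝ := 2 * α with hd
    have hd1 : 1 ≤ d := by linarith
    set x : ℝ := ((j : ℝ) - 2) * τ + 2 with hx
    have hkey := mul_rpow_le_of_sq_le (x := x) hα1 hm1 hsq' hd hτ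
    have hexp : x + 2 * (τ - 1) = (j : ℝ) * τ := by rw [hx]; ring
    rw [hexp] at hkey
    have h1 : (1 : ℝ) ≤ d ^ j := one_le_pow₀ hd1
    simp only [prefixes, OfNat.ofNat_ne_zero, OfNat.ofNat_ne_one, if_false, chainBound,
      Nat.cast_ofNat, ← hx]
    rw [List.map_const', List.sum_replicate, nsmul_eq_mul]
    push_cast
    rw [← hd]
    calc (es.length : ℝ) * (d ^ j + 1) ^ τ ≤ es.length * (2 * d ^ j) ^ τ := by
          refine mul_le_mul_of_nonneg_left (rpow_le_rpow (by positivity) (by linarith)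
            (by linarith)) (by linarith)
      _ = 2 ^ τ * (es.length * d ^ ((j : ℝ) * τ)) := by
          rw [mul_rpow (by norm_num) (by positivity), ← rpow_natCast, ← rpow_mul (by linarith)]
          ring
      _ ≤ 2 ^ τ * (8 ^ (τ - 1) * 2 ^ x * ((α : ℝ) ^ x * (es.length : ℝ) ^ τ)) := by gcongr
      _ = _ := by ring

/-- The program `findCliques`, followed by an output instruction. -/
theorem BilinearAlg.exists_solves (a : BilinearAlg) {r j : ℕ} {τ : ℝ} (hr : r ≤ 2) (hj : 2 ≤ j)
    (hτ : 2 ≤ τ) (hR : (a.R : ℝ) < (a.n : ℝ) ^ τ) (e : Expr)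
    (Q : ∀ n : ℕ, SimpleGraph (Fin n) → State → Prop)
    (hQ : ∀ (n w : ℕ) (G : SimpleGraph (Fin n)) (s : State), 1 < 2 ^ w →
      s.reg 2 = {K : Finset (Fin n) | G.IsNClique (3 * j + r) K}.ncard → s.reg 2 < 2 ^ w →
      (s.reg 2 ≠ 0 → ∃ v : Fin (3 * j + r) → Fin n, (∀ i : Fin (3 * j + r), s.arr 2 i = v i) ∧
        ∀ i i' : Fin (3 * j + r), i ≠ i' → G.Adj (v i) (v i')) → Q n G (s.setReg 0 (e.eval w s))) :
    SolvableInTime Q (fun _ G => cliqueBound j r τ G) := by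
  obtain ⟨C₁, hC₁, h1⟩ := a.exists_processTime_le hτ hR j
  obtain ⟨C₂, hC₂, h2⟩ := DegenerateOrder.exists_sum_chainBound_le r j hr hj hτ
  refine ⟨a.findCliques r j ;; 0 ≔ e, a.wordExp j, C₁ * C₂ + 2000 + (e.cost + 1),
    fun n G L hL w hw => ?_⟩
  have hrun := a.WP_findCliques hr hj hL hw
  obtain ⟨s, t, hst, g1, g2, g3, V, pos, hdeg, ht⟩ := hrun
  have hw1 : 1 < 2 ^ w := by
    refine lt_of_lt_of_le ?_ hw
    exact Nat.one_lt_pow (by simp [BilinearAlg.wordExp]) (by omega)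
  refine ⟨_, _, .seq hst (.assign 0 e s), hQ n w G s hw1 g1 g2 g3, fun hm => ?_⟩
  have hlen : (natEdges L).length = numEdges G := by rw [natEdges, List.length_map, hL.length_eq]
  have hα := one_le_arboricity hm
  have hbound := h2 _ V _ pos hdeg (by omega) hα (by rw [hlen]; exact arboricity_sq_le G)
  rw [hlen] at hbound
  set P := prefixes r (natEdges L) V
  set B := DegenerateOrder.chainBound r j (2 * arboricity G) (natEdges L) V
    (orientation (natEdges L) pos)
  have hB : ∀ p, 1 ≤ B p := by
    intro p
    simp only [B, DegenerateOrder.chainBound]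
    split_ifs <;> exact Nat.le_add_left _ _
  have hsum : (((P.map fun p => a.processTime j (B p) (B p)).sum : ℕ) : ℝ) ≤
      C₁ * (P.map fun p => (B p : ℝ) ^ τ).sum := by
    rw [Nat.cast_list_sum, List.map_map, ← List.sum_map_mul_left]
    exact List.sum_le_sum fun p _ => h1 _ (hB p)
  change ((P.map fun p => (B p : ℝ) ^ τ).sum ≤ C₂ * cliqueBound j r τ G) at hbound
  have hm1 : (1 : ℝ) ≤ numEdges G := by exact_mod_cast hm
  have hα1 : (1 : ℝ) ≤ arboricity G := by exact_mod_cast hα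
  have hj2 : (2 : ℝ) ≤ j := by exact_mod_cast hj
  have hmm : (numEdges G : ℝ) ^ 2 ≤ cliqueBound j r τ G := by
    have e1 : (numEdges G : ℝ) ^ 2 ≤ (numEdges G : ℝ) ^ τ := by
      rw [← rpow_two]; exact rpow_le_rpow_of_exponent_le hm1 hτ
    have e2 : (1 : ℝ) ≤ (arboricity G : ℝ) ^ (((j : ℝ) - 2) * τ + r) :=
      one_le_rpow hα1 (add_nonneg (mul_nonneg (by linarith) (by linarith)) (Nat.cast_nonneg _))
    exact e1.trans (le_mul_of_one_le_left (by positivity) e2)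
  have hc1 : 1 ≤ cliqueBound j r τ G := le_trans (one_le_pow₀ hm1) hmm
  rw [zero_add] at ht
  have ht' : (t : ℝ) ≤ (((P.map fun p => a.processTime j (B p) (B p)).sum : ℕ) : ℝ) +
      1000 * ((numEdges G : ℝ) ^ 2 + 1) := by exact_mod_cast ht
  have e1 := mul_le_mul_of_nonneg_left hbound hC₁
  have e2 : ((e.cost : ℝ) + 1) * 1 ≤ (e.cost + 1) * cliqueBound j r τ G :=
    mul_le_mul_of_nonneg_left hc1 (by positivity)
  push_cast
  linarith

/-- A bilinear algorithm with `R < n ^ τ` solves both problems in the required time. -/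
theorem BilinearAlg.solvableInTime (a : BilinearAlg) {r j : ℕ} {τ : ℝ} (hr : r ≤ 2) (hj : 2 ≤ j)
    (hτ : 2 ≤ τ) (hR : (a.R : ℝ) < (a.n : ℝ) ^ τ) :
    SolvableInTime (OutputsCliqueCount (3 * j + r)) (fun _ G => cliqueBound j r τ G) ∧
      SolvableInTime (OutputsCliqueDetection (3 * j + r)) (fun _ G => cliqueBound j r τ G) := by
  constructor
  · refine a.exists_solves hr hj hτ hR (.reg 2) _ fun n w G s hw h1 h2 h3 => ?_
    simpa [OutputsCliqueCount] using h1
  · refine a.exists_solves hr hj hτ hR (.op .lt (.const 0) (.reg 2)) _ fun n w G s hw h1 h2 h3 => ?_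
    by_cases h0 : s.reg 2 = 0
    · left
      refine ⟨fun K hK => ?_, by simp [h0]⟩
      rw [h0, eq_comm, Set.ncard_eq_zero (Set.toFinite _)] at h1
      exact Set.eq_empty_iff_forall_notMem.mp h1 K hK
    · right
      exact ⟨by simp [Nat.pos_of_ne_zero h0], by simpa using h3 h0⟩

end WordRAM

/-! ### From straight-line programs to bilinear algorithms -/

section Jets
open Filter Topology

variable {E : Type*} [AddCommGroup E] [Module ℝ E]

/-- `c + l + q` is the Taylor polynomial of `f` of order `2` at the origin, along every line. -/
def HasJet (f : E → ℝ) (c : ℝ) (l : E →ₗ[ℝ] ℝ) (q : E → ℝ) : Prop :=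
  ∀ p, ∃ ρ : ℝ → ℝ, Tendsto ρ (𝓝[≠] 0) (𝓝 (q p)) ∧
    ∀ x : ℝ, f (x • p) = c + x * l p + x ^ 2 * ρ x

theorem hasJet_const (c : ℝ) : HasJet (fun _ : E => c) c 0 0 :=
  fun _ => ⟨fun _ => 0, tendsto_const_nhds, fun x => by simp⟩

theorem hasJet_linear (l : E →ₗ[ℝ] ℝ) : HasJet l 0 l 0 :=
  fun _ => ⟨fun _ => 0, tendsto_const_nhds, fun x => by simp⟩

theorem tendsto_punctured_zero : Tendsto (fun x : ℝ => x) (𝓝[≠] 0) (𝓝 0) :=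
  tendsto_id.mono_left nhdsWithin_le_nhds

namespace HasJet
variable {f g h : E → ℝ} {c c' : ℝ} {l l' : E →ₗ[ℝ] ℝ} {q q' : E → ℝ}

theorem add (hg : HasJet g c l q) (hh : HasJet h c' l' q') :
    HasJet (g + h) (c + c') (l + l') (q + q') := by
  intro p
  obtain ⟨ρ, h1, h2⟩ := hg p
  obtain ⟨ρ', h1', h2'⟩ := hh p
  refine ⟨fun x => ρ x + ρ' x, h1.add h1', fun x => ?_⟩
  rw [Pi.add_apply, h2, h2', LinearMap.add_apply]
  ring

theorem sub (hg : HasJet g c l q) (hh : HasJet h c' l' q') :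
    HasJet (g - h) (c - c') (l - l') (q - q') := by
  intro p
  obtain ⟨ρ, h1, h2⟩ := hg p
  obtain ⟨ρ', h1', h2'⟩ := hh p
  refine ⟨fun x => ρ x - ρ' x, h1.sub h1', fun x => ?_⟩
  rw [Pi.sub_apply, h2, h2', LinearMap.sub_apply]
  ring

theorem mul (hg : HasJet g c l q) (hh : HasJet h c' l' q') :
    HasJet (g * h) (c * c') (c • l' + c' • l) (c • q' + c' • q + l * l') := by
  intro p
  obtain ⟨ρ, h1, h2⟩ := hg p
  obtain ⟨ρ', h1', h2'⟩ := hh p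
  refine ⟨fun x => c * ρ' x + c' * ρ x + l p * l' p +
    x * (l p * ρ' x + l' p * ρ x + x * (ρ x * ρ' x)), ?_, fun x => ?_⟩
  · have := (((h1'.const_mul c).add (h1.const_mul c')).add_const (l p * l' p)).add
      (tendsto_punctured_zero.mul (((h1'.const_mul (l p)).add (h1.const_mul (l' p))).add
        (tendsto_punctured_zero.mul (h1.mul h1'))))
    simpa using this
  · simp only [Pi.mul_apply, h2, h2', LinearMap.add_apply, LinearMap.smul_apply, smul_eq_mul]
    ring

theorem apply_zero (hg : HasJet g c l q) : g 0 = c := by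
  obtain ⟨ρ, -, h⟩ := hg 0
  simpa using h 0

theorem div (hg : HasJet g c l q) (hh : HasJet h c' l' q') (h0 : ∀ p, h p ≠ 0) :
    HasJet (g / h) (c / c') (c'⁻¹ • (l - (c / c') • l'))
      (c'⁻¹ • (q - (c / c') • q' - l' * ⇑(c'⁻¹ • (l - (c / c') • l')))) := by
  have hc' : c' ≠ 0 := by rw [← hh.apply_zero]; exact h0 0
  intro p
  obtain ⟨ρ, h1, h2⟩ := hg p
  obtain ⟨ρ', h1', h2'⟩ := hh p
  set k : E →ₗ[ℝ] ℝ := c'⁻¹ • (l - (c / c') • l') with hk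
  have hkp : c' * k p = l p - c / c' * l' p := by
    rw [hk]
    simp only [LinearMap.smul_apply, LinearMap.sub_apply, smul_eq_mul]
    field_simp
  refine ⟨fun x => (c' + x * l' p + x ^ 2 * ρ' x)⁻¹ *
    (ρ x - c / c' * ρ' x - l' p * k p - x * (ρ' x * k p)), ?_, fun x => ?_⟩
  · have hden : Tendsto (fun x : ℝ => c' + x * l' p + x ^ 2 * ρ' x) (𝓝[≠] 0) (𝓝 c') := by
      have := ((tendsto_punctured_zero.mul_const (l' p)).const_add c').add
        ((tendsto_punctured_zero.pow 2).mul h1')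
      simpa using this
    have := (hden.inv₀ hc').mul (((h1.sub (h1'.const_mul (c / c'))).sub_const (l' p * k p)).sub
      (tendsto_punctured_zero.mul (h1'.mul_const (k p))))
    simpa using this
  · have hx := h0 (x • p)
    rw [Pi.div_apply, h2]
    rw [h2'] at hx ⊢
    rw [div_eq_iff hx]
    have e : (c' + x * l' p + x ^ 2 * ρ' x)⁻¹ * (c' + x * l' p + x ^ 2 * ρ' x) = 1 :=
      inv_mul_cancel₀ hx
    have e' : c / c' * c' = c := div_mul_cancel₀ c hc'
    linear_combination (-x) * hkp - e' -
      x ^ 2 * (ρ x - c / c' * ρ' x - l' p * k p - x * (ρ' x * k p)) * e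

/-- A function that is homogeneous of degree `2` agrees with the quadratic part of its jet. -/
theorem eq_of_homogeneous (hf : HasJet f c l q) (h2 : ∀ (x : ℝ) p, f (x • p) = x ^ 2 * f p) :
    q = f := by
  funext p
  obtain ⟨ρ, h1, h⟩ := hf p
  have hc : c = 0 := by
    have := h 0
    rw [h2] at this
    simpa using this.symm
  have hev : ∀ᶠ x : ℝ in 𝓝[≠] 0, l p = x * (f p - ρ x) := by
    filter_upwards [self_mem_nhdsWithin] with x hx
    have := h x
    rw [h2, hc] at this
    have hx' : x ≠ 0 := hx
    apply mul_left_cancel₀ hx'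
    linear_combination -this
  have hl : l p = 0 := by
    have h3 : Tendsto (fun x : ℝ => x * (f p - ρ x)) (𝓝[≠] 0) (𝓝 0) := by
      simpa using tendsto_punctured_zero.mul (h1.const_sub (f p))
    exact tendsto_nhds_unique (tendsto_const_nhds.congr' hev) h3
  refine tendsto_nhds_unique h1 (tendsto_const_nhds.congr' ?_)
  filter_upwards [self_mem_nhdsWithin] with x hx
  have := h x
  rw [h2, hc, hl] at this
  have hx' : x ^ 2 ≠ 0 := pow_ne_zero _ hx
  apply mul_left_cancel₀ hx'
  linear_combination this

end HasJet

/-- The quadratic parts of all values computed by a straight-line program with `s` instructions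
lie in the span of `s` products of two linear forms: an instruction adds at most one product. -/
theorem IsStraightLine.exists_products {I : Set (E → ℝ)} {s : ℕ} {f : Fin s → E → ℝ}
    (hf : IsStraightLine I f) (hI : ∀ g ∈ I, ∃ l : E →ₗ[ℝ] ℝ, g = l) :
    ∃ u v : ℕ → E →ₗ[ℝ] ℝ, ∀ k, ∃ c l q, HasJet (f k) c l q ∧
      q ∈ Submodule.span ℝ ((fun i => (u i * v i : E → ℝ)) '' Set.Iio s) := by
  have key : ∀ N ≤ s, ∃ u v : ℕ → E →ₗ[ℝ] ℝ, ∀ k : Fin s, (k : ℕ) < N → ∃ c l q,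
      HasJet (f k) c l q ∧ q ∈ Submodule.span ℝ ((fun i => (u i * v i : E → ℝ)) '' Set.Iio N) := by
    intro N
    induction N with
    | zero => exact fun _ => ⟨0, 0, fun k hk => absurd hk (Nat.not_lt_zero _)⟩
    | succ N ih =>
      intro hN
      obtain ⟨u, v, huv⟩ := ih (by omega)
      set S := Submodule.span ℝ ((fun i => (u i * v i : E → ℝ)) '' Set.Iio N) with hS
      -- it suffices to add one product for the new instruction
      suffices hnew : ∃ a b : E →ₗ[ℝ] ℝ, ∃ c l q, HasJet (f ⟨N, hN⟩) c l q ∧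
          ∃ q₀ ∈ S, ∃ z : ℝ, q = q₀ + z • (a * b : E → ℝ) by
        obtain ⟨a, b, c, l, q, hjet, q₀, hq₀, z, rfl⟩ := hnew
        refine ⟨Function.update u N a, Function.update v N b, fun k hk => ?_⟩
        set S' := Submodule.span ℝ ((fun i => (Function.update u N a i * Function.update v N b i :
          E → ℝ)) '' Set.Iio (N + 1)) with hS'
        have hle : S ≤ S' := by
          refine Submodule.span_le.mpr ?_
          rintro _ ⟨i, hi, rfl⟩
          refine Submodule.subset_span ⟨i, Nat.lt_succ_of_lt hi, ?_⟩
          have hne : i ≠ N := ne_of_lt hi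
          simp only [Function.update_of_ne hne]
        rcases Nat.lt_succ_iff_lt_or_eq.mp hk with h | h
        · obtain ⟨c', l', q', h1, h2⟩ := huv k h
          exact ⟨c', l', q', h1, hle h2⟩
        · have hk' : k = ⟨N, hN⟩ := Fin.ext h
          refine ⟨c, l, _, hk' ▸ hjet, S'.add_mem (hle hq₀) (S'.smul_mem _ ?_)⟩
          refine Submodule.subset_span ⟨N, Nat.lt_succ_self N, ?_⟩
          simp only [Function.update_self]
      have hprev : ∀ g ∈ I ∪ f '' {i | i < ⟨N, hN⟩}, ∃ c l, ∃ q ∈ S, HasJet g c l q := by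
        rintro g (hg | ⟨i, hi, rfl⟩)
        · obtain ⟨l, rfl⟩ := hI g hg
          exact ⟨0, l, 0, S.zero_mem, hasJet_linear l⟩
        · obtain ⟨c, l, q, h1, h2⟩ := huv i hi
          exact ⟨c, l, q, h2, h1⟩
      rcases hf ⟨N, hN⟩ with ⟨c, hc⟩ | ⟨g, hg, h, hh, hop⟩
      · exact ⟨0, 0, c, 0, 0, hc ▸ hasJet_const c, 0, S.zero_mem, 0, by simp⟩
      · obtain ⟨c, l, q, hq, hgj⟩ := hprev g hg
        obtain ⟨c', l', q', hq', hhj⟩ := hprev h hh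
        rcases hop with hop | hop | hop | ⟨h0, hop⟩ <;> rw [hop]
        · exact ⟨0, 0, _, _, _, hgj.add hhj, _, S.add_mem hq hq', 0, by simp⟩
        · exact ⟨0, 0, _, _, _, hgj.sub hhj, _, S.sub_mem hq hq', 0, by simp⟩
        · exact ⟨l, l', _, _, _, hgj.mul hhj, _, S.add_mem (S.smul_mem c hq') (S.smul_mem c' hq),
            1, by simp⟩
        · refine ⟨l', c'⁻¹ • (l - (c / c') • l'), _, _, _, hgj.div hhj h0, _,
            S.smul_mem c'⁻¹ (S.sub_mem hq (S.smul_mem (c / c') hq')), -c'⁻¹, ?_⟩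
          rw [smul_sub c'⁻¹ (q - _), neg_smul, sub_eq_add_neg]
  obtain ⟨u, v, h⟩ := key s le_rfl
  exact ⟨u, v, fun k => h k k.2⟩

end Jets

/-- The bilinear forms `U i` and `V i` and the coefficients `W i` compute `c` times the product of
two matrices: `∑ i, W i * U i (X) * V i (Y) = c • (X * Y)`. -/
def Decomposes {K m ι : Type*} [CommRing K] [DecidableEq m] [Fintype ι] (c : K)
    (U V W : ι → m → m → K) : Prop :=
  ∀ x y y' z x' z', ∑ i, W i x' z' * U i x y * V i y' z =
    if x = x' ∧ y = y' ∧ z = z' then c else 0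

/-- A straight-line program with `s` instructions yields a bilinear algorithm with `2 s`
multiplications. -/
theorem CanMultiply.exists_decomposes {n s : ℕ} (h : CanMultiply n s) :
    ∃ U V W : Fin s ⊕ Fin s → Fin n → Fin n → ℝ, Decomposes 1 U V W := by
  obtain ⟨f, hf, hout⟩ := h
  have hI : ∀ g ∈ {g : (Matrix (Fin n) (Fin n) ℝ × Matrix (Fin n) (Fin n) ℝ) → ℝ |
      ∃ a b : Fin n, g = (fun p => p.1 a b) ∨ g = (fun p => p.2 a b)},
      ∃ l : (Matrix (Fin n) (Fin n) ℝ × Matrix (Fin n) (Fin n) ℝ) →ₗ[ℝ] ℝ, g = l := by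
    rintro g ⟨a, b, rfl | rfl⟩
    · exact ⟨Matrix.entryLinearMap ℝ ℝ a b ∘ₗ LinearMap.fst ℝ _ _, rfl⟩
    · exact ⟨Matrix.entryLinearMap ℝ ℝ a b ∘ₗ LinearMap.snd ℝ _ _, rfl⟩
  obtain ⟨u, v, huv⟩ := hf.exists_products hI
  have hspan : ∀ a b : Fin n, ∃ w : Fin s → ℝ, ∀ p : Matrix (Fin n) (Fin n) ℝ × Matrix (Fin n) (Fin n) ℝ,
      (p.1 * p.2) a b = ∑ i, w i * (u i p * v i p) := by
    intro a b
    obtain ⟨k, hk⟩ := hout a b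
    obtain ⟨c, l, q, hjet, hq⟩ := huv k
    have hqf := hjet.eq_of_homogeneous fun x p => by
      rw [hk, hk, Prod.smul_fst, Prod.smul_snd, Matrix.smul_mul, Matrix.mul_smul, smul_smul,
        Matrix.smul_apply, smul_eq_mul, sq]
    rw [hqf] at hq
    have hset : (fun i => ⇑(u i) * ⇑(v i)) '' Set.Iio s =
        Set.range fun i : Fin s => ⇑(u i) * ⇑(v i) := by
      ext g
      constructor
      · rintro ⟨i, hi, rfl⟩; exact ⟨⟨i, hi⟩, rfl⟩
      · rintro ⟨i, rfl⟩; exact ⟨i, i.2, rfl⟩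
    rw [hset, Submodule.mem_span_range_iff_exists_fun] at hq
    obtain ⟨w, hw⟩ := hq
    refine ⟨w, fun p => ?_⟩
    rw [← hk, ← hw]
    simp
  choose w hw using hspan
  let X : Fin n → Fin n → Matrix (Fin n) (Fin n) ℝ × Matrix (Fin n) (Fin n) ℝ :=
    fun x y => (Matrix.single x y 1, 0)
  let Y : Fin n → Fin n → Matrix (Fin n) (Fin n) ℝ × Matrix (Fin n) (Fin n) ℝ :=
    fun y z => (0, Matrix.single y z 1)
  refine ⟨Sum.elim (fun i x y => u i (X x y)) (fun i x y => v i (X x y)),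
    Sum.elim (fun i y z => v i (Y y z)) (fun i y z => u i (Y y z)),
    Sum.elim (fun i a b => w a b i) (fun i a b => w a b i), fun x y y' z x' z' => ?_⟩
  -- polarize: the product vanishes if one of the factors does
  have h1 := hw x' z' (X x y + Y y' z)
  have h2 := hw x' z' (X x y)
  have h3 := hw x' z' (Y y' z)
  have e1 : ((X x y + Y y' z).1 * (X x y + Y y' z).2) x' z' =
      if x = x' ∧ y = y' ∧ z = z' then 1 else 0 := by
    simp only [X, Y, Prod.fst_add, Prod.snd_add, add_zero, zero_add]
    by_cases hy : y = y'
    · subst hy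
      rw [Matrix.single_mul_single_same, Matrix.single_apply]
      simp
    · rw [Matrix.single_mul_single_of_ne _ _ _ _ hy]
      simp [hy]
  rw [e1] at h1
  have e2 : ((X x y).1 * (X x y).2) x' z' = 0 := by simp [X]
  have e3 : ((Y y' z).1 * (Y y' z).2) x' z' = 0 := by simp [Y]
  rw [e2] at h2
  rw [e3] at h3
  rw [Fintype.sum_sum_type]
  simp only [Sum.elim_inl, Sum.elim_inr]
  rw [h1, ← sub_zero (∑ i, w x' z' i * _), ← sub_zero (_ - 0)]
  nth_rewrite 1 [h2]
  rw [h3, ← Finset.sum_sub_distrib, ← Finset.sum_sub_distrib, ← Finset.sum_add_distrib]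
  refine Finset.sum_congr rfl fun i _ => ?_
  rw [map_add, map_add]
  ring

namespace Decomposes
variable {K m ι : Type*} [CommRing K] [DecidableEq m] [Fintype ι] {c : K} {U V W : ι → m → m → K}

theorem map {K' : Type*} [CommRing K'] (h : Decomposes c U V W) (φ : K →+* K') :
    Decomposes (φ c) (fun i x y => φ (U i x y)) (fun i x y => φ (V i x y))
      (fun i x y => φ (W i x y)) := by
  intro x y y' z x' z'
  simp only [← map_mul, ← map_sum]
  rw [h]
  split_ifs
  exacts [rfl, map_zero φ]

theorem of_map {K' : Type*} [CommRing K'] {φ : K →+* K'} (hφ : Function.Injective φ)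
    (h : Decomposes (φ c) (fun i x y => φ (U i x y)) (fun i x y => φ (V i x y))
      (fun i x y => φ (W i x y))) : Decomposes c U V W := by
  intro x y y' z x' z'
  have := h x y y' z x' z'
  simp only [← map_mul, ← map_sum] at this
  apply hφ
  rw [this]
  split_ifs
  exacts [rfl, (map_zero φ).symm]

/-- The `k`-th Kronecker power of a bilinear algorithm. -/
theorem pow [Fintype m] (h : Decomposes c U V W) (k : ℕ) :
    Decomposes (m := Fin k → m) (ι := Fin k → ι) (c ^ k) (fun i x y => ∏ a, U (i a) (x a) (y a))
      (fun i x y => ∏ a, V (i a) (x a) (y a)) (fun i x y => ∏ a, W (i a) (x a) (y a)) := by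
  intro x y y' z x' z'
  simp only [← Finset.prod_mul_distrib]
  have := Finset.prod_univ_sum (fun _ : Fin k => (Finset.univ : Finset ι))
    fun a i => W i (x' a) (z' a) * U i (x a) (y a) * V i (y' a) (z a)
  rw [Fintype.piFinset_univ] at this
  rw [← this, Finset.prod_congr rfl fun a _ => h (x a) (y a) (y' a) (z a) (x' a) (z' a)]
  by_cases hc : x = x' ∧ y = y' ∧ z = z'
  · obtain ⟨rfl, rfl, rfl⟩ := hc
    simp
  · rw [if_neg hc]
    have : ∃ a, ¬ (x a = x' a ∧ y a = y' a ∧ z a = z' a) := by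
      by_contra! hall
      exact hc ⟨funext fun a => (hall a).1, funext fun a => (hall a).2.1,
        funext fun a => (hall a).2.2⟩
    obtain ⟨a, ha⟩ := this
    exact Finset.prod_eq_zero (Finset.mem_univ a) (if_neg ha)

theorem reindex {m' ι' : Type*} [DecidableEq m'] [Fintype ι'] (h : Decomposes c U V W)
    (e : m' ≃ m) (f : ι' ≃ ι) :
    Decomposes c (fun i x y => U (f i) (e x) (e y)) (fun i x y => V (f i) (e x) (e y))
      (fun i x y => W (f i) (e x) (e y)) := by
  intro x y y' z x' z'
  rw [Equiv.sum_comp f fun i => W i (e x') (e z') * U i (e x) (e y) * V i (e y') (e z), h]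
  simp only [e.apply_eq_iff_eq]

/-- The coefficients can be taken from `ℚ` instead of a field of degree `d` at the cost of a factor
`d ^ 3`: expand them in a basis, and apply a linear functional that maps `1` to `1`. -/
theorem exists_rat {K : Type*} [Field K] [Algebra ℚ K] [Module.Finite ℚ K]
    {U V W : ι → m → m → K} (h : Decomposes (1 : K) U V W) :
    ∃ (d : ℕ), d = Module.finrank ℚ K ∧ ∃ U' V' W' : ι × Fin d × Fin d × Fin d → m → m → ℚ,
      Decomposes 1 U' V' W' := by
  refine ⟨_, rfl, ?_⟩
  let b := Module.finBasis ℚ K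
  obtain ⟨φ, hφ⟩ : ∃ φ : K →ₗ[ℚ] ℚ, φ 1 = 1 :=
    LinearMap.exists_leftInverse_of_injective (LinearMap.toSpanSingleton ℚ K 1)
      (LinearMap.ker_eq_bot.mpr fun x y hxy => by
        simpa [LinearMap.toSpanSingleton_apply] using hxy) |>.imp fun φ hφ => by
          have := LinearMap.congr_fun hφ 1
          simpa [LinearMap.toSpanSingleton_apply] using this
  refine ⟨fun i x y => b.repr (U i.1 x y) i.2.2.1, fun i x y => b.repr (V i.1 x y) i.2.1,
    fun i x y => b.repr (W i.1 x y) i.2.2.2 * φ (b i.2.2.2 * b i.2.2.1 * b i.2.1),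
    fun x y y' z x' z' => ?_⟩
  have key : ∀ p q r : K, ∑ k : Fin _ × Fin _ × Fin _,
      b.repr p k.2.2 * φ (b k.2.2 * b k.2.1 * b k.1) * b.repr q k.2.1 * b.repr r k.1 =
        φ (p * q * r) := by
    intro p q r
    conv_rhs => rw [← b.sum_repr p, ← b.sum_repr q, ← b.sum_repr r]
    simp only [Fintype.sum_prod_type, Finset.sum_mul, Finset.mul_sum, map_sum]
    simp only [smul_mul_assoc, mul_smul_comm, map_smul, smul_eq_mul]
    refine Finset.sum_congr rfl fun _ _ => Finset.sum_congr rfl fun _ _ =>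
      Finset.sum_congr rfl fun _ _ => ?_
    ring
  rw [Fintype.sum_prod_type]
  simp only [key]
  rw [← map_sum, h]
  split_ifs
  exacts [hφ, map_zero φ]

end Decomposes

theorem exists_common_denominator {T : Type*} [Finite T] (f : T → ℚ) :
    ∃ N : ℕ, 0 < N ∧ ∀ t, ∃ z : ℤ, (z : ℚ) = N * f t := by
  have := Fintype.ofFinite T
  refine ⟨∏ t, (f t).den, Finset.prod_pos fun t _ => (f t).den_pos, fun t => ?_⟩
  obtain ⟨k, hk⟩ := Finset.dvd_prod_of_mem (fun t => (f t).den) (Finset.mem_univ t)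
  refine ⟨k * (f t).num, ?_⟩
  rw [hk]
  push_cast
  nth_rewrite 3 [← Rat.num_div_den (f t)]
  have : ((f t).den : ℚ) ≠ 0 := by exact_mod_cast (f t).den_ne_zero
  field_simp

/-- A bilinear algorithm over `ℚ` gives one over `ℤ` for a multiple of the product; products with
zero may be added to it. -/
theorem Decomposes.exists_bilinearAlg {m ι : Type*} [DecidableEq m] [Fintype m] [Fintype ι]
    {U V W : ι → m → m → ℚ} (h : Decomposes 1 U V W) {R : ℕ} (hm : 1 < Fintype.card m)
    (hR : Fintype.card ι ≤ R) (hsq : Fintype.card m ^ 2 ≤ R) :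
    ∃ a : WordRAM.BilinearAlg, a.n = Fintype.card m ∧ a.R = R := by
  -- clear the denominators
  obtain ⟨N₁, hN₁, hU⟩ := exists_common_denominator fun i : ι × m × m => U i.1 i.2.1 i.2.2
  obtain ⟨N₂, hN₂, hV⟩ := exists_common_denominator fun i : ι × m × m => V i.1 i.2.1 i.2.2
  obtain ⟨N₃, hN₃, hW⟩ := exists_common_denominator fun i : ι × m × m => W i.1 i.2.1 i.2.2
  choose U' hU' using hU
  choose V' hV' using hV
  choose W' hW' using hW
  have hint : Decomposes ((N₁ * N₂ * N₃ : ℕ) : ℤ) (fun i x y => U' (i, x, y))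
      (fun i x y => V' (i, x, y)) (fun i x y => W' (i, x, y)) := by
    refine Decomposes.of_map (φ := Int.castRingHom ℚ) Int.cast_injective fun x y y' z x' z' => ?_
    simp only [eq_intCast, hU', hV', hW']
    have := congrArg (fun q : ℚ => N₁ * N₂ * N₃ * q) (h x y y' z x' z')
    simp only [Finset.mul_sum] at this
    calc _ = ∑ i, (N₁ : ℚ) * N₂ * N₃ * (W i x' z' * U i x y * V i y' z) :=
          Finset.sum_congr rfl fun i _ => by ring
      _ = _ := by
          rw [this]
          split_ifs <;> push_cast <;> ring
  -- number the indices
  set n := Fintype.card m with hn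
  set R' := Fintype.card ι with hR'
  have hfin := hint.reindex (Fintype.equivFin m).symm (Fintype.equivFin ι).symm
  generalize hUf : (fun (i : Fin R') (x y : Fin n) => U' ((Fintype.equivFin ι).symm i,
    (Fintype.equivFin m).symm x, (Fintype.equivFin m).symm y)) = Uf at hfin
  generalize hVf : (fun (i : Fin R') (x y : Fin n) => V' ((Fintype.equivFin ι).symm i,
    (Fintype.equivFin m).symm x, (Fintype.equivFin m).symm y)) = Vf at hfin
  generalize hWf : (fun (i : Fin R') (x y : Fin n) => W' ((Fintype.equivFin ι).symm i,
    (Fintype.equivFin m).symm x, (Fintype.equivFin m).symm y)) = Wf at hfin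
  have hn0 : 0 < n := by omega
  let ext : (Fin R' → Fin n → Fin n → ℤ) → ℕ → ℕ → ℤ := fun F q t =>
    if ht : t < R' then if hq : q / n < n then F ⟨t, ht⟩ ⟨q / n, hq⟩ ⟨q % n, Nat.mod_lt _ hn0⟩ else 0
    else 0
  have hext : ∀ F (t : Fin R') (x y : Fin n), ext F (n * x + y) t = F t x y := by
    intro F t x y
    have h1 : (n * (x : ℕ) + y) / n = x := by
      rw [Nat.mul_add_div hn0, Nat.div_eq_of_lt y.2, add_zero]
    have h2 : (n * (x : ℕ) + y) % n = y := by rw [Nat.mul_add_mod, Nat.mod_eq_of_lt y.2]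
    simp only [ext, t.2, dif_pos, h1, h2, x.2]
  refine ⟨{ n := n, R := R, D := N₁ * N₂ * N₃, U := fun t q => ext Uf q t, V := fun t q => ext Vf q t, W := ext Wf,
            one_lt_n := hm, sq_le_R := hsq, D_pos := by positivity,
            mul := fun x hx y hy y' hy' z hz x' hx' z' hz' => ?_ }, rfl, rfl⟩
  have h0 : ∀ t ∈ Finset.range R, t ∉ Finset.range R' →
      ext Wf (n * x' + z') t * ext Uf (n * x + y) t * ext Vf (n * y' + z) t = 0 := by
    intro t _ ht
    have : ¬ t < R' := by simpa using ht
    simp [ext, this]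
  beta_reduce
  rw [← Finset.sum_subset (Finset.range_subset_range.mpr hR) h0,
    ← Fin.sum_univ_eq_sum_range (fun t => ext Wf (n * x' + z') t * ext Uf (n * x + y) t *
      ext Vf (n * y' + z) t)]
  have := hfin ⟨x, hx⟩ ⟨y, hy⟩ ⟨y', hy'⟩ ⟨z, hz⟩ ⟨x', hx'⟩ ⟨z', hz'⟩
  simp only [← hext] at this
  rw [this]
  simp only [Fin.mk.injEq]

/-! ### The exponent of matrix multiplication -/

/-- A bilinear algorithm over `ℝ` can be specialized to one over a number field: reduce the algebra
generated by its coefficients modulo a maximal ideal. -/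
theorem Decomposes.exists_field {m ι : Type} [DecidableEq m] [Finite m] [Fintype ι]
    {U V W : ι → m → m → ℝ} (h : Decomposes 1 U V W) :
    ∃ (K : Type) (_ : Field K) (_ : Algebra ℚ K) (_ : Module.Finite ℚ K) (U' V' W' : ι → m → m → K),
      Decomposes 1 U' V' W' := by
  classical
  have := Fintype.ofFinite m
  -- the `ℚ`-algebra generated by the coefficients
  let T : Finset ℝ := (Finset.univ.image fun i : ι × m × m => U i.1 i.2.1 i.2.2) ∪
    (Finset.univ.image fun i : ι × m × m => V i.1 i.2.1 i.2.2) ∪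
    Finset.univ.image fun i : ι × m × m => W i.1 i.2.1 i.2.2
  let A := Algebra.adjoin ℚ (T : Set ℝ)
  have hU : ∀ i x y, U i x y ∈ A := fun i x y => Algebra.subset_adjoin (by
    simp only [T, Finset.coe_union, Finset.coe_image]
    exact .inl (.inl ⟨(i, x, y), by simp, rfl⟩))
  have hV : ∀ i x y, V i x y ∈ A := fun i x y => Algebra.subset_adjoin (by
    simp only [T, Finset.coe_union, Finset.coe_image]
    exact .inl (.inr ⟨(i, x, y), by simp, rfl⟩))
  have hW : ∀ i x y, W i x y ∈ A := fun i x y => Algebra.subset_adjoin (by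
    simp only [T, Finset.coe_union, Finset.coe_image]
    exact .inr ⟨(i, x, y), by simp, rfl⟩)
  have hA : Decomposes (1 : A) (fun i x y => ⟨U i x y, hU i x y⟩) (fun i x y => ⟨V i x y, hV i x y⟩)
      (fun i x y => ⟨W i x y, hW i x y⟩) := by
    refine Decomposes.of_map (φ := (A.val : A →+* ℝ)) Subtype.val_injective ?_
    rw [map_one]
    exact h
  have hfg : Algebra.FiniteType ℚ A :=
    A.fg_iff_finiteType.mp (Subalgebra.fg_adjoin_finset T)
  obtain ⟨M, hM⟩ := Ideal.exists_maximal A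
  let _ : Field (A ⧸ M) := Ideal.Quotient.field M
  have hft : Algebra.FiniteType ℚ (A ⧸ M) :=
    Algebra.FiniteType.of_surjective (Ideal.Quotient.mkₐ ℚ M) Ideal.Quotient.mk_surjective
  refine ⟨A ⧸ M, inferInstance, inferInstance, finite_of_finite_type_of_isJacobsonRing ℚ (A ⧸ M),
    fun i x y => Ideal.Quotient.mk M ⟨U i x y, hU i x y⟩,
    fun i x y => Ideal.Quotient.mk M ⟨V i x y, hV i x y⟩,
    fun i x y => Ideal.Quotient.mk M ⟨W i x y, hW i x y⟩, ?_⟩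
  have := hA.map (Ideal.Quotient.mk M)
  rwa [map_one] at this

/-- The school method: with `q = (a n + b) n + c`, instruction `2 q` computes the `c`-th summand of
the entry `(a, b)`, and instruction `2 q + 1` the sum of the summands up to this one. -/
theorem canMultiply_two_mul_cube {n : ℕ} (hn : 1 ≤ n) : CanMultiply n (2 * n ^ 3) := by
  let X := Matrix (Fin n) (Fin n) ℝ × Matrix (Fin n) (Fin n) ℝ
  let row : ℕ → Fin n := fun q => ⟨q / n / n % n, Nat.mod_lt _ hn⟩
  let col : ℕ → Fin n := fun q => ⟨q / n % n, Nat.mod_lt _ hn⟩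
  let prod : ℕ → ℕ → X → ℝ := fun q i p =>
    if hi : i < n then p.1 (row q) ⟨i, hi⟩ * p.2 ⟨i, hi⟩ (col q) else 0
  let f : ℕ → X → ℝ := fun k =>
    if k % 2 = 0 then prod (k / 2) (k / 2 % n)
    else ∑ i ∈ Finset.range (k / 2 % n + 1), prod (k / 2) i
  refine ⟨fun k => f k, fun k => .inr ?_, fun a b => ?_⟩
  · set q := (k : ℕ) / 2 with hq
    have hqn : q % n < n := Nat.mod_lt _ hn
    have hprod : ∃ g ∈ {g : X → ℝ | ∃ a b : Fin n, g = (fun p => p.1 a b) ∨ g = (fun p => p.2 a b)},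
        ∃ h ∈ {g : X → ℝ | ∃ a b : Fin n, g = (fun p => p.1 a b) ∨ g = (fun p => p.2 a b)},
        prod q (q % n) = g * h := by
      refine ⟨_, ⟨row q, ⟨q % n, hqn⟩, .inl rfl⟩, _, ⟨⟨q % n, hqn⟩, col q, .inr rfl⟩, ?_⟩
      funext p
      simp only [prod, dif_pos hqn, Pi.mul_apply]
    by_cases h2 : (k : ℕ) % 2 = 0
    · obtain ⟨g, hg, h, hh, hgh⟩ := hprod
      exact ⟨g, .inl hg, h, .inl hh, .inr (.inr (.inl (by simp only [f, h2, if_true]; exact hgh)))⟩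
    · by_cases h0 : q % n = 0
      · obtain ⟨g, hg, h, hh, hgh⟩ := hprod
        refine ⟨g, .inl hg, h, .inl hh, .inr (.inr (.inl ?_))⟩
        rw [← hgh]
        simp only [f, h2, if_false, ← hq, h0]
        simp
      · have hq1 : (q - 1) % n = q % n - 1 ∧ (q - 1) / n = q / n := by
          have h1 := Nat.div_add_mod q n
          have h3 : q - 1 = n * (q / n) + (q % n - 1) := by omega
          have h4 : q % n - 1 < n := by omega
          rw [h3, Nat.mul_add_mod, Nat.mul_add_div hn, Nat.mod_eq_of_lt h4, Nat.div_eq_of_lt h4]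
          exact ⟨rfl, add_zero _⟩
        have hqpos : 1 ≤ q := by
          by_contra! h
          have : q = 0 := by omega
          exact h0 (by simp [this])
        refine ⟨_, .inr ⟨⟨2 * (q - 1) + 1, by omega⟩, by
          simp only [Set.mem_ofPred_eq, Fin.lt_def]; omega, rfl⟩, _,
          .inr ⟨⟨2 * q, by omega⟩, by simp only [Set.mem_ofPred_eq, Fin.lt_def]; omega, rfl⟩,
          .inl ?_⟩
        have e1 : (2 * (q - 1) + 1) / 2 = q - 1 := by omega
        have e2 : (2 * (q - 1) + 1) % 2 = 1 := by omega
        have e3 : 2 * q / 2 = q := by omega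
        have e4 : 2 * q % 2 = 0 := by omega
        have hp : prod (q - 1) = prod q := by
          simp only [prod, row, col, hq1.2]
        simp only [f, h2, if_false, ← hq, e1, e2, e3, e4, one_ne_zero, if_true, hp, hq1.1]
        rw [Finset.sum_range_succ, Nat.sub_add_cancel (Nat.one_le_iff_ne_zero.mpr h0)]
  · -- the last partial sum
    set q := (a * n + b) * n + (n - 1) with hq
    have ha := a.2
    have hb := b.2
    have h1 : q % n = n - 1 := by
      rw [hq, mul_comm _ n, Nat.mul_add_mod, Nat.mod_eq_of_lt (by omega)]
    have h2 : q / n = a * n + b := by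
      rw [hq, mul_comm _ n, Nat.mul_add_div hn, Nat.div_eq_of_lt (by omega), add_zero]
    have h3 : (a * n + b) / n = a := by
      rw [mul_comm _ n, Nat.mul_add_div hn, Nat.div_eq_of_lt hb, add_zero]
    have h4 : ((a : ℕ) * n + b) % n = b := by
      rw [mul_comm _ n, Nat.mul_add_mod, Nat.mod_eq_of_lt hb]
    have hlt : 2 * q + 1 < 2 * n ^ 3 := by
      have e1 : (a * n + b) + 1 ≤ n * n := WordRAM.HasRel.idx ha hb
      have e2 := Nat.mul_le_mul_right n e1
      rw [add_mul] at e2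
      have e3 : n * n * n = n ^ 3 := by ring
      omega
    refine ⟨⟨2 * q + 1, hlt⟩, fun p => ?_⟩
    have e1 : (2 * q + 1) / 2 = q := by omega
    have e2 : (2 * q + 1) % 2 = 1 := by omega
    have hrow : row q = a := by
      apply Fin.ext
      simp only [row, h2, h3, Nat.mod_eq_of_lt ha]
    have hcol : col q = b := by
      apply Fin.ext
      simp only [col, h2, h4]
    simp only [f, e1, e2, one_ne_zero, if_false, h1, Nat.sub_add_cancel hn, Finset.sum_apply]
    rw [Matrix.mul_apply, ← Fin.sum_univ_eq_sum_range (fun i => prod q i p)]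
    refine Finset.sum_congr rfl fun i _ => ?_
    simp only [prod, i.2, dif_pos, hrow, hcol]

/-- The `n ^ 2` entries of a product are different functions of the factors. -/
theorem CanMultiply.sq_le {n s : ℕ} (h : CanMultiply n s) : n ^ 2 ≤ s := by
  obtain ⟨f, -, hf⟩ := h
  choose k hk using hf
  have hinj : Function.Injective fun ab : Fin n × Fin n => k ab.1 ab.2 := by
    rintro ⟨a, b⟩ ⟨a', b'⟩ hab
    have h1 := hk a b (1, Matrix.single a b 1)
    have h2 := hk a' b' (1, Matrix.single a b 1)
    simp only at hab
    rw [hab, h2] at h1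
    simp only [one_mul, Matrix.single_apply_same] at h1
    rw [Matrix.single_apply] at h1
    by_contra hne
    rw [if_neg] at h1
    · exact zero_ne_one h1
    · rintro ⟨rfl, rfl⟩
      exact hne rfl
  simpa [sq] using Fintype.card_le_of_injective _ hinj

theorem three_mem_exponents : (3 : ℝ) ∈ {τ : ℝ | ∃ C : ℝ, ∀ n : ℕ, 1 ≤ n →
    ∃ s : ℕ, CanMultiply n s ∧ (s : ℝ) ≤ C * (n : ℝ) ^ τ} := by
  refine ⟨2, fun n hn => ⟨_, canMultiply_two_mul_cube hn, ?_⟩⟩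
  rw [show (3 : ℝ) = ((3 : ℕ) : ℝ) by norm_num, Real.rpow_natCast]
  push_cast
  exact le_rfl

theorem two_le_of_mem_exponents {τ : ℝ} (h : ∃ C : ℝ, ∀ n : ℕ, 1 ≤ n →
    ∃ s : ℕ, CanMultiply n s ∧ (s : ℝ) ≤ C * (n : ℝ) ^ τ) : 2 ≤ τ := by
  obtain ⟨C, hC⟩ := h
  by_contra! hlt
  have ht : Filter.Tendsto (fun n : ℕ => (n : ℝ) ^ (2 - τ)) Filter.atTop Filter.atTop :=
    (tendsto_rpow_atTop (by linarith)).comp tendsto_natCast_atTop_atTop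
  obtain ⟨n, hn1, hn⟩ := ((Filter.eventually_ge_atTop 1).and
    (ht.eventually_gt_atTop C)).exists
  obtain ⟨s, hs, hsC⟩ := hC n hn1
  have hn0 : (0 : ℝ) < n := by exact_mod_cast hn1
  have h1 : (n : ℝ) ^ (2 : ℝ) ≤ C * (n : ℝ) ^ τ := by
    rw [Real.rpow_two]
    exact le_trans (by exact_mod_cast hs.sq_le) hsC
  rw [Real.rpow_sub hn0, lt_div_iff₀ (by positivity)] at hn
  linarith

theorem two_le_matMulExponent : 2 ≤ matMulExponent :=
  le_csInf ⟨3, three_mem_exponents⟩ fun _ h => two_le_of_mem_exponents h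

theorem matMulExponent_le_three : matMulExponent ≤ 3 :=
  csInf_le ⟨2, fun _ h => two_le_of_mem_exponents h⟩ three_mem_exponents

/-- Every exponent `τ > ω` is achieved by a bilinear algorithm with integer coefficients. A program
for matrices of some order has few enough instructions to give a bilinear algorithm over `ℝ` with
fewer than `n ^ τ` multiplications; specializing its coefficients gives one over a number field; the
Kronecker powers of this one absorb the loss in the passage to `ℚ`. -/
theorem exists_bilinearAlg {τ : ℝ} (hτ : matMulExponent < τ) :
    ∃ a : WordRAM.BilinearAlg, (a.R : ℝ) < (a.n : ℝ) ^ τ := by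
  have hτ2 : 2 < τ := two_le_matMulExponent.trans_lt hτ
  obtain ⟨τ', ⟨C, hC⟩, hlt⟩ := exists_lt_of_csInf_lt ⟨3, three_mem_exponents⟩ hτ
  have ht : Filter.Tendsto (fun n : ℕ => (n : ℝ) ^ (τ - τ')) Filter.atTop Filter.atTop :=
    (tendsto_rpow_atTop (by linarith)).comp tendsto_natCast_atTop_atTop
  obtain ⟨n, hn2, hn⟩ := ((Filter.eventually_ge_atTop 2).and
    (ht.eventually_gt_atTop (2 * C))).exists
  obtain ⟨s, hs, hsC⟩ := hC n (by omega)
  have hn0 : (0 : ℝ) < n := by exact_mod_cast (by omega : 0 < n)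
  have hn1 : (1 : ℝ) < n := by exact_mod_cast (by omega : 1 < n)
  have hsτ : ((2 * s : ℕ) : ℝ) < (n : ℝ) ^ τ := by
    rw [Real.rpow_sub hn0, lt_div_iff₀ (by positivity)] at hn
    push_cast
    linarith
  obtain ⟨U, V, W, hUVW⟩ := hs.exists_decomposes
  obtain ⟨K, _, _, _, U', V', W', hK⟩ := hUVW.exists_field
  set d := Module.finrank ℚ K with hd
  -- a power for which the factor `d ^ 3` is absorbed
  set T := (n : ℝ) ^ τ with hT
  have hT0 : 0 < T := by positivity
  have hs0 : 0 < ((2 * s : ℕ) : ℝ) := by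
    have := hs.sq_le
    have : 0 < s := lt_of_lt_of_le (by positivity) this
    positivity
  obtain ⟨k, hk⟩ := pow_unbounded_of_one_lt ((d : ℝ) ^ 3) ((one_lt_div hs0).mpr hsτ)
  have hk' : ((2 * s : ℕ) : ℝ) ^ (k + 1) * (d : ℝ) ^ 3 < T ^ (k + 1) := by
    have hle : (T / ((2 * s : ℕ) : ℝ)) ^ k ≤ (T / ((2 * s : ℕ) : ℝ)) ^ (k + 1) :=
      pow_le_pow_right₀ ((one_lt_div hs0).mpr hsτ).le (Nat.le_succ k)
    have := hk.trans_le hle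
    rw [div_pow, lt_div_iff₀ (by positivity)] at this
    linarith
  have hpow := hK.pow (k + 1)
  rw [one_pow] at hpow
  obtain ⟨d', hd', U'', V'', W'', hQ⟩ := hpow.exists_rat
  obtain rfl : d' = d := hd'
  have hcm : Fintype.card (Fin (k + 1) → Fin n) = n ^ (k + 1) := by simp
  have hcard : Fintype.card ((Fin (k + 1) → Fin s ⊕ Fin s) × Fin d × Fin d × Fin d) =
      (2 * s) ^ (k + 1) * d ^ 3 := by
    simp
    ring
  obtain ⟨a, h1, h2⟩ := hQ.exists_bilinearAlg
    (R := max ((2 * s) ^ (k + 1) * d ^ 3) ((n ^ (k + 1)) ^ 2))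
    (by rw [hcm]; exact Nat.one_lt_pow (Nat.succ_ne_zero k) (by omega))
    (by rw [hcard]; exact le_max_left _ _) (by rw [hcm]; exact le_max_right _ _)
  refine ⟨a, ?_⟩
  rw [h1, h2, hcm]
  have e : ((n ^ (k + 1) : ℕ) : ℝ) ^ τ = T ^ (k + 1) := by
    push_cast
    rw [hT, ← Real.rpow_natCast, ← Real.rpow_natCast, ← Real.rpow_mul hn0.le,
      ← Real.rpow_mul hn0.le, mul_comm]
  rw [e, Nat.cast_max, max_lt_iff]
  constructor
  · exact_mod_cast hk'
  · rw [← e, Nat.cast_pow, ← Real.rpow_two]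
    refine Real.rpow_lt_rpow_of_exponent_lt ?_ hτ2
    exact_mod_cast Nat.one_lt_pow (Nat.succ_ne_zero k) (by omega)

/-! ### Comparison of the bounds -/

open Filter Asymptotics Real in
theorem isLittleO_rpow_of_lt {u : ℕ → ℝ} (hu : Tendsto u atTop atTop) {a b : ℝ} (hab : a < b) :
    (fun i => u i ^ a) =o[atTop] fun i => u i ^ b := by
  have h0 : Tendsto (fun i => u i ^ (-(b - a))) atTop (nhds 0) :=
    (tendsto_rpow_neg_atTop (by linarith)).comp hu
  refine (isLittleO_iff_tendsto' ?_).mpr (h0.congr' ?_)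
  · filter_upwards [hu.eventually_gt_atTop 0] with i hi h
    exact absurd h (by positivity)
  · filter_upwards [hu.eventually_gt_atTop 0] with i hi
    rw [← rpow_sub hi]
    congr 1
    ring

/-- The arboricity is at most `√(2 m)`. -/
theorem exists_cliqueBound_le {j : ℕ} (hj : 3 ≤ j) {τ : ℝ} (hτ : matMulExponent ≤ τ) :
    ∃ C : ℝ, ∀ (n : ℕ) (G : SimpleGraph (Fin n)),
      cliqueBound j 0 τ G ≤ C * (numEdges G : ℝ) ^ (((3 * j + 0 : ℕ) : ℝ) * τ / 6) := by
  have hτ2 : 2 ≤ τ := two_le_matMulExponent.trans hτ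
  have hj3 : (3 : ℝ) ≤ j := by exact_mod_cast hj
  set x : ℝ := ((j : ℝ) - 2) * τ with hx
  have hx0 : 0 ≤ x := mul_nonneg (by linarith) (by linarith)
  have hexp : ((3 * j + 0 : ℕ) : ℝ) * τ / 6 = x / 2 + τ := by
    push_cast
    rw [hx]
    ring
  refine ⟨2 ^ (x / 2), fun n G => ?_⟩
  rw [hexp, cliqueBound, Nat.cast_zero, add_zero, ← hx]
  rcases Nat.eq_zero_or_pos (numEdges G) with h0 | h0
  · rw [h0, Nat.cast_zero, Real.zero_rpow (by linarith), Real.zero_rpow (by linarith)]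
    simp
  · have hm : (0 : ℝ) < numEdges G := by exact_mod_cast h0
    have hsq : (arboricity G : ℝ) ^ (2 : ℝ) ≤ 2 * numEdges G := by
      rw [Real.rpow_two]
      exact_mod_cast arboricity_sq_le G
    have h1 : (arboricity G : ℝ) ^ x ≤ (2 * numEdges G) ^ (x / 2) := by
      calc (arboricity G : ℝ) ^ x = ((arboricity G : ℝ) ^ (2 : ℝ)) ^ (x / 2) := by
            rw [← Real.rpow_mul (by positivity)]
            congr 1
            ring
        _ ≤ _ := Real.rpow_le_rpow (by positivity) hsq (by linarith)
    calc (arboricity G : ℝ) ^ x * (numEdges G : ℝ) ^ τ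
        ≤ (2 * numEdges G) ^ (x / 2) * (numEdges G : ℝ) ^ τ := by gcongr
      _ = _ := by
        rw [Real.mul_rpow (by norm_num) hm.le, Real.rpow_add hm, mul_assoc]

open Filter Asymptotics in
theorem cliqueBound_isBigO {j r : ℕ} (hj : 2 ≤ j) {τ x : ℝ} (hτ : 0 ≤ τ) {N : ℕ → ℕ}
    {G : ∀ i : ℕ, SimpleGraph (Fin (N i))}
    (hm : Tendsto (fun i => (numEdges (G i) : ℝ)) atTop atTop)
    (hα : (fun i => (arboricity (G i) : ℝ)) =O[atTop] fun i => (numEdges (G i) : ℝ) ^ x) :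
    (fun i => cliqueBound j r τ (G i)) =O[atTop]
      fun i => (numEdges (G i) : ℝ) ^ (x * (((j : ℝ) - 2) * τ + r) + τ) := by
  have hj2 : (2 : ℝ) ≤ j := by exact_mod_cast hj
  have he : 0 ≤ ((j : ℝ) - 2) * τ + r :=
    add_nonneg (mul_nonneg (by linarith) hτ) (Nat.cast_nonneg _)
  have h1 := (hα.rpow he (Eventually.of_forall fun i => by positivity)).mul
    (isBigO_refl (fun i => (numEdges (G i) : ℝ) ^ τ) atTop)
  refine h1.congr' (EventuallyEq.refl _ _) ?_
  filter_upwards [hm.eventually_gt_atTop 0] with i hi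
  rw [← Real.rpow_mul hi.le, ← Real.rpow_add hi]

open Filter Asymptotics in
/-- For `α = Θ(m ^ x)` the new bound is `O(m ^ (τ (x (j - 2) + 1) + x r))`; the left end of the
interval is where its exponent for `τ = ω` meets that of `α ^ (ℓ - 2) * m`, the right end where it
meets that of `m ^ ((j ω + r) / 2)`. -/
theorem exists_isLittleO {j r : ℕ} (hj : 2 ≤ j) (hjr : r = 0 → 3 ≤ j) {x : ℝ}
    (hx : x ∈ arboricityInterval j) :
    ∃ τ₀ : ℝ, matMulExponent < τ₀ ∧ ∀ τ : ℝ, matMulExponent ≤ τ → τ < τ₀ →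
      ∀ (N : ℕ → ℕ) (G : ∀ i : ℕ, SimpleGraph (Fin (N i))),
        Tendsto (fun i => numEdges (G i)) atTop atTop →
        (fun i => (arboricity (G i) : ℝ)) =Θ[atTop] (fun i => (numEdges (G i) : ℝ) ^ x) →
        (fun i => cliqueBound j r τ (G i)) =o[atTop]
          (fun i => (numEdges (G i) : ℝ) ^ ((j * matMulExponent + r) / 2)) ∧
        (fun i => cliqueBound j r τ (G i)) =o[atTop]
          (fun i => (arboricity (G i) : ℝ) ^ (3 * j + r - 2) * (numEdges (G i) : ℝ)) := by
  obtain ⟨hx1, hx2⟩ := hx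
  have h2 := two_le_matMulExponent
  have h3 := matMulExponent_le_three
  set ω := matMulExponent
  have hj2 : (2 : ℝ) ≤ j := by exact_mod_cast hj
  have hr0 : (0 : ℝ) ≤ r := Nat.cast_nonneg r
  have hden : 0 < (j : ℝ) * (3 - ω) + 2 * (ω - 1) := by
    have : 0 ≤ (j : ℝ) * (3 - ω) := mul_nonneg (by linarith) (by linarith)
    linarith
  have hx0 : 0 < x := lt_trans (div_pos (by linarith) hden) hx1
  rw [div_lt_iff₀ hden] at hx1
  -- both comparisons of exponents are strict at `ω`, hence on a neighbourhood
  have hK : 0 < x * ((j : ℝ) - 2) + 1 := by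
    have := mul_nonneg hx0.le (show (0 : ℝ) ≤ (j : ℝ) - 2 by linarith)
    linarith
  have hA : ω * (x * ((j : ℝ) - 2) + 1) < (j * ω + r) / 2 - x * r := by
    have hpos : 0 < ((j : ℝ) - 2) * ω + r := by
      rcases Nat.eq_zero_or_pos r with h | h
      · have : (3 : ℝ) ≤ j := by exact_mod_cast hjr h
        nlinarith
      · have h1 : (1 : ℝ) ≤ r := by exact_mod_cast h
        have := mul_nonneg (show (0 : ℝ) ≤ (j : ℝ) - 2 by linarith) (show 0 ≤ ω by linarith)
        linarith
    have := mul_pos (show (0 : ℝ) < 1 / 2 - x by linarith) hpos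
    linarith
  have hB : ω * (x * ((j : ℝ) - 2) + 1) < x * (3 * j - 2) + 1 := by linarith
  refine ⟨min (((j * ω + r) / 2 - x * r) / (x * ((j : ℝ) - 2) + 1))
    ((x * (3 * j - 2) + 1) / (x * ((j : ℝ) - 2) + 1)),
    lt_min ((lt_div_iff₀ hK).mpr hA) ((lt_div_iff₀ hK).mpr hB), fun τ hτ hlt N G hm hα => ?_⟩
  obtain ⟨hlt1, hlt2⟩ := lt_min_iff.mp hlt
  rw [lt_div_iff₀ hK] at hlt1 hlt2
  have hm' : Tendsto (fun i => (numEdges (G i) : ℝ)) atTop atTop :=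
    tendsto_natCast_atTop_atTop.comp hm
  have hO := cliqueBound_isBigO (r := r) hj (show 0 ≤ τ by linarith) hm' hα.1
  constructor
  · exact hO.trans_isLittleO (isLittleO_rpow_of_lt hm' (by linarith))
  · have h4 : (fun i => (numEdges (G i) : ℝ) ^ (x * (3 * j + r - 2 : ℝ) + 1)) =O[atTop]
        fun i => (arboricity (G i) : ℝ) ^ (3 * j + r - 2) * (numEdges (G i) : ℝ) := by
      refine ((hα.2.pow (3 * j + r - 2)).mul (isBigO_refl _ _)).congr' ?_ (EventuallyEq.refl _ _)
      filter_upwards [hm'.eventually_gt_atTop 0] with i hi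
      rw [Real.rpow_add hi, Real.rpow_one, Real.rpow_mul hi.le, ← Real.rpow_natCast,
        Nat.cast_sub (by omega)]
      push_cast
      rfl
    exact (hO.trans_isLittleO (isLittleO_rpow_of_lt hm' (by linarith))).trans_isBigO h4

theorem mainTheorem5 (j r : ℕ) (hj : 2 ≤ j) (hr : r ≤ 2) (hjr : r = 0 → 3 ≤ j) :
    -- counting, and detection with a witness, of `K_ℓ` for `ℓ = 3j + r`
    (∀ τ : ℝ, matMulExponent < τ →
      WordRAM.SolvableInTime (WordRAM.OutputsCliqueCount (3 * j + r))
        (fun _ G => cliqueBound j r τ G) ∧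
      WordRAM.SolvableInTime (WordRAM.OutputsCliqueDetection (3 * j + r))
        (fun _ G => cliqueBound j r τ G)) ∧
    -- for `ℓ = 3j` the bound is `O(m ^ (ℓ τ / 6))`
    (r = 0 → ∀ τ : ℝ, matMulExponent ≤ τ →
      ∃ C : ℝ, ∀ (n : ℕ) (G : SimpleGraph (Fin n)),
        cliqueBound j r τ G ≤ C * (numEdges G : ℝ) ^ (((3 * j + r : ℕ) : ℝ) * τ / 6)) ∧
    -- for `α = Θ(m ^ x)` with `x ∈ I_j` the bound is of smaller order than the previous ones
    (∀ x ∈ arboricityInterval j, ∃ τ₀ : ℝ, matMulExponent < τ₀ ∧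
      ∀ τ : ℝ, matMulExponent ≤ τ → τ < τ₀ →
      ∀ (N : ℕ → ℕ) (G : ∀ i : ℕ, SimpleGraph (Fin (N i))),
        Filter.Tendsto (fun i => numEdges (G i)) Filter.atTop Filter.atTop →
        Asymptotics.IsTheta Filter.atTop (fun i => (arboricity (G i) : ℝ))
          (fun i => (numEdges (G i) : ℝ) ^ x) →
        Asymptotics.IsLittleO Filter.atTop (fun i => cliqueBound j r τ (G i))
          (fun i => (numEdges (G i) : ℝ) ^ ((j * matMulExponent + r) / 2)) ∧
        Asymptotics.IsLittleO Filter.atTop (fun i => cliqueBound j r τ (G i))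
          (fun i => (arboricity (G i) : ℝ) ^ (3 * j + r - 2) * (numEdges (G i) : ℝ))) := by
  refine ⟨fun τ hτ => ?_, fun hr0 τ hτ => ?_, fun x hx => exists_isLittleO hj hjr hx⟩
  · obtain ⟨a, ha⟩ := exists_bilinearAlg hτ
    exact a.solvableInTime hr hj (two_le_matMulExponent.trans hτ.le) ha
  · subst hr0
    exact exists_cliqueBound_le (hjr rfl) hτ
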